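/- Let $R$ be a commutative ring with unit. All differential graded (dg) $R$-modules are $\mathbb Z$-graded with differential of degree $+1$, and Koszul signs are used. A *unital augmented operad* is an operad $\mathcal O$ in dg $R$-modules with a morphism of operads $\epsilon:\mathcal O\to\mathcal{C}om$ (where $\mathcal{C}om(n)=R$ for all $n\ge 0$) which is an isomorphism in arities $0$ and $1$; morphisms are morphisms of operads over $\mathcal{C}om$. In the category of unital augmented operads, weak equivalences are the arity-wise quasi-isomorphisms, fibrations are the arity-wise epimorphisms, and an operad is *cofibrant* if the morphism from the initial operad has the left lifting property with respect to the fibrations that are weak equivalences. A *cofibrant model of* $\mathcal{C}om$ is a cofibrant unital augmented operad whose augmentation is a weak equivalence. For a unital augmented operad $\mathcal O$, let $1_0\in\mathcal O(0)=R$ be the unit, and let $\Omega^{\mathcal O}_*$ be the simplicial $\mathcal O$-algebra $$\Omega^{\mathcal O}_n=\mathcal O(x_0,\dots,x_n;dx_0,\dots,dx_n)/I_n ,$$ the quotient of the free $\mathcal O$-algebra on generators $x_i$ of degree $0$ and $dx_i$ of degree $1$ (with $d(x_i)=dx_i$) by the ideal generated by $\sum_i x_i-1_0$ and $\sum_i dx_i$;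 a map $\alpha:[m]\to[n]$ acts by $x_i\mapsto\sum_{\alpha(j)=i}x_j$, $dx_i\mapsto\sum_{\alpha(j)=i}dx_j$. For a simplicial set $X$ let $\Omega^{\mathcal O}(X)$ be the dg module whose component of degree $k$ is the module of simplicial maps $X\to(\Omega^{\mathcal O}_*)^k$, with the differential computed pointwise. **Proposition.** Let $\mathcal O$ be a cofibrant unital augmented operad whose augmentation $\epsilon:\mathcal O\to\mathcal{C}om$ is surjective in every arity, and let $\mathcal E_\infty$ be any cofibrant model of $\mathcal{C}om$. Then the functor $\Omega^{\mathcal O}$ takes values in the category of $\mathcal E_\infty$-algebras: there are $\mathcal E_\infty$-algebra structures on the dg modules $\Omega^{\mathcal O}(X)$, for all simplicial sets $X$, such that for every map of simplicial sets $f:X\to Y$ the morphism $\Omega^{\mathcal O}(f):\Omega^{\mathcal O}(Y)\to\Omega^{\mathcal O}(X)$ is a morphism of $\mathcal E_\infty$-algebras. -/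

import Mathlib

open CategoryTheory Simplicial

universe u

/-! ### Differential `ℤ`-graded modules -/

/-- A differential `ℤ`-graded `R`-module: an `R`-module which is the internal direct sum of its
homogeneous components `gr k`, with a differential of degree `+1`. -/
structure DGModule (R : Type u) [CommRing R] where
  carrier : Type u
  [addCommGroup : AddCommGroup carrier]
  [module : Module R carrier]
  gr : ℤ → Submodule R carrier
  isInternal : DirectSum.IsInternal gr
  d : carrier →ₗ[R] carrier
  d_mem : ∀ {k : ℤ} {x : carrier}, x ∈ gr k → d x ∈ gr (k + 1)
  d_d : ∀ x : carrier, d (d x) = 0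

attribute [instance] DGModule.addCommGroup DGModule.module

namespace DGModule

variable {R : Type u} [CommRing R]

instance : CoeSort (DGModule R) (Type u) := ⟨DGModule.carrier⟩

/-- Morphisms of differential graded modules: linear maps of degree `0` commuting with `d`. -/
structure Hom (M N : DGModule R) where
  toLin : M →ₗ[R] N
  map_gr : ∀ {k : ℤ} {x : M}, x ∈ M.gr k → toLin x ∈ N.gr k
  map_d : ∀ x : M, toLin (M.d x) = N.d (toLin x)

/-- The (total) cohomology module `ker d / im d`. -/
abbrev Cohomology (M : DGModule R) : Type u :=
  LinearMap.ker M.d ⧸ (LinearMap.range M.d).submoduleOf (LinearMap.ker M.d)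

/-- The map induced in cohomology. -/
def Hom.mapCohomology {M N : DGModule R} (f : Hom M N) : M.Cohomology →ₗ[R] N.Cohomology :=
  Submodule.mapQ _ _
    (f.toLin.restrict (p := LinearMap.ker M.d) (q := LinearMap.ker N.d) (by
      intro x hx
      rw [LinearMap.mem_ker] at hx ⊢
      rw [← f.map_d, hx, map_zero]))
    (by
      rintro ⟨x, hx⟩ ⟨y, hy⟩
      exact ⟨f.toLin y, by rw [← f.map_d, hy]; rfl⟩)

/-- Quasi-isomorphisms. The cohomology of `M` is the direct sum of its homogeneous components, so
bijectivity on the total cohomology is bijectivity in every degree. -/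
def Hom.IsQuasiIso {M N : DGModule R} (f : Hom M N) : Prop :=
  Function.Bijective f.mapCohomology

/-- The linear map out of `M` given by linear maps on the homogeneous components. -/
noncomputable def lift (M : DGModule R) {P : Type u} [AddCommGroup P] [Module R P]
    (f : ∀ k : ℤ, M.gr k →ₗ[R] P) : M →ₗ[R] P :=
  DirectSum.toModule R ℤ P f ∘ₗ
    (LinearEquiv.ofBijective (DirectSum.coeLinearMap M.gr) M.isInternal).symm.toLinearMap

theorem lift_apply (M : DGModule R) {P : Type u} [AddCommGroup P] [Module R P]
    (f : ∀ k : ℤ, M.gr k →ₗ[R] P) {k : ℤ} {x : M} (hx : x ∈ M.gr k) :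
    M.lift f x = f k ⟨x, hx⟩ := by
  have h : (LinearEquiv.ofBijective (DirectSum.coeLinearMap M.gr) M.isInternal).symm x
      = DirectSum.lof R ℤ (fun k => M.gr k) k ⟨x, hx⟩ := by
    rw [LinearEquiv.symm_apply_eq]
    exact (DirectSum.coeLinearMap_lof (A := M.gr) k ⟨x, hx⟩).symm
  simp only [lift, LinearMap.comp_apply, LinearEquiv.coe_coe, h, DirectSum.toModule_lof]

/-- The involution `x ↦ (-1)^{|x|} x`. -/
noncomputable def sgn (M : DGModule R) : M →ₗ[R] M :=
  M.lift fun k => k.negOnePow • (M.gr k).subtype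

theorem sgn_apply (M : DGModule R) {k : ℤ} {x : M} (hx : x ∈ M.gr k) :
    M.sgn x = k.negOnePow • x := by
  rw [sgn, lift_apply _ _ hx]
  rfl

/-- The projection to the component of degree `k`. -/
noncomputable def proj (M : DGModule R) (k : ℤ) : M →ₗ[R] M :=
  M.lift fun j => if j = k then (M.gr j).subtype else 0

theorem proj_apply_self (M : DGModule R) {k : ℤ} {x : M} (hx : x ∈ M.gr k) :
    M.proj k x = x := by
  simp [proj, lift_apply _ _ hx]

theorem proj_apply_of_ne (M : DGModule R) {j k : ℤ} (h : j ≠ k) {x : M} (hx : x ∈ M.gr j) :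
    M.proj k x = 0 := by
  simp [proj, lift_apply _ _ hx, h]

theorem iSup_gr (M : DGModule R) : ⨆ k, M.gr k = ⊤ :=
  ((DirectSum.isInternal_submodule_iff_iSupIndep_and_iSup_eq_top _).1 M.isInternal).2

theorem iSupIndep_gr (M : DGModule R) : iSupIndep M.gr :=
  ((DirectSum.isInternal_submodule_iff_iSupIndep_and_iSup_eq_top _).1 M.isInternal).1

/-- Two linear maps which agree on homogeneous elements are equal. -/
theorem hom_ext (M : DGModule R) {P : Type u} [AddCommGroup P] [Module R P] {f g : M →ₗ[R] P}
    (h : ∀ (k : ℤ) (x : M), x ∈ M.gr k → f x = g x) : f = g := by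
  have : LinearMap.eqLocus f g = ⊤ := by
    rw [eq_top_iff, ← M.iSup_gr]
    exact iSup_le fun k x hx => h k x hx
  exact LinearMap.eqLocus_eq_top.1 this

theorem sgn_sgn (M : DGModule R) (x : M) : M.sgn (M.sgn x) = x := by
  have : M.sgn ∘ₗ M.sgn = LinearMap.id := by
    refine M.hom_ext fun k x hx => ?_
    simp only [LinearMap.comp_apply, LinearMap.id_apply]
    rw [M.sgn_apply hx, M.sgn_apply (Submodule.smul_of_tower_mem _ _ hx), smul_smul,
      ← Int.negOnePow_add, Int.negOnePow_even _ ⟨k, rfl⟩, one_smul]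
  exact LinearMap.congr_fun this x

theorem d_sgn (M : DGModule R) (x : M) : M.d (M.sgn x) = - M.sgn (M.d x) := by
  have : M.d ∘ₗ M.sgn = - (M.sgn ∘ₗ M.d) := by
    refine M.hom_ext fun k x hx => ?_
    simp only [LinearMap.comp_apply, LinearMap.neg_apply]
    rw [M.sgn_apply hx, M.sgn_apply (M.d_mem hx), Int.negOnePow_succ, Units.neg_smul, neg_neg,
      Units.smul_def, Units.smul_def, map_zsmul]
  exact LinearMap.congr_fun this x

/-- Independence of a family of submodules can be tested after applying a jointly injective
family of linear maps. -/
theorem iSupIndep_of_jointly_injective {T : Type u} [AddCommGroup T] [Module R T]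
    {ι : Type*} {N : ι → DGModule R} (φ : ∀ i, T →ₗ[R] N i) (s : ι → ℤ)
    (hφ : ∀ t, (∀ i, φ i t = 0) → t = 0) {g : ℤ → Submodule R T}
    (hg : ∀ k t, t ∈ g k → ∀ i, φ i t ∈ (N i).gr (k - s i)) : iSupIndep g := by
  intro k
  rw [Submodule.disjoint_def]
  intro t ht ht'
  refine hφ t fun i => ?_
  have h1 := (N i).proj_apply_self (hg k t ht i)
  have h2 : (⨆ j, ⨆ (_ : j ≠ k), g j) ≤ LinearMap.ker ((N i).proj (k - s i) ∘ₗ φ i) := by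
    refine iSup_le fun j => iSup_le fun hj x hx => ?_
    rw [LinearMap.mem_ker, LinearMap.comp_apply]
    exact (N i).proj_apply_of_ne (by omega) (hg j x hx i)
  rw [← h1]
  exact h2 ht'

theorem proj_mem (M : DGModule R) (k : ℤ) (x : M) : M.proj k x ∈ M.gr k := by
  have h : (⊤ : Submodule R M) ≤ (M.gr k).comap (M.proj k) := by
    rw [← M.iSup_gr]
    refine iSup_le fun j y hy => ?_
    rw [Submodule.mem_comap]
    by_cases hj : j = k
    · subst hj
      rwa [M.proj_apply_self hy]
    · rw [M.proj_apply_of_ne hj hy]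
      exact Submodule.zero_mem _
  exact h Submodule.mem_top

/-- A linear map of degree `s` commutes with the projections. -/
theorem proj_map {M N : DGModule R} (f : M →ₗ[R] N) (s : ℤ)
    (hf : ∀ k x, x ∈ M.gr k → f x ∈ N.gr (k + s)) (k : ℤ) (x : M) :
    N.proj k (f x) = f (M.proj (k - s) x) := by
  have : N.proj k ∘ₗ f = f ∘ₗ M.proj (k - s) := by
    refine M.hom_ext fun j x hx => ?_
    simp only [LinearMap.comp_apply]
    by_cases hj : j = k - s
    · subst hj
      rw [M.proj_apply_self hx, N.proj_apply_self]
      simpa using hf _ x hx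
    · rw [M.proj_apply_of_ne hj hx, N.proj_apply_of_ne _ (hf _ x hx), map_zero]
      omega
  exact LinearMap.congr_fun this x

/-- A linear map of degree `0` commutes with the sign involution. -/
theorem sgn_map {M N : DGModule R} (f : M →ₗ[R] N)
    (hf : ∀ k x, x ∈ M.gr k → f x ∈ N.gr k) (x : M) : N.sgn (f x) = f (M.sgn x) := by
  have : N.sgn ∘ₗ f = f ∘ₗ M.sgn := by
    refine M.hom_ext fun j x hx => ?_
    simp only [LinearMap.comp_apply]
    rw [M.sgn_apply hx, N.sgn_apply (hf _ x hx), Units.smul_def, Units.smul_def, map_zsmul]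
  exact LinearMap.congr_fun this x

/-- The quotient of a differential graded module by a homogeneous submodule stable under `d`. -/
def quotient (M : DGModule R) (N : Submodule R M) (hgr : ∀ k, ∀ x ∈ N, M.proj k x ∈ N)
    (hd : ∀ x ∈ N, M.d x ∈ N) : DGModule R where
  carrier := M ⧸ N
  gr k := (M.gr k).map N.mkQ
  isInternal := by
    rw [DirectSum.isInternal_submodule_iff_iSupIndep_and_iSup_eq_top]
    constructor
    · intro k
      rw [Submodule.disjoint_def]
      rintro _ ⟨a, ha, rfl⟩ h
      simp only [← Submodule.map_iSup] at h
      obtain ⟨b, hb, hab⟩ := h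
      have h2 : (⨆ j, ⨆ (_ : j ≠ k), M.gr j) ≤ LinearMap.ker (M.proj k) :=
        iSup_le fun j => iSup_le fun hj x hx => M.proj_apply_of_ne hj hx
      have h3 : b - a ∈ N := (Submodule.Quotient.eq N).1 hab
      have h4 := hgr k _ h3
      rw [map_sub, M.proj_apply_self ha, LinearMap.mem_ker.1 (h2 hb), zero_sub] at h4
      exact (Submodule.Quotient.mk_eq_zero N).2 (by simpa using h4)
    · rw [← Submodule.map_iSup, M.iSup_gr, Submodule.map_top, Submodule.range_mkQ]
  d := N.mapQ N M.d hd
  d_mem := by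
    rintro k _ ⟨a, ha, rfl⟩
    exact ⟨M.d a, M.d_mem ha, rfl⟩
  d_d x := by
    obtain ⟨a, rfl⟩ := N.mkQ_surjective x
    simp [M.d_d]

end DGModule

/-! ### Operads -/

/-- The Koszul sign of the permutation `σ` acting on a tensor product of homogeneous elements of
degrees `q 0, …, q (n - 1)`: a factor `(-1)^{q i q j}` for every inversion of `σ`. -/
def koszulSign {n : ℕ} (σ : Equiv.Perm (Fin n)) (q : Fin n → ℤ) : ℤˣ :=
  (∑ i, ∑ j, if i < j ∧ σ j < σ i then q i * q j else 0).negOnePow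

/-- When an operation with `n` inputs is plugged into the `i`-th input of an operation with `m`
inputs, the resulting operation has `l = m + n - 1` inputs. The `j`-th input of the outer operation,
`j ≠ i`, becomes the following input of the composite. -/
def outerSlot {m n l : ℕ} (h : m + n = l + 1) (i j : Fin m) (hj : j ≠ i) : Fin l :=
  if hlt : j < i then ⟨j, by have := i.2; omega⟩
  else ⟨j + n - 1, by have := j.2; have := Fin.val_ne_of_ne hj; omega⟩

/-- The `k`-th input of the inner operation becomes the following input of the composite. -/
def innerSlot {m n l : ℕ} (h : m + n = l + 1) (i : Fin m) (k : Fin n) : Fin l :=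
  ⟨i + k, by have := i.2; have := k.2; omega⟩

/-- An operad in differential `ℤ`-graded `R`-modules, presented by its right actions of the
symmetric groups, its unit and its partial compositions
`x ∘_i y = circ h i x y = γ(x; 1, …, 1, y, 1, …, 1)`. The arity `l` of the composite is a variable
constrained by `m + n = l + 1`. -/
structure DGOperad (R : Type u) [CommRing R] where
  obj : ℕ → DGModule R
  act : ∀ {n : ℕ}, Equiv.Perm (Fin n) → obj n →ₗ[R] obj n
  act_one : ∀ {n : ℕ} (x : obj n), act 1 x = x
  act_mul : ∀ {n : ℕ} (σ τ : Equiv.Perm (Fin n)) (x : obj n), act (σ * τ) x = act τ (act σ x)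
  act_gr : ∀ {n : ℕ} (σ : Equiv.Perm (Fin n)) {k : ℤ} {x : obj n},
    x ∈ (obj n).gr k → act σ x ∈ (obj n).gr k
  act_d : ∀ {n : ℕ} (σ : Equiv.Perm (Fin n)) (x : obj n), (obj n).d (act σ x) = act σ ((obj n).d x)
  one : obj 1
  one_gr : one ∈ (obj 1).gr 0
  one_d : (obj 1).d one = 0
  circ : ∀ {m n l : ℕ}, m + n = l + 1 → Fin m → (obj m →ₗ[R] obj n →ₗ[R] obj l)
  circ_gr : ∀ {m n l : ℕ} (h : m + n = l + 1) (i : Fin m) {p q : ℤ} {x : obj m} {y : obj n},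
    x ∈ (obj m).gr p → y ∈ (obj n).gr q → circ h i x y ∈ (obj l).gr (p + q)
  circ_d : ∀ {m n l : ℕ} (h : m + n = l + 1) (i : Fin m) {p : ℤ} {x : obj m} (y : obj n),
    x ∈ (obj m).gr p →
      (obj l).d (circ h i x y) =
        circ h i ((obj m).d x) y + p.negOnePow • circ h i x ((obj n).d y)
  one_circ : ∀ {n : ℕ} (h : 1 + n = n + 1) (x : obj n), circ h 0 one x = x
  circ_one : ∀ {n : ℕ} (h : n + 1 = n + 1) (i : Fin n) (x : obj n), circ h i x one = x
  /-- Sequential associativity `(x ∘_i y) ∘_{i + j} z = x ∘_i (y ∘_j z)`. -/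
  circ_seq : ∀ {m n r a b l : ℕ} (h₁ : m + n = a + 1) (h₂ : a + r = l + 1) (h₃ : n + r = b + 1)
    (h₄ : m + b = l + 1) (i : Fin m) (j : Fin n) (x : obj m) (y : obj n) (z : obj r),
      circ h₂ (innerSlot h₁ i j) (circ h₁ i x y) z = circ h₄ i x (circ h₃ j y z)
  /-- Parallel associativity: up to the Koszul sign, plugging `y` into the `i`-th input and `z`
  into the `k`-th input of `x`, with `i ≠ k`, can be done in either order. -/
  circ_par : ∀ {m n r a b l : ℕ} (h₁ : m + n = a + 1) (h₂ : a + r = l + 1) (h₃ : m + r = b + 1)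
    (h₄ : b + n = l + 1) (i k : Fin m) (hik : i ≠ k) {p q : ℤ} (x : obj m) {y : obj n} {z : obj r},
      y ∈ (obj n).gr p → z ∈ (obj r).gr q →
        circ h₂ (outerSlot h₁ i k hik.symm) (circ h₁ i x y) z =
          (p * q).negOnePow • circ h₄ (outerSlot h₃ k i hik) (circ h₃ k x z) y
  /-- Equivariance: `xσ ∘_i yτ = (x ∘_{σ i} y)ρ`, where `ρ` is the permutation of the inputs of
  the composite which is given by `σ` on the inputs of `x` and by `τ` on those of `y`. -/
  circ_act : ∀ {m n l : ℕ} (h : m + n = l + 1) (i : Fin m) (σ : Equiv.Perm (Fin m))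
    (τ : Equiv.Perm (Fin n)) (ρ : Equiv.Perm (Fin l)),
      (∀ (j : Fin m) (hj : j ≠ i),
        ρ (outerSlot h i j hj) = outerSlot h (σ i) (σ j) (fun e => hj (σ.injective e))) →
      (∀ k : Fin n, ρ (innerSlot h i k) = innerSlot h (σ i) (τ k)) →
      ∀ (x : obj m) (y : obj n), circ h i (act σ x) (act τ y) = act ρ (circ h (σ i) x y)

namespace DGOperad

variable {R : Type u} [CommRing R]

/-- Morphisms of operads. -/
structure Hom (O P : DGOperad R) where
  app : ∀ n : ℕ, DGModule.Hom (O.obj n) (P.obj n)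
  map_act : ∀ {n : ℕ} (σ : Equiv.Perm (Fin n)) (x : O.obj n),
    (app n).toLin (O.act σ x) = P.act σ ((app n).toLin x)
  map_one : (app 1).toLin O.one = P.one
  map_circ : ∀ {m n l : ℕ} (h : m + n = l + 1) (i : Fin m) (x : O.obj m) (y : O.obj n),
    (app l).toLin (O.circ h i x y) = P.circ h i ((app m).toLin x) ((app n).toLin y)

/-- A morphism of operads is a fibration if it is an epimorphism in every arity. -/
def Hom.IsFibration {O P : DGOperad R} (f : Hom O P) : Prop :=
  ∀ n : ℕ, Function.Surjective (f.app n).toLin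

/-- A morphism of operads is a weak equivalence if it is a quasi-isomorphism in every arity. -/
def Hom.IsWeakEquivalence {O P : DGOperad R} (f : Hom O P) : Prop :=
  ∀ n : ℕ, (f.app n).IsQuasiIso

end DGOperad

/-- The grading of `R` concentrated in degree `0`. -/
def baseGr (R : Type u) [CommRing R] (k : ℤ) : Submodule R R := if k = 0 then ⊤ else ⊥

theorem mem_baseGr {R : Type u} [CommRing R] {k : ℤ} {x : R} :
    x ∈ baseGr R k ↔ (k ≠ 0 → x = 0) := by
  by_cases hk : k = 0 <;> simp [baseGr, hk]

theorem baseGr_isInternal (R : Type u) [CommRing R] : DirectSum.IsInternal (baseGr R) := by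
  rw [DirectSum.isInternal_submodule_iff_iSupIndep_and_iSup_eq_top]
  constructor
  · intro k
    by_cases hk : k = 0
    · subst hk
      have : (⨆ j : ℤ, ⨆ (_ : j ≠ 0), baseGr R j) = ⊥ := by
        refine le_bot_iff.1 (iSup_le fun j => iSup_le fun hj => ?_)
        simp [baseGr, hj]
      rw [this]
      exact disjoint_bot_right
    · have : baseGr R k = ⊥ := by simp [baseGr, hk]
      rw [this]
      exact disjoint_bot_left
  · refine top_le_iff.1 (le_trans ?_ (le_iSup _ (0 : ℤ)))
    simp [baseGr]

theorem baseGr_mul {R : Type u} [CommRing R] {p q : ℤ} {x y : R} (hx : x ∈ baseGr R p)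
    (hy : y ∈ baseGr R q) : x * y ∈ baseGr R (p + q) := by
  rw [mem_baseGr] at *
  intro h
  by_cases hp : p = 0
  · rw [hy (by omega), mul_zero]
  · rw [hx hp, zero_mul]

theorem baseGr_swap {R : Type u} [CommRing R] {p q : ℤ} (x : R) {y z : R} (hy : y ∈ baseGr R p) :
    x * y * z = (p * q).negOnePow • (x * z * y) := by
  by_cases hp : p = 0
  · simp only [hp, zero_mul, Int.negOnePow_zero, one_smul]
    ring
  · simp [mem_baseGr.1 hy hp]

theorem base_leibniz {R : Type u} [CommRing R] (p : ℤ) (x y : R) :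
    (0 : R) = 0 * y + p.negOnePow • (x * 0) := by simp

/-- The differential graded module `R`, concentrated in degree `0`. -/
def DGModule.base (R : Type u) [CommRing R] : DGModule R where
  carrier := R
  gr := baseGr R
  isInternal := baseGr_isInternal R
  d := 0
  d_mem _ := Submodule.zero_mem _
  d_d _ := rfl

/-- The operad `𝒞om` of unital commutative algebras: `𝒞om(n) = R` for every `n ≥ 0`. -/
def comOperad (R : Type u) [CommRing R] : DGOperad R where
  obj _ := DGModule.base R
  act _ := LinearMap.id
  act_one _ := rfl
  act_mul _ _ _ := rfl
  act_gr _ _ _ hx := hx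
  act_d _ _ := rfl
  one := (1 : R)
  one_gr := (mem_baseGr (R := R)).2 fun h => absurd rfl h
  one_d := rfl
  circ _ _ := LinearMap.mul R R
  circ_gr _ _ _ _ _ _ hx hy := baseGr_mul (R := R) hx hy
  circ_d _ _ p x y _ := base_leibniz (R := R) p x y
  one_circ _ x := one_mul (M := R) x
  circ_one _ _ x := mul_one (M := R) x
  circ_seq _ _ _ _ _ _ x y z := mul_assoc (G := R) x y z
  circ_par _ _ _ _ _ _ _ _ _ x _ _ hy _ := baseGr_swap (R := R) x hy
  circ_act _ _ _ _ _ _ _ _ _ := rfl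

/-- Unital augmented operads: operads with an augmentation to `𝒞om` which is an isomorphism in
arities `0` and `1`, so that `𝒪(0) = R` and `𝒪(1) = R`. -/
structure UAOperad (R : Type u) [CommRing R] extends DGOperad R where
  aug : DGOperad.Hom toDGOperad (comOperad R)
  aug_zero : Function.Bijective (aug.app 0).toLin
  aug_one : Function.Bijective (aug.app 1).toLin

namespace UAOperad

variable {R : Type u} [CommRing R]

/-- Morphisms of unital augmented operads: morphisms of operads over `𝒞om`. (In arities `0` and `1`
this says that the morphism is the identity of `R`; this implies the condition in every arity.) -/
structure Hom (O P : UAOperad R) extends DGOperad.Hom O.toDGOperad P.toDGOperad where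
  map_aug : ∀ (n : ℕ) (x : O.obj n), (P.aug.app n).toLin ((app n).toLin x) = (O.aug.app n).toLin x

/-- Cofibrant objects of the model category of unital augmented operads, whose weak equivalences
are the arity-wise quasi-isomorphisms and whose fibrations are the arity-wise epimorphisms: the
morphism from the initial operad has the left lifting property against trivial fibrations. -/
def IsCofibrant (O : UAOperad R) : Prop :=
  ∀ (P Q : UAOperad R) (p : Hom P Q), p.toHom.IsFibration → p.toHom.IsWeakEquivalence →
    ∀ f : Hom O Q, ∃ g : Hom O P,
      ∀ (n : ℕ) (x : O.obj n), (p.app n).toLin ((g.app n).toLin x) = (f.app n).toLin x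

/-- `E` is a cofibrant model of the operad `𝒞om`. -/
def IsCofibrantModelOfCom (E : UAOperad R) : Prop :=
  E.IsCofibrant ∧ E.aug.IsWeakEquivalence

/-- The element `1₀` of `𝒪(0) = R`. -/
noncomputable def pt (O : UAOperad R) : O.obj 0 :=
  (LinearEquiv.ofBijective _ O.aug_zero).symm (1 : R)

end UAOperad

/-- An algebra structure over the operad `O` on the differential graded module `A`:
evaluation products `θ n : O(n) ⊗ A^{⊗ n} → A` which are morphisms of differential graded modules
and are associative, unital and equivariant. -/
structure DGOperad.Algebra {R : Type u} [CommRing R] (O : DGOperad R) (A : DGModule R) where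
  θ : ∀ n : ℕ, O.obj n →ₗ[R] MultilinearMap R (fun _ : Fin n => A.carrier) A.carrier
  θ_gr : ∀ {n : ℕ} {p : ℤ} {q : Fin n → ℤ} {x : O.obj n} {a : Fin n → A},
    x ∈ (O.obj n).gr p → (∀ i, a i ∈ A.gr (q i)) → θ n x a ∈ A.gr (p + ∑ i, q i)
  θ_d : ∀ {n : ℕ} {p : ℤ} {q : Fin n → ℤ} {x : O.obj n} {a : Fin n → A},
    x ∈ (O.obj n).gr p → (∀ i, a i ∈ A.gr (q i)) →
      A.d (θ n x a) = θ n ((O.obj n).d x) a +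
        ∑ i, (p + ∑ j with j < i, q j).negOnePow • θ n x (Function.update a i (A.d (a i)))
  θ_one : ∀ a : Fin 1 → A, θ 1 O.one a = a 0
  θ_act : ∀ {n : ℕ} (σ : Equiv.Perm (Fin n)) {q : Fin n → ℤ} (x : O.obj n) {a : Fin n → A},
    (∀ i, a i ∈ A.gr (q i)) → θ n (O.act σ x) a = koszulSign σ q • θ n x (a ∘ σ.symm)
  θ_circ : ∀ {m n l : ℕ} (h : m + n = l + 1) (i : Fin m) {p : ℤ} {q : Fin l → ℤ} (x : O.obj m)
    {y : O.obj n} {a : Fin l → A}, y ∈ (O.obj n).gr p → (∀ k, a k ∈ A.gr (q k)) →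
      θ l (O.circ h i x y) a =
        (p * ∑ k with k.val < i.val, q k).negOnePow •
          θ m x (fun j => if hj : j = i then θ n y (fun k => a (innerSlot h i k))
            else a (outerSlot h i j hj))

/-- The morphism of differential graded modules `f` is a morphism of algebras over `O`. -/
def DGOperad.Algebra.IsHom {R : Type u} [CommRing R] {O : DGOperad R} {A B : DGModule R}
    (α : O.Algebra A) (β : O.Algebra B) (f : DGModule.Hom A B) : Prop :=
  ∀ (n : ℕ) (x : O.obj n) (a : Fin n → A),
    f.toLin (α.θ n x a) = β.θ n x (fun i => f.toLin (a i))

/-! ### Generalised differential forms -/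

/-- The generators `x₀, …, xₙ` (left) and `dx₀, …, dxₙ` (right). -/
abbrev FormGen (n : ℕ) : Type := Fin (n + 1) ⊕ Fin (n + 1)

/-- The generators `xᵢ` have degree `0` and the generators `dxᵢ` have degree `1`. -/
def FormGen.deg {n : ℕ} (g : FormGen n) : ℤ := Sum.elim (fun _ => 0) (fun _ => 1) g

/-- Words in the generators: the words of length `p` are a basis of the `p`-th tensor power
`V^{⊗ p}` of the free graded module `V` on the generators. -/
abbrev FormWord (n : ℕ) : Type := Σ p : ℕ, (Fin p → FormGen n)

namespace UAOperad

variable {R : Type u} [CommRing R] (O : UAOperad R)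

theorem aug_pt : (O.aug.app 0).toLin O.pt = (1 : R) :=
  (LinearEquiv.ofBijective _ O.aug_zero).apply_symm_apply (1 : R)

theorem pt_gr : O.pt ∈ (O.obj 0).gr 0 := by
  have h : (O.obj 0).proj 0 O.pt = O.pt := by
    apply O.aug_zero.1
    have h1 := DGModule.proj_map (O.aug.app 0).toLin 0
      (fun k x hx => by simpa using (O.aug.app 0).map_gr hx) 0 O.pt
    rw [sub_zero] at h1
    rw [← h1]
    apply DGModule.proj_apply_self
    rw [aug_pt]
    exact (mem_baseGr (R := R)).2 fun h => absurd rfl h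
  rw [← h]
  exact DGModule.proj_mem _ _ _

theorem pt_d : (O.obj 0).d O.pt = 0 := by
  apply O.aug_zero.1
  rw [(O.aug.app 0).map_d, map_zero]
  rfl

/-- The module `⨁_p 𝒪(p) ⊗ V^{⊗ p}`, where `V` is the free graded module on `x₀, …, xₙ` and
`dx₀, …, dxₙ`. -/
abbrev FormSum (n : ℕ) : Type u := DirectSum (FormWord n) fun w => (O.obj w.1).carrier

/-- `O.word w o` is the tensor `o ⊗ w₁ ⊗ ⋯ ⊗ w_p`. -/
def word {n p : ℕ} (w : Fin p → FormGen n) : O.obj p →ₗ[R] O.FormSum n :=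
  DirectSum.lof R (FormWord n) (fun w => (O.obj w.1).carrier) ⟨p, w⟩

theorem formSum_hom_ext {n : ℕ} {P : Type u} [AddCommGroup P] [Module R P]
    {f g : O.FormSum n →ₗ[R] P}
    (h : ∀ (p : ℕ) (w : Fin p → FormGen n) (o : O.obj p), f (O.word w o) = g (O.word w o)) :
    f = g :=
  DirectSum.linearMap_ext R fun w => LinearMap.ext fun o => h w.1 w.2 o

/-- The effect of the differential of `V`, which sends `xⱼ` to `dxⱼ` and `dxⱼ` to `0`, on the
`i`-th letter of the tensor `o ⊗ w₁ ⊗ ⋯ ⊗ w_p`, with the sign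
`(-1)^{|o| + |w₁| + ⋯ + |w_{i - 1}|}`. -/
noncomputable def dLetter {n p : ℕ} (w : Fin p → FormGen n) (i : Fin p) :
    O.obj p →ₗ[R] O.FormSum n :=
  match w i with
  | .inl j => (∑ k with k < i, (w k).deg).negOnePow •
      (O.word (Function.update w i (.inr j)) ∘ₗ (O.obj p).sgn)
  | .inr _ => 0

/-- The differential of `⨁_p 𝒪(p) ⊗ V^{⊗ p}`. -/
noncomputable def dSum (n : ℕ) : O.FormSum n →ₗ[R] O.FormSum n :=
  DirectSum.toModule R (FormWord n) (O.FormSum n) fun w =>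
    O.word w.2 ∘ₗ (O.obj w.1).d + ∑ i, O.dLetter w.2 i

theorem dSum_word {n p : ℕ} (w : Fin p → FormGen n) (o : O.obj p) :
    O.dSum n (O.word w o) = O.word w ((O.obj p).d o) + ∑ i, O.dLetter w i o := by
  simp only [dSum, word]
  rw [DirectSum.toModule_lof]
  simp

theorem dLetter_inl {n p : ℕ} {w : Fin p → FormGen n} {i : Fin p} {j : Fin (n + 1)}
    (h : w i = .inl j) (o : O.obj p) :
    O.dLetter w i o = (∑ k with k < i, (w k).deg).negOnePow •
      O.word (Function.update w i (.inr j)) ((O.obj p).sgn o) := by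
  simp [dLetter, h]

theorem dLetter_inr {n p : ℕ} {w : Fin p → FormGen n} {i : Fin p} {j : Fin (n + 1)}
    (h : w i = .inr j) (o : O.obj p) : O.dLetter w i o = 0 := by
  simp [dLetter, h]

/-- The prefix degrees after changing the `i`-th letter from degree `0` to degree `1`. -/
theorem prefix_update {n p : ℕ} {w : Fin p → FormGen n} {i : Fin p} {j : Fin (n + 1)}
    (h : w i = .inl j) (k : Fin p) :
    ∑ a with a < k, (Function.update w i (.inr j) a).deg =
      (∑ a with a < k, (w a).deg) + if i < k then 1 else 0 := by
  have : ∀ a, (Function.update w i (.inr j) a).deg = (w a).deg + if a = i then 1 else 0 := by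
    intro a
    by_cases ha : a = i
    · subst ha
      simp [h, FormGen.deg]
    · simp [ha]
  simp only [this, Finset.sum_add_distrib, Finset.sum_ite_eq', Finset.mem_filter, Finset.mem_univ,
    true_and]

/-- Differentiating the letters `i` and `k`. -/
theorem dLetter_anticomm {n p : ℕ} {w : Fin p → FormGen n} {i k : Fin p} (hik : i < k)
    {a b : Fin (n + 1)} (hi : w i = .inl a) (hk : w k = .inl b) (o : O.obj p) :
    (∑ k with k < i, (w k).deg).negOnePow •
        O.dLetter (Function.update w i (.inr a)) k ((O.obj p).sgn o) =
      - ((∑ j with j < k, (w j).deg).negOnePow •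
        O.dLetter (Function.update w k (.inr b)) i ((O.obj p).sgn o)) := by
  rw [O.dLetter_inl (j := b) (by rw [Function.update_of_ne hik.ne', hk]),
    O.dLetter_inl (j := a) (by rw [Function.update_of_ne hik.ne, hi]),
    prefix_update hi, prefix_update hk, if_pos hik, if_neg hik.asymm,
    Function.update_comm hik.ne, DGModule.sgn_sgn, Int.negOnePow_succ, add_zero,
    Units.neg_smul, smul_neg, smul_smul, smul_smul, mul_comm]

theorem dSum_dSum (n : ℕ) (t : O.FormSum n) : O.dSum n (O.dSum n t) = 0 := by
  have : O.dSum n ∘ₗ O.dSum n = 0 := by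
    refine O.formSum_hom_ext fun p w o => ?_
    simp only [LinearMap.comp_apply, LinearMap.zero_apply]
    rw [dSum_word, map_add, dSum_word, DGModule.d_d, map_zero, zero_add, map_sum]
    let E : Fin p → Fin p → O.FormSum n := fun i k =>
      match w i with
      | .inl j => (∑ k with k < i, (w k).deg).negOnePow •
          O.dLetter (Function.update w i (.inr j)) k ((O.obj p).sgn o)
      | .inr _ => 0
    have hE : ∀ i, O.dSum n (O.dLetter w i o) = - O.dLetter w i ((O.obj p).d o) + ∑ k, E i k := by
      intro i
      rcases hw : w i with j | j
      · rw [O.dLetter_inl hw, O.dLetter_inl hw, Units.smul_def, map_zsmul, dSum_word,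
          DGModule.d_sgn, map_neg, ← Units.smul_def, smul_add, smul_neg, Finset.smul_sum]
        simp [E, hw]
      · rw [O.dLetter_inr hw, O.dLetter_inr hw]
        simp [E, hw]
    simp only [hE, Finset.sum_add_distrib, Finset.sum_neg_distrib, add_neg_cancel_left]
    have hdiag : ∀ i, E i i = 0 := by
      intro i
      rcases hw : w i with j | j
      · simp only [E, hw]
        rw [O.dLetter_inr (j := j) (by simp), smul_zero]
      · simp [E, hw]
    have hanti : ∀ i k, i < k → E i k = - E k i := by
      intro i k hik
      rcases hi : w i with a | a
      · rcases hk : w k with b | b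
        · simp only [E, hi, hk]
          exact O.dLetter_anticomm hik hi hk o
        · simp only [E, hi, hk]
          rw [O.dLetter_inr (j := b) (by rw [Function.update_of_ne hik.ne', hk])]
          simp
      · rcases hk : w k with b | b
        · simp only [E, hi, hk]
          rw [O.dLetter_inr (j := a) (by rw [Function.update_of_ne hik.ne, hi])]
          simp
        · simp [E, hi, hk]
    have hsplit : ∀ i k, E i k = (if i < k then E i k else 0) + (if k < i then E i k else 0) := by
      intro i k
      rcases lt_trichotomy i k with h | h | h
      · simp [h, h.asymm]
      · subst h
        simp [hdiag]
      · simp [h, h.asymm]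
    have h2 : ∑ i, ∑ k, (if k < i then E i k else 0) =
        - ∑ i, ∑ k, (if i < k then E i k else 0) := by
      rw [Finset.sum_comm, ← Finset.sum_neg_distrib]
      refine Finset.sum_congr rfl fun i _ => ?_
      rw [← Finset.sum_neg_distrib]
      refine Finset.sum_congr rfl fun k _ => ?_
      by_cases h : i < k
      · simp [h, hanti i k h]
      · simp [h]
    calc ∑ i, ∑ k, E i k
        = ∑ i, ∑ k, ((if i < k then E i k else 0) + (if k < i then E i k else 0)) :=
          Finset.sum_congr rfl fun i _ => Finset.sum_congr rfl fun k _ => hsplit i k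
      _ = 0 := by simp only [Finset.sum_add_distrib, h2, add_neg_cancel]
  exact LinearMap.congr_fun this t

/-- The total degree of a word. -/
def _root_.FormWord.deg {n : ℕ} (w : FormWord n) : ℤ := ∑ i, (w.2 i).deg

/-- The component of degree `k` of `⨁_p 𝒪(p) ⊗ V^{⊗ p}`. -/
def formSumGr (n : ℕ) (k : ℤ) : Submodule R (O.FormSum n) :=
  ⨅ w : FormWord n, ((O.obj w.1).gr (k - w.deg)).comap
    (DirectSum.component R (FormWord n) (fun w => (O.obj w.1).carrier) w)

theorem word_gr {n p : ℕ} (w : Fin p → FormGen n) {k : ℤ} {o : O.obj p}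
    (ho : o ∈ (O.obj p).gr k) : O.word w o ∈ O.formSumGr n (k + FormWord.deg ⟨p, w⟩) := by
  simp only [formSumGr, Submodule.mem_iInf, Submodule.mem_comap]
  intro v
  by_cases h : (⟨p, w⟩ : FormWord n) = v
  · subst h
    rw [word, DirectSum.component.lof_self, add_sub_cancel_right]
    exact ho
  · rw [word, DirectSum.component.of, dif_neg h]
    exact Submodule.zero_mem _

theorem formSum_induction {n : ℕ} {S : Submodule R (O.FormSum n)}
    (h : ∀ (p : ℕ) (w : Fin p → FormGen n) (k : ℤ) (o : O.obj p), o ∈ (O.obj p).gr k →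
      O.word w o ∈ S) (t : O.FormSum n) : t ∈ S := by
  induction t using DirectSum.induction_on with
  | zero => exact S.zero_mem
  | of w o =>
    have h1 : (⊤ : Submodule R (O.obj w.1)) ≤ S.comap (O.word w.2) := by
      rw [← DGModule.iSup_gr]
      exact iSup_le fun k o ho => h _ _ k o ho
    exact h1 (Submodule.mem_top (x := o))
  | add x y hx hy => exact S.add_mem hx hy

theorem formSum_isInternal (n : ℕ) : DirectSum.IsInternal (O.formSumGr n) := by
  rw [DirectSum.isInternal_submodule_iff_iSupIndep_and_iSup_eq_top]
  constructor
  · refine DGModule.iSupIndep_of_jointly_injective (N := fun w : FormWord n => O.obj w.1)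
      (fun w => DirectSum.component R (FormWord n) (fun w => (O.obj w.1).carrier) w)
      (fun w => w.deg) (fun t ht => ?_) (fun k t ht w => ?_)
    · exact DFinsupp.ext ht
    · simp only [formSumGr, Submodule.mem_iInf] at ht
      exact ht w
  · rw [eq_top_iff]
    intro t _
    refine O.formSum_induction (fun p w k o ho => ?_) t
    exact le_iSup (O.formSumGr n) (k + FormWord.deg ⟨p, w⟩) (O.word_gr w ho)

theorem deg_update {n p : ℕ} {w : Fin p → FormGen n} {i : Fin p} {j : Fin (n + 1)}
    (h : w i = .inl j) :
    FormWord.deg ⟨p, Function.update w i (.inr j)⟩ = FormWord.deg ⟨p, w⟩ + 1 := by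
  have : ∀ a, (Function.update w i (.inr j) a).deg = (w a).deg + if a = i then 1 else 0 := by
    intro a
    by_cases ha : a = i
    · subst ha
      simp [h, FormGen.deg]
    · simp [ha]
  simp [FormWord.deg, this, Finset.sum_add_distrib]

theorem formSumGr_le {n : ℕ} {k : ℤ} {S : Submodule R (O.FormSum n)}
    (h : ∀ (p : ℕ) (w : Fin p → FormGen n) (o : O.obj p),
      o ∈ (O.obj p).gr (k - FormWord.deg ⟨p, w⟩) → O.word w o ∈ S) : O.formSumGr n k ≤ S := by
  classical
  intro t ht
  rw [← DirectSum.sum_support_of t]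
  refine S.sum_mem fun w _ => ?_
  simp only [formSumGr, Submodule.mem_iInf] at ht
  exact h w.1 w.2 (t w) (ht w)

theorem word_gr' {n p : ℕ} (w : Fin p → FormGen n) {k : ℤ} {o : O.obj p}
    (ho : o ∈ (O.obj p).gr (k - FormWord.deg ⟨p, w⟩)) : O.word w o ∈ O.formSumGr n k := by
  simpa using O.word_gr w ho

theorem dLetter_gr {n p : ℕ} (w : Fin p → FormGen n) (i : Fin p) {k : ℤ} {o : O.obj p}
    (ho : o ∈ (O.obj p).gr (k - FormWord.deg ⟨p, w⟩)) :
    O.dLetter w i o ∈ O.formSumGr n (k + 1) := by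
  rcases hw : w i with j | j
  · rw [O.dLetter_inl hw, DGModule.sgn_apply _ ho]
    refine Submodule.smul_of_tower_mem _ _ (O.word_gr' _ (Submodule.smul_of_tower_mem _ _ ?_))
    rw [deg_update hw, add_sub_add_right_eq_sub]
    exact ho
  · rw [O.dLetter_inr hw]
    exact Submodule.zero_mem _

/-- The differential graded module `⨁_p 𝒪(p) ⊗ V^{⊗ p}`. -/
noncomputable def formSum (n : ℕ) : DGModule R where
  carrier := O.FormSum n
  gr := O.formSumGr n
  isInternal := O.formSum_isInternal n
  d := O.dSum n
  d_mem {k x} hx := by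
    have : O.formSumGr n k ≤ (O.formSumGr n (k + 1)).comap (O.dSum n) := by
      refine O.formSumGr_le fun p w o ho => ?_
      rw [Submodule.mem_comap, dSum_word]
      refine Submodule.add_mem _ (O.word_gr' _ ?_)
        (Submodule.sum_mem _ fun i _ => O.dLetter_gr w i ho)
      have := (O.obj p).d_mem ho
      rwa [sub_add_eq_add_sub] at this
    exact this hx
  d_d := O.dSum_dSum n

/-- The operation `o ∘_i 1₀`, obtained by plugging `1₀` into the `i`-th input of `o`. -/
noncomputable def plugPt {p : ℕ} (i : Fin (p + 1)) : O.obj (p + 1) →ₗ[R] O.obj p :=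
  (O.circ (n := 0) (l := p) rfl i).flip O.pt

/-- The element `oσ ⊗ w₁ ⊗ ⋯ ⊗ w_p - o ⊗ σ(w₁ ⊗ ⋯ ⊗ w_p)`; these elements generate the kernel of
`⨁_p 𝒪(p) ⊗ V^{⊗ p} → ⨁_p 𝒪(p) ⊗_{R[Σ_p]} V^{⊗ p} = 𝒪(V)`. -/
noncomputable def relAct {n p : ℕ} (σ : Equiv.Perm (Fin p)) (w : Fin p → FormGen n) :
    O.obj p →ₗ[R] O.FormSum n :=
  O.word w ∘ₗ O.act σ -
    koszulSign σ (fun i => (w i).deg) • O.word (w ∘ σ.symm)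

/-- The element `o(w₁, …, w_{i - 1}, ∑ⱼ xⱼ - 1₀, w_i, …, w_p)`. -/
noncomputable def relSum {n p : ℕ} (i : Fin (p + 1)) (w : Fin p → FormGen n) :
    O.obj (p + 1) →ₗ[R] O.FormSum n :=
  ∑ j : Fin (n + 1), O.word (i.insertNth (α := fun _ => FormGen n) (.inl j) w) -
    O.word w ∘ₗ O.plugPt i

/-- The element `o(w₁, …, w_{i - 1}, ∑ⱼ dxⱼ, w_i, …, w_p)`. -/
noncomputable def relDSum {n p : ℕ} (i : Fin (p + 1)) (w : Fin p → FormGen n) :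
    O.obj (p + 1) →ₗ[R] O.FormSum n :=
  ∑ j : Fin (n + 1), O.word (i.insertNth (α := fun _ => FormGen n) (.inr j) w)

/-- The kernel of `⨁_p 𝒪(p) ⊗ V^{⊗ p} → 𝒪(x₀, …, xₙ; dx₀, …, dxₙ) / Iₙ`. The ideal `Iₙ` of the free
algebra generated by `∑ⱼ xⱼ - 1₀` and `∑ⱼ dxⱼ` is spanned by the values of the operations on
families consisting of generators and one of these two elements. -/
def formRel (n : ℕ) : Submodule R (O.FormSum n) :=
  Submodule.span R
    ({t | ∃ (p : ℕ) (σ : Equiv.Perm (Fin p)) (w : Fin p → FormGen n) (o : O.obj p),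
        t = O.relAct σ w o} ∪
     {t | ∃ (p : ℕ) (i : Fin (p + 1)) (w : Fin p → FormGen n) (o : O.obj (p + 1)),
        t = O.relSum i w o} ∪
     {t | ∃ (p : ℕ) (i : Fin (p + 1)) (w : Fin p → FormGen n) (o : O.obj (p + 1)),
        t = O.relDSum i w o})

theorem relAct_mem {n p : ℕ} (σ : Equiv.Perm (Fin p)) (w : Fin p → FormGen n) (o : O.obj p) :
    O.relAct σ w o ∈ O.formRel n :=
  Submodule.subset_span (Or.inl (Or.inl ⟨p, σ, w, o, rfl⟩))

theorem relSum_mem {n p : ℕ} (i : Fin (p + 1)) (w : Fin p → FormGen n) (o : O.obj (p + 1)) :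
    O.relSum i w o ∈ O.formRel n :=
  Submodule.subset_span (Or.inl (Or.inr ⟨p, i, w, o, rfl⟩))

theorem relDSum_mem {n p : ℕ} (i : Fin (p + 1)) (w : Fin p → FormGen n) (o : O.obj (p + 1)) :
    O.relDSum i w o ∈ O.formRel n :=
  Submodule.subset_span (Or.inr ⟨p, i, w, o, rfl⟩)

theorem formRel_le {n : ℕ} {S : Submodule R (O.FormSum n)}
    (h₁ : ∀ (p : ℕ) (σ : Equiv.Perm (Fin p)) (w : Fin p → FormGen n) (o : O.obj p),
      O.relAct σ w o ∈ S)
    (h₂ : ∀ (p : ℕ) (i : Fin (p + 1)) (w : Fin p → FormGen n) (o : O.obj (p + 1)),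
      O.relSum i w o ∈ S)
    (h₃ : ∀ (p : ℕ) (i : Fin (p + 1)) (w : Fin p → FormGen n) (o : O.obj (p + 1)),
      O.relDSum i w o ∈ S) : O.formRel n ≤ S := by
  refine Submodule.span_le.2 ?_
  rintro t ((⟨p, σ, w, o, rfl⟩ | ⟨p, i, w, o, rfl⟩) | ⟨p, i, w, o, rfl⟩)
  · exact h₁ p σ w o
  · exact h₂ p i w o
  · exact h₃ p i w o

theorem relAct_apply {n p : ℕ} (σ : Equiv.Perm (Fin p)) (w : Fin p → FormGen n) (o : O.obj p) :
    O.relAct σ w o = O.word w (O.act σ o) -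
      koszulSign σ (fun i => (w i).deg) • O.word (w ∘ σ.symm) o := rfl

theorem relSum_apply {n p : ℕ} (i : Fin (p + 1)) (w : Fin p → FormGen n) (o : O.obj (p + 1)) :
    O.relSum i w o =
      ∑ j : Fin (n + 1), O.word (i.insertNth (α := fun _ => FormGen n) (.inl j) w) o -
        O.word w (O.plugPt i o) := by
  simp [relSum]

theorem relDSum_apply {n p : ℕ} (i : Fin (p + 1)) (w : Fin p → FormGen n) (o : O.obj (p + 1)) :
    O.relDSum i w o =
      ∑ j : Fin (n + 1), O.word (i.insertNth (α := fun _ => FormGen n) (.inr j) w) o := by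
  simp [relDSum]

/-- The projection to the component of degree `k`. -/
noncomputable def projSum (n : ℕ) (k : ℤ) : O.FormSum n →ₗ[R] O.FormSum n := (O.formSum n).proj k

theorem proj_word {n p : ℕ} (w : Fin p → FormGen n) (k : ℤ) (o : O.obj p) :
    O.projSum n k (O.word w o) =
      O.word w ((O.obj p).proj (k - FormWord.deg ⟨p, w⟩) o) :=
  DGModule.proj_map (N := O.formSum n) (O.word w) _ (fun _ _ hx => O.word_gr w hx) k o

theorem proj_act {p : ℕ} (σ : Equiv.Perm (Fin p)) (k : ℤ) (o : O.obj p) :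
    (O.obj p).proj k (O.act σ o) = O.act σ ((O.obj p).proj k o) := by
  simpa using DGModule.proj_map (O.act σ) 0 (fun _ _ hx => by simpa using O.act_gr σ hx) k o

theorem circ_pt_gr {p : ℕ} (i : Fin (p + 1)) {k : ℤ} {o : O.obj (p + 1)}
    (ho : o ∈ (O.obj (p + 1)).gr k) :
    O.plugPt i o ∈ (O.obj p).gr k := by
  have := O.circ_gr (n := 0) (l := p) rfl i ho O.pt_gr
  rwa [add_zero] at this

theorem proj_circ_pt {p : ℕ} (i : Fin (p + 1)) (k : ℤ) (o : O.obj (p + 1)) :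
    (O.obj p).proj k (O.plugPt i o) = O.plugPt i ((O.obj (p + 1)).proj k o) := by
  simpa using DGModule.proj_map (O.plugPt i) 0
    (fun _ _ hx => by simpa using O.circ_pt_gr i hx) k o

theorem sgn_circ_pt {p : ℕ} (i : Fin (p + 1)) (o : O.obj (p + 1)) :
    (O.obj p).sgn (O.plugPt i o) = O.plugPt i ((O.obj (p + 1)).sgn o) :=
  DGModule.sgn_map (O.plugPt i) (fun _ _ hx => O.circ_pt_gr i hx) o

theorem d_circ_pt {p : ℕ} (i : Fin (p + 1)) (o : O.obj (p + 1)) :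
    (O.obj p).d (O.plugPt i o) = O.plugPt i ((O.obj (p + 1)).d o) := by
  have : (O.obj p).d ∘ₗ O.plugPt i =
      O.plugPt i ∘ₗ (O.obj (p + 1)).d := by
    refine DGModule.hom_ext _ fun k x hx => ?_
    simp only [LinearMap.comp_apply, plugPt, LinearMap.flip_apply]
    rw [O.circ_d (n := 0) (l := p) rfl i O.pt hx, O.pt_d, map_zero, smul_zero, add_zero]
  exact LinearMap.congr_fun this o

theorem deg_comp_symm {n p : ℕ} (σ : Equiv.Perm (Fin p)) (w : Fin p → FormGen n) :
    FormWord.deg ⟨p, w ∘ σ.symm⟩ = FormWord.deg ⟨p, w⟩ :=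
  Equiv.sum_comp σ.symm fun i => (w i).deg

theorem deg_insertNth {n p : ℕ} (i : Fin (p + 1)) (b : FormGen n) (w : Fin p → FormGen n) :
    FormWord.deg ⟨p + 1, i.insertNth (α := fun _ => FormGen n) b w⟩ =
      b.deg + FormWord.deg ⟨p, w⟩ := by
  simp [FormWord.deg, Fin.sum_univ_succAbove _ i]

theorem formRel_proj (n : ℕ) (k : ℤ) (t : O.FormSum n) (ht : t ∈ O.formRel n) :
    O.projSum n k t ∈ O.formRel n := by
  have : O.formRel n ≤ (O.formRel n).comap (O.projSum n k) := by
    refine O.formRel_le (fun p σ w o => ?_) (fun p i w o => ?_) (fun p i w o => ?_)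
    · show O.projSum n k _ ∈ O.formRel n
      have h : O.projSum n k (O.relAct σ w o) =
          O.relAct σ w ((O.obj p).proj (k - FormWord.deg ⟨p, w⟩) o) := by
        rw [relAct_apply, relAct_apply, map_sub, Units.smul_def, map_zsmul, proj_word, proj_word,
          deg_comp_symm, proj_act, Units.smul_def]
      rw [h]
      exact O.relAct_mem _ _ _
    · show O.projSum n k _ ∈ O.formRel n
      have h : O.projSum n k (O.relSum i w o) =
          O.relSum i w ((O.obj (p + 1)).proj (k - FormWord.deg ⟨p, w⟩) o) := by
        rw [relSum_apply, relSum_apply, map_sub, map_sum, proj_word, proj_circ_pt]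
        simp [proj_word, deg_insertNth, FormGen.deg]
      rw [h]
      exact O.relSum_mem _ _ _
    · show O.projSum n k _ ∈ O.formRel n
      have h : O.projSum n k (O.relDSum i w o) =
          O.relDSum i w ((O.obj (p + 1)).proj (k - (1 + FormWord.deg ⟨p, w⟩)) o) := by
        rw [relDSum_apply, relDSum_apply, map_sum]
        simp [proj_word, deg_insertNth, FormGen.deg]
      rw [h]
      exact O.relDSum_mem _ _ _
  exact this ht

theorem koszulSign_update {p : ℕ} (σ : Equiv.Perm (Fin p)) (q : Fin p → ℤ) (i : Fin p) :
    koszulSign σ (fun a => q a + if a = i then 1 else 0) =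
      koszulSign σ q * (∑ a with a < i, q a).negOnePow *
        (∑ a with a < σ i, q (σ.symm a)).negOnePow := by
  have hP2 : ∑ a with a < σ i, q (σ.symm a) = ∑ a, if σ a < σ i then q a else 0 := by
    rw [Finset.sum_filter, ← Equiv.sum_comp σ]
    simp
  have hK : (∑ a, ∑ b, if a < b ∧ σ b < σ a then
        (q a + if a = i then 1 else 0) * (q b + if b = i then 1 else 0) else 0) =
      (∑ a, ∑ b, if a < b ∧ σ b < σ a then q a * q b else 0) +
        (∑ a, if a < i ∧ σ i < σ a then q a else 0) +
        (∑ b, if i < b ∧ σ b < σ i then q b else 0) := by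
    have h1 : (∑ a, if a < i ∧ σ i < σ a then q a else 0) =
        ∑ a, ∑ b, if b = i then (if a < b ∧ σ b < σ a then q a else 0) else 0 := by
      simp
    have h2 : (∑ b, if i < b ∧ σ b < σ i then q b else 0) =
        ∑ a, ∑ b, if a = i then (if a < b ∧ σ b < σ a then q b else 0) else 0 := by
      rw [Finset.sum_comm]
      simp
    rw [h1, h2, ← Finset.sum_add_distrib, ← Finset.sum_add_distrib]
    refine Finset.sum_congr rfl fun a _ => ?_
    rw [← Finset.sum_add_distrib, ← Finset.sum_add_distrib]
    refine Finset.sum_congr rfl fun b _ => ?_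
    by_cases hab : a < b ∧ σ b < σ a
    · by_cases ha : a = i
      · have hb : b ≠ i := fun hb => hab.1.ne (ha.trans hb.symm)
        rw [if_pos hab, if_pos hab, if_neg hb, if_neg hb, if_pos ha, if_pos ha, if_pos hab]
        ring
      · by_cases hb : b = i
        · rw [if_pos hab, if_pos hab, if_pos hb, if_pos hb, if_neg ha, if_neg ha, if_pos hab]
          ring
        · simp [hab, ha, hb]
    · simp [hab]
  rw [koszulSign, koszulSign, ← Int.negOnePow_add, ← Int.negOnePow_add, Int.negOnePow_eq_iff, hK,
    hP2, Finset.sum_filter]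
  refine ⟨- ∑ a, if a < i ∧ σ a < σ i then q a else 0, ?_⟩
  have key : (∑ a, if a < i ∧ σ i < σ a then q a else 0) +
      (∑ b, if i < b ∧ σ b < σ i then q b else 0) +
      (∑ a, if a < i ∧ σ a < σ i then q a else 0) + (∑ a, if a < i ∧ σ a < σ i then q a else 0) =
      (∑ a, if a < i then q a else 0) + ∑ a, if σ a < σ i then q a else 0 := by
    simp only [← Finset.sum_add_distrib]
    refine Finset.sum_congr rfl fun a _ => ?_
    rcases lt_trichotomy a i with h | h | h
    · rcases lt_trichotomy (σ a) (σ i) with h' | h' | h'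
      · simp [h, h', h.asymm, h'.asymm]
      · exact absurd (σ.injective h') h.ne
      · simp [h, h', h.asymm, h'.asymm]
    · simp [h]
    · rcases lt_trichotomy (σ a) (σ i) with h' | h' | h'
      · simp [h, h', h.asymm, h'.asymm]
      · exact absurd (σ.injective h') h.ne'
      · simp [h, h', h.asymm, h'.asymm]
  linarith

theorem prefix_insertNth {n p : ℕ} (i : Fin (p + 1)) (b : FormGen n) (w : Fin p → FormGen n)
    (k : Fin p) :
    ∑ a with a < i.succAbove k, (i.insertNth (α := fun _ => FormGen n) b w a).deg =
      (if i < i.succAbove k then b.deg else 0) + ∑ a with a < k, (w a).deg := by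
  rw [Finset.sum_filter, Fin.sum_univ_succAbove _ i, Finset.sum_filter]
  simp

theorem prefix_insertNth_self {n p : ℕ} (i : Fin (p + 1)) (b : FormGen n)
    (w : Fin p → FormGen n) :
    ∑ a with a < i, (i.insertNth (α := fun _ => FormGen n) b w a).deg =
      ∑ a with i.succAbove a < i, (w a).deg := by
  rw [Finset.sum_filter, Fin.sum_univ_succAbove _ i, Finset.sum_filter]
  simp

theorem dLetter_insertNth {n p : ℕ} (i : Fin (p + 1)) (b : FormGen n) (w : Fin p → FormGen n)
    {k : Fin p} {c : Fin (n + 1)} (hk : w k = .inl c) (o : O.obj (p + 1)) :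
    O.dLetter (i.insertNth (α := fun _ => FormGen n) b w) (i.succAbove k) o =
      (if i < i.succAbove k then b.deg else 0).negOnePow • (∑ a with a < k, (w a).deg).negOnePow •
        O.word (i.insertNth (α := fun _ => FormGen n) b (Function.update w k (.inr c)))
          ((O.obj (p + 1)).sgn o) := by
  rw [O.dLetter_inl (j := c) (by simpa using hk), prefix_insertNth, Int.negOnePow_add, smul_smul,
    Fin.insertNth_update]

theorem dLetter_comp_symm {n p : ℕ} (σ : Equiv.Perm (Fin p)) (w : Fin p → FormGen n) (i : Fin p)
    (o : O.obj p) :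
    O.dLetter w i (O.act σ o) -
      koszulSign σ (fun i => (w i).deg) • O.dLetter (w ∘ σ.symm) (σ i) o ∈ O.formRel n := by
  rcases hw : w i with j | j
  · have hdeg : ∀ a, (Function.update w i (.inr j) a).deg = (w a).deg + if a = i then 1 else 0 := by
      intro a
      by_cases ha : a = i
      · subst ha
        simp [hw, FormGen.deg]
      · simp [ha]
    have hup : Function.update (w ∘ σ.symm) (σ i) (.inr j) =
        Function.update w i (.inr j) ∘ σ.symm := by
      ext a : 1
      by_cases ha : a = σ i
      · subst ha
        simp
      · have : σ.symm a ≠ i := fun h => ha (by rw [← h, Equiv.apply_symm_apply])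
        simp [ha, this]
    have h := Submodule.smul_of_tower_mem (O.formRel n) (∑ k with k < i, (w k).deg).negOnePow
      (O.relAct_mem σ (Function.update w i (.inr j)) ((O.obj p).sgn o))
    rw [O.dLetter_inl hw, O.dLetter_inl (j := j) (by simpa using hw), hup,
      DGModule.sgn_map (O.act σ) (fun _ _ hx => O.act_gr σ hx)]
    rw [relAct_apply, smul_sub] at h
    simp only [hdeg] at h
    rw [koszulSign_update σ (fun a => (w a).deg) i, smul_smul] at h
    convert h using 2
    rw [smul_smul]
    congr 1
    have := Int.units_mul_self (∑ k with k < i, (w k).deg).negOnePow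
    simp only [Function.comp_apply]
    rw [mul_comm (koszulSign _ _) (Int.negOnePow (∑ k with k < i, (w k).deg)), mul_assoc,
      ← mul_assoc, ← mul_assoc, this, one_mul]
  · rw [O.dLetter_inr hw, O.dLetter_inr (j := j) (by simpa using hw)]
    simp

theorem formRel_d (n : ℕ) (t : O.FormSum n) (ht : t ∈ O.formRel n) :
    O.dSum n t ∈ O.formRel n := by
  have : O.formRel n ≤ (O.formRel n).comap (O.dSum n) := by
    refine O.formRel_le (fun p σ w o => ?_) (fun p i w o => ?_) (fun p i w o => ?_)
    · rw [Submodule.mem_comap, relAct_apply, map_sub, Units.smul_def, map_zsmul, dSum_word,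
        dSum_word, O.act_d, ← Equiv.sum_comp σ (fun i => O.dLetter (w ∘ σ.symm) i o), ← Units.smul_def, smul_add, add_sub_add_comm,
        Finset.smul_sum, ← Finset.sum_sub_distrib]
      exact Submodule.add_mem _ (O.relAct_mem σ w ((O.obj p).d o))
        (Submodule.sum_mem _ fun i _ => O.dLetter_comp_symm σ w i o)
    · have hk : ∀ k : Fin p, ∑ j, O.dLetter (i.insertNth (α := fun _ => FormGen n) (.inl j) w)
          (i.succAbove k) o - O.dLetter w k (O.plugPt i o) ∈ O.formRel n := by
        intro k
        rcases hw : w k with c | c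
        · have h := Submodule.smul_of_tower_mem (O.formRel n)
            (∑ a with a < k, (w a).deg).negOnePow
            (O.relSum_mem i (Function.update w k (.inr c)) ((O.obj (p + 1)).sgn o))
          rw [relSum_apply, smul_sub, Finset.smul_sum] at h
          rw [O.dLetter_inl hw, O.sgn_circ_pt]
          simp only [O.dLetter_insertNth i _ w hw]
          simpa [FormGen.deg] using h
        · rw [O.dLetter_inr hw]
          simp only [O.dLetter_inr (w := i.insertNth (α := fun _ => FormGen n) _ w) (j := c)
            (i := i.succAbove k) (by simpa using hw)]
          simp
      have hi : ∑ j, O.dLetter (i.insertNth (α := fun _ => FormGen n) (.inl j) w) i o ∈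
          O.formRel n := by
        have h := Submodule.smul_of_tower_mem (O.formRel n)
          (∑ a with i.succAbove a < i, (w a).deg).negOnePow
          (O.relDSum_mem i w ((O.obj (p + 1)).sgn o))
        rw [relDSum_apply, Finset.smul_sum] at h
        convert h using 2 with j
        rw [O.dLetter_inl (j := j) (by simp), prefix_insertNth_self, Fin.update_insertNth]
      have h := Submodule.add_mem _ (Submodule.add_mem _
        (O.relSum_mem i w ((O.obj (p + 1)).d o)) hi)
        (Submodule.sum_mem _ fun k (_ : k ∈ Finset.univ) => hk k)
      rw [Submodule.mem_comap, relSum_apply, map_sub, map_sum, dSum_word, O.d_circ_pt]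
      simp only [dSum_word, Fin.sum_univ_succAbove _ i, Finset.sum_add_distrib]
      rw [relSum_apply, Finset.sum_sub_distrib, Finset.sum_comm] at h
      convert h using 1
      abel
    · have hk : ∀ k : Fin p, ∑ j, O.dLetter (i.insertNth (α := fun _ => FormGen n) (.inr j) w)
          (i.succAbove k) o ∈ O.formRel n := by
        intro k
        rcases hw : w k with c | c
        · have h := Submodule.smul_of_tower_mem (O.formRel n)
            (∑ a with a < k, (w a).deg).negOnePow
            (O.relDSum_mem i (Function.update w k (.inr c)) ((O.obj (p + 1)).sgn o))
          have h := Submodule.smul_of_tower_mem (O.formRel n)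
            (if i < i.succAbove k then (1 : ℤ) else 0).negOnePow h
          rw [relDSum_apply, Finset.smul_sum, Finset.smul_sum] at h
          simp only [O.dLetter_insertNth i _ w hw]
          simpa [FormGen.deg] using h
        · simp only [O.dLetter_inr (w := i.insertNth (α := fun _ => FormGen n) _ w) (j := c)
            (i := i.succAbove k) (by simpa using hw)]
          simp
      have h := Submodule.add_mem _ (O.relDSum_mem i w ((O.obj (p + 1)).d o))
        (Submodule.sum_mem _ fun k (_ : k ∈ Finset.univ) => hk k)
      rw [Submodule.mem_comap, relDSum_apply, map_sum]
      simp only [dSum_word, Fin.sum_univ_succAbove _ i, Finset.sum_add_distrib]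
      rw [relDSum_apply, Finset.sum_comm] at h
      convert h using 2
      have : ∀ j, O.dLetter (i.insertNth (α := fun _ => FormGen n) (.inr j) w) i o = 0 :=
        fun j => O.dLetter_inr (j := j) (by simp) o
      simp [this]
  exact this ht

/-- The differential graded module `𝒪(x₀, …, xₙ; dx₀, …, dxₙ) / Iₙ`. -/
noncomputable def omega (n : ℕ) : DGModule R :=
  (O.formSum n).quotient (O.formRel n) (O.formRel_proj n) (O.formRel_d n)

/-- The map `𝒪(V_n) → 𝒪(V_m)` induced by `xᵢ ↦ ∑_{f a = i} x_a` and `dxᵢ ↦ ∑_{f a = i} dx_a`, on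
representatives: a word is sent to the sum of the words lying above it. -/
noncomputable def pullSum {m n : ℕ} (f : Fin (m + 1) → Fin (n + 1)) :
    O.FormSum n →ₗ[R] O.FormSum m :=
  DirectSum.toModule R (FormWord n) (O.FormSum m) fun w =>
    ∑ v : Fin w.1 → FormGen m with Sum.map f f ∘ v = w.2, O.word v

theorem pullSum_word {m n p : ℕ} (f : Fin (m + 1) → Fin (n + 1)) (w : Fin p → FormGen n)
    (o : O.obj p) :
    O.pullSum f (O.word w o) = ∑ v : Fin p → FormGen m with Sum.map f f ∘ v = w, O.word v o := by
  rw [pullSum, word, DirectSum.toModule_lof, LinearMap.sum_apply]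

theorem deg_map {m n : ℕ} (f : Fin (m + 1) → Fin (n + 1)) (g : FormGen m) :
    FormGen.deg (Sum.map f f g) = g.deg := by
  rcases g with a | a <;> rfl

theorem deg_of_over {m n p : ℕ} {f : Fin (m + 1) → Fin (n + 1)} {v : Fin p → FormGen m}
    {w : Fin p → FormGen n} (h : Sum.map f f ∘ v = w) (i : Fin p) : (w i).deg = (v i).deg := by
  rw [← h]
  exact deg_map f (v i)

theorem pullSum_gr {m n : ℕ} (f : Fin (m + 1) → Fin (n + 1)) (k : ℤ) (t : O.FormSum n)
    (ht : t ∈ O.formSumGr n k) : O.pullSum f t ∈ O.formSumGr m k := by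
  have : O.formSumGr n k ≤ (O.formSumGr m k).comap (O.pullSum f) := by
    refine O.formSumGr_le fun p w o ho => ?_
    rw [Submodule.mem_comap, pullSum_word]
    refine Submodule.sum_mem _ fun v hv => O.word_gr' v ?_
    have h : FormWord.deg ⟨p, v⟩ = FormWord.deg ⟨p, w⟩ :=
      Finset.sum_congr rfl fun i _ => (deg_of_over (Finset.mem_filter.1 hv).2 i).symm
    rwa [h]
  exact this ht

theorem pullSum_dLetter {m n p : ℕ} (f : Fin (m + 1) → Fin (n + 1)) (w : Fin p → FormGen n)
    (i : Fin p) (o : O.obj p) :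
    O.pullSum f (O.dLetter w i o) =
      ∑ v : Fin p → FormGen m with Sum.map f f ∘ v = w, O.dLetter v i o := by
  rcases hw : w i with j | j
  · rw [O.dLetter_inl hw, Units.smul_def, map_zsmul, ← Units.smul_def, pullSum_word,
      Finset.smul_sum]
    symm
    refine Finset.sum_nbij' (fun v => Function.update v i (.inr (Sum.elim id id (v i))))
      (fun v => Function.update v i (.inl (Sum.elim id id (v i)))) ?_ ?_ ?_ ?_ ?_
    · intro v hv
      simp only [Finset.mem_filter, Finset.mem_univ, true_and] at hv ⊢
      have hi := congrFun hv i
      rw [hw] at hi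
      ext a : 1
      by_cases ha : a = i
      · subst ha
        rcases hva : v a with c | c
        · simp only [Function.comp_apply, hva, Sum.map_inl, Sum.inl.injEq] at hi
          simp [hi]
        · simp [hva] at hi
      · simpa [ha] using congrFun hv a
    · intro v hv
      simp only [Finset.mem_filter, Finset.mem_univ, true_and] at hv ⊢
      have hi := congrFun hv i
      ext a : 1
      by_cases ha : a = i
      · subst ha
        rcases hva : v a with c | c
        · simp [hva] at hi
        · simp only [Function.comp_apply, hva, Sum.map_inr, Function.update_self,
            Sum.inr.injEq] at hi
          simp [hi, hw]
      · simpa [ha] using congrFun hv a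
    · intro v hv
      simp only [Finset.mem_filter, Finset.mem_univ, true_and] at hv
      have hi := congrFun hv i
      rw [hw] at hi
      rcases hva : v i with c | c
      · simp [hva, Function.update_eq_self_iff]
      · simp [hva] at hi
    · intro v hv
      simp only [Finset.mem_filter, Finset.mem_univ, true_and] at hv
      have hi := congrFun hv i
      rcases hva : v i with c | c
      · simp [hva] at hi
      · simp [hva, Function.update_eq_self_iff]
    · intro v hv
      simp only [Finset.mem_filter, Finset.mem_univ, true_and] at hv
      have hi := congrFun hv i
      rw [hw] at hi
      rcases hva : v i with c | c
      · rw [O.dLetter_inl hva]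
        simp [deg_of_over hv]
      · simp [hva] at hi
  · rw [O.dLetter_inr hw, map_zero]
    refine (Finset.sum_eq_zero fun v hv => ?_).symm
    simp only [Finset.mem_filter, Finset.mem_univ, true_and] at hv
    have hi := congrFun hv i
    rw [hw] at hi
    rcases hva : v i with c | c
    · simp [hva] at hi
    · exact O.dLetter_inr hva o

theorem pullSum_d {m n : ℕ} (f : Fin (m + 1) → Fin (n + 1)) (t : O.FormSum n) :
    O.pullSum f (O.dSum n t) = O.dSum m (O.pullSum f t) := by
  have : O.pullSum f ∘ₗ O.dSum n = O.dSum m ∘ₗ O.pullSum f := by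
    refine O.formSum_hom_ext fun p w o => ?_
    simp only [LinearMap.comp_apply]
    rw [dSum_word, map_add, map_sum, pullSum_word, pullSum_word, map_sum]
    simp only [pullSum_dLetter, dSum_word, Finset.sum_add_distrib]
    rw [Finset.sum_comm]
  exact LinearMap.congr_fun this t

theorem sum_over_insertNth {m n p : ℕ} {P : Type u} [AddCommGroup P]
    (f : Fin (m + 1) → Fin (n + 1)) (i : Fin (p + 1)) (b : FormGen n) (w : Fin p → FormGen n)
    (F : (Fin (p + 1) → FormGen m) → P) :
    ∑ v : Fin (p + 1) → FormGen m with
        Sum.map f f ∘ v = i.insertNth (α := fun _ => FormGen n) b w, F v =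
      ∑ u : Fin p → FormGen m with Sum.map f f ∘ u = w,
        ∑ c : FormGen m with Sum.map f f c = b, F (i.insertNth (α := fun _ => FormGen m) c u) := by
  have hiff : ∀ (c : FormGen m) (u : Fin p → FormGen m),
      Sum.map f f ∘ i.insertNth (α := fun _ => FormGen m) c u =
        i.insertNth (α := fun _ => FormGen n) b w ↔ Sum.map f f ∘ u = w ∧ Sum.map f f c = b := by
    intro c u
    rw [Fin.eq_insertNth_iff]
    constructor
    · rintro ⟨h1, h2⟩
      refine ⟨?_, by simpa using h1⟩
      rw [← h2]
      funext a
      simp [Fin.removeNth]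
    · rintro ⟨h1, h2⟩
      refine ⟨by simpa using h2, ?_⟩
      rw [← h1]
      ext a : 1
      simp [Fin.removeNth]
  rw [Finset.sum_filter, ← Equiv.sum_comp (Fin.insertNthEquiv (fun _ => FormGen m) i),
    Fintype.sum_prod_type, Finset.sum_comm, Finset.sum_filter]
  refine Finset.sum_congr rfl fun u _ => ?_
  by_cases hu : Sum.map f f ∘ u = w
  · rw [if_pos hu, Finset.sum_filter]
    refine Finset.sum_congr rfl fun c _ => ?_
    refine (if_congr ((hiff c u).trans ?_) rfl rfl)
    simp [hu]
  · rw [if_neg hu]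
    refine Finset.sum_eq_zero fun c _ => ?_
    exact if_neg fun h => hu ((hiff c u).1 h).1

theorem sum_inl {m n : ℕ} {P : Type u} [AddCommGroup P] (f : Fin (m + 1) → Fin (n + 1))
    (F : FormGen m → P) :
    ∑ j : Fin (n + 1), ∑ c : FormGen m with Sum.map f f c = .inl j, F c =
      ∑ a : Fin (m + 1), F (.inl a) := by
  simp only [Finset.sum_filter, Fintype.sum_sum_type, Sum.map_inl, Sum.map_inr, Sum.inl.injEq,
    reduceCtorEq, if_false, Finset.sum_const_zero, add_zero]
  rw [Finset.sum_comm]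
  simp

theorem sum_inr {m n : ℕ} {P : Type u} [AddCommGroup P] (f : Fin (m + 1) → Fin (n + 1))
    (F : FormGen m → P) :
    ∑ j : Fin (n + 1), ∑ c : FormGen m with Sum.map f f c = .inr j, F c =
      ∑ a : Fin (m + 1), F (.inr a) := by
  simp only [Finset.sum_filter, Fintype.sum_sum_type, Sum.map_inl, Sum.map_inr, Sum.inr.injEq,
    reduceCtorEq, if_false, Finset.sum_const_zero, zero_add]
  rw [Finset.sum_comm]
  simp

theorem pullSum_formRel {m n : ℕ} (f : Fin (m + 1) → Fin (n + 1)) :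
    O.formRel n ≤ (O.formRel m).comap (O.pullSum f) := by
  refine O.formRel_le (fun p σ w o => ?_) (fun p i w o => ?_) (fun p i w o => ?_)
  · have h : O.pullSum f (O.relAct σ w o) =
        ∑ v : Fin p → FormGen m with Sum.map f f ∘ v = w, O.relAct σ v o := by
      rw [relAct_apply, map_sub, Units.smul_def, map_zsmul, ← Units.smul_def, pullSum_word,
        pullSum_word, Finset.smul_sum]
      simp only [relAct_apply, Finset.sum_sub_distrib]
      congr 1
      symm
      refine Finset.sum_nbij' (fun v => v ∘ σ.symm) (fun v => v ∘ σ) ?_ ?_ ?_ ?_ ?_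
      · intro v hv
        simp only [Finset.mem_filter, Finset.mem_univ, true_and] at hv ⊢
        rw [← hv, Function.comp_assoc]
      · intro v hv
        simp only [Finset.mem_filter, Finset.mem_univ, true_and] at hv ⊢
        rw [← Function.comp_assoc, hv, Function.comp_assoc]
        simp
      · intro v _
        simp [Function.comp_assoc]
      · intro v _
        simp [Function.comp_assoc]
      · intro v hv
        simp only [Finset.mem_filter, Finset.mem_univ, true_and] at hv
        simp only [deg_of_over hv]
    rw [Submodule.mem_comap, h]
    exact Submodule.sum_mem _ fun v _ => O.relAct_mem σ v o
  · have h : O.pullSum f (O.relSum i w o) =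
        ∑ u : Fin p → FormGen m with Sum.map f f ∘ u = w, O.relSum i u o := by
      rw [relSum_apply, map_sub, map_sum, pullSum_word]
      simp only [pullSum_word, relSum_apply, Finset.sum_sub_distrib]
      congr 1
      simp only [sum_over_insertNth]
      rw [Finset.sum_comm]
      refine Finset.sum_congr rfl fun u _ => ?_
      exact sum_inl f fun c => O.word (i.insertNth (α := fun _ => FormGen m) c u) o
    rw [Submodule.mem_comap, h]
    exact Submodule.sum_mem _ fun v _ => O.relSum_mem i v o
  · have h : O.pullSum f (O.relDSum i w o) =
        ∑ u : Fin p → FormGen m with Sum.map f f ∘ u = w, O.relDSum i u o := by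
      rw [relDSum_apply, map_sum]
      simp only [pullSum_word, relDSum_apply]
      simp only [sum_over_insertNth]
      rw [Finset.sum_comm]
      refine Finset.sum_congr rfl fun u _ => ?_
      exact sum_inr f fun c => O.word (i.insertNth (α := fun _ => FormGen m) c u) o
    rw [Submodule.mem_comap, h]
    exact Submodule.sum_mem _ fun v _ => O.relDSum_mem i v o

/-- The simplicial operator `Ω_n → Ω_m` of a map `[m] → [n]`: it is induced by
`xᵢ ↦ ∑_{f a = i} x_a` and `dxᵢ ↦ ∑_{f a = i} dx_a`. For the coface maps and the codegeneracy maps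
these are the usual face and degeneracy operators. -/
noncomputable def omegaPull {m n : ℕ} (f : Fin (m + 1) → Fin (n + 1)) :
    DGModule.Hom (O.omega n) (O.omega m) where
  toLin := Submodule.mapQ (O.formRel n) (O.formRel m) (O.pullSum f) (O.pullSum_formRel f)
  map_gr {k x} hx := by
    obtain ⟨t, ht, rfl⟩ := hx
    exact ⟨O.pullSum f t, O.pullSum_gr f k t ht, rfl⟩
  map_d x := by
    obtain ⟨t, rfl⟩ := (O.formRel n).mkQ_surjective x
    exact congrArg (O.formRel m).mkQ (O.pullSum_d f t)

theorem omegaPull_id {n : ℕ} (x : O.omega n) : (O.omegaPull (id : Fin (n + 1) → _)).toLin x = x := by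
  have h : O.pullSum (id : Fin (n + 1) → _) = LinearMap.id := by
    refine O.formSum_hom_ext fun p w o => ?_
    rw [pullSum_word]
    simp [Finset.filter_eq']
  obtain ⟨t, rfl⟩ := (O.formRel n).mkQ_surjective x
  exact congrArg (O.formRel n).mkQ (LinearMap.congr_fun h t)

theorem omegaPull_comp {l m n : ℕ} (g : Fin (l + 1) → Fin (m + 1)) (f : Fin (m + 1) → Fin (n + 1))
    (x : O.omega n) :
    (O.omegaPull (f ∘ g)).toLin x = (O.omegaPull g).toLin ((O.omegaPull f).toLin x) := by
  have h : O.pullSum (f ∘ g) = O.pullSum g ∘ₗ O.pullSum f := by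
    refine O.formSum_hom_ext fun p w o => ?_
    rw [LinearMap.comp_apply, pullSum_word, pullSum_word, map_sum]
    simp only [pullSum_word]
    rw [← Finset.sum_biUnion]
    · refine Finset.sum_congr ?_ fun _ _ => rfl
      ext v
      simp [← Sum.map_comp_map, Function.comp_assoc]
    · intro a _ b _ hab
      rw [Function.onFun, Finset.disjoint_left]
      intro v hv hv'
      simp only [Finset.mem_filter, Finset.mem_univ, true_and] at hv hv'
      exact hab (hv.symm.trans hv')
  obtain ⟨t, rfl⟩ := (O.formRel n).mkQ_surjective x
  exact congrArg (O.formRel l).mkQ (LinearMap.congr_fun h t)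

/-- The homogeneous elements of degree `k` of `Ω(X)`: simplicial maps `X → Ω_*` whose values are
homogeneous of degree `k`. -/
def formsGr (X : SSet.{u}) (k : ℤ) : Submodule R (∀ n : ℕ, X _⦋n⦌ → O.omega n) where
  carrier := {ω | (∀ (m n : ℕ) (α : ⦋m⦌ ⟶ ⦋n⦌) (s : X _⦋n⦌),
      ω m (X.map α.op s) = (O.omegaPull α.toOrderHom).toLin (ω n s)) ∧
    ∀ (n : ℕ) (s : X _⦋n⦌), ω n s ∈ (O.omega n).gr k}
  zero_mem' := ⟨fun _ _ _ _ => (map_zero _).symm, fun _ _ => Submodule.zero_mem _⟩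
  add_mem' hω hη := ⟨fun m n α s => by simp [hω.1 m n α s, hη.1 m n α s],
    fun n s => Submodule.add_mem _ (hω.2 n s) (hη.2 n s)⟩
  smul_mem' c ω hω := ⟨fun m n α s => by simp [hω.1 m n α s],
    fun n s => Submodule.smul_mem _ c (hω.2 n s)⟩

/-- The differential of `Ω(X)`, which is computed pointwise. -/
noncomputable def formsD (X : SSet.{u}) :
    (∀ n : ℕ, X _⦋n⦌ → O.omega n) →ₗ[R] (∀ n : ℕ, X _⦋n⦌ → O.omega n) :=
  LinearMap.pi fun n => LinearMap.pi fun s =>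
    (O.omega n).d ∘ₗ LinearMap.proj s ∘ₗ LinearMap.proj n

theorem formsD_mem (X : SSet.{u}) {k : ℤ} {ω : ∀ n : ℕ, X _⦋n⦌ → O.omega n}
    (hω : ω ∈ O.formsGr X k) : O.formsD X ω ∈ O.formsGr X (k + 1) := by
  refine ⟨fun m n α s => ?_, fun n s => (O.omega n).d_mem (hω.2 n s)⟩
  change (O.omega m).d (ω m _) = (O.omegaPull α.toOrderHom).toLin ((O.omega n).d (ω n s))
  rw [hω.1 m n α s, DGModule.Hom.map_d]

/-- The differential graded module of generalised differential forms
`Ω^𝒪(X) = Hom(X, Ω^𝒪_*)`: its component of degree `k` consists of the simplicial maps from `X` to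
the component of degree `k` of `Ω^𝒪_*`. -/
noncomputable def forms (X : SSet.{u}) : DGModule R where
  carrier := ↥(⨆ k, O.formsGr X k)
  gr k := (O.formsGr X k).comap (⨆ k, O.formsGr X k).subtype
  isInternal := by
    rw [DirectSum.isInternal_submodule_iff_iSupIndep_and_iSup_eq_top]
    constructor
    · exact DGModule.iSupIndep_of_jointly_injective
        (N := fun i : Σ n : ℕ, X _⦋n⦌ => O.omega i.1)
        (fun i => LinearMap.proj i.2 ∘ₗ LinearMap.proj i.1 ∘ₗ (⨆ k, O.formsGr X k).subtype)
        (fun _ => 0)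
        (fun _ ht => Subtype.ext (funext fun n => funext fun s => ht ⟨n, s⟩))
        (fun k t ht i => by rw [sub_zero]; exact ht.2 i.1 i.2)
    · apply Submodule.map_injective_of_injective (⨆ k, O.formsGr X k).injective_subtype
      rw [Submodule.map_iSup, Submodule.map_subtype_top]
      refine iSup_congr fun k => ?_
      rw [Submodule.map_comap_subtype, inf_eq_right]
      exact le_iSup (O.formsGr X) k
  d := (O.formsD X).restrict (by
    have : (⨆ k, O.formsGr X k) ≤ (⨆ k, O.formsGr X k).comap (O.formsD X) :=
      iSup_le fun k ω hω => (le_iSup (O.formsGr X) (k + 1)) (O.formsD_mem X hω)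
    exact this)
  d_mem hx := O.formsD_mem X hx
  d_d x := Subtype.ext (funext fun n => funext fun s => (O.omega n).d_d _)

/-- Composition with a map of simplicial sets `f : X → Y`. -/
noncomputable def formsPull {X Y : SSet.{u}} (f : X ⟶ Y) :
    (∀ n : ℕ, Y _⦋n⦌ → O.omega n) →ₗ[R] (∀ n : ℕ, X _⦋n⦌ → O.omega n) :=
  LinearMap.pi fun n => LinearMap.pi fun s =>
    LinearMap.proj (f.app (.op ⦋n⦌) s) ∘ₗ LinearMap.proj n

theorem formsPull_mem {X Y : SSet.{u}} (f : X ⟶ Y) {k : ℤ} {ω : ∀ n : ℕ, Y _⦋n⦌ → O.omega n}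
    (hω : ω ∈ O.formsGr Y k) : O.formsPull f ω ∈ O.formsGr X k := by
  refine ⟨fun m n α s => ?_, fun n s => hω.2 n _⟩
  change ω m (f.app (.op ⦋m⦌) (X.map α.op s)) =
    (O.omegaPull α.toOrderHom).toLin (ω n (f.app (.op ⦋n⦌) s))
  rw [← hω.1 m n α, NatTrans.naturality_apply]

/-- The morphism `Ω^𝒪(f) : Ω^𝒪(Y) → Ω^𝒪(X)` induced by a map of simplicial sets `f : X → Y`. -/
noncomputable def formsMap {X Y : SSet.{u}} (f : X ⟶ Y) :
    DGModule.Hom (O.forms Y) (O.forms X) where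
  toLin := LinearMap.restrict (O.formsPull f)
    (p := ⨆ k, O.formsGr Y k) (q := ⨆ k, O.formsGr X k) (by
      have : (⨆ k, O.formsGr Y k) ≤ (⨆ k, O.formsGr X k).comap (O.formsPull f) :=
        iSup_le fun k ω hω => (le_iSup (O.formsGr X) k) (O.formsPull_mem f hω)
      exact this)
  map_gr hx := O.formsPull_mem f hx
  map_d x := rfl

end UAOperad

/-!
The dg operad `P` of operations on `Ω_*` is considered: an element of arity `n` is a family of
multilinear maps `(Ω_N)^n → Ω_N`, one for every `N`, which is natural for all maps of vertices and
*unital*, that is, multiplication by a scalar in each variable when the other variables are the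
unit of `Ω_N`. Its value at the units on the `0`-simplex is an augmentation `P → 𝒞om`, bijective in
arities `0` and `1`. Elements of `P` act pointwise on simplicial maps `X → Ω_*`, and this action is
natural in `X` for free (`UAOperad.formsAlgebra`). So it suffices that `P → 𝒞om` is a trivial
fibration: as `E` is cofibrant, its augmentation then lifts to a morphism `E → P`.

This is proved for any `FormSystem`, an axiomatic version of `Ω_*`. It consists of the evaluations
`ev v` at the vertices, of operators `L v` which are a natural partition of unity of `Ω_N` indexed
by its vertices, and of homotopies `h v` from the identity to the evaluation at `v`, such that
`f^* ∘ h (f v) = h v ∘ f^*`, `h v 1 = 0`, and `h v` lowers a weight which is finite on every element.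
For a cycle `φ` in the kernel of the augmentation, the operation
`a ↦ ∑ v, L v (φ (H v a))`, where `H v` is the homotopy on `n`-fold tensors induced by `h v`, is
natural, and bounds `±φ` up to an error term, since the `L v` are not chain maps
(`FormSystem.endD_contract`). The error term is again a cycle and lowers the weight, so that the
iterates of the procedure can be summed: the kernel of the augmentation is acyclic. The binary
operation `a, b ↦ ∑ v, L v (a *_v b)`, where `*_v` is the product of the square-zero extension
along `ev v` (`FormSystem.binaryOp`), and its iterates have augmentation `1`, so that the
augmentation is surjective.

For `Ω_* = Ω^𝒪_*` the operator `L v` is right multiplication by `x_v`, by means of a binary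
operation `μ ∈ 𝒪(2)` of degree `0` and augmentation `1` (`UAOperad.omegaMul`); such an operation
exists because the augmentation of `𝒪` is surjective. They sum to the identity because
`∑ x_v = 1` in `Ω_N`.

The homotopies `h v` come from the cofibrancy of `𝒪`. Let `J` be the complex of cochains of the
interval, with basis `1, t, dt`. Inside `𝒪 ⊗ End(J)` there is the path operad (`pathOperad`) of the
operations which restrict to one and the same element of `𝒪` at both endpoints of the interval; the
restriction to the endpoint is a trivial fibration from the path operad to `𝒪`, and has a section as
`𝒪` is cofibrant (`UAOperad.IsCofibrant.exists_pathSection`). The section makes `Ω_N ⊗ J` into an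
`𝒪`-algebra, and the affine contraction `xᵢ ↦ (1 - t) xᵢ(v) + t xᵢ` of the simplex to the vertex `v`
becomes a morphism of algebras `Ω_N → Ω_N ⊗ J`. Its component at `dt` is the homotopy `h v`, up to
sign (`UAOperad.pathMap`, `UAOperad.omegaH`).

The signs are organised as follows. A `GradedOperad` is an operad presented by ambient modules and
submodules of homogeneous elements, on which alone the axioms are imposed. Endomorphism operads and
matrix operads are first formed with the simpler differential and then twisted by a Maurer–Cartan
element of arity one (`GradedOperad.twist`), which supplies the Koszul signs of the differentials of
`Ω_N` and `J`.
-/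

/-! ### Differential graded modules -/

namespace DGModule

variable {R : Type u} [CommRing R]

theorem induction_gr (M : DGModule R) {p : M → Prop} (x : M) (h : ∀ k, ∀ x ∈ M.gr k, p x)
    (hadd : ∀ x y, p x → p y → p (x + y)) : p x :=
  Submodule.iSup_induction M.gr (motive := p) (by rw [M.iSup_gr]; trivial) h
    (h 0 0 (Submodule.zero_mem _)) hadd

/-- Every element is the sum of its homogeneous components. -/
theorem exists_sum_proj (M : DGModule R) (x : M) :
    ∃ s : Finset ℤ, ∀ t, s ⊆ t → ∑ k ∈ t, M.proj k x = x := by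
  refine M.induction_gr (p := fun x => ∃ s : Finset ℤ, ∀ t, s ⊆ t → ∑ k ∈ t, M.proj k x = x) x
    (fun k x hx => ⟨{k}, fun t ht => ?_⟩) ?_
  · rw [Finset.sum_eq_single k (fun j _ hj => M.proj_apply_of_ne hj.symm hx)
      (fun h => absurd (ht (Finset.mem_singleton_self k)) h), M.proj_apply_self hx]
  · rintro x y ⟨s, hs⟩ ⟨s', hs'⟩
    refine ⟨s ∪ s', fun t ht => ?_⟩
    simp only [map_add, Finset.sum_add_distrib]
    rw [hs t (Finset.union_subset_left ht), hs' t (Finset.union_subset_right ht)]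

theorem Hom.proj_apply {M N : DGModule R} (f : Hom M N) (k : ℤ) (x : M) :
    N.proj k (f.toLin x) = f.toLin (M.proj k x) := by
  simpa using proj_map f.toLin 0 (fun k x hx => by simpa using f.map_gr hx) k x

theorem proj_d (M : DGModule R) (k : ℤ) (x : M) : M.proj (k + 1) (M.d x) = M.d (M.proj k x) := by
  simpa using proj_map M.d 1 (fun k x hx => M.d_mem hx) (k + 1) x

/-- A surjective morphism whose kernel is acyclic is a quasi-isomorphism; acyclicity of the kernel
need only be tested on homogeneous cycles. -/
theorem Hom.isQuasiIso_of_surjective {M N : DGModule R} (f : Hom M N)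
    (hs : Function.Surjective f.toLin)
    (hk : ∀ k, ∀ x ∈ M.gr k, f.toLin x = 0 → M.d x = 0 → ∃ y, f.toLin y = 0 ∧ M.d y = x) :
    f.IsQuasiIso := by
  have hk' : ∀ x, f.toLin x = 0 → M.d x = 0 → ∃ y, f.toLin y = 0 ∧ M.d y = x := by
    intro x hx hdx
    obtain ⟨s, hsum⟩ := M.exists_sum_proj x
    have h : ∀ k, ∃ y, f.toLin y = 0 ∧ M.d y = M.proj k x := fun k =>
      hk k _ (M.proj_mem k x) (by rw [← f.proj_apply, hx, map_zero])
        (by rw [← M.proj_d, hdx, map_zero])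
    choose y hy hdy using h
    refine ⟨∑ k ∈ s, y k, by simp [hy], ?_⟩
    rw [map_sum, Finset.sum_congr rfl fun k _ => hdy k]
    exact hsum s subset_rfl
  constructor
  · rw [← LinearMap.ker_eq_bot, LinearMap.ker_eq_bot']
    intro c hc
    obtain ⟨⟨x, hx⟩, rfl⟩ := Submodule.mkQ_surjective _ c
    have hx' : M.d x = 0 := hx
    have h1 := (Submodule.Quotient.mk_eq_zero _).1 hc
    obtain ⟨z, hz⟩ := h1
    obtain ⟨w, rfl⟩ := hs z
    have hz' : N.d (f.toLin w) = f.toLin x := hz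
    obtain ⟨y, _, hdy⟩ := hk' (x - M.d w) (by rw [map_sub, f.map_d, hz', sub_self])
      (by rw [map_sub, hx', M.d_d, sub_zero])
    refine (Submodule.Quotient.mk_eq_zero _).2 ⟨y + w, ?_⟩
    change M.d (y + w) = x
    rw [map_add, hdy, sub_add_cancel]
  · intro c
    obtain ⟨⟨z, hz⟩, rfl⟩ := Submodule.mkQ_surjective _ c
    obtain ⟨x, rfl⟩ := hs z
    have hz' : N.d (f.toLin x) = 0 := hz
    obtain ⟨y, hy, hdy⟩ := hk' (M.d x) (by rw [f.map_d, hz']) (M.d_d x)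
    have hc : M.d (x - y) = 0 := by rw [map_sub, hdy, sub_self]
    refine ⟨Submodule.Quotient.mk ⟨x - y, hc⟩, ?_⟩
    refine congrArg Submodule.Quotient.mk (Subtype.ext ?_)
    change f.toLin (x - y) = f.toLin x
    rw [map_sub, hy, sub_zero]

/-- The sum of an independent family of submodules of a module, as a graded module with zero
differential. -/
def ofIndep {T : Type u} [AddCommGroup T] [Module R T] (g : ℤ → Submodule R T)
    (hg : iSupIndep g) : DGModule R where
  carrier := ↥(⨆ k, g k)
  gr k := (g k).comap (⨆ k, g k).subtype
  isInternal := by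
    rw [DirectSum.isInternal_submodule_iff_iSupIndep_and_iSup_eq_top]
    have hmap : ∀ k, ((g k).comap (⨆ k, g k).subtype).map (⨆ k, g k).subtype = g k := by
      intro k
      rw [Submodule.map_comap_subtype, inf_eq_right]
      exact le_iSup g k
    constructor
    · intro k
      rw [Submodule.disjoint_def]
      intro x hx hx'
      have h := Submodule.disjoint_def.1 (hg k) x.1 hx
      refine Subtype.ext (h ?_)
      have := Submodule.mem_map_of_mem (f := (⨆ k, g k).subtype) hx'
      simp only [Submodule.map_iSup, hmap] at this
      exact this
    · apply Submodule.map_injective_of_injective (⨆ k, g k).injective_subtype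
      rw [Submodule.map_iSup, Submodule.map_subtype_top]
      exact iSup_congr hmap
  d := 0
  d_mem _ := Submodule.zero_mem _
  d_d _ := rfl

section ofGraded

variable {T : Type u} [AddCommGroup T] [Module R T] (g : ℤ → Submodule R T) (hg : iSupIndep g)

/-- The inclusion of the sum of the submodules `g k` into the ambient module. -/
def incl : ofIndep g hg →ₗ[R] T := (⨆ k, g k).subtype

theorem incl_injective : Function.Injective (incl g hg) := (⨆ k, g k).injective_subtype

theorem mem_ofIndep_gr {k : ℤ} {x : ofIndep g hg} :
    x ∈ (ofIndep g hg).gr k ↔ incl g hg x ∈ g k := Iff.rfl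

/-- A linear map into the sum of the `g k`, from a map into the ambient module. -/
def codIncl {P : Type u} [AddCommGroup P] [Module R P] (f : P →ₗ[R] T)
    (hf : ∀ x, f x ∈ ⨆ k, g k) : P →ₗ[R] ofIndep g hg :=
  f.codRestrict (⨆ k, g k) hf

variable (δ : ℤ → T →ₗ[R] T) (hδ : ∀ k, ∀ x ∈ g k, δ k x ∈ g (k + 1))

/-- The endomorphism of the sum of the `g k` which is given by `δ k` on `g k`. -/
noncomputable def gradedD : ofIndep g hg →ₗ[R] ofIndep g hg :=
  (ofIndep g hg).lift fun k =>
    codIncl g hg (δ k ∘ₗ incl g hg ∘ₗ ((ofIndep g hg).gr k).subtype)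
      fun x => le_iSup g (k + 1) (hδ k _ x.2)

theorem incl_gradedD {k : ℤ} {x : ofIndep g hg} (hx : x ∈ (ofIndep g hg).gr k) :
    incl g hg (gradedD g hg δ hδ x) = δ k (incl g hg x) := by
  rw [gradedD, lift_apply _ _ hx]
  rfl

/-- The differential graded module on the sum of an independent family of submodules, with a
differential given separately in every degree. -/
noncomputable def ofGraded (hδδ : ∀ k, ∀ x ∈ g k, δ (k + 1) (δ k x) = 0) : DGModule R where
  carrier := (ofIndep g hg).carrier
  gr k := (ofIndep g hg).gr k
  isInternal := (ofIndep g hg).isInternal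
  d := gradedD g hg δ hδ
  d_mem {k x} hx := by
    rw [mem_ofIndep_gr, incl_gradedD g hg δ hδ hx]
    exact hδ k _ hx
  d_d x := by
    induction x using (ofIndep g hg).induction_gr with
    | h k x hx =>
      have h1 : gradedD g hg δ hδ x ∈ (ofIndep g hg).gr (k + 1) := by
        rw [mem_ofIndep_gr, incl_gradedD g hg δ hδ hx]
        exact hδ k _ hx
      apply incl_injective g hg
      rw [incl_gradedD g hg δ hδ h1, incl_gradedD g hg δ hδ hx, map_zero]
      exact hδδ k _ hx
    | hadd x y hx hy => rw [map_add, map_add, hx, hy, add_zero]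

end ofGraded

end DGModule

/-! ### Operads presented by homogeneous operations -/

/-- An operad in differential graded modules presented by ambient modules `T n` without grading and
independent submodules `gr n k` of homogeneous elements of degree `k`. The signs in the differential
and in the partial compositions depend on degrees; therefore `d k` is the differential of elements
of degree `k`, and `circ h i q` is the partial composition with elements of degree `q` on the right.
The axioms are imposed on homogeneous elements only. -/
structure GradedOperad (R : Type u) [CommRing R] where
  T : ℕ → Type u
  [addCommGroup : ∀ n, AddCommGroup (T n)]
  [module : ∀ n, Module R (T n)]
  gr : ∀ n, ℤ → Submodule R (T n)
  indep : ∀ n, iSupIndep (gr n)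
  d : ∀ {n : ℕ}, ℤ → T n →ₗ[R] T n
  d_mem : ∀ {n : ℕ} {k : ℤ} {x : T n}, x ∈ gr n k → d k x ∈ gr n (k + 1)
  d_d : ∀ {n : ℕ} {k : ℤ} {x : T n}, x ∈ gr n k → d (k + 1) (d k x) = 0
  act : ∀ {n : ℕ}, Equiv.Perm (Fin n) → T n →ₗ[R] T n
  act_mem : ∀ {n : ℕ} (σ : Equiv.Perm (Fin n)) {k : ℤ} {x : T n}, x ∈ gr n k → act σ x ∈ gr n k
  act_one : ∀ {n : ℕ} {k : ℤ} {x : T n}, x ∈ gr n k → act 1 x = x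
  act_mul : ∀ {n : ℕ} (σ τ : Equiv.Perm (Fin n)) {k : ℤ} {x : T n}, x ∈ gr n k →
    act (σ * τ) x = act τ (act σ x)
  act_d : ∀ {n : ℕ} (σ : Equiv.Perm (Fin n)) {k : ℤ} {x : T n}, x ∈ gr n k →
    d k (act σ x) = act σ (d k x)
  one : T 1
  one_mem : one ∈ gr 1 0
  one_d : d 0 one = 0
  circ : ∀ {m n l : ℕ}, m + n = l + 1 → Fin m → ℤ → (T m →ₗ[R] T n →ₗ[R] T l)
  circ_mem : ∀ {m n l : ℕ} (h : m + n = l + 1) (i : Fin m) {p q : ℤ} {x : T m} {y : T n},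
    x ∈ gr m p → y ∈ gr n q → circ h i q x y ∈ gr l (p + q)
  circ_d : ∀ {m n l : ℕ} (h : m + n = l + 1) (i : Fin m) {p q : ℤ} {x : T m} {y : T n},
    x ∈ gr m p → y ∈ gr n q →
      d (p + q) (circ h i q x y) =
        circ h i q (d p x) y + p.negOnePow • circ h i (q + 1) x (d q y)
  one_circ : ∀ {n : ℕ} (h : 1 + n = n + 1) {k : ℤ} {x : T n}, x ∈ gr n k → circ h 0 k one x = x
  circ_one : ∀ {n : ℕ} (h : n + 1 = n + 1) (i : Fin n) {k : ℤ} {x : T n}, x ∈ gr n k →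
    circ h i 0 x one = x
  circ_seq : ∀ {m n r a b l : ℕ} (h₁ : m + n = a + 1) (h₂ : a + r = l + 1) (h₃ : n + r = b + 1)
    (h₄ : m + b = l + 1) (i : Fin m) (j : Fin n) {p q s : ℤ} {x : T m} {y : T n} {z : T r},
      x ∈ gr m p → y ∈ gr n q → z ∈ gr r s →
        circ h₂ (innerSlot h₁ i j) s (circ h₁ i q x y) z =
          circ h₄ i (q + s) x (circ h₃ j s y z)
  circ_par : ∀ {m n r a b l : ℕ} (h₁ : m + n = a + 1) (h₂ : a + r = l + 1) (h₃ : m + r = b + 1)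
    (h₄ : b + n = l + 1) (i k : Fin m) (hik : i ≠ k) {p q s : ℤ} {x : T m} {y : T n} {z : T r},
      x ∈ gr m p → y ∈ gr n q → z ∈ gr r s →
        circ h₂ (outerSlot h₁ i k hik.symm) s (circ h₁ i q x y) z =
          (q * s).negOnePow • circ h₄ (outerSlot h₃ k i hik) q (circ h₃ k s x z) y
  circ_act : ∀ {m n l : ℕ} (h : m + n = l + 1) (i : Fin m) (σ : Equiv.Perm (Fin m))
    (τ : Equiv.Perm (Fin n)) (ρ : Equiv.Perm (Fin l)),
      (∀ (j : Fin m) (hj : j ≠ i),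
        ρ (outerSlot h i j hj) = outerSlot h (σ i) (σ j) (fun e => hj (σ.injective e))) →
      (∀ k : Fin n, ρ (innerSlot h i k) = innerSlot h (σ i) (τ k)) →
      ∀ {p q : ℤ} {x : T m} {y : T n}, x ∈ gr m p → y ∈ gr n q →
        circ h i q (act σ x) (act τ y) = act ρ (circ h (σ i) q x y)

attribute [instance] GradedOperad.addCommGroup GradedOperad.module

namespace GradedOperad

variable {R : Type u} [CommRing R] (G : GradedOperad R)

/-- A suboperad, given by smaller modules of homogeneous elements. -/
def restrict (gr' : ∀ n, ℤ → Submodule R (G.T n)) (hle : ∀ {n k x}, x ∈ gr' n k → x ∈ G.gr n k)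
    (d_mem : ∀ {n : ℕ} {k : ℤ} {x : G.T n}, x ∈ gr' n k → G.d k x ∈ gr' n (k + 1))
    (act_mem : ∀ {n : ℕ} (σ : Equiv.Perm (Fin n)) {k : ℤ} {x : G.T n},
      x ∈ gr' n k → G.act σ x ∈ gr' n k)
    (one_mem : G.one ∈ gr' 1 0)
    (circ_mem : ∀ {m n l : ℕ} (h : m + n = l + 1) (i : Fin m) {p q : ℤ} {x : G.T m} {y : G.T n},
      x ∈ gr' m p → y ∈ gr' n q → G.circ h i q x y ∈ gr' l (p + q)) : GradedOperad R where
  T := G.T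
  gr := gr'
  indep n := (G.indep n).mono fun _ _ => hle
  d := G.d
  d_mem := d_mem
  d_d hx := G.d_d (hle hx)
  act := G.act
  act_mem := act_mem
  act_one hx := G.act_one (hle hx)
  act_mul σ τ _ _ hx := G.act_mul σ τ (hle hx)
  act_d σ _ _ hx := G.act_d σ (hle hx)
  one := G.one
  one_mem := one_mem
  one_d := G.one_d
  circ := G.circ
  circ_mem := circ_mem
  circ_d h i _ _ _ _ hx hy := G.circ_d h i (hle hx) (hle hy)
  one_circ h _ _ hx := G.one_circ h (hle hx)
  circ_one h i _ _ hx := G.circ_one h i (hle hx)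
  circ_seq h₁ h₂ h₃ h₄ i j _ _ _ _ _ _ hx hy hz :=
    G.circ_seq h₁ h₂ h₃ h₄ i j (hle hx) (hle hy) (hle hz)
  circ_par h₁ h₂ h₃ h₄ i k hik _ _ _ _ _ _ hx hy hz :=
    G.circ_par h₁ h₂ h₃ h₄ i k hik (hle hx) (hle hy) (hle hz)
  circ_act h i σ τ ρ h₁ h₂ _ _ _ _ hx hy := G.circ_act h i σ τ ρ h₁ h₂ (hle hx) (hle hy)

/-- The differential graded module of operations of arity `n`. -/
noncomputable def obj (n : ℕ) : DGModule R :=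
  DGModule.ofGraded (G.gr n) (G.indep n) G.d (fun _ _ hx => G.d_mem hx) (fun _ _ hx => G.d_d hx)

/-- The inclusion of the operations into the ambient module. -/
noncomputable def incl {n : ℕ} : G.obj n →ₗ[R] G.T n := DGModule.incl (G.gr n) (G.indep n)

variable {G}

theorem incl_injective {n : ℕ} : Function.Injective (G.incl (n := n)) :=
  DGModule.incl_injective _ _

theorem mem_gr {n : ℕ} {k : ℤ} {x : G.obj n} : x ∈ (G.obj n).gr k ↔ G.incl x ∈ G.gr n k := Iff.rfl

theorem incl_d {n : ℕ} {k : ℤ} {x : G.obj n} (hx : x ∈ (G.obj n).gr k) :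
    G.incl ((G.obj n).d x) = G.d k (G.incl x) :=
  DGModule.incl_gradedD (G.gr n) (G.indep n) G.d (fun _ _ hx => G.d_mem hx) hx

/-- Restriction of the codomain of a linear map to the module of operations. -/
noncomputable def cod {n : ℕ} {P : Type u} [AddCommGroup P] [Module R P] (f : P →ₗ[R] G.T n)
    (hf : ∀ x, f x ∈ ⨆ k, G.gr n k) : P →ₗ[R] G.obj n :=
  DGModule.codIncl (G.gr n) (G.indep n) f hf

@[simp] theorem incl_cod {n : ℕ} {P : Type u} [AddCommGroup P] [Module R P] (f : P →ₗ[R] G.T n)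
    (hf : ∀ x, f x ∈ ⨆ k, G.gr n k) (x : P) : G.incl (cod f hf x) = f x := rfl

/-- The operation defined by a homogeneous element of the ambient module. -/
noncomputable def ofMem {n : ℕ} {k : ℤ} (x : G.T n) (hx : x ∈ G.gr n k) : G.obj n :=
  (⟨x, le_iSup (G.gr n) k hx⟩ : ↥(⨆ k, G.gr n k))

@[simp] theorem incl_ofMem {n : ℕ} {k : ℤ} (x : G.T n) (hx : x ∈ G.gr n k) :
    G.incl (ofMem x hx) = x := rfl

theorem ofMem_mem {n : ℕ} {k : ℤ} (x : G.T n) (hx : x ∈ G.gr n k) :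
    ofMem x hx ∈ (G.obj n).gr k := hx

theorem mem_iSup_of_homogeneous {m l : ℕ} (f : G.T m →ₗ[R] G.T l)
    (hf : ∀ k, ∀ x ∈ G.gr m k, ∃ j, f x ∈ G.gr l j) (x : G.obj m) :
    f (G.incl x) ∈ ⨆ k, G.gr l k := by
  induction x using DGModule.induction_gr with
  | h k x hx =>
    obtain ⟨j, hj⟩ := hf k _ hx
    exact le_iSup (G.gr l) j hj
  | hadd x y hx hy =>
    rw [map_add, map_add]
    exact Submodule.add_mem _ hx hy

variable (G)

/-- The action of a permutation on the module of operations. -/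
noncomputable def objAct {n : ℕ} (σ : Equiv.Perm (Fin n)) : G.obj n →ₗ[R] G.obj n :=
  cod (G.act σ ∘ₗ G.incl) (mem_iSup_of_homogeneous _ fun k _ hx => ⟨k, G.act_mem σ hx⟩)

@[simp] theorem incl_objAct {n : ℕ} (σ : Equiv.Perm (Fin n)) (x : G.obj n) :
    G.incl (G.objAct σ x) = G.act σ (G.incl x) := rfl

/-- The partial composition on the module of operations. -/
noncomputable def objCirc {m n l : ℕ} (h : m + n = l + 1) (i : Fin m) :
    G.obj m →ₗ[R] G.obj n →ₗ[R] G.obj l :=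
  LinearMap.flip <| (G.obj n).lift fun q =>
    { toFun := fun y => cod ((G.circ h i q).flip (G.incl y.1) ∘ₗ G.incl)
        (mem_iSup_of_homogeneous ((G.circ h i q).flip (G.incl y.1)) fun p x hx =>
          ⟨p + q, G.circ_mem (x := x) (y := G.incl y.1) h i hx y.2⟩)
      map_add' := fun y z => LinearMap.ext fun x => incl_injective (by simp)
      map_smul' := fun c y => LinearMap.ext fun x => incl_injective (by simp) }

theorem incl_objCirc {m n l : ℕ} (h : m + n = l + 1) (i : Fin m) {q : ℤ} (x : G.obj m)
    {y : G.obj n} (hy : y ∈ (G.obj n).gr q) :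
    G.incl (G.objCirc h i x y) = G.circ h i q (G.incl x) (G.incl y) := by
  rw [objCirc, LinearMap.flip_apply, DGModule.lift_apply _ _ hy]
  rfl

theorem objCirc_mem {m n l : ℕ} (h : m + n = l + 1) (i : Fin m) {p q : ℤ} {x : G.obj m}
    {y : G.obj n} (hx : x ∈ (G.obj m).gr p) (hy : y ∈ (G.obj n).gr q) :
    G.objCirc h i x y ∈ (G.obj l).gr (p + q) := by
  rw [mem_gr, G.incl_objCirc h i x hy]
  exact G.circ_mem h i hx hy

/-- The operad presented by homogeneous operations. -/
noncomputable def toDGOperad : DGOperad R where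
  obj := G.obj
  act := G.objAct
  act_one x := by
    induction x using DGModule.induction_gr with
    | h k x hx => exact incl_injective (G.act_one hx)
    | hadd x y hx hy => rw [map_add, hx, hy]
  act_mul σ τ x := by
    induction x using DGModule.induction_gr with
    | h k x hx => exact incl_injective (G.act_mul σ τ hx)
    | hadd x y hx hy => rw [map_add, map_add, map_add, hx, hy]
  act_gr σ _ _ hx := G.act_mem σ hx
  act_d σ x := by
    induction x using DGModule.induction_gr with
    | h k x hx =>
      apply incl_injective
      rw [incl_d (k := k) (G.act_mem σ hx), incl_objAct, incl_objAct, incl_d hx, G.act_d σ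
        (mem_gr.1 hx)]
    | hadd x y hx hy => simp only [map_add, hx, hy]
  one := ofMem G.one G.one_mem
  one_gr := G.one_mem
  one_d := incl_injective (by rw [incl_d (ofMem_mem _ G.one_mem), incl_ofMem, G.one_d, map_zero])
  circ := G.objCirc
  circ_gr h i _ _ _ _ hx hy := G.objCirc_mem h i hx hy
  circ_d {m n l} h i p x y hx := by
    induction y using DGModule.induction_gr with
    | h q y hy =>
      apply incl_injective
      rw [incl_d (G.objCirc_mem h i hx hy), G.incl_objCirc h i x hy, G.circ_d h i (mem_gr.1 hx)
        (mem_gr.1 hy), map_add,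
        Units.smul_def, Units.smul_def, map_zsmul, G.incl_objCirc h i _ hy,
        G.incl_objCirc h i _ ((G.obj n).d_mem hy), incl_d hx, incl_d hy]
    | hadd y z hy hz =>
      simp only [map_add, hy, hz, smul_add]
      abel
  one_circ h x := by
    induction x using DGModule.induction_gr with
    | h k x hx =>
      apply incl_injective
      rw [G.incl_objCirc h _ _ hx, incl_ofMem, G.one_circ h (mem_gr.1 hx)]
    | hadd x y hx hy => rw [map_add, hx, hy]
  circ_one h i x := by
    induction x using DGModule.induction_gr with
    | h k x hx =>
      apply incl_injective
      rw [G.incl_objCirc h _ _ (ofMem_mem _ G.one_mem), incl_ofMem, G.circ_one h i (mem_gr.1 hx)]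
    | hadd x y hx hy => rw [map_add, LinearMap.add_apply, hx, hy]
  circ_seq h₁ h₂ h₃ h₄ i j x y z := by
    induction x using DGModule.induction_gr with
    | hadd x x' hx hx' => simp only [map_add, LinearMap.add_apply, hx, hx']
    | h p x hx =>
    induction y using DGModule.induction_gr with
    | hadd x x' hx hx' => simp only [map_add, LinearMap.add_apply, hx, hx']
    | h q y hy =>
    induction z using DGModule.induction_gr with
    | hadd x x' hx hx' => simp only [map_add, hx, hx']
    | h s z hz =>
    apply incl_injective
    rw [G.incl_objCirc h₂ _ _ hz, G.incl_objCirc h₁ _ _ hy,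
      G.incl_objCirc h₄ _ _ (G.objCirc_mem h₃ j hy hz), G.incl_objCirc h₃ _ _ hz]
    exact G.circ_seq h₁ h₂ h₃ h₄ i j hx hy hz
  circ_par h₁ h₂ h₃ h₄ i k hik p q x y z hy hz := by
    induction x using DGModule.induction_gr with
    | hadd x x' hx hx' => simp only [map_add, LinearMap.add_apply, hx, hx', smul_add]
    | h s x hx =>
    apply incl_injective
    rw [Units.smul_def, map_zsmul, G.incl_objCirc h₂ _ _ hz, G.incl_objCirc h₁ _ _ hy,
      G.incl_objCirc h₄ _ _ hy, G.incl_objCirc h₃ _ _ hz, ← Units.smul_def]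
    exact G.circ_par h₁ h₂ h₃ h₄ i k hik hx hy hz
  circ_act h i σ τ ρ h₁ h₂ x y := by
    induction x using DGModule.induction_gr with
    | hadd x x' hx hx' => simp only [map_add, LinearMap.add_apply, hx, hx']
    | h p x hx =>
    induction y using DGModule.induction_gr with
    | hadd x x' hx hx' => simp only [map_add, hx, hx']
    | h q y hy =>
    apply incl_injective
    rw [G.incl_objCirc h _ _ (q := q) (G.act_mem τ hy), incl_objAct, incl_objAct, incl_objAct,
      G.incl_objCirc h _ _ hy]
    exact G.circ_act h i σ τ ρ h₁ h₂ hx hy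

end GradedOperad

/-! ### Input slots of partial compositions -/

theorem LinearMap.map_intUnit_smul {R M N : Type*} [CommRing R] [AddCommGroup M] [AddCommGroup N]
    [Module R M] [Module R N] (f : M →ₗ[R] N) (c : ℤˣ) (x : M) : f (c • x) = c • f x := by
  rw [Units.smul_def, map_zsmul, ← Units.smul_def]

theorem LinearMap.map_intUnit_smul₂ {R M N P : Type*} [CommRing R] [AddCommGroup M]
    [AddCommGroup N] [AddCommGroup P] [Module R M] [Module R N] [Module R P]
    (f : M →ₗ[R] N →ₗ[R] P) (c : ℤˣ) (x : M) (y : N) : f (c • x) y = c • f x y := by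
  rw [map_intUnit_smul, LinearMap.smul_apply]

theorem Finset.sum_sum_eq_zero_of_antisymm {ι P : Type*} [Fintype ι] [AddCommGroup P]
    (F : ι → ι → P) (h₀ : ∀ i, F i i = 0) (h : ∀ i j, i ≠ j → F i j = - F j i) :
    ∑ i, ∑ j, F i j = 0 := by
  rw [← Fintype.sum_prod_type']
  refine Finset.sum_involution (fun a _ => a.swap) ?_ ?_ (fun _ _ => Finset.mem_univ _)
    (fun _ _ => Prod.swap_swap _)
  · rintro ⟨i, j⟩ _
    by_cases hij : i = j
    · subst hij
      simp [h₀]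
    · simp [h i j hij]
  · rintro ⟨i, j⟩ _ hne he
    simp only [Prod.swap_prod_mk, Prod.mk.injEq] at he
    rw [he.1] at hne
    exact hne (h₀ i)

section Slots

variable {m n l : ℕ} (h : m + n = l + 1) (i : Fin m)

@[simp] theorem innerSlot_val (k : Fin n) : (innerSlot h i k).val = i.val + k.val := rfl

theorem outerSlot_val (j : Fin m) (hj : j ≠ i) :
    (outerSlot h i j hj).val = if j < i then j.val else j.val + n - 1 := by
  unfold outerSlot
  split_ifs <;> rfl

theorem innerSlot_injective : Function.Injective (innerSlot h i) := fun a b hab => by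
  have := congrArg Fin.val hab
  simp only [innerSlot_val] at this
  exact Fin.ext (by omega)

theorem outerSlot_injective {j k : Fin m} (hj : j ≠ i) (hk : k ≠ i)
    (e : outerSlot h i j hj = outerSlot h i k hk) : j = k := by
  have := congrArg Fin.val e
  simp only [outerSlot_val, Fin.lt_def] at this
  have h1 := Fin.val_ne_of_ne hj
  have h2 := Fin.val_ne_of_ne hk
  apply Fin.ext
  split_ifs at this <;> omega

theorem innerSlot_ne_outerSlot (k : Fin n) (j : Fin m) (hj : j ≠ i) :
    innerSlot h i k ≠ outerSlot h i j hj := by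
  intro e
  have := congrArg Fin.val e
  simp only [outerSlot_val, innerSlot_val, Fin.lt_def] at this
  have h1 := Fin.val_ne_of_ne hj
  have := k.2
  split_ifs at * <;> omega

/-- Every input of the composite belongs to the inner or to the outer operation. -/
theorem slot_cases (s : Fin l) :
    (∃ k, s = innerSlot h i k) ∨ ∃ j, ∃ hj : j ≠ i, s = outerSlot h i j hj := by
  rcases lt_or_ge s.val i.val with h1 | h1
  · have hj : (⟨s.val, h1.trans i.2⟩ : Fin m) ≠ i := Fin.ne_of_val_ne h1.ne
    refine Or.inr ⟨⟨s.val, h1.trans i.2⟩, hj, Fin.ext ?_⟩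
    rw [outerSlot_val, if_pos (show (⟨s.val, _⟩ : Fin m) < i from h1)]
  · rcases lt_or_ge s.val (i.val + n) with h2 | h2
    · exact Or.inl ⟨⟨s.val - i.val, by omega⟩, Fin.ext (by simp only [innerSlot_val]; omega)⟩
    · have hs := s.2
      have h3 : s.val + 1 - n < m := by omega
      have hj : (⟨s.val + 1 - n, h3⟩ : Fin m) ≠ i := Fin.ne_of_val_ne (by simp only; omega)
      refine Or.inr ⟨⟨s.val + 1 - n, h3⟩, hj, Fin.ext ?_⟩
      rw [outerSlot_val, if_neg (by rw [Fin.lt_def]; simp only; omega)]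
      simp only
      omega

/-- The inputs of the composite are the inputs of the inner operation and the inputs of the outer
operation other than the `i`-th. -/
noncomputable def slotEquiv : Fin n ⊕ {j : Fin m // j ≠ i} ≃ Fin l :=
  Equiv.ofBijective (Sum.elim (innerSlot h i) fun j => outerSlot h i j.1 j.2) (by
    constructor
    · rintro (a | a) (b | b) e
      · exact congrArg Sum.inl (innerSlot_injective h i e)
      · exact absurd e (innerSlot_ne_outerSlot h i a b.1 b.2)
      · exact absurd e.symm (innerSlot_ne_outerSlot h i b a.1 a.2)
      · exact congrArg Sum.inr (Subtype.ext (outerSlot_injective h i a.2 b.2 e))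
    · intro s
      rcases slot_cases h i s with ⟨k, rfl⟩ | ⟨j, hj, rfl⟩
      · exact ⟨.inl k, rfl⟩
      · exact ⟨.inr ⟨j, hj⟩, rfl⟩)

theorem sum_slots {P : Type*} [AddCommMonoid P] (f : Fin l → P) :
    ∑ s, f s =
      ∑ k, f (innerSlot h i k) + ∑ j : {j : Fin m // j ≠ i}, f (outerSlot h i j.1 j.2) := by
  rw [← Equiv.sum_comp (slotEquiv h i), Fintype.sum_sum_type]
  rfl

theorem outerSlot_one (h : m + 1 = m + 1) (i j : Fin m) (hj : j ≠ i) : outerSlot h i j hj = j := by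
  apply Fin.ext
  rw [outerSlot_val]
  split_ifs <;> omega

theorem innerSlot_zero (h : m + (n + 1) = l + 1) (i : Fin m) (hi : i.val < l) :
    innerSlot h i 0 = ⟨i.val, hi⟩ := Fin.ext (by simp)

theorem one_innerSlot (h : 1 + n = n + 1) (k : Fin n) : innerSlot h 0 k = k := Fin.ext (by simp)

/-- The inputs of the outer operation, when `y` is the output of the inner operation and `a` are the
inputs of the composite. -/
def plugAt {X : Type*} (y : X) (a : Fin l → X) (j : Fin m) : X :=
  if hj : j = i then y else a (outerSlot h i j hj)

end Slots

/-! ### Twisting an operad by a unary operation -/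

namespace GradedOperad

variable {R : Type u} [CommRing R] (G : GradedOperad R)

/-- The graded commutator with an operation `δ` of arity `1` and degree `1`, on operations of
degree `k`. -/
def ad (δ : G.T 1) {n : ℕ} (k : ℤ) : G.T n →ₗ[R] G.T n :=
  G.circ (add_comm 1 n) 0 k δ - k.negOnePow • ∑ i, (G.circ rfl i 1).flip δ

theorem ad_apply (δ : G.T 1) {n : ℕ} (k : ℤ) (x : G.T n) :
    G.ad δ k x = G.circ (add_comm 1 n) 0 k δ x - k.negOnePow • ∑ i, G.circ rfl i 1 x δ := by
  simp [ad]

variable {G} {δ : G.T 1}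

theorem ad_mem (hδ : δ ∈ G.gr 1 1) {n : ℕ} {k : ℤ} {x : G.T n} (hx : x ∈ G.gr n k) :
    G.ad δ k x ∈ G.gr n (k + 1) := by
  rw [ad_apply]
  refine Submodule.sub_mem _ ?_ (Submodule.smul_of_tower_mem _ _ (Submodule.sum_mem _ fun i _ =>
    G.circ_mem rfl i hx hδ))
  rw [add_comm]
  exact G.circ_mem _ 0 hδ hx

theorem circ_circ_unary (hδ : δ ∈ G.gr 1 1) {n : ℕ} {k : ℤ} {x : G.T n} (hx : x ∈ G.gr n k)
    (i : Fin n) :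
    G.circ (rfl : n + 1 = n + 1) i 1 (G.circ rfl i 1 x δ) δ =
      G.circ rfl i (1 + 1) x (G.circ rfl 0 1 δ δ) := by
  have := G.circ_seq (rfl : n + 1 = n + 1) (rfl : n + 1 = n + 1) rfl rfl i 0 hx hδ hδ
  rwa [innerSlot_zero _ _ i.2] at this

/-- Inserting an operation of degree `1` at two different inputs, in either order, gives opposite
results; this is the Koszul sign of parallel associativity. -/
theorem circ_circ_unary_of_ne (hδ : δ ∈ G.gr 1 1) {n : ℕ} {k : ℤ} {x : G.T n} (hx : x ∈ G.gr n k)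
    (i j : Fin n)
    (hij : i ≠ j) :
    G.circ (rfl : n + 1 = n + 1) j 1 (G.circ rfl i 1 x δ) δ =
      - G.circ rfl i 1 (G.circ rfl j 1 x δ) δ := by
  have := G.circ_par (rfl : n + 1 = n + 1) (rfl : n + 1 = n + 1) rfl rfl i j hij hx hδ hδ
  rw [outerSlot_one, outerSlot_one] at this
  rw [this]
  simp

/-- The commutator with an operation of square zero is of square zero: the terms with `δ` inserted
twice at the same place vanish, all the others cancel in pairs. -/
theorem ad_ad (hδ : δ ∈ G.gr 1 1) {n : ℕ} {k : ℤ} {x : G.T n} (hx : x ∈ G.gr n k)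
    (hδδ : G.circ rfl 0 1 δ δ = 0) : G.ad δ (k + 1) (G.ad δ k x) = 0 := by
  have h1 : G.circ (add_comm 1 n) 0 (k + 1) δ (G.circ (add_comm 1 n) 0 k δ x) = 0 := by
    have := G.circ_seq (rfl : 1 + 1 = 1 + 1) (add_comm 1 n) (add_comm 1 n) (add_comm 1 n) 0 0
      hδ hδ hx
    rw [add_comm, ← this, hδδ, map_zero, LinearMap.zero_apply]
  have h2 : ∀ i, G.circ rfl i 1 (G.circ (add_comm 1 n) 0 k δ x) δ =
      G.circ (add_comm 1 n) 0 (k + 1) δ (G.circ rfl i 1 x δ) := by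
    intro i
    have := G.circ_seq (add_comm 1 n) rfl rfl (add_comm 1 n) 0 i hδ hx hδ
    rwa [one_innerSlot] at this
  have h3 : ∑ i, ∑ j, G.circ (rfl : n + 1 = n + 1) i 1 (G.circ rfl j 1 x δ) δ = 0 := by
    refine Finset.sum_sum_eq_zero_of_antisymm _ (fun i => ?_)
      (fun i j hij => circ_circ_unary_of_ne hδ hx j i hij.symm)
    rw [circ_circ_unary hδ hx, hδδ, map_zero]
  rw [ad_apply, ad_apply, map_sub, h1]
  simp only [map_sub, LinearMap.sub_apply, LinearMap.map_intUnit_smul, map_sum,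
    LinearMap.smul_apply,
    LinearMap.sum_apply, h2, Finset.sum_sub_distrib, ← Finset.smul_sum, h3, smul_zero, sub_zero,
    Int.negOnePow_succ, Units.neg_smul, zero_sub, sub_neg_eq_add, neg_add_cancel]

/-- The commutator is a derivation of the partial compositions. The inputs of the composite at which
`δ` is inserted are those of `y` and those of `x` other than the `i`-th one; the term with `δ`
inserted at the `i`-th input of `x` cancels against the one with `δ` applied to `y`. -/
theorem ad_circ (hδ : δ ∈ G.gr 1 1) {m n l : ℕ} (h : m + n = l + 1) (i : Fin m) {p q : ℤ}
    {x : G.T m} {y : G.T n}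
    (hx : x ∈ G.gr m p) (hy : y ∈ G.gr n q) :
    G.ad δ (p + q) (G.circ h i q x y) =
      G.circ h i q (G.ad δ p x) y + p.negOnePow • G.circ h i (q + 1) x (G.ad δ q y) := by
  have h1 : G.circ (add_comm 1 l) 0 (p + q) δ (G.circ h i q x y) =
      G.circ h i q (G.circ (add_comm 1 m) 0 p δ x) y := by
    have := G.circ_seq (add_comm 1 m) h h (add_comm 1 l) 0 i hδ hx hy
    rw [one_innerSlot] at this
    exact this.symm
  have h2 : ∀ j, G.circ rfl (innerSlot h i j) 1 (G.circ h i q x y) δ =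
      G.circ h i (q + 1) x (G.circ rfl j 1 y δ) := fun j => G.circ_seq h rfl rfl h i j hx hy hδ
  have h3 : ∀ j (hj : j ≠ i), G.circ rfl (outerSlot h i j hj) 1 (G.circ h i q x y) δ =
      q.negOnePow • G.circ h i q (G.circ rfl j 1 x δ) y := by
    intro j hj
    have := G.circ_par h rfl rfl h i j hj.symm hx hy hδ
    rwa [outerSlot_one, mul_one] at this
  have h4 : G.circ h i q (G.circ rfl i 1 x δ) y =
      G.circ h i (q + 1) x (G.circ (add_comm 1 n) 0 q δ y) := by
    have := G.circ_seq rfl h (add_comm 1 n) h i 0 hx hδ hy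
    rw [innerSlot_zero _ _ i.2] at this
    rwa [add_comm 1 q] at this
  have h5 : ∑ j, G.circ h i q (G.circ rfl j 1 x δ) y =
      G.circ h i (q + 1) x (G.circ (add_comm 1 n) 0 q δ y) +
        ∑ j : {j : Fin m // j ≠ i}, G.circ h i q (G.circ rfl j.1 1 x δ) y := by
    rw [sum_slots (rfl : m + 1 = m + 1) i]
    simp [innerSlot_zero _ _ i.2, outerSlot_one, h4]
  simp only [ad_apply, map_sub, LinearMap.sub_apply, LinearMap.map_intUnit_smul, map_sum,
    LinearMap.smul_apply, LinearMap.sum_apply, h1, sum_slots h i, h2, h3, h5, smul_add,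
    ← Finset.smul_sum, smul_sub, smul_smul, Int.negOnePow_add]
  rw [mul_assoc, Int.units_mul_self, mul_one]
  abel

theorem ad_act (hδ : δ ∈ G.gr 1 1) {n : ℕ} {k : ℤ} {x : G.T n} (hx : x ∈ G.gr n k)
    (σ : Equiv.Perm (Fin n)) :
    G.ad δ k (G.act σ x) = G.act σ (G.ad δ k x) := by
  have h1 : G.circ (add_comm 1 n) 0 k δ (G.act σ x) = G.act σ (G.circ (add_comm 1 n) 0 k δ x) := by
    have := G.circ_act (add_comm 1 n) 0 1 σ σ
      (fun j hj => absurd (Subsingleton.elim j 0) hj) (fun k => by simp [one_innerSlot]) hδ hx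
    rwa [G.act_one hδ] at this
  have h2 : ∀ i, G.circ rfl i 1 (G.act σ x) δ = G.act σ (G.circ rfl (σ i) 1 x δ) := by
    intro i
    have := G.circ_act rfl i σ 1 σ (fun j hj => by simp [outerSlot_one])
      (fun k => by
        obtain rfl : k = 0 := Subsingleton.elim _ _
        simp [innerSlot_zero _ _ (Fin.is_lt _)]) hx hδ
    rwa [G.act_one hδ] at this
  simp only [ad_apply, h1, h2, map_sub, LinearMap.map_intUnit_smul, map_sum]
  rw [Equiv.sum_comp σ fun i => G.act σ (G.circ rfl i 1 x δ)]

theorem ad_d (hδ : δ ∈ G.gr 1 1) {n : ℕ} {k : ℤ} {x : G.T n} (hx : x ∈ G.gr n k)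
    (hdδ : G.d 1 δ = 0) :
    G.ad δ (k + 1) (G.d k x) = - G.d (k + 1) (G.ad δ k x) := by
  have h1 : G.d (k + 1) (G.circ (add_comm 1 n) 0 k δ x) =
      - G.circ (add_comm 1 n) 0 (k + 1) δ (G.d k x) := by
    rw [add_comm k 1, G.circ_d (add_comm 1 n) 0 hδ hx, hdδ, map_zero, LinearMap.zero_apply,
      zero_add,
      add_comm k 1, Int.negOnePow_one, Units.neg_smul, one_smul]
  have h2 : ∀ i, G.d (k + 1) (G.circ rfl i 1 x δ) = G.circ rfl i 1 (G.d k x) δ := by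
    intro i
    rw [G.circ_d rfl i hx hδ, hdδ, map_zero, smul_zero, add_zero]
  simp only [ad_apply, map_sub, LinearMap.map_intUnit_smul, map_sum, h1, h2, Int.negOnePow_succ,
    Units.neg_smul]
  abel

theorem ad_one (hδ : δ ∈ G.gr 1 1) : G.ad δ 0 G.one = 0 := by
  rw [ad_apply, G.circ_one _ _ hδ]
  simp [G.one_circ rfl hδ]

variable (G) in
/-- The differential of an operad can be perturbed by the graded commutator with a unary operation
of degree `1` which is a cycle of square zero. -/
def twist (δ : G.T 1) (hδ : δ ∈ G.gr 1 1) (hdδ : G.d 1 δ = 0) (hδδ : G.circ rfl 0 1 δ δ = 0) :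
    GradedOperad R where
  T := G.T
  gr := G.gr
  indep := G.indep
  d k := G.d k + G.ad δ k
  d_mem hx := Submodule.add_mem _ (G.d_mem hx) (ad_mem hδ hx)
  d_d hx := by
    simp only [LinearMap.add_apply, map_add]
    rw [G.d_d hx, ad_ad hδ hx hδδ, ad_d hδ hx hdδ]
    abel
  act := G.act
  act_mem := G.act_mem
  act_one := G.act_one
  act_mul := G.act_mul
  act_d σ _ _ hx := by
    simp only [LinearMap.add_apply, map_add]
    rw [G.act_d σ hx, ad_act hδ hx]
  one := G.one
  one_mem := G.one_mem
  one_d := by rw [LinearMap.add_apply, G.one_d, ad_one hδ, add_zero]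
  circ := G.circ
  circ_mem := G.circ_mem
  circ_d h i _ _ _ _ hx hy := by
    simp only [LinearMap.add_apply, map_add]
    rw [G.circ_d h i hx hy, ad_circ hδ h i hx hy, smul_add]
    abel
  one_circ := G.one_circ
  circ_one := G.circ_one
  circ_seq := G.circ_seq
  circ_par := G.circ_par
  circ_act := G.circ_act

end GradedOperad

/-! ### Arguments of nested compositions -/

section Plug

variable {X Y : Type*}

@[simp] theorem plugAt_self {m n l : ℕ} (h : m + n = l + 1) (i : Fin m) (y : X) (a : Fin l → X) :
    plugAt h i y a i = y := by simp [plugAt]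

theorem plugAt_of_ne {m n l : ℕ} (h : m + n = l + 1) (i : Fin m) (y : X) (a : Fin l → X)
    {j : Fin m} (hj : j ≠ i) : plugAt h i y a j = a (outerSlot h i j hj) := by simp [plugAt, hj]

theorem apply_plugAt {m n l : ℕ} (h : m + n = l + 1) (i : Fin m) (f : X → Y) (y : X)
    (a : Fin l → X) (j : Fin m) : f (plugAt h i y a j) = plugAt h i (f y) (fun k => f (a k)) j := by
  unfold plugAt
  split_ifs <;> rfl

theorem update_plugAt {m n l : ℕ} (h : m + n = l + 1) (i : Fin m) (y z : X) (a : Fin l → X) :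
    Function.update (plugAt h i y a) i z = plugAt h i z a := by
  funext j
  by_cases hj : j = i
  · subst hj; simp
  · rw [Function.update_of_ne hj, plugAt_of_ne _ _ _ _ hj, plugAt_of_ne _ _ _ _ hj]

theorem plugAt_update_inner {m n l : ℕ} (h : m + n = l + 1) (i : Fin m) (y x : X) (a : Fin l → X)
    (k : Fin n) : plugAt h i y (Function.update a (innerSlot h i k) x) = plugAt h i y a := by
  funext j
  by_cases hj : j = i
  · subst hj; simp
  · rw [plugAt_of_ne _ _ _ _ hj, plugAt_of_ne _ _ _ _ hj,
      Function.update_of_ne (innerSlot_ne_outerSlot h i k j hj).symm]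

theorem plugAt_update_outer {m n l : ℕ} (h : m + n = l + 1) (i : Fin m) (y x : X) (a : Fin l → X)
    {k : Fin m} (hk : k ≠ i) :
    plugAt h i y (Function.update a (outerSlot h i k hk) x) =
      Function.update (plugAt h i y a) k x := by
  funext j
  by_cases hj : j = i
  · subst hj; simp [Function.update_of_ne hk.symm]
  · rw [plugAt_of_ne _ _ _ _ hj]
    by_cases hjk : j = k
    · subst hjk; simp
    · rw [Function.update_of_ne hjk, plugAt_of_ne _ _ _ _ hj,
        Function.update_of_ne fun e => hjk (outerSlot_injective h i hj hk e)]

theorem update_comp_innerSlot {m n l : ℕ} (h : m + n = l + 1) (i : Fin m) (x : X) (a : Fin l → X)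
    (k : Fin n) : Function.update a (innerSlot h i k) x ∘ innerSlot h i =
      Function.update (a ∘ innerSlot h i) k x :=
  Function.update_comp_eq_of_injective a (innerSlot_injective h i) k x

theorem update_outer_comp_innerSlot {m n l : ℕ} (h : m + n = l + 1) (i : Fin m) (x : X)
    (a : Fin l → X) {k : Fin m} (hk : k ≠ i) :
    Function.update a (outerSlot h i k hk) x ∘ innerSlot h i = a ∘ innerSlot h i := by
  funext j
  exact Function.update_of_ne (innerSlot_ne_outerSlot h i j k hk) _ _

section Seq

variable {m n r a' b l : ℕ} (h₁ : m + n = a' + 1) (h₂ : a' + r = l + 1) (h₃ : n + r = b + 1)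
  (h₄ : m + b = l + 1) (i : Fin m) (j : Fin n) (a : Fin l → X)

theorem innerSlot_innerSlot (k : Fin r) : innerSlot h₂ (innerSlot h₁ i j) k =
    innerSlot h₄ i (innerSlot h₃ j k) := Fin.ext (by simp [add_assoc])

theorem plugAt_comp_innerSlot (z : X) :
    plugAt h₂ (innerSlot h₁ i j) z a ∘ innerSlot h₁ i = plugAt h₃ j z (a ∘ innerSlot h₄ i) := by
  funext k
  rw [Function.comp_apply]
  by_cases hk : k = j
  · subst hk; simp
  · have hk' : innerSlot h₁ i k ≠ innerSlot h₁ i j := fun e => hk (innerSlot_injective _ _ e)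
    rw [plugAt_of_ne _ _ _ _ hk', plugAt_of_ne _ _ _ _ hk, Function.comp_apply]
    congr 1
    apply Fin.ext
    have := Fin.val_ne_of_ne hk
    simp only [outerSlot_val, innerSlot_val, Fin.lt_def]
    split_ifs <;> omega

theorem plugAt_plugAt_inner (y z : X) :
    plugAt h₁ i y (plugAt h₂ (innerSlot h₁ i j) z a) = plugAt h₄ i y a := by
  funext k
  by_cases hk : k = i
  · subst hk; simp
  · rw [plugAt_of_ne _ _ _ _ hk, plugAt_of_ne _ _ _ _ hk,
      plugAt_of_ne _ _ _ _ (innerSlot_ne_outerSlot h₁ i j k hk).symm]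
    congr 1
    apply Fin.ext
    have := Fin.val_ne_of_ne hk
    have := j.2
    simp only [outerSlot_val, innerSlot_val, Fin.lt_def]
    split_ifs <;> omega

end Seq

section Par

variable {m n r a' b l : ℕ} (h₁ : m + n = a' + 1) (h₂ : a' + r = l + 1) (h₃ : m + r = b + 1)
  (h₄ : b + n = l + 1) (i k : Fin m) (hik : i ≠ k) (a : Fin l → X)

theorem plugAt_outer_comp_innerSlot (z : X) :
    plugAt h₂ (outerSlot h₁ i k hik.symm) z a ∘ innerSlot h₁ i =
      a ∘ innerSlot h₄ (outerSlot h₃ k i hik) := by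
  funext s
  rw [Function.comp_apply, plugAt_of_ne _ _ _ _ (innerSlot_ne_outerSlot h₁ i s k hik.symm),
    Function.comp_apply]
  congr 1
  apply Fin.ext
  have := Fin.val_ne_of_ne hik
  have := s.2
  simp only [outerSlot_val, innerSlot_val, Fin.lt_def]
  split_ifs <;> omega

theorem plugAt_plugAt_outer (y z : X) :
    plugAt h₁ i y (plugAt h₂ (outerSlot h₁ i k hik.symm) z a) =
      plugAt h₃ k z (plugAt h₄ (outerSlot h₃ k i hik) y a) := by
  funext s
  by_cases hs : s = i
  · subst hs
    rw [plugAt_self, plugAt_of_ne _ _ _ _ hik, plugAt_self]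
  · rw [plugAt_of_ne _ _ _ _ hs]
    by_cases hsk : s = k
    · subst hsk
      simp
    · rw [plugAt_of_ne _ _ _ _ hsk,
        plugAt_of_ne _ _ _ _ fun e => hsk (outerSlot_injective h₁ i hs hik.symm e),
        plugAt_of_ne _ _ _ _ fun e => hs (outerSlot_injective h₃ k hsk hik e)]
      congr 1
      apply Fin.ext
      have := Fin.val_ne_of_ne hik
      have := Fin.val_ne_of_ne hs
      have := Fin.val_ne_of_ne hsk
      simp only [outerSlot_val, Fin.lt_def]
      split_ifs <;> omega

end Par

section Act

variable {m n l : ℕ} (h : m + n = l + 1) (i : Fin m) (σ : Equiv.Perm (Fin m))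
  (τ : Equiv.Perm (Fin n)) (ρ : Equiv.Perm (Fin l))
  (hρ : ∀ (j : Fin m) (hj : j ≠ i),
    ρ (outerSlot h i j hj) = outerSlot h (σ i) (σ j) (fun e => hj (σ.injective e)))
  (hρ' : ∀ k : Fin n, ρ (innerSlot h i k) = innerSlot h (σ i) (τ k)) (a : Fin l → X)

theorem symm_comp_innerSlot (hρ' : ∀ k : Fin n, ρ (innerSlot h i k) = innerSlot h (σ i) (τ k)) :
    (a ∘ ρ.symm) ∘ innerSlot h (σ i) = (a ∘ innerSlot h i) ∘ τ.symm := by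
  funext k
  have := hρ' (τ.symm k)
  rw [Equiv.apply_symm_apply] at this
  simp [← this]

theorem plugAt_comp_symm (hρ : ∀ (j : Fin m) (hj : j ≠ i),
    ρ (outerSlot h i j hj) = outerSlot h (σ i) (σ j) (fun e => hj (σ.injective e))) (y : X) :
    plugAt h (σ i) y (a ∘ ρ.symm) = plugAt h i y a ∘ σ.symm := by
  funext k
  obtain ⟨k, rfl⟩ := σ.surjective k
  rw [Function.comp_apply, Equiv.symm_apply_apply]
  by_cases hk : k = i
  · subst hk; simp
  · rw [plugAt_of_ne _ _ _ _ fun e => hk (σ.injective e), plugAt_of_ne _ _ _ _ hk, ← hρ k hk]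
    simp

end Act

end Plug

/-! ### Koszul signs -/

section Signs

theorem innerSlot_lt_innerSlot {m n l : ℕ} (h : m + n = l + 1) (i : Fin m) {k k' : Fin n} :
    innerSlot h i k < innerSlot h i k' ↔ k < k' := by
  simp only [Fin.lt_def, innerSlot_val, Nat.add_lt_add_iff_left]

theorem outerSlot_lt_outerSlot {m n l : ℕ} (h : m + n = l + 1) (i : Fin m) {j j' : Fin m}
    (hj : j ≠ i) (hj' : j' ≠ i) : outerSlot h i j hj < outerSlot h i j' hj' ↔ j < j' := by
  have := Fin.val_ne_of_ne hj
  have := Fin.val_ne_of_ne hj'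
  simp only [outerSlot_val, Fin.lt_def]
  split_ifs <;> omega

theorem innerSlot_lt_outerSlot {m n l : ℕ} (h : m + n = l + 1) (i : Fin m) (k : Fin n) {j : Fin m}
    (hj : j ≠ i) : innerSlot h i k < outerSlot h i j hj ↔ i < j := by
  have := Fin.val_ne_of_ne hj
  have := k.2
  simp only [outerSlot_val, innerSlot_val, Fin.lt_def]
  split_ifs <;> omega

theorem outerSlot_lt_innerSlot {m n l : ℕ} (h : m + n = l + 1) (i : Fin m) (k : Fin n) {j : Fin m}
    (hj : j ≠ i) : outerSlot h i j hj < innerSlot h i k ↔ j < i := by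
  have := Fin.val_ne_of_ne hj
  have := k.2
  simp only [outerSlot_val, innerSlot_val, Fin.lt_def]
  split_ifs <;> omega

theorem outerSlot_val_lt {m n l : ℕ} (h : m + n = l + 1) (i : Fin m) {j : Fin m}
    (hj : j ≠ i) : (outerSlot h i j hj).val < i.val ↔ j < i := by
  have := Fin.val_ne_of_ne hj
  simp only [outerSlot_val, Fin.lt_def]
  split_ifs <;> omega

/-- The sum of the first `N` terms of a finite sequence of degrees. -/
def prefixSum {n : ℕ} (q : Fin n → ℤ) (N : ℕ) : ℤ := ∑ k with k.val < N, q k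

theorem prefixSum_eq {n : ℕ} (q : Fin n → ℤ) (N : ℕ) :
    prefixSum q N = ∑ k, if k.val < N then q k else 0 := Finset.sum_filter _ _

variable {m n l : ℕ} (h : m + n = l + 1) (i : Fin m) (α : Fin l → ℤ)

theorem sum_plugAt_eq {P : Type*} [AddCommGroup P] (f : Fin m → ℤ → P) (y : ℤ) :
    ∑ j, f j (plugAt h i y α j) =
      f i y + ∑ j : {j : Fin m // j ≠ i}, f j.1 (α (outerSlot h i j.1 j.2)) := by
  rw [Fintype.sum_eq_add_sum_subtype_ne _ i, plugAt_self]
  congr 1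
  exact Finset.sum_congr rfl fun j _ => by rw [plugAt_of_ne _ _ _ _ j.2]

theorem sum_plugAt (y : ℤ) :
    ∑ j, plugAt h i y α j = y + ∑ k, α k - ∑ k, α (innerSlot h i k) := by
  rw [sum_plugAt_eq h i α (fun _ x => x), sum_slots h i]
  ring

theorem prefixSum_plugAt (y : ℤ) {N : ℕ} (hN : i.val < N) :
    prefixSum (plugAt h i y α) N =
      y + prefixSum α (N + n - 1) - ∑ s, α (innerSlot h i s) := by
  rw [prefixSum_eq, prefixSum_eq, sum_plugAt_eq h i α (fun j x => if j.val < N then x else 0),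
    sum_slots h i, if_pos hN]
  have h1 : ∀ k, (innerSlot h i k).val < N + n - 1 := fun k => by
    have := k.2
    rw [innerSlot_val]
    omega
  have h2 : ∀ j : {j : Fin m // j ≠ i}, (outerSlot h i j.1 j.2).val < N + n - 1 ↔ j.1.val < N := by
    intro j
    have := Fin.val_ne_of_ne j.2
    rw [outerSlot_val]
    simp only [Fin.lt_def]
    split_ifs <;> omega
  simp only [h1, h2, if_true]
  ring

theorem prefixSum_plugAt_of_le (y : ℤ) {N : ℕ} (hN : N ≤ i.val) :
    prefixSum (plugAt h i y α) N = prefixSum α N := by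
  rw [prefixSum_eq, prefixSum_eq, sum_plugAt_eq h i α (fun j x => if j.val < N then x else 0),
    sum_slots h i, if_neg (not_lt.2 hN), zero_add]
  have h1 : ∑ k, (if (innerSlot h i k).val < N then α (innerSlot h i k) else 0) = 0 :=
    Finset.sum_eq_zero fun k _ => if_neg (by rw [innerSlot_val]; omega)
  rw [h1, zero_add]
  refine Finset.sum_congr rfl fun j _ => if_congr ?_ rfl rfl
  have := Fin.val_ne_of_ne j.2
  rw [outerSlot_val]
  simp only [Fin.lt_def]
  split_ifs <;> omega

theorem prefixSum_innerSlot {m n r a b l : ℕ} (h₁ : m + n = a + 1) (h₃ : n + r = b + 1)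
    (h₄ : m + b = l + 1) (i : Fin m) (j : Fin n) (α : Fin l → ℤ) :
    prefixSum α (innerSlot h₁ i j).val =
      prefixSum α i.val + prefixSum (α ∘ innerSlot h₄ i) j.val := by
  rw [prefixSum_eq, prefixSum_eq, prefixSum_eq, sum_slots h₄ i, sum_slots h₄ i]
  have h1 : ∑ k, (if (innerSlot h₄ i k).val < i.val then α (innerSlot h₄ i k) else 0) = 0 :=
    Finset.sum_eq_zero fun k _ => if_neg (by simp)
  have h2 : ∀ s : {s : Fin m // s ≠ i}, (outerSlot h₄ i s.1 s.2).val < (innerSlot h₁ i j).val ↔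
      (outerSlot h₄ i s.1 s.2).val < i.val := by
    intro s
    have := Fin.val_ne_of_ne s.2
    have := j.2
    simp only [outerSlot_val, innerSlot_val, Fin.lt_def]
    split_ifs <;> omega
  rw [h1]
  simp only [h2]
  simp only [innerSlot_val, Nat.add_lt_add_iff_left, Function.comp_apply]
  ring

theorem sum_sum_symm {n : ℕ} (F : Fin n → Fin n → ℤ) (hF : ∀ i, F i i = 0) :
    ∑ i, ∑ j, F i j = ∑ i, ∑ j, if i < j then F i j + F j i else 0 := by
  have h1 : ∀ i j, F i j = (if i < j then F i j else 0) + if j < i then F i j else 0 := by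
    intro i j
    rcases lt_trichotomy i j with h | h | h
    · simp [h, h.asymm]
    · subst h; simp [hF]
    · simp [h, h.asymm]
  have h2 : ∑ i, ∑ j, (if j < i then F i j else 0) = ∑ i, ∑ j, if i < j then F j i else 0 :=
    Finset.sum_comm
  calc ∑ i, ∑ j, F i j
      = ∑ i, ∑ j, ((if i < j then F i j else 0) + if j < i then F i j else 0) :=
        Finset.sum_congr rfl fun i _ => Finset.sum_congr rfl fun j _ => h1 i j
    _ = _ := by
        simp only [Finset.sum_add_distrib, h2]
        simp only [← Finset.sum_add_distrib]
        refine Finset.sum_congr rfl fun i _ => Finset.sum_congr rfl fun j _ => ?_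
        split_ifs <;> simp

theorem even_sum {ι : Type*} (s : Finset ι) (f : ι → ℤ) (hf : ∀ i ∈ s, Even (f i)) :
    Even (∑ i ∈ s, f i) := Finset.sum_induction f Even (fun _ _ => Even.add) Even.zero hf

/-- The Koszul sign depends only on the parities of the degrees. -/
theorem koszulSign_congr {n : ℕ} (σ : Equiv.Perm (Fin n)) {q q' : Fin n → ℤ}
    (hq : ∀ i, Even (q i - q' i)) : koszulSign σ q = koszulSign σ q' := by
  rw [koszulSign, koszulSign, Int.negOnePow_eq_iff]
  simp only [← Finset.sum_sub_distrib]
  refine even_sum _ _ fun i _ => even_sum _ _ fun j _ => ?_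
  split_ifs
  · have : q i * q j - q' i * q' j = (q i - q' i) * q j + q' i * (q j - q' j) := by ring
    rw [this]
    exact ((hq i).mul_right _).add ((hq j).mul_left _)
  · simp

theorem koszulSign_mul {n : ℕ} (σ τ : Equiv.Perm (Fin n)) (q : Fin n → ℤ) :
    koszulSign (σ * τ) q = koszulSign τ q * koszulSign σ (q ∘ τ.symm) := by
  rw [koszulSign, koszulSign, koszulSign, ← Int.negOnePow_add, Int.negOnePow_eq_iff]
  have h1 : (∑ i, ∑ j, if i < j ∧ σ j < σ i then (q ∘ τ.symm) i * (q ∘ τ.symm) j else 0) =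
      ∑ i, ∑ j, if τ i < τ j ∧ σ (τ j) < σ (τ i) then q i * q j else 0 := by
    rw [← Equiv.sum_comp τ]
    refine Finset.sum_congr rfl fun i _ => ?_
    rw [← Equiv.sum_comp τ]
    simp
  rw [h1, sum_sum_symm (fun i j => if τ i < τ j ∧ σ (τ j) < σ (τ i) then q i * q j else 0)
    (fun i => by simp), ← Finset.sum_add_distrib, ← Finset.sum_sub_distrib]
  refine even_sum _ _ fun i _ => ?_
  rw [← Finset.sum_add_distrib, ← Finset.sum_sub_distrib]
  refine even_sum _ _ fun j _ => ?_
  by_cases hij : i < j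
  · have hτ : τ i ≠ τ j := fun e => hij.ne (τ.injective e)
    have hσ : σ (τ i) ≠ σ (τ j) := fun e => hτ (σ.injective e)
    simp only [hij, true_and, if_true, Equiv.Perm.mul_apply]
    rcases hτ.lt_or_gt with h | h <;> rcases hσ.lt_or_gt with h' | h' <;>
      simp [h, h', h.asymm, h'.asymm, mul_comm (q j)]
  · simp [hij]

theorem koszulSign_one {n : ℕ} (q : Fin n → ℤ) : koszulSign 1 q = 1 := by
  have : ∀ i j : Fin n, ¬ (i < j ∧ j < i) := fun i j h => h.1.asymm h.2
  simp [koszulSign, this]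

/-- No sign arises from a permutation of elements at most one of which has odd degree; here all
degrees but one are zero. -/
theorem koszulSign_eq_one {n : ℕ} (σ : Equiv.Perm (Fin n)) {q : Fin n → ℤ} {s : Fin n}
    (hq : ∀ j, j ≠ s → q j = 0) : koszulSign σ q = 1 := by
  have : ∀ i j : Fin n, (if i < j ∧ σ j < σ i then q i * q j else 0) = 0 := by
    intro i j
    split_ifs with h
    · by_cases hi : i = s
      · rw [hq j (fun e => h.1.ne (hi.trans e.symm)), mul_zero]
      · rw [hq i hi, zero_mul]
    · rfl
  simp [koszulSign, this]

/-- The Koszul sign of the block permutation `ρ` which is given by `σ` on the outer inputs and by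
`τ` on the inner ones: the inner inputs move past the outer ones as a single block, and the sign of
an inner operation of degree `q` is taken into account on both sides. -/
theorem koszulSign_circ (σ : Equiv.Perm (Fin m)) (τ : Equiv.Perm (Fin n)) (ρ : Equiv.Perm (Fin l))
    (hρ : ∀ (j : Fin m) (hj : j ≠ i),
      ρ (outerSlot h i j hj) = outerSlot h (σ i) (σ j) (fun e => hj (σ.injective e)))
    (hρ' : ∀ k : Fin n, ρ (innerSlot h i k) = innerSlot h (σ i) (τ k)) (q : ℤ) :
    koszulSign ρ α * (q * prefixSum (α ∘ ρ.symm) (σ i).val).negOnePow =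
      (q * prefixSum α i.val).negOnePow *
        koszulSign σ (plugAt h i (q + ∑ k, α (innerSlot h i k)) α) *
          koszulSign τ (α ∘ innerSlot h i) := by
  set A := ∑ k, α (innerSlot h i k) with hA
  -- The total degree of the outer inputs which change sides with the block.
  let I : ℤ := ∑ j : {j : Fin m // j ≠ i},
    ((if i < j.1 ∧ σ j.1 < σ i then α (outerSlot h i j.1 j.2) else 0) +
      if j.1 < i ∧ σ i < σ j.1 then α (outerSlot h i j.1 j.2) else 0)
  let K : ℤ := ∑ j : {j : Fin m // j ≠ i}, ∑ j' : {j : Fin m // j ≠ i},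
    if j.1 < j'.1 ∧ σ j'.1 < σ j.1 then
      α (outerSlot h i j.1 j.2) * α (outerSlot h i j'.1 j'.2) else 0
  have hσ : ∀ y, (∑ a, ∑ b, if a < b ∧ σ b < σ a then plugAt h i y α a * plugAt h i y α b else 0) =
      y * I + K := by
    intro y
    rw [sum_plugAt_eq h i α (fun a x => ∑ b, if a < b ∧ σ b < σ a then x * plugAt h i y α b else 0),
      sum_plugAt_eq h i α (fun b x => if i < b ∧ σ b < σ i then y * x else 0)]
    have h1 : ∀ a : {j : Fin m // j ≠ i}, (∑ b, if a.1 < b ∧ σ b < σ a.1 then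
        α (outerSlot h i a.1 a.2) * plugAt h i y α b else 0) =
        (if a.1 < i ∧ σ i < σ a.1 then α (outerSlot h i a.1 a.2) * y else 0) +
          ∑ b : {j : Fin m // j ≠ i}, if a.1 < b.1 ∧ σ b.1 < σ a.1 then
            α (outerSlot h i a.1 a.2) * α (outerSlot h i b.1 b.2) else 0 := fun a =>
      sum_plugAt_eq h i α (fun b x => if a.1 < b ∧ σ b < σ a.1 then
        α (outerSlot h i a.1 a.2) * x else 0) y
    simp only [h1, Finset.sum_add_distrib, lt_irrefl, false_and, if_false, zero_add, I, K, mul_add,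
      Finset.mul_sum, mul_ite, mul_zero, add_assoc, mul_comm _ y]
  have hρK : (∑ a, ∑ b, if a < b ∧ ρ b < ρ a then α a * α b else 0) =
      (∑ a, ∑ b, if a < b ∧ τ b < τ a then (α ∘ innerSlot h i) a * (α ∘ innerSlot h i) b else 0) +
        (A * I + K) := by
    rw [sum_slots h i]
    have h1 : ∀ a, (∑ b, if a < b ∧ ρ b < ρ a then α a * α b else 0) =
        (∑ b, if a < innerSlot h i b ∧ ρ (innerSlot h i b) < ρ a then
          α a * α (innerSlot h i b) else 0) + ∑ b : {j : Fin m // j ≠ i},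
          if a < outerSlot h i b.1 b.2 ∧ ρ (outerSlot h i b.1 b.2) < ρ a then
            α a * α (outerSlot h i b.1 b.2) else 0 := fun a => sum_slots h i _
    simp only [h1]
    simp only [Finset.sum_add_distrib, hρ, hρ', innerSlot_lt_innerSlot, innerSlot_lt_outerSlot,
      outerSlot_lt_innerSlot, outerSlot_lt_outerSlot, Function.comp_apply]
    have h2 : (∑ k : Fin n, ∑ j : {j : Fin m // j ≠ i}, if i < j.1 ∧ σ j.1 < σ i then
        α (innerSlot h i k) * α (outerSlot h i j.1 j.2) else 0) =
        A * ∑ j : {j : Fin m // j ≠ i},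
          if i < j.1 ∧ σ j.1 < σ i then α (outerSlot h i j.1 j.2) else 0 := by
      rw [hA, Finset.sum_mul_sum]
      simp only [mul_ite, mul_zero]
    have h3 : (∑ j : {j : Fin m // j ≠ i}, ∑ k : Fin n, if j.1 < i ∧ σ i < σ j.1 then
        α (outerSlot h i j.1 j.2) * α (innerSlot h i k) else 0) =
        A * ∑ j : {j : Fin m // j ≠ i},
          if j.1 < i ∧ σ i < σ j.1 then α (outerSlot h i j.1 j.2) else 0 := by
      rw [Finset.sum_comm, hA, Finset.sum_mul_sum]
      simp only [mul_ite, mul_zero, mul_comm]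
    rw [h2, h3]
    simp only [I, K, Finset.sum_add_distrib]
    ring
  have hpre : prefixSum α i.val = ∑ j : {j : Fin m // j ≠ i},
      if j.1 < i then α (outerSlot h i j.1 j.2) else 0 := by
    rw [prefixSum_eq, sum_slots h i]
    simp [outerSlot_val_lt]
  have hpre' : prefixSum (α ∘ ρ.symm) (σ i).val = ∑ j : {j : Fin m // j ≠ i},
      if σ j.1 < σ i then α (outerSlot h i j.1 j.2) else 0 := by
    rw [prefixSum_eq, ← Equiv.sum_comp ρ, sum_slots h i]
    simp only [Function.comp_apply, Equiv.symm_apply_apply]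
    simp [hρ, hρ', outerSlot_val_lt]
  have hI : Even (prefixSum α i.val + prefixSum (α ∘ ρ.symm) (σ i).val + I) := by
    rw [hpre, hpre']
    simp only [I, ← Finset.sum_add_distrib]
    refine even_sum _ _ fun j _ => ?_
    have hσ : σ j.1 ≠ σ i := fun e => j.2 (σ.injective e)
    rcases lt_or_gt_of_ne j.2 with h1 | h1 <;> rcases hσ.lt_or_gt with h2 | h2 <;>
      simp [h1, h2, h1.asymm, h2.asymm]
  rw [koszulSign, koszulSign, koszulSign, ← Int.negOnePow_add, ← Int.negOnePow_add,
    ← Int.negOnePow_add, Int.negOnePow_eq_iff, hσ, hρK]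
  obtain ⟨c, hc⟩ := hI
  refine ⟨q * (c - prefixSum α i.val - I), ?_⟩
  linear_combination q * hc

end Signs

/-! ### Homogeneous arguments of multilinear maps -/

theorem Int.negOnePow_sum {ι : Type*} (s : Finset ι) (f : ι → ℤ) :
    (∑ i ∈ s, f i).negOnePow = ∏ i ∈ s, (f i).negOnePow := by
  classical
  induction s using Finset.induction_on with
  | empty => simp
  | insert a s ha ih => rw [Finset.sum_insert ha, Finset.prod_insert ha, Int.negOnePow_add, ih]

theorem MultilinearMap.map_intUnit_smul_univ {R ι M N : Type*} [CommRing R] [Fintype ι]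
    [AddCommGroup M] [AddCommGroup N] [Module R M] [Module R N]
    (φ : MultilinearMap R (fun _ : ι => M) N) (c : ι → ℤˣ) (v : ι → M) :
    φ (fun i => c i • v i) = (∏ i, c i) • φ v := by
  have h : ∀ (c : ℤˣ) (x : M), c • x = ((c : ℤ) : R) • x :=
    fun c x => by rw [Units.smul_def, Int.cast_smul_eq_zsmul]
  have h' : ∀ (c : ℤˣ) (x : N), c • x = ((c : ℤ) : R) • x :=
    fun c x => by rw [Units.smul_def, Int.cast_smul_eq_zsmul]
  have h2 : (fun i => c i • v i) = fun i => ((c i : ℤ) : R) • v i := funext fun i => h _ _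
  rw [h2, φ.map_smul_univ, h']
  simp

namespace DGModule

variable {R : Type u} [CommRing R]

/-- The projection to the even part (`e = false`) or to the odd part (`e = true`). -/
noncomputable def parityProj (M : DGModule R) (e : Bool) : M →ₗ[R] M :=
  M.lift fun k => if decide (Odd k) = e then (M.gr k).subtype else 0

theorem parityProj_apply (M : DGModule R) (e : Bool) {k : ℤ} {x : M} (hx : x ∈ M.gr k) :
    M.parityProj e x = if decide (Odd k) = e then x else 0 := by
  rw [parityProj, lift_apply _ _ hx]
  split_ifs <;> rfl

/-- The `k`-th power of the involution `x ↦ (-1)^{|x|} x`. -/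
noncomputable def sgnPow (M : DGModule R) (k : ℤ) : M →ₗ[R] M :=
  M.lift fun q => (k * q).negOnePow • (M.gr q).subtype

theorem sgnPow_apply (M : DGModule R) (k : ℤ) {q : ℤ} {x : M} (hx : x ∈ M.gr q) :
    M.sgnPow k x = (k * q).negOnePow • x := by
  rw [sgnPow, lift_apply _ _ hx]
  rfl

/-- Multilinear maps on a graded module are determined by their values on homogeneous elements. -/
theorem multilinearMap_ext {M : DGModule R} {n : ℕ} {P : Type u} [AddCommGroup P] [Module R P]
    {φ ψ : MultilinearMap R (fun _ : Fin n => M.carrier) P}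
    (h : ∀ (q : Fin n → ℤ) (a : Fin n → M), (∀ i, a i ∈ M.gr (q i)) → φ a = ψ a) : φ = ψ := by
  have key : ∀ (s : Finset (Fin n)) (a : Fin n → M), (∀ i ∉ s, ∃ k, a i ∈ M.gr k) →
      φ a = ψ a := by
    intro s
    induction s using Finset.induction_on with
    | empty =>
      intro a ha
      choose q hq using fun i => ha i (Finset.notMem_empty i)
      exact h q a hq
    | insert i s _ ih =>
      intro a ha
      rw [← Function.update_eq_self i a]
      generalize a i = x
      induction x using induction_gr with
      | h k x hx =>
        refine ih _ fun j hj => ?_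
        by_cases hji : j = i
        · subst hji
          exact ⟨k, by simpa using hx⟩
        · rw [Function.update_of_ne hji]
          exact ha j (by simp [hji, hj])
      | hadd x y hx hy => rw [φ.map_update_add, ψ.map_update_add, hx, hy]
  exact MultilinearMap.ext fun a => key Finset.univ a fun i hi => absurd (Finset.mem_univ i) hi

end DGModule

/-! ### The endomorphism operad of a family of differential graded modules -/

section Multi

variable {R : Type u} [CommRing R] {M : Type u} [AddCommGroup M] [Module R M]

theorem MultilinearMap.map_plugAt_smul {m n l : ℕ} (h : m + n = l + 1) (i : Fin m)
    (φ : MultilinearMap R (fun _ : Fin m => M) M) (c : ℤˣ) (y : M) (a : Fin l → M) :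
    φ (plugAt h i (c • y) a) = c • φ (plugAt h i y a) := by
  rw [← update_plugAt h i y (c • y), Units.smul_def, ← Int.cast_smul_eq_zsmul R,
    φ.map_update_smul, update_plugAt, Int.cast_smul_eq_zsmul, ← Units.smul_def]

/-- Substitution of the multilinear map `ψ` into the `i`-th argument of the multilinear map `φ`. -/
def MultilinearMap.subst {m n l : ℕ} (h : m + n = l + 1) (i : Fin m)
    (φ : MultilinearMap R (fun _ : Fin m => M) M) (ψ : MultilinearMap R (fun _ : Fin n => M) M) :
    MultilinearMap R (fun _ : Fin l => M) M where
  toFun a := φ (plugAt h i (ψ (a ∘ innerSlot h i)) a)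
  map_update_add' := by
    intro inst a k x y
    obtain rfl : inst = instDecidableEqFin l := Subsingleton.elim _ _
    rcases slot_cases h i k with ⟨k, rfl⟩ | ⟨j, hj, rfl⟩
    · simp only [plugAt_update_inner, update_comp_innerSlot, ψ.map_update_add]
      rw [← update_plugAt h i 0, φ.map_update_add, update_plugAt, update_plugAt]
    · simp only [plugAt_update_outer, update_outer_comp_innerSlot, φ.map_update_add]
  map_update_smul' := by
    intro inst a k c x
    obtain rfl : inst = instDecidableEqFin l := Subsingleton.elim _ _
    rcases slot_cases h i k with ⟨k, rfl⟩ | ⟨j, hj, rfl⟩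
    · simp only [plugAt_update_inner, update_comp_innerSlot, ψ.map_update_smul]
      rw [← update_plugAt h i 0, φ.map_update_smul, update_plugAt]
    · simp only [plugAt_update_outer, update_outer_comp_innerSlot, φ.map_update_smul]

theorem MultilinearMap.subst_apply {m n l : ℕ} (h : m + n = l + 1) (i : Fin m)
    (φ : MultilinearMap R (fun _ : Fin m => M) M) (ψ : MultilinearMap R (fun _ : Fin n => M) M)
    (a : Fin l → M) : φ.subst h i ψ a = φ (plugAt h i (ψ (a ∘ innerSlot h i)) a) := rfl

end Multi

section End

variable {R : Type u} [CommRing R] {ι : Type} (A : ι → DGModule R)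

/-- Families of multilinear maps `(A x)ⁿ → A x`. -/
abbrev MultiOp (n : ℕ) : Type u := ∀ x : ι, MultilinearMap R (fun _ : Fin n => (A x).carrier) (A x)

namespace MultiOp

variable {A}

/-- The partial composition with a family of degree `q`; the Koszul sign arises from moving this
family past the preceding arguments. -/
noncomputable def circ {m n l : ℕ} (h : m + n = l + 1) (i : Fin m) (q : ℤ) :
    MultiOp A m →ₗ[R] MultiOp A n →ₗ[R] MultiOp A l :=
  LinearMap.mk₂ R (fun φ ψ x => ((φ x).subst h i (ψ x)).compLinearMap
      fun k => if k.val < i.val then (A x).sgnPow q else LinearMap.id)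
    (fun φ φ' ψ => by ext x a; simp [MultilinearMap.subst_apply])
    (fun c φ ψ => by ext x a; simp [MultilinearMap.subst_apply])
    (fun φ ψ ψ' => by
      ext x a
      simp only [MultilinearMap.subst_apply, MultilinearMap.compLinearMap_apply, Pi.add_apply,
        add_apply]
      rw [← update_plugAt h i 0, MultilinearMap.map_update_add, update_plugAt, update_plugAt])
    (fun c φ ψ => by
      ext x a
      simp only [MultilinearMap.subst_apply, MultilinearMap.compLinearMap_apply, Pi.smul_apply,
        smul_apply]
      rw [← update_plugAt h i 0, MultilinearMap.map_update_smul, update_plugAt])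

theorem circ_apply {m n l : ℕ} (h : m + n = l + 1) (i : Fin m) (q : ℤ) (φ : MultiOp A m)
    (ψ : MultiOp A n) {x : ι} {α : Fin l → ℤ} {a : Fin l → A x} (ha : ∀ k, a k ∈ (A x).gr (α k)) :
    circ h i q φ ψ x a =
      (q * prefixSum α i.val).negOnePow • φ x (plugAt h i (ψ x (a ∘ innerSlot h i)) a) := by
  let β : Fin m → ℤ := fun j => if j.val < i.val then q * plugAt h i 0 α j else 0
  have hβ : ∑ j, β j = q * prefixSum α i.val := by
    rw [← prefixSum_plugAt_of_le h i α 0 le_rfl, prefixSum_eq, Finset.mul_sum]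
    exact Finset.sum_congr rfl fun j _ => by simp only [β, mul_ite, mul_zero]
  change φ x (plugAt h i (ψ x fun k => _) fun k => _) = _
  have h1 : (fun k => (if (innerSlot h i k).val < i.val then (A x).sgnPow q else LinearMap.id)
      (a (innerSlot h i k))) = a ∘ innerSlot h i :=
    funext fun k => by rw [if_neg (by simp)]; rfl
  rw [← hβ, Int.negOnePow_sum, ← MultilinearMap.map_intUnit_smul_univ]
  congr 1
  funext j
  by_cases hj : j = i
  · subst hj
    rw [plugAt_self, plugAt_self]
    simp only [β, lt_irrefl, if_false, Int.negOnePow_zero, one_smul]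
    exact congrArg (ψ x) h1
  · rw [plugAt_of_ne _ _ _ _ hj, plugAt_of_ne _ _ _ _ hj]
    simp only [β, outerSlot_val_lt, Fin.lt_def]
    split_ifs
    · rw [DGModule.sgnPow_apply _ _ (ha _), plugAt_of_ne _ _ _ _ hj]
    · simp

/-- The action of a permutation on families of multilinear maps. The Koszul sign depends only on the
parities of the arguments. -/
noncomputable def act {n : ℕ} (σ : Equiv.Perm (Fin n)) : MultiOp A n →ₗ[R] MultiOp A n where
  toFun φ x := ∑ ε : Fin n → Bool, koszulSign σ (fun i => if ε i then 1 else 0) •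
    ((φ x).domDomCongr σ.symm).compLinearMap fun i => (A x).parityProj (ε i)
  map_add' φ ψ := by
    ext x a
    simp [Finset.sum_add_distrib]
  map_smul' c φ := by
    ext x a
    simp only [sum_apply, RingHom.id_apply, Pi.smul_apply, smul_apply,
      MultilinearMap.compLinearMap_apply, MultilinearMap.domDomCongr_apply, Finset.smul_sum]
    exact Finset.sum_congr rfl fun ε _ => smul_comm _ _ _

theorem act_apply {n : ℕ} (σ : Equiv.Perm (Fin n)) (φ : MultiOp A n) {x : ι} {α : Fin n → ℤ}
    {a : Fin n → A x} (ha : ∀ k, a k ∈ (A x).gr (α k)) :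
    act σ φ x a = koszulSign σ α • φ x (a ∘ σ.symm) := by
  change (∑ ε : Fin n → Bool, koszulSign σ (fun i => if ε i then 1 else 0) •
    ((φ x).domDomCongr σ.symm).compLinearMap fun i => (A x).parityProj (ε i)) a = _
  rw [sum_apply, Finset.sum_eq_single fun i => decide (Odd (α i))]
  · rw [smul_apply, MultilinearMap.compLinearMap_apply,
      MultilinearMap.domDomCongr_apply]
    congr 1
    · refine koszulSign_congr σ fun i => ?_
      simp only [decide_eq_true_eq]
      split_ifs with h
      · exact odd_one.sub_odd h
      · exact Even.zero.sub (Int.not_odd_iff_even.1 h)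
    · congr 1
      funext i
      rw [DGModule.parityProj_apply _ _ (ha _), if_pos rfl]
      rfl
  · intro ε _ hε
    obtain ⟨i, hi⟩ := Function.ne_iff.1 hε
    rw [smul_apply, MultilinearMap.compLinearMap_apply,
      MultilinearMap.domDomCongr_apply,
      MultilinearMap.map_coord_zero _ (σ i) (by
        rw [Equiv.symm_apply_apply, DGModule.parityProj_apply _ _ (ha _), if_neg (Ne.symm hi)]),
      smul_zero]
  · exact fun h => absurd (Finset.mem_univ _) h

variable (A) in
/-- The families of multilinear maps of degree `k`. -/
def gr (n : ℕ) (k : ℤ) : Submodule R (MultiOp A n) where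
  carrier := {φ | ∀ (x : ι) (α : Fin n → ℤ) (a : Fin n → A x), (∀ i, a i ∈ (A x).gr (α i)) →
    φ x a ∈ (A x).gr (k + ∑ i, α i)}
  zero_mem' _ _ _ _ := Submodule.zero_mem _
  add_mem' hφ hψ x α a ha := Submodule.add_mem _ (hφ x α a ha) (hψ x α a ha)
  smul_mem' c _ hφ x α a ha := Submodule.smul_mem _ c (hφ x α a ha)

theorem ext_homogeneous {n : ℕ} {φ ψ : MultiOp A n}
    (h : ∀ (x : ι) (α : Fin n → ℤ) (a : Fin n → A x),
    (∀ i, a i ∈ (A x).gr (α i)) → φ x a = ψ x a) : φ = ψ :=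
  funext fun x => DGModule.multilinearMap_ext (h x)

variable (A) in
theorem gr_indep (n : ℕ) : iSupIndep (gr A n) := by
  refine DGModule.iSupIndep_of_jointly_injective
    (ι := {t : Σ x : ι, (Fin n → A x) × (Fin n → ℤ) // ∀ i, t.2.1 i ∈ (A t.1).gr (t.2.2 i)})
    (N := fun t => A t.1.1)
    (fun t => { toFun := fun φ => φ t.1.1 t.1.2.1
                map_add' := fun _ _ => rfl
                map_smul' := fun _ _ => rfl })
    (fun t => - ∑ i, t.1.2.2 i) (fun φ hφ => ?_) (fun k φ hφ t => ?_)
  · exact ext_homogeneous fun x α a ha => hφ ⟨⟨x, a, α⟩, ha⟩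
  · rw [sub_neg_eq_add]
    exact hφ t.1.1 _ _ t.2

theorem plugAt_mem {m n l : ℕ} (h : m + n = l + 1) (i : Fin m) {M : DGModule R} {α : Fin l → ℤ}
    {a : Fin l → M} (ha : ∀ k, a k ∈ M.gr (α k)) {y : M} {q : ℤ} (hy : y ∈ M.gr q) (j : Fin m) :
    plugAt h i y a j ∈ M.gr (plugAt h i q α j) := by
  by_cases hj : j = i
  · subst hj; simpa using hy
  · rw [plugAt_of_ne _ _ _ _ hj, plugAt_of_ne _ _ _ _ hj]
    exact ha _

theorem circ_mem {m n l : ℕ} (h : m + n = l + 1) (i : Fin m) {p q : ℤ} {φ : MultiOp A m}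
    {ψ : MultiOp A n} (hφ : φ ∈ gr A m p) (hψ : ψ ∈ gr A n q) :
    circ h i q φ ψ ∈ gr A l (p + q) := by
  intro x α a ha
  rw [circ_apply h i q φ ψ ha]
  refine Submodule.smul_of_tower_mem _ _ ?_
  have := hφ x _ _ (plugAt_mem h i ha (hψ x _ (a ∘ innerSlot h i) fun k => ha _))
  rw [sum_plugAt] at this
  convert this using 2
  ring

theorem circ_seq {m n r a b l : ℕ} (h₁ : m + n = a + 1) (h₂ : a + r = l + 1) (h₃ : n + r = b + 1)
    (h₄ : m + b = l + 1) (i : Fin m) (j : Fin n) {q s : ℤ} (φ : MultiOp A m)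
    {ψ : MultiOp A n} {χ : MultiOp A r} (hχ : χ ∈ gr A r s) :
    circ h₂ (innerSlot h₁ i j) s (circ h₁ i q φ ψ) χ =
      circ h₄ i (q + s) φ (circ h₃ j s ψ χ) := by
  refine ext_homogeneous fun x α v hv => ?_
  rw [circ_apply h₂ _ _ _ _ hv, circ_apply h₄ _ _ _ _ hv,
    circ_apply h₁ _ _ _ _ (plugAt_mem h₂ _ hv (hχ x _ (v ∘ innerSlot h₂ _) fun k => hv _)),
    circ_apply h₃ _ _ _ _ (a := v ∘ innerSlot h₄ i) (α := α ∘ innerSlot h₄ i) (fun k => hv _),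
    MultilinearMap.map_plugAt_smul, plugAt_comp_innerSlot h₁ h₂ h₃ h₄, plugAt_plugAt_inner h₁ h₂ h₄,
    smul_smul, smul_smul, ← Int.negOnePow_add, ← Int.negOnePow_add,
    prefixSum_plugAt_of_le _ _ _ _ (by simp), prefixSum_innerSlot h₁ h₃ h₄]
  congr 2
  · ring
  · congr 4
    funext k
    simp only [Function.comp_apply, innerSlot_innerSlot h₁ h₂ h₃ h₄]

theorem circ_par {m n r a b l : ℕ} (h₁ : m + n = a + 1) (h₂ : a + r = l + 1) (h₃ : m + r = b + 1)
    (h₄ : b + n = l + 1) (i k : Fin m) (hik : i ≠ k) {q s : ℤ} (φ : MultiOp A m)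
    {ψ : MultiOp A n} {χ : MultiOp A r} (hψ : ψ ∈ gr A n q) (hχ : χ ∈ gr A r s) :
    circ h₂ (outerSlot h₁ i k hik.symm) s (circ h₁ i q φ ψ) χ =
      (q * s).negOnePow • circ h₄ (outerSlot h₃ k i hik) q (circ h₃ k s φ χ) ψ := by
  refine ext_homogeneous fun x α v hv => ?_
  rw [Pi.smul_apply, smul_apply, circ_apply h₂ _ _ _ _ hv, circ_apply h₄ _ _ _ _ hv,
    circ_apply h₁ _ _ _ _ (plugAt_mem h₂ _ hv (hχ x _ (v ∘ innerSlot h₂ _) fun k => hv _)),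
    circ_apply h₃ _ _ _ _ (plugAt_mem h₄ _ hv (hψ x _ (v ∘ innerSlot h₄ _) fun k => hv _)),
    plugAt_outer_comp_innerSlot h₁ h₂ h₃ h₄ i k hik,
    plugAt_outer_comp_innerSlot h₃ h₄ h₁ h₂ k i hik.symm,
    plugAt_plugAt_outer h₁ h₂ h₃ h₄ i k hik, smul_smul, smul_smul, smul_smul, ← Int.negOnePow_add,
    ← Int.negOnePow_add, ← Int.negOnePow_add]
  congr 1
  rw [Int.negOnePow_eq_iff]
  have hs := outerSlot_val h₁ i k hik.symm
  have ht := outerSlot_val h₃ k i hik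
  rcases hik.lt_or_gt with h | h
  · have h' := Fin.lt_def.1 h
    rw [if_neg h.asymm] at hs
    rw [if_pos h] at ht
    rw [prefixSum_plugAt_of_le h₂ _ _ _ (by omega), prefixSum_plugAt h₄ _ _ _ (by omega), hs, ht]
    exact ⟨-q * s, by ring⟩
  · have h' := Fin.lt_def.1 h
    rw [if_pos h] at hs
    rw [if_neg h.asymm] at ht
    rw [prefixSum_plugAt_of_le h₄ _ _ _ (by omega), prefixSum_plugAt h₂ _ _ _ (by omega), hs, ht]
    exact ⟨0, by ring⟩

theorem circ_act {m n l : ℕ} (h : m + n = l + 1) (i : Fin m) (σ : Equiv.Perm (Fin m))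
    (τ : Equiv.Perm (Fin n)) (ρ : Equiv.Perm (Fin l))
    (hρ : ∀ (j : Fin m) (hj : j ≠ i),
      ρ (outerSlot h i j hj) = outerSlot h (σ i) (σ j) (fun e => hj (σ.injective e)))
    (hρ' : ∀ k : Fin n, ρ (innerSlot h i k) = innerSlot h (σ i) (τ k)) {q : ℤ} (φ : MultiOp A m)
    {ψ : MultiOp A n} (hψ : ψ ∈ gr A n q) :
    circ h i q (act σ φ) (act τ ψ) = act ρ (circ h (σ i) q φ ψ) := by
  refine ext_homogeneous fun x α v hv => ?_
  have hv' : ∀ k, (v ∘ innerSlot h i) k ∈ (A x).gr ((α ∘ innerSlot h i) k) := fun k => hv _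
  have hv'' : ∀ k, ((v ∘ innerSlot h i) ∘ τ.symm) k ∈ (A x).gr (((α ∘ innerSlot h i) ∘ τ.symm) k) :=
    fun k => hv _
  have hdeg : ∑ k, ((α ∘ innerSlot h i) ∘ τ.symm) k = ∑ k, α (innerSlot h i k) :=
    Equiv.sum_comp τ.symm fun k => α (innerSlot h i k)
  have hy := hψ x _ _ hv''
  rw [hdeg] at hy
  rw [circ_apply h _ _ _ _ hv, act_apply τ _ hv', MultilinearMap.map_plugAt_smul,
    act_apply σ _ (plugAt_mem h i hv hy), act_apply ρ _ hv,
    circ_apply h _ _ _ _ (a := v ∘ ρ.symm) (α := α ∘ ρ.symm) (fun k => hv _), smul_smul, smul_smul,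
    smul_smul, koszulSign_circ h i α σ τ ρ hρ hρ', symm_comp_innerSlot h i σ τ ρ v hρ',
    plugAt_comp_symm h i σ ρ v hρ]
  congr 1
  exact mul_right_comm _ _ _

theorem act_mem {n : ℕ} (σ : Equiv.Perm (Fin n)) {k : ℤ} {φ : MultiOp A n} (hφ : φ ∈ gr A n k) :
    act σ φ ∈ gr A n k := by
  intro x α a ha
  rw [act_apply σ φ ha, ← Equiv.sum_comp σ.symm α]
  exact Submodule.smul_of_tower_mem _ _ (hφ x _ _ fun i => ha _)

variable (A) in
/-- A family of linear maps, as a family of multilinear maps with one argument. -/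
def ofLinear (f : ∀ x, A x →ₗ[R] A x) : MultiOp A 1 := fun x =>
  MultilinearMap.ofSubsingleton R (A x).carrier (A x).carrier (0 : Fin 1) (f x)

@[simp] theorem ofLinear_apply (f : ∀ x, A x →ₗ[R] A x) (x : ι) (a : Fin 1 → A x) :
    ofLinear A f x a = f x (a 0) := rfl

end MultiOp

open MultiOp in
/-- The endomorphism operad of a family of differential graded modules, without its differential. -/
noncomputable def preEndOperad : GradedOperad R where
  T := MultiOp A
  gr := gr A
  indep := gr_indep A
  d _ := 0
  d_mem _ := Submodule.zero_mem _
  d_d _ := rfl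
  act := act
  act_mem := act_mem
  act_one {n k φ} _ := ext_homogeneous fun x α a ha => by
    rw [act_apply 1 φ ha, koszulSign_one, one_smul]
    rfl
  act_mul {n} σ τ k φ _ := ext_homogeneous fun x α a ha => by
    rw [act_apply _ φ ha, act_apply τ _ ha,
      act_apply σ φ (a := a ∘ τ.symm) (α := α ∘ τ.symm) fun i => ha _, koszulSign_mul, mul_smul]
    rfl
  act_d _ _ _ _ := by simp
  one := ofLinear A fun _ => LinearMap.id
  one_mem x α a ha := by simpa using ha 0
  one_d := rfl
  circ := circ
  circ_mem h i _ _ _ _ := circ_mem h i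
  circ_d _ _ _ _ _ _ _ _ := by simp
  one_circ {n} h k φ hφ := ext_homogeneous fun x α a ha => by
    rw [circ_apply h 0 k _ _ ha, ofLinear_apply, plugAt_self]
    have : a ∘ innerSlot h 0 = a := funext fun j => by rw [Function.comp_apply, one_innerSlot]
    simp [this, prefixSum]
  circ_one {n} h i k φ hφ := ext_homogeneous fun x α a ha => by
    rw [circ_apply h i 0 _ _ ha]
    have : plugAt h i (a i) a = a := by
      funext j
      by_cases hj : j = i
      · subst hj; simp
      · rw [plugAt_of_ne _ _ _ _ hj, outerSlot_one]
    simp [innerSlot_zero _ _ i.2, this]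
  circ_seq h₁ h₂ h₃ h₄ i j _ _ _ _ _ _ _ _ hz := circ_seq h₁ h₂ h₃ h₄ i j _ hz
  circ_par h₁ h₂ h₃ h₄ i k hik _ _ _ _ _ _ _ hy hz := circ_par h₁ h₂ h₃ h₄ i k hik _ hy hz
  circ_act h i σ τ ρ h₁ h₂ _ _ _ _ _ hy := circ_act h i σ τ ρ h₁ h₂ _ hy

/-- The endomorphism operad of a family of differential graded modules. -/
noncomputable def endOperad : GradedOperad R :=
  (preEndOperad A).twist (MultiOp.ofLinear A fun x => (A x).d)
    (fun x α a ha => by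
      have := (A x).d_mem (ha 0)
      rw [add_comm] at this
      simpa using this)
    rfl
    (MultiOp.ext_homogeneous fun x α a ha => by
      change MultiOp.circ _ _ _ _ _ x a = 0
      rw [MultiOp.circ_apply _ _ _ _ _ ha]
      simp [(A x).d_d])

variable {A}

/-- The differential of the endomorphism operad on families of degree `k`. -/
noncomputable def MultiOp.endD {n : ℕ} (k : ℤ) : MultiOp A n →ₗ[R] MultiOp A n := (endOperad A).d k

/-- The twisting by the differentials of the `A x` gives the usual differential of an endomorphism
operad. -/
theorem MultiOp.endD_apply {n : ℕ} (k : ℤ) (φ : MultiOp A n) {x : ι} {α : Fin n → ℤ}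
    {a : Fin n → A x} (ha : ∀ i, a i ∈ (A x).gr (α i)) :
    MultiOp.endD k φ x a = (A x).d (φ x a) -
      k.negOnePow • ∑ i : Fin n, (prefixSum α i.val).negOnePow •
        φ x (Function.update a i ((A x).d (a i))) := by
  have h : MultiOp.endD k φ =
      (MultiOp.circ (add_comm 1 n) 0 k (MultiOp.ofLinear A fun x => (A x).d) φ -
        k.negOnePow • ∑ i : Fin n, MultiOp.circ (rfl : n + 1 = n + 1) i 1 φ
          (MultiOp.ofLinear A fun x => (A x).d) : MultiOp A n) :=
    (zero_add _).trans (GradedOperad.ad_apply (G := preEndOperad A) _ _ _)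
  rw [h]
  change MultiOp.circ (add_comm 1 n) 0 k (MultiOp.ofLinear A fun x => (A x).d) φ x a -
    (k.negOnePow • ∑ i : Fin n, MultiOp.circ (rfl : n + 1 = n + 1) i 1 φ
          (MultiOp.ofLinear A fun x => (A x).d)) x a = _
  rw [MultiOp.circ_apply _ _ _ _ _ ha]
  simp only [Pi.smul_apply, Finset.sum_apply, smul_apply, sum_apply]
  congr 1
  · have : a ∘ innerSlot (add_comm 1 n) 0 = a :=
      funext fun j => by rw [Function.comp_apply, one_innerSlot]
    simp [this, prefixSum]
  · congr 1
    refine Finset.sum_congr rfl fun i _ => ?_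
    rw [MultiOp.circ_apply _ _ _ _ _ ha, one_mul, MultiOp.ofLinear_apply, Function.comp_apply,
      innerSlot_zero _ _ i.2]
    congr 2
    funext j
    by_cases hj : j = i
    · subst hj; simp
    · rw [plugAt_of_ne _ _ _ _ hj, Function.update_of_ne hj, outerSlot_one]

end End

/-! ### Morphisms out of operads presented by homogeneous operations -/

namespace GradedOperad

variable {R : Type u} [CommRing R] (G : GradedOperad R)

/-- A morphism from the operad presented by `G`, given by linear maps on the ambient modules which
are compatible with the structure on homogeneous elements. -/
noncomputable def toHom (C : DGOperad R) (f : ∀ n, G.T n →ₗ[R] C.obj n)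
    (f_mem : ∀ {n : ℕ} {k : ℤ} {x : G.T n}, x ∈ G.gr n k → f n x ∈ (C.obj n).gr k)
    (f_d : ∀ {n : ℕ} {k : ℤ} {x : G.T n}, x ∈ G.gr n k → f n (G.d k x) = (C.obj n).d (f n x))
    (f_act : ∀ {n : ℕ} (σ : Equiv.Perm (Fin n)) {k : ℤ} {x : G.T n}, x ∈ G.gr n k →
      f n (G.act σ x) = C.act σ (f n x))
    (f_one : f 1 G.one = C.one)
    (f_circ : ∀ {m n l : ℕ} (h : m + n = l + 1) (i : Fin m) {p q : ℤ} {x : G.T m} {y : G.T n},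
      x ∈ G.gr m p → y ∈ G.gr n q → f l (G.circ h i q x y) = C.circ h i (f m x) (f n y)) :
    DGOperad.Hom G.toDGOperad C where
  app n :=
    { toLin := f n ∘ₗ G.incl
      map_gr := fun hx => f_mem (mem_gr.1 hx)
      map_d := fun x => by
        induction x using DGModule.induction_gr with
        | h k x hx =>
          have h := incl_d hx
          change f n (G.incl ((G.obj n).d x)) = _
          rw [h]
          exact f_d (mem_gr.1 hx)
        | hadd x y hx hy => simp only [map_add, hx, hy] }
  map_act σ x := by
    induction x using DGModule.induction_gr with
    | h k x hx => exact f_act σ (mem_gr.1 hx)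
    | hadd x y hx hy => simp only [map_add, hx, hy]
  map_one := f_one
  map_circ {m n l} h i x y := by
    induction x using DGModule.induction_gr with
    | hadd x x' hx hx' => simp only [map_add, LinearMap.add_apply, hx, hx']
    | h p x hx =>
    induction y using DGModule.induction_gr with
    | hadd x x' hx hx' => simp only [map_add, hx, hx']
    | h q y hy =>
    change f l (G.incl (G.objCirc h i x y)) = _
    rw [G.incl_objCirc h i x hy]
    exact f_circ h i (mem_gr.1 hx) (mem_gr.1 hy)

end GradedOperad

theorem DGModule.Hom.injective_of_homogeneous {R : Type u} [CommRing R] {M N : DGModule R}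
    (f : DGModule.Hom M N) (h : ∀ k, ∀ x ∈ M.gr k, f.toLin x = 0 → x = 0) :
    Function.Injective f.toLin := by
  rw [← LinearMap.ker_eq_bot, LinearMap.ker_eq_bot']
  intro x hx
  obtain ⟨s, hs⟩ := M.exists_sum_proj x
  rw [← hs s subset_rfl]
  exact Finset.sum_eq_zero fun k _ =>
    h k _ (M.proj_mem k x) (by rw [← f.proj_apply, hx, map_zero])

/-- A morphism to the base is surjective as soon as it hits `1`. -/
theorem DGModule.Hom.surjective_base {R : Type u} [CommRing R] {M : DGModule R}
    (f : DGModule.Hom M (DGModule.base R)) {x : M} (hx : f.toLin x = (1 : R)) :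
    Function.Surjective f.toLin := by
  intro (r : R)
  exact ⟨r • x, by rw [map_smul, hx]; exact mul_one (M := R) r⟩

/-! ### Systems of forms -/

/-- Differential graded modules `A n`, `n ≥ 0`, behaving like the differential forms on the standard
simplices. There are pullbacks along all maps of vertices, a unit which generates `A 0`, evaluations
`ev v` at the vertices, operators `L v` which behave like multiplications by the barycentric
coordinates, and contracting homotopies `h v` to the vertices. The homotopies lower an exhaustive
filtration `W` by weights. -/
structure FormSystem (R : Type u) [CommRing R] where
  A : ℕ → DGModule R
  pull : ∀ {m n : ℕ}, (Fin (m + 1) → Fin (n + 1)) → DGModule.Hom (A n) (A m)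
  unit : ∀ n, A n
  unit_mem : ∀ n, unit n ∈ (A n).gr 0
  unit_d : ∀ n, (A n).d (unit n) = 0
  pull_unit : ∀ {m n : ℕ} (f : Fin (m + 1) → Fin (n + 1)), (pull f).toLin (unit n) = unit m
  ev : ∀ {n : ℕ}, Fin (n + 1) → A n →ₗ[R] R
  ev_of_ne : ∀ {n : ℕ} (v : Fin (n + 1)) {k : ℤ} {x : A n}, x ∈ (A n).gr k → k ≠ 0 → ev v x = 0
  ev_d : ∀ {n : ℕ} (v : Fin (n + 1)) (x : A n), ev v ((A n).d x) = 0
  ev_unit : ∀ {n : ℕ} (v : Fin (n + 1)), ev v (unit n) = 1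
  ev_pull : ∀ {m n : ℕ} (f : Fin (m + 1) → Fin (n + 1)) (v : Fin (m + 1)) (x : A n),
    ev v ((pull f).toLin x) = ev (f v) x
  eq_unit : ∀ x : A 0, x = ev 0 x • unit 0
  L : ∀ {n : ℕ}, Fin (n + 1) → A n →ₗ[R] A n
  L_mem : ∀ {n : ℕ} (v : Fin (n + 1)) {k : ℤ} {x : A n}, x ∈ (A n).gr k → L v x ∈ (A n).gr k
  pull_L : ∀ {m n : ℕ} (f : Fin (m + 1) → Fin (n + 1)) (v : Fin (n + 1)) (x : A n),
    (pull f).toLin (L v x) = ∑ w with f w = v, L w ((pull f).toLin x)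
  sum_L : ∀ {n : ℕ} (x : A n), ∑ v, L v x = x
  h : ∀ {n : ℕ}, Fin (n + 1) → A n →ₗ[R] A n
  h_mem : ∀ {n : ℕ} (v : Fin (n + 1)) {k : ℤ} {x : A n}, x ∈ (A n).gr k → h v x ∈ (A n).gr (k - 1)
  d_h : ∀ {n : ℕ} (v : Fin (n + 1)) (x : A n),
    (A n).d (h v x) + h v ((A n).d x) = x - ev v x • unit n
  h_unit : ∀ {n : ℕ} (v : Fin (n + 1)), h v (unit n) = 0
  pull_h : ∀ {m n : ℕ} (f : Fin (m + 1) → Fin (n + 1)) (v : Fin (m + 1)) (x : A n),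
    (pull f).toLin (h (f v) x) = h v ((pull f).toLin x)
  W : ∀ n, ℕ → Submodule R (A n)
  exists_mem_W : ∀ {n : ℕ} (x : A n), ∃ N, x ∈ W n N
  unit_mem_W : ∀ n, unit n ∈ W n 0
  h_W_zero : ∀ {n : ℕ} (v : Fin (n + 1)) {x : A n}, x ∈ W n 0 → h v x = 0
  h_W_succ : ∀ {n : ℕ} (v : Fin (n + 1)) {N : ℕ} {x : A n}, x ∈ W n (N + 1) → h v x ∈ W n N

namespace FormSystem

variable {R : Type u} [CommRing R] (S : FormSystem R)

/-- Families of multilinear operations compatible with all pullbacks. -/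
def IsNatural {n : ℕ} (φ : MultiOp S.A n) : Prop :=
  ∀ ⦃m N : ℕ⦄ (f : Fin (m + 1) → Fin (N + 1)) (a : Fin n → S.A N),
    (S.pull f).toLin (φ N a) = φ m fun j => (S.pull f).toLin (a j)

/-- The value of an operation at the units, on the `0`-simplex. -/
noncomputable def value (n : ℕ) : MultiOp S.A n →ₗ[R] R where
  toFun φ := S.ev 0 (φ 0 fun _ => S.unit 0)
  map_add' φ ψ := by simp
  map_smul' c φ := by simp

theorem value_apply {n : ℕ} (φ : MultiOp S.A n) :
    S.value n φ = S.ev 0 (φ 0 fun _ => S.unit 0) := rfl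

/-- An operation is unital if it is a multiple of the identity in every argument, when the other
arguments are units. -/
def IsUnital {n : ℕ} (φ : MultiOp S.A n) : Prop :=
  ∀ (N : ℕ) (i : Fin n) (a : S.A N),
    φ N (Function.update (fun _ => S.unit N) i a) = S.value n φ • a

variable {S}

/-- By naturality for the map from the `N`-simplex to the `0`-simplex, where every element is a
multiple of the unit, a natural operation sends units to a multiple of the unit. -/
theorem IsNatural.apply_unit {n : ℕ} {φ : MultiOp S.A n} (hφ : S.IsNatural φ) (N : ℕ) :
    φ N (fun _ => S.unit N) = S.value n φ • S.unit N := by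
  have h := hφ (fun _ : Fin (N + 1) => (0 : Fin 1)) (fun _ => S.unit 0)
  simp only [S.pull_unit] at h
  rw [← h, S.eq_unit (φ 0 fun _ => S.unit 0), map_smul, S.pull_unit]
  rfl

theorem value_of_ne {n : ℕ} {k : ℤ} {φ : MultiOp S.A n} (hφ : φ ∈ MultiOp.gr S.A n k)
    (hk : k ≠ 0) : S.value n φ = 0 := by
  have h := hφ 0 (fun _ => 0) (fun _ => S.unit 0) (fun _ => S.unit_mem 0)
  exact S.ev_of_ne 0 h (by simpa using hk)

theorem isUnital_of_homogeneous {n : ℕ} {φ : MultiOp S.A n}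
    (h : ∀ (N : ℕ) (i : Fin n) (k : ℤ) (a : S.A N), a ∈ (S.A N).gr k →
      φ N (Function.update (fun _ => S.unit N) i a) = S.value n φ • a) : S.IsUnital φ := by
  intro N i a
  induction a using DGModule.induction_gr with
  | h k a ha => exact h N i k a ha
  | hadd a b ha hb => rw [MultilinearMap.map_update_add, ha, hb, smul_add]

theorem isNatural_of_homogeneous {n : ℕ} {φ : MultiOp S.A n}
    (h : ∀ (m N : ℕ) (f : Fin (m + 1) → Fin (N + 1)) (α : Fin n → ℤ) (a : Fin n → S.A N),
      (∀ i, a i ∈ (S.A N).gr (α i)) →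
        (S.pull f).toLin (φ N a) = φ m fun j => (S.pull f).toLin (a j)) : S.IsNatural φ := by
  intro m N f
  have : (S.pull f).toLin.compMultilinearMap (φ N) =
      (φ m).compLinearMap fun _ => (S.pull f).toLin :=
    DGModule.multilinearMap_ext fun α a ha => h m N f α a ha
  exact fun a => DFunLike.congr_fun this a

variable (S)

/-- The natural and unital operations of degree `k`. -/
def opGr (n : ℕ) (k : ℤ) : Submodule R (MultiOp S.A n) where
  carrier := {φ | φ ∈ MultiOp.gr S.A n k ∧ S.IsNatural φ ∧ S.IsUnital φ}
  zero_mem' := ⟨Submodule.zero_mem _, fun _ _ _ _ => map_zero _, fun N i a => by simp⟩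
  add_mem' {φ ψ} hφ hψ := ⟨Submodule.add_mem _ hφ.1 hψ.1,
    fun m N f a => by simp [hφ.2.1 f a, hψ.2.1 f a],
    fun N i a => by simp [hφ.2.2 N i a, hψ.2.2 N i a, add_smul]⟩
  smul_mem' c φ hφ := ⟨Submodule.smul_mem _ c hφ.1,
    fun m N f a => by simp [hφ.2.1 f a],
    fun N i a => by simp [hφ.2.2 N i a, smul_smul]⟩

variable {S}

/-- Degrees of a tuple of units with one entry replaced. -/
theorem update_unit_mem {n N : ℕ} (i : Fin n) {k : ℤ} {a : S.A N} (ha : a ∈ (S.A N).gr k)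
    (j : Fin n) :
    Function.update (fun _ => S.unit N) i a j ∈
      (S.A N).gr (Function.update (fun _ => (0 : ℤ)) i k j) := by
  by_cases hj : j = i
  · subst hj; simpa using ha
  · simpa [hj] using S.unit_mem N

theorem prefixSum_update_self {n : ℕ} (i : Fin n) (k : ℤ) :
    prefixSum (Function.update (fun _ => (0 : ℤ)) i k) i.val = 0 :=
  Finset.sum_eq_zero fun j hj => by
    rw [Function.update_of_ne]
    exact fun e => absurd (Finset.mem_filter.1 hj).2 (by simp [e])

theorem isNatural_d {n : ℕ} {k : ℤ} {φ : MultiOp S.A n} (hφ : S.IsNatural φ) :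
    S.IsNatural (n := n) (MultiOp.endD k φ) := by
  refine isNatural_of_homogeneous fun m N f α a ha => ?_
  have h1 := MultiOp.endD_apply k φ ha
  have h2 := MultiOp.endD_apply k φ (fun i => (S.pull f).map_gr (ha i))
  rw [h1, h2, map_sub, DGModule.Hom.map_d, hφ, LinearMap.map_intUnit_smul, map_sum]
  congr 2
  refine Finset.sum_congr rfl fun i _ => ?_
  rw [LinearMap.map_intUnit_smul, hφ]
  congr 2
  funext j
  by_cases hj : j = i
  · subst hj; simp [DGModule.Hom.map_d]
  · simp [hj]

theorem value_d {n : ℕ} {k : ℤ} {φ : MultiOp S.A n} :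
    S.value n (MultiOp.endD k φ) = 0 := by
  have h1 := MultiOp.endD_apply k φ (fun _ : Fin n => S.unit_mem 0)
  rw [value_apply, h1, map_sub, S.ev_d, zero_sub, neg_eq_zero, LinearMap.map_intUnit_smul, map_sum]
  rw [Finset.sum_eq_zero, smul_zero]
  intro i _
  rw [S.unit_d, MultilinearMap.map_update_zero, smul_zero, map_zero]

theorem opGr_d {n : ℕ} {k : ℤ} {φ : MultiOp S.A n} (hφ : φ ∈ S.opGr n k) :
    MultiOp.endD k φ ∈ S.opGr n (k + 1) := by
  refine ⟨(endOperad S.A).d_mem hφ.1, isNatural_d hφ.2.1, isUnital_of_homogeneous ?_⟩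
  intro N i j a ha
  have h1 := MultiOp.endD_apply k φ (update_unit_mem i ha)
  rw [value_d, zero_smul, h1, hφ.2.2 N i a, Finset.sum_eq_single i, Function.update_idem,
    Function.update_self, hφ.2.2 N i, prefixSum_update_self, Int.negOnePow_zero, one_smul, map_smul]
  · by_cases hk : k = 0
    · simp [hk]
    · simp [value_of_ne hφ.1 hk]
  · intro b _ hb
    rw [Function.update_of_ne hb, S.unit_d, MultilinearMap.map_update_zero, smul_zero]
  · exact fun h => absurd (Finset.mem_univ _) h

theorem value_act {n : ℕ} (σ : Equiv.Perm (Fin n)) (φ : MultiOp S.A n) :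
    S.value n (MultiOp.act σ φ) = S.value n φ := by
  rw [value_apply, MultiOp.act_apply σ φ (α := fun _ => 0) (fun _ => S.unit_mem 0)]
  have : koszulSign σ (fun _ => (0 : ℤ)) = 1 := by simp [koszulSign]
  rw [this, one_smul]
  rfl

theorem opGr_act {n : ℕ} (σ : Equiv.Perm (Fin n)) {k : ℤ} {φ : MultiOp S.A n}
    (hφ : φ ∈ S.opGr n k) : MultiOp.act σ φ ∈ S.opGr n k := by
  refine ⟨MultiOp.act_mem σ hφ.1, isNatural_of_homogeneous fun m N f α a ha => ?_,
    isUnital_of_homogeneous fun N i j a ha => ?_⟩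
  · rw [MultiOp.act_apply σ φ ha, MultiOp.act_apply σ φ (fun i => (S.pull f).map_gr (ha i)),
      LinearMap.map_intUnit_smul, hφ.2.1]
    rfl
  · rw [MultiOp.act_apply σ φ (update_unit_mem i ha), value_act,
      koszulSign_eq_one σ (s := i) (fun j hj => by simp [hj]), one_smul, ← hφ.2.2 N (σ i)]
    congr 1
    funext j
    by_cases hj : j = σ i
    · subst hj; simp
    · have : σ.symm j ≠ i := fun e => hj (by rw [← e, Equiv.apply_symm_apply])
      simp [hj, this]

theorem value_circ {m n l : ℕ} (h : m + n = l + 1) (i : Fin m) {q : ℤ} {φ : MultiOp S.A m}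
    {ψ : MultiOp S.A n} (hψ : S.IsNatural ψ) :
    S.value l (MultiOp.circ h i q φ ψ) = S.value m φ * S.value n ψ := by
  rw [value_apply, MultiOp.circ_apply h i q φ ψ (α := fun _ => 0) (fun _ => S.unit_mem 0)]
  have h1 : ψ 0 ((fun _ => S.unit 0) ∘ innerSlot h i) = S.value n ψ • S.unit 0 := hψ.apply_unit 0
  have h2 : plugAt h i (S.value n ψ • S.unit 0) (fun _ => S.unit 0) =
      Function.update (fun _ => S.unit 0) i (S.value n ψ • S.unit 0) := by
    funext j
    by_cases hj : j = i
    · subst hj; simp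
    · simp [hj, plugAt_of_ne]
  have h3 : prefixSum (fun _ : Fin l => (0 : ℤ)) i.val = 0 := by simp [prefixSum]
  rw [h1, h2, MultilinearMap.map_update_smul, Function.update_eq_self_iff.2 rfl, h3, mul_zero,
    Int.negOnePow_zero, one_smul, map_smul, smul_eq_mul, mul_comm]
  rfl

theorem opGr_circ {m n l : ℕ} (h : m + n = l + 1) (i : Fin m) {p q : ℤ} {φ : MultiOp S.A m}
    {ψ : MultiOp S.A n} (hφ : φ ∈ S.opGr m p) (hψ : ψ ∈ S.opGr n q) :
    MultiOp.circ h i q φ ψ ∈ S.opGr l (p + q) := by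
  refine ⟨MultiOp.circ_mem h i hφ.1 hψ.1, isNatural_of_homogeneous fun M N f α a ha => ?_,
    isUnital_of_homogeneous fun N s j a ha => ?_⟩
  · rw [MultiOp.circ_apply h i q φ ψ ha,
      MultiOp.circ_apply h i q φ ψ (fun i => (S.pull f).map_gr (ha i)),
      LinearMap.map_intUnit_smul, hφ.2.1]
    congr 2
    funext j
    rw [apply_plugAt h i (S.pull f).toLin, hψ.2.1]
    rfl
  · rw [MultiOp.circ_apply h i q φ ψ (update_unit_mem s ha), value_circ h i hψ.2.1]
    rcases slot_cases h i s with ⟨k, rfl⟩ | ⟨k, hk, rfl⟩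
    · have h1 : Function.update (fun _ => S.unit N) (innerSlot h i k) a ∘ innerSlot h i =
          Function.update (fun _ => S.unit N) k a := update_comp_innerSlot h i a _ k
      have h2 : prefixSum (Function.update (fun _ : Fin l => (0 : ℤ)) (innerSlot h i k) j) i.val =
        0 := by
        refine Finset.sum_eq_zero fun t ht => ?_
        rw [Function.update_of_ne]
        intro e
        have := (Finset.mem_filter.1 ht).2
        rw [e, innerSlot_val] at this
        omega
      have h3 : ∀ y, plugAt h i y (fun _ => S.unit N) =
          Function.update (fun _ => S.unit N) i y := fun y => by
        funext j
        by_cases hj : j = i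
        · subst hj; simp
        · simp [hj, plugAt_of_ne]
      rw [h1, hψ.2.2, h2, mul_zero, Int.negOnePow_zero, one_smul, plugAt_update_inner, h3, hφ.2.2,
        smul_smul]
    · have h1 : Function.update (fun _ => S.unit N) (outerSlot h i k hk) a ∘ innerSlot h i =
          fun _ => S.unit N := update_outer_comp_innerSlot h i a _ hk
      have h3 : plugAt h i (S.unit N) (fun _ => S.unit N) = fun _ => S.unit N := by
        funext j
        simp [plugAt]
      rw [h1, hψ.2.1.apply_unit, plugAt_update_outer]
      rw [← update_plugAt h i (S.unit N), Function.update_comm hk.symm,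
        MultilinearMap.map_update_smul,
        Function.update_comm hk, update_plugAt, h3, hφ.2.2, smul_smul, mul_comm (S.value n ψ)]
      by_cases hq : q = 0
      · rw [hq, zero_mul, Int.negOnePow_zero, one_smul]
      · rw [value_of_ne hψ.1 hq]
        simp

variable (S)

/-- The operad of natural and unital operations on a system of forms. -/
noncomputable def opOperad : GradedOperad R :=
  (endOperad S.A).restrict S.opGr (fun hx => hx.1) (fun hx => opGr_d hx)
    (fun σ _ _ hx => opGr_act σ hx)
    ⟨(endOperad S.A).one_mem, fun _ _ _ _ => rfl, fun N i a => by
      obtain rfl : i = 0 := Subsingleton.elim _ _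
      change a = S.ev 0 (S.unit 0) • a
      rw [S.ev_unit, one_smul]⟩
    (fun h i _ _ _ _ hx hy => opGr_circ h i hx hy)

/-- The augmentation of the operad of natural and unital operations. -/
noncomputable def opAug : DGOperad.Hom S.opOperad.toDGOperad (comOperad R) :=
  S.opOperad.toHom (comOperad R) S.value
    (fun {n} {_} {_} hx => (mem_baseGr (R := R)).2 fun hk => value_of_ne (n := n) hx.1 hk)
    (fun {n} {k} {x} _ => value_d (n := n) (k := k) (φ := x))
    (fun {n} σ {_} {x} _ => value_act (n := n) σ x)
    (S.ev_unit 0)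
    (fun {m} {n} {l} h i {_} {_} {_} {_} _ hy =>
      (value_circ (R := R) (S := S) (m := m) (n := n) (l := l) h i hy.2.1 :))

theorem opAug_injective {n : ℕ} (h : ∀ φ : MultiOp S.A n, S.IsNatural φ → S.IsUnital φ →
    S.value n φ = 0 → φ = 0) : Function.Injective (S.opAug.app n).toLin :=
  DGModule.Hom.injective_of_homogeneous _ fun _ φ hφ h0 =>
    GradedOperad.incl_injective (h (S.opOperad.incl φ) hφ.2.1 hφ.2.2 h0)

end FormSystem

/-! ### The tensor contraction -/

namespace FormSystem

variable {R : Type u} [CommRing R] (S : FormSystem R)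

/-- The evaluation at the vertex `v`, followed by the unit. -/
noncomputable def e {N : ℕ} (v : Fin (N + 1)) : S.A N →ₗ[R] S.A N := (S.ev v).smulRight (S.unit N)

@[simp] theorem e_apply {N : ℕ} (v : Fin (N + 1)) (x : S.A N) : S.e v x = S.ev v x • S.unit N := rfl

theorem e_mem {N : ℕ} (v : Fin (N + 1)) {k : ℤ} {x : S.A N} (hx : x ∈ (S.A N).gr k) :
    S.e v x ∈ (S.A N).gr k := by
  rw [e_apply]
  by_cases hk : k = 0
  · subst hk
    exact Submodule.smul_mem _ _ (S.unit_mem N)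
  · rw [S.ev_of_ne v hx hk, zero_smul]
    exact Submodule.zero_mem _

theorem d_e {N : ℕ} (v : Fin (N + 1)) (x : S.A N) : (S.A N).d (S.e v x) = 0 := by
  rw [e_apply, map_smul, S.unit_d, smul_zero]

theorem e_d {N : ℕ} (v : Fin (N + 1)) (x : S.A N) : S.e v ((S.A N).d x) = 0 := by
  rw [e_apply, S.ev_d, zero_smul]

/-- The tuple `(e a₀, …, e a_{M - 1}, a_M, …)`. -/
noncomputable def evalBelow {N n : ℕ} (v : Fin (N + 1)) (M : ℕ) (a : Fin n → S.A N) :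
    Fin n → S.A N :=
  fun j => if j.val < M then S.e v (a j) else a j

/-- The tuple `(e a₀, …, e a_{i - 1}, h aᵢ, a_{i + 1}, …)`. -/
noncomputable def hAt {N n : ℕ} (v : Fin (N + 1)) (i : Fin n) (a : Fin n → S.A N) : Fin n → S.A N :=
  Function.update (S.evalBelow v i.val a) i (S.h v (a i))

/-- The composite of a multilinear map with the homotopy of `n`-fold tensors which contracts one
factor after the other to the vertex `v`. -/
noncomputable def compH {N n : ℕ} (v : Fin (N + 1))
    (ψ : MultilinearMap R (fun _ : Fin n => (S.A N).carrier) (S.A N)) :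
    MultilinearMap R (fun _ : Fin n => (S.A N).carrier) (S.A N) :=
  ∑ i : Fin n, ψ.compLinearMap fun j =>
    if j = i then S.h v else if j.val < i.val then S.e v else LinearMap.id

theorem compH_apply {N n : ℕ} (v : Fin (N + 1))
    (ψ : MultilinearMap R (fun _ : Fin n => (S.A N).carrier) (S.A N)) (a : Fin n → S.A N) :
    S.compH v ψ a = ∑ i, ψ (S.hAt v i a) := by
  rw [compH, sum_apply]
  refine Finset.sum_congr rfl fun i _ => ?_
  rw [MultilinearMap.compLinearMap_apply]
  congr 1
  funext j
  unfold hAt evalBelow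
  by_cases hj : j = i
  · subst hj; simp
  · rw [if_neg hj, Function.update_of_ne hj]
    split_ifs <;> rfl

/-- The operator `φ ↦ ∑ᵥ Λᵥ ∘ φ ∘ Hᵥ`, where `Hᵥ` is the tensor contraction. -/
noncomputable def contract {n : ℕ} (Λ : ∀ N : ℕ, Fin (N + 1) → S.A N →ₗ[R] S.A N) :
    MultiOp S.A n →ₗ[R] MultiOp S.A n where
  toFun φ N := ∑ v, (Λ N v).compMultilinearMap (S.compH v (φ N))
  map_add' φ ψ := by
    ext N a
    simp [compH_apply, Finset.sum_add_distrib]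
  map_smul' c φ := by
    ext N a
    simp [compH_apply, Finset.smul_sum]

theorem contract_apply {n : ℕ} (Λ : ∀ N : ℕ, Fin (N + 1) → S.A N →ₗ[R] S.A N) (φ : MultiOp S.A n)
    (N : ℕ) (a : Fin n → S.A N) :
    S.contract Λ φ N a = ∑ v, Λ N v (∑ i, φ N (S.hAt v i a)) := by
  change (∑ v, (Λ N v).compMultilinearMap (S.compH v (φ N))) a = _
  rw [sum_apply]
  exact Finset.sum_congr rfl fun v _ => by
    rw [LinearMap.compMultilinearMap_apply, compH_apply]

theorem hAt_mem {N n : ℕ} (v : Fin (N + 1)) (i : Fin n) {α : Fin n → ℤ} {a : Fin n → S.A N}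
    (ha : ∀ j, a j ∈ (S.A N).gr (α j)) (j : Fin n) :
    S.hAt v i a j ∈ (S.A N).gr (Function.update α i (α i - 1) j) := by
  by_cases hj : j = i
  · subst hj
    simpa [hAt] using S.h_mem v (ha j)
  · rw [hAt, Function.update_of_ne hj, Function.update_of_ne hj, evalBelow]
    split_ifs
    · exact S.e_mem v (ha j)
    · exact ha j

theorem sum_update_sub_one {n : ℕ} (α : Fin n → ℤ) (i : Fin n) :
    ∑ j, Function.update α i (α i - 1) j = ∑ j, α j - 1 := by
  rw [Finset.sum_update_of_mem (Finset.mem_univ i), Finset.sum_eq_add_sum_sdiff_singleton_of_mem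
    (Finset.mem_univ i)]
  ring

theorem contract_mem {n : ℕ} {Λ : ∀ N : ℕ, Fin (N + 1) → S.A N →ₗ[R] S.A N} {s : ℤ}
    (hΛ : ∀ N v k x, x ∈ (S.A N).gr k → Λ N v x ∈ (S.A N).gr (k + s)) {k : ℤ} {φ : MultiOp S.A n}
    (hφ : φ ∈ MultiOp.gr S.A n k) : S.contract Λ φ ∈ MultiOp.gr S.A n (k + s - 1) := by
  intro N α a ha
  rw [contract_apply]
  refine Submodule.sum_mem _ fun v _ => ?_
  have h1 : ∑ i : Fin n, φ N (S.hAt v i a) ∈ (S.A N).gr (k + (∑ j, α j - 1)) := by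
    refine Submodule.sum_mem _ fun (i : Fin n) _ => ?_
    have := hφ N _ _ (S.hAt_mem v i ha)
    rwa [sum_update_sub_one] at this
  have := hΛ N v _ _ h1
  convert this using 2
  ring

theorem pull_hAt {M N n : ℕ} (f : Fin (M + 1) → Fin (N + 1)) (v : Fin (M + 1)) (i : Fin n)
    (a : Fin n → S.A N) (j : Fin n) :
    (S.pull f).toLin (S.hAt (f v) i a j) = S.hAt v i (fun j => (S.pull f).toLin (a j)) j := by
  unfold hAt evalBelow
  by_cases hj : j = i
  · subst hj; simp [S.pull_h]
  · rw [Function.update_of_ne hj, Function.update_of_ne hj]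
    split_ifs
    · simp [S.ev_pull, S.pull_unit]
    · rfl

/-- The contraction of a natural operation is natural, provided that the operators `Λ v` pull back
like a partition of unity indexed by the vertices: the sum over `v` and the sum over the vertices
above `v` combine to a sum over all vertices. -/
theorem contract_natural {n : ℕ} {Λ : ∀ N : ℕ, Fin (N + 1) → S.A N →ₗ[R] S.A N}
    (hΛ : ∀ (M N : ℕ) (f : Fin (M + 1) → Fin (N + 1)) (v : Fin (N + 1)) (x : S.A N),
      (S.pull f).toLin (Λ N v x) = ∑ w with f w = v, Λ M w ((S.pull f).toLin x))
    {φ : MultiOp S.A n} (hφ : S.IsNatural φ) : S.IsNatural (S.contract Λ φ) := by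
  intro M N f a
  rw [contract_apply, contract_apply, map_sum]
  simp only [hΛ, Finset.sum_filter]
  rw [Finset.sum_comm]
  refine Finset.sum_congr rfl fun w _ => ?_
  rw [Finset.sum_ite_eq, if_pos (Finset.mem_univ _), map_sum, map_sum, map_sum]
  refine Finset.sum_congr rfl fun i _ => ?_
  rw [hφ f]
  congr 2
  funext j
  exact S.pull_hAt f w i a j

/-- An operation is reduced if it vanishes when all arguments but one are units. -/
def IsReduced {n : ℕ} (φ : MultiOp S.A n) : Prop := S.IsUnital φ ∧ S.value n φ = 0

theorem contract_reduced {n : ℕ} (Λ : ∀ N : ℕ, Fin (N + 1) → S.A N →ₗ[R] S.A N)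
    {φ : MultiOp S.A n} (hφ : S.IsReduced φ) : S.IsReduced (S.contract Λ φ) := by
  have h0 : S.value n (S.contract Λ φ) = 0 := by
    rw [value_apply, contract_apply, Finset.sum_eq_zero, map_zero]
    intro v _
    rw [Finset.sum_eq_zero, map_zero]
    intro i _
    rw [hAt, S.h_unit, MultilinearMap.map_update_zero]
  refine ⟨fun N i a => ?_, h0⟩
  rw [h0, zero_smul, contract_apply]
  refine Finset.sum_eq_zero fun v _ => ?_
  rw [Finset.sum_eq_zero, map_zero]
  intro j _
  by_cases hj : j = i
  · subst hj
    have : S.hAt v j (Function.update (fun _ => S.unit N) j a) =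
        Function.update (fun _ => S.unit N) j (S.h v a) := by
      unfold hAt evalBelow
      funext k
      by_cases hk : k = j
      · subst hk; simp
      · simp [hk, S.ev_unit]
    rw [this, hφ.1, hφ.2, zero_smul]
  · rw [hAt, Function.update_of_ne hj, S.h_unit, MultilinearMap.map_update_zero]

/-! #### The homotopy formula -/

/-- The composite of a multilinear map with the differential of tensors. -/
noncomputable def tensorD {N n : ℕ} (ψ : MultilinearMap R (fun _ : Fin n => (S.A N).carrier)
    (S.A N))
    (α : Fin n → ℤ) (a : Fin n → S.A N) : S.A N :=
  ∑ j : Fin n, (prefixSum α j.val).negOnePow • ψ (Function.update a j ((S.A N).d (a j)))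

variable {S}

/-- The Koszul sign of moving past the factors which have been evaluated is `1`, unless the term
vanishes: the evaluations vanish outside degree `0`. -/
theorem sgn_smul_evalBelow {N n : ℕ} (ψ : MultilinearMap R (fun _ : Fin n => (S.A N).carrier)
    (S.A N))
    (v : Fin (N + 1)) (i : Fin n) {α : Fin n → ℤ} {a : Fin n → S.A N}
    (ha : ∀ j, a j ∈ (S.A N).gr (α j)) (y : S.A N) :
    (prefixSum α i.val).negOnePow • ψ (Function.update (S.evalBelow v i.val a) i y) =
      ψ (Function.update (S.evalBelow v i.val a) i y) := by
  by_cases h : ∃ j : Fin n, j.val < i.val ∧ α j ≠ 0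
  · obtain ⟨j, hj, hαj⟩ := h
    rw [ψ.map_coord_zero j, smul_zero]
    rw [Function.update_of_ne (Fin.ne_of_val_ne hj.ne), evalBelow, if_pos hj, e_apply,
      S.ev_of_ne v (ha j) hαj, zero_smul]
  · push Not at h
    have : prefixSum α i.val = 0 := Finset.sum_eq_zero fun j hj => h j (Finset.mem_filter.1 hj).2
    rw [this, Int.negOnePow_zero, one_smul]

theorem evalBelow_succ {N n : ℕ} (v : Fin (N + 1)) (i : Fin n) (a : Fin n → S.A N) :
    S.evalBelow v (i.val + 1) a = Function.update (S.evalBelow v i.val a) i (S.e v (a i)) := by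
  funext j
  by_cases hj : j = i
  · subst hj; simp [evalBelow]
  · rw [Function.update_of_ne hj]
    have := Fin.val_ne_of_ne hj
    have h : j.val < i.val + 1 ↔ j.val < i.val := by omega
    simp only [evalBelow, h]

theorem hAt_apply_lt {N n : ℕ} (v : Fin (N + 1)) {i j : Fin n} (h : j < i) (a : Fin n → S.A N) :
    S.hAt v i a j = S.e v (a j) := by
  rw [hAt, Function.update_of_ne h.ne, evalBelow, if_pos (Fin.lt_def.1 h)]

theorem hAt_apply_gt {N n : ℕ} (v : Fin (N + 1)) {i j : Fin n} (h : i < j) (a : Fin n → S.A N) :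
    S.hAt v i a j = a j := by
  rw [hAt, Function.update_of_ne h.ne', evalBelow, if_neg (by rw [Fin.lt_def] at h; omega)]

theorem hAt_update_gt {N n : ℕ} (v : Fin (N + 1)) {i j : Fin n} (h : i < j) (a : Fin n → S.A N)
    (y : S.A N) : S.hAt v i (Function.update a j y) = Function.update (S.hAt v i a) j y := by
  funext k
  by_cases hk : k = j
  · subst hk; rw [hAt_apply_gt v h]; simp
  · rw [Function.update_of_ne hk]
    by_cases hki : k = i
    · subst hki; simp [hAt, h.ne]
    · simp [hAt, hki, evalBelow, hk]

theorem prefixSum_update_gt {n : ℕ} (α : Fin n → ℤ) {i j : Fin n} (h : i < j) :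
    prefixSum (Function.update α i (α i - 1)) j.val = prefixSum α j.val - 1 := by
  have hi : i ∈ (Finset.univ.filter fun k : Fin n => k.val < j.val) := by
    simpa using Fin.lt_def.1 h
  rw [prefixSum, prefixSum, Finset.sum_update_of_mem hi, ← Finset.add_sum_erase _ _ hi,
    Finset.sdiff_singleton_eq_erase]
  ring

theorem prefixSum_update_le {n : ℕ} (α : Fin n → ℤ) (i : Fin n) (x : ℤ) {M : ℕ} (h : M ≤ i.val) :
    prefixSum (Function.update α i x) M = prefixSum α M :=
  Finset.sum_congr rfl fun k hk => by
    rw [Function.update_of_ne]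
    rintro rfl
    have := (Finset.mem_filter.1 hk).2
    omega

/-- The homotopy formula for the tensor contraction: on homogeneous arguments `d H + H d` is the
difference of the identity and the evaluation of all factors. -/
theorem tensorD_hAt {N n : ℕ} (ψ : MultilinearMap R (fun _ : Fin n => (S.A N).carrier) (S.A N))
    (v : Fin (N + 1)) {α : Fin n → ℤ} {a : Fin n → S.A N} (ha : ∀ j, a j ∈ (S.A N).gr (α j)) :
    ∑ i, S.tensorD ψ (Function.update α i (α i - 1)) (S.hAt v i a) + S.tensorD (S.compH v ψ) α a =
      ψ a - ψ (fun j => S.e v (a j)) := by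
  -- only the terms with `j = i` survive, and these telescope
  have h1 : ∀ i j : Fin n,
      (prefixSum (Function.update α i (α i - 1)) j.val).negOnePow •
          ψ (Function.update (S.hAt v i a) j ((S.A N).d (S.hAt v i a j))) +
        (prefixSum α j.val).negOnePow • ψ (S.hAt v i (Function.update a j ((S.A N).d (a j)))) =
      if j = i then ψ (S.evalBelow v i.val a) - ψ (S.evalBelow v (i.val + 1) a) else 0 := by
    intro i j
    rcases lt_trichotomy j i with h | h | h
    · rw [if_neg h.ne, hAt_apply_lt v h, S.d_e, MultilinearMap.map_update_zero,
        ψ.map_coord_zero j (m := S.hAt v i _), smul_zero, smul_zero, add_zero]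
      rw [hAt_apply_lt v h, Function.update_self, S.e_d]
    · subst h
      have h2 : S.hAt v j (Function.update a j ((S.A N).d (a j))) =
          Function.update (S.evalBelow v j.val a) j (S.h v ((S.A N).d (a j))) := by
        unfold hAt evalBelow
        funext k
        by_cases hk : k = j
        · subst hk; simp
        · simp [hk]
      have h3 : S.evalBelow v j.val a = Function.update (S.evalBelow v j.val a) j (a j) := by
        symm
        rw [Function.update_eq_self_iff]
        simp [evalBelow]
      rw [if_pos rfl, prefixSum_update_le α j _ le_rfl, h2, hAt, Function.update_self,
        Function.update_idem, sgn_smul_evalBelow ψ v j ha, sgn_smul_evalBelow ψ v j ha,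
        ← MultilinearMap.map_update_add, S.d_h, MultilinearMap.map_update_sub, ← h3,
        evalBelow_succ, e_apply]
    · rw [if_neg h.ne', hAt_apply_gt v h, hAt_update_gt v h, prefixSum_update_gt α h,
        Int.negOnePow_sub, Int.negOnePow_one, mul_neg, mul_one, Units.neg_smul, neg_add_cancel]
  have h2 : ∑ i : Fin n, (ψ (S.evalBelow v i.val a) - ψ (S.evalBelow v (i.val + 1) a)) =
      ψ a - ψ (fun j => S.e v (a j)) := by
    rw [Fin.sum_univ_eq_sum_range
      (fun i => ψ (S.evalBelow v i a) - ψ (S.evalBelow v (i + 1) a)), Finset.sum_range_sub']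
    congr 2
    funext j
    simp [evalBelow]
  rw [← h2]
  simp only [tensorD, compH_apply, Finset.smul_sum]
  have h3 := Finset.sum_comm (s := Finset.univ) (t := Finset.univ) (f := fun j i : Fin n =>
    (prefixSum α j.val).negOnePow • ψ (S.hAt v i (Function.update a j ((S.A N).d (a j)))))
  rw [h3, ← Finset.sum_add_distrib]
  refine Finset.sum_congr rfl fun i _ => ?_
  rw [← Finset.sum_add_distrib, Finset.sum_congr rfl fun j _ => h1 i j]
  simp

end FormSystem

/-! ### Acyclicity of the kernel of the augmentation -/

/-- A sequence of multilinear maps which is eventually zero at every point can be summed. -/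
theorem MultilinearMap.exists_locallyFinite_sum {R M N : Type*} [CommRing R] [AddCommGroup M]
    [AddCommGroup N] [Module R M] [Module R N] {n : ℕ}
    (F : ℕ → MultilinearMap R (fun _ : Fin n => M) N) (hF : ∀ a, ∃ J, ∀ j ≥ J, F j a = 0) :
    ∃ χ : MultilinearMap R (fun _ : Fin n => M) N,
      ∀ a, ∀ᶠ J in Filter.atTop, χ a = ∑ j ∈ Finset.range J, F j a := by
  choose J hJ using hF
  have key : ∀ a K, J a ≤ K → ∑ j ∈ Finset.range (J a), F j a = ∑ j ∈ Finset.range K, F j a :=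
    fun a K hK => (Finset.eventually_constant_sum (fun j hj => hJ a j hj) hK).symm
  refine ⟨{ toFun := fun a => ∑ j ∈ Finset.range (J a), F j a
            map_update_add' := fun a i x y => ?_
            map_update_smul' := fun a i c x => ?_ },
    fun a => Filter.eventually_atTop.2 ⟨J a, fun K hK => key a K hK⟩⟩
  · let K := max (J (Function.update a i (x + y)))
      (max (J (Function.update a i x)) (J (Function.update a i y)))
    rw [key _ K (le_max_left _ _), key _ K ((le_max_left _ _).trans (le_max_right _ _)),
      key _ K ((le_max_right _ _).trans (le_max_right _ _)), ← Finset.sum_add_distrib]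
    exact Finset.sum_congr rfl fun j _ => (F j).map_update_add a i x y
  · let K := max (J (Function.update a i (c • x))) (J (Function.update a i x))
    rw [key _ K (le_max_left _ _), key _ K (le_max_right _ _), Finset.smul_sum]
    exact Finset.sum_congr rfl fun j _ => (F j).map_update_smul a i c x

namespace FormSystem

variable {R : Type u} [CommRing R] (S : FormSystem R)

/-- The commutators of the differential with the operators `L v`. -/
noncomputable def dL (N : ℕ) (v : Fin (N + 1)) : S.A N →ₗ[R] S.A N :=
  (S.A N).d ∘ₗ S.L v - S.L v ∘ₗ (S.A N).d

theorem dL_apply (N : ℕ) (v : Fin (N + 1)) (x : S.A N) :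
    S.dL N v x = (S.A N).d (S.L v x) - S.L v ((S.A N).d x) := rfl

/-- The deviation from being a homotopy of the contraction with the operators `L v`. -/
noncomputable def deviation {n : ℕ} (k : ℤ) : MultiOp S.A n →ₗ[R] MultiOp S.A n :=
  - (k.negOnePow • S.contract S.dL)

theorem deviation_apply {n : ℕ} (k : ℤ) (φ : MultiOp S.A n) :
    S.deviation k φ = - (k.negOnePow • S.contract S.dL φ) := rfl

variable {S}

theorem endD_apply' {n : ℕ} (k : ℤ) (φ : MultiOp S.A n) {N : ℕ} {α : Fin n → ℤ}
    {a : Fin n → S.A N} (ha : ∀ i, a i ∈ (S.A N).gr (α i)) :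
    MultiOp.endD k φ N a = (S.A N).d (φ N a) - k.negOnePow • S.tensorD (φ N) α a :=
  MultiOp.endD_apply k φ ha

/-- The closed, natural and reduced operations of degree `k`. -/
structure IsReducedCycle {n : ℕ} (k : ℤ) (φ : MultiOp S.A n) : Prop where
  mem : φ ∈ MultiOp.gr S.A n k
  natural : S.IsNatural φ
  reduced : S.IsReduced φ
  closed : MultiOp.endD k φ = 0

theorem tensorD_contract {n : ℕ} (φ : MultiOp S.A n) {N : ℕ} (α : Fin n → ℤ) (a : Fin n → S.A N) :
    S.tensorD (S.contract (fun _ v => S.L v) φ N) α a =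
      ∑ v, S.L v (S.tensorD (S.compH v (φ N)) α a) := by
  simp only [tensorD, contract_apply, compH_apply, Finset.smul_sum, map_sum,
    LinearMap.map_intUnit_smul]
  exact Finset.sum_comm

/-- The contraction of a cycle bounds the cycle, up to a sign and the deviation. -/
theorem endD_contract {n : ℕ} {k : ℤ} {φ : MultiOp S.A n} (hφ : IsReducedCycle k φ) :
    MultiOp.endD (k - 1) (S.contract (fun _ v => S.L v) φ) =
      k.negOnePow • (φ - S.deviation k φ) := by
  refine MultiOp.ext_homogeneous fun N α a ha => ?_
  have he : φ N (fun _ => S.unit N) = 0 := by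
    rw [hφ.natural.apply_unit, hφ.reduced.2, zero_smul]
  have hcl : ∀ (β : Fin n → ℤ) (b : Fin n → S.A N), (∀ i, b i ∈ (S.A N).gr (β i)) →
      (S.A N).d (φ N b) = k.negOnePow • S.tensorD (φ N) β b := fun β b hb => by
    have := endD_apply' k φ hb
    rw [hφ.closed] at this
    exact (sub_eq_zero.1 this.symm)
  rw [endD_apply' _ _ ha, tensorD_contract, Int.negOnePow_sub, Int.negOnePow_one, mul_neg, mul_one,
    Units.neg_smul, sub_neg_eq_add]
  have hk : k.negOnePow • (φ - S.deviation k φ) = k.negOnePow • φ + S.contract S.dL φ := by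
    rw [deviation_apply, sub_neg_eq_add, smul_add, smul_smul, Int.units_mul_self, one_smul]
  have hL : φ N a = ∑ v, S.L v (φ N a) := (S.sum_L _).symm
  rw [hk, Pi.add_apply, add_apply, Pi.smul_apply, smul_apply, hL, contract_apply, contract_apply,
    map_sum, Finset.smul_sum, Finset.smul_sum, ← Finset.sum_add_distrib, ← Finset.sum_add_distrib]
  refine Finset.sum_congr rfl fun v _ => ?_
  have h1 := tensorD_hAt (φ N) v ha
  have h2 : φ N (fun j => S.e v (a j)) = 0 := by
    simp only [e_apply]
    rw [MultilinearMap.map_smul_univ, he, smul_zero]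
  rw [h2, sub_zero, ← eq_sub_iff_add_eq'] at h1
  have h3 : (S.A N).d (∑ i, φ N (S.hAt v i a)) =
      k.negOnePow • ∑ i, S.tensorD (φ N) (Function.update α i (α i - 1)) (S.hAt v i a) := by
    rw [map_sum, Finset.sum_congr rfl fun i _ => hcl _ _ (S.hAt_mem v i ha), ← Finset.smul_sum]
  rw [h1, dL_apply, h3, map_sub, smul_sub, LinearMap.map_intUnit_smul]
  abel

theorem pull_dL {M N : ℕ} (f : Fin (M + 1) → Fin (N + 1)) (v : Fin (N + 1)) (x : S.A N) :
    (S.pull f).toLin (S.dL N v x) = ∑ w with f w = v, S.dL M w ((S.pull f).toLin x) := by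
  simp only [dL_apply, map_sub, DGModule.Hom.map_d, S.pull_L, map_sum, Finset.sum_sub_distrib]

theorem IsReduced.smul {n : ℕ} {φ : MultiOp S.A n} (h : S.IsReduced φ) (c : R) :
    S.IsReduced (c • φ) :=
  ⟨fun N i a => by simp [h.1 N i a, smul_smul], by simp [h.2]⟩

theorem units_smul_eq {M : Type*} [AddCommGroup M] [Module R M] (c : ℤˣ) (x : M) :
    c • x = ((c : ℤ) : R) • x := by rw [Units.smul_def, Int.cast_smul_eq_zsmul]

theorem contract_isNatural {n : ℕ} {φ : MultiOp S.A n} (h : S.IsNatural φ) :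
    S.IsNatural (S.contract (fun _ v => S.L v) φ) :=
  S.contract_natural (fun _ _ f v x => S.pull_L f v x) h

theorem contract_L_mem {n : ℕ} {k : ℤ} {φ : MultiOp S.A n} (hφ : φ ∈ MultiOp.gr S.A n k) :
    S.contract (fun _ v => S.L v) φ ∈ MultiOp.gr S.A n (k - 1) := by
  have := S.contract_mem (Λ := fun _ v => S.L v) (s := 0)
    (fun N v k x hx => by rw [add_zero]; exact S.L_mem v hx) hφ
  rwa [add_zero] at this

/-- The deviation of a cycle is a cycle, because its difference from the cycle is a boundary. -/
theorem IsReducedCycle.deviation {n : ℕ} {k : ℤ} {φ : MultiOp S.A n} (h : IsReducedCycle k φ) :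
    IsReducedCycle k (S.deviation k φ) := by
  have hmem : S.contract S.dL φ ∈ MultiOp.gr S.A n k := by
    have := S.contract_mem (Λ := S.dL) (s := 1)
      (fun N v k x hx => Submodule.sub_mem _ ((S.A N).d_mem (S.L_mem v hx))
        (S.L_mem v ((S.A N).d_mem hx))) h.mem
    rwa [add_sub_cancel_right] at this
  have hnat := S.contract_natural (Λ := S.dL) (fun _ _ f v x => pull_dL f v x) h.natural
  have hdev : S.deviation k φ = (-((k.negOnePow : ℤ) : R)) • S.contract S.dL φ := by
    rw [deviation_apply, units_smul_eq (R := R), neg_smul]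
  refine ⟨?_, ?_, ?_, ?_⟩
  · rw [hdev]
    exact Submodule.smul_mem _ _ hmem
  · rw [hdev]
    intro m N f a
    simp [hnat f a]
  · rw [hdev]
    exact (S.contract_reduced S.dL h.reduced).smul _
  · have h1 := endD_contract h
    have h2 : MultiOp.endD k (MultiOp.endD (k - 1) (S.contract (fun _ v => S.L v) φ)) = 0 := by
      have := (endOperad S.A).d_d (contract_L_mem h.mem)
      rwa [sub_add_cancel] at this
    rw [h1, LinearMap.map_intUnit_smul, map_sub, h.closed, zero_sub, smul_neg, neg_eq_zero] at h2
    have h3 := congrArg (fun x => k.negOnePow • x) h2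
    simpa only [smul_smul, Int.units_mul_self, one_smul, smul_zero] using h3

/-- Operations vanishing on tuples of total weight less than `j`. -/
def VanishesBelow {n : ℕ} (j : ℕ) (φ : MultiOp S.A n) : Prop :=
  ∀ (N : ℕ) (w : Fin n → ℕ) (a : Fin n → S.A N), (∀ i, a i ∈ S.W N (w i)) → ∑ i, w i < j → φ N a = 0

/-- In every term of the contraction one argument is replaced by its image under a homotopy `h v`,
which lowers its weight, and others by multiples of the unit, which has weight `0`. -/
theorem VanishesBelow.deviation {n : ℕ} {j : ℕ} {φ : MultiOp S.A n} (h : VanishesBelow j φ)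
    (k : ℤ) :
    VanishesBelow (j + 1) (S.deviation k φ) := by
  intro N w a ha hw
  have h0 : S.contract S.dL φ N a = 0 := by
    rw [contract_apply]
    refine Finset.sum_eq_zero fun v _ => ?_
    rw [Finset.sum_eq_zero, map_zero]
    intro i _
    rcases hi : w i with _ | t
    · have h1 := ha i
      rw [hi] at h1
      rw [hAt, S.h_W_zero v h1, MultilinearMap.map_update_zero]
    · refine h N (fun m => if m = i then t else if m.val < i.val then 0 else w m) _ (fun m => ?_) ?_
      · by_cases hm : m = i
        · subst hm
          have h1 := ha m
          rw [hi] at h1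
          simpa [hAt] using S.h_W_succ v h1
        · rw [if_neg hm, hAt, Function.update_of_ne hm, evalBelow]
          split_ifs
          · exact Submodule.smul_mem _ _ (S.unit_mem_W N)
          · exact ha m
      · refine lt_of_lt_of_le (Finset.sum_lt_sum (g := w)
        (fun m _ => ?_) ⟨i, Finset.mem_univ i, ?_⟩)
          (Nat.lt_succ_iff.1 hw)
        · split_ifs with h1 h2
          · subst h1; omega
          · omega
          · exact le_rfl
        · simp [hi]
  rw [deviation_apply, Pi.neg_apply, Pi.smul_apply, neg_apply, smul_apply, h0, smul_zero, neg_zero]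

/-- Every closed reduced operation is the differential of a reduced operation: the contraction with
the operators `L v` is a homotopy up to the deviation, and the deviation is locally nilpotent as
the homotopies `h v` lower weights, so that the geometric series of the deviation can be summed. -/
theorem IsReducedCycle.exists_primitive {n : ℕ} {k : ℤ} {φ : MultiOp S.A n}
    (h : IsReducedCycle k φ) :
    ∃ ψ : MultiOp S.A n, ψ ∈ MultiOp.gr S.A n (k - 1) ∧ S.IsNatural ψ ∧ S.IsReduced ψ ∧
      MultiOp.endD (k - 1) ψ = φ := by
  let F : ℕ → MultiOp S.A n := fun j => (S.deviation k)^[j] φ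
  have hF : ∀ j, IsReducedCycle k (F j) := fun j => by
    induction j with
    | zero => exact h
    | succ j ih => rw [show F (j + 1) = S.deviation k (F j) from Function.iterate_succ_apply' _ _ _]
                   exact ih.deviation
  have hV : ∀ j, VanishesBelow j (F j) := fun j => by
    induction j with
    | zero => exact fun _ _ _ _ hw => absurd hw (Nat.not_lt_zero _)
    | succ j ih => rw [show F (j + 1) = S.deviation k (F j) from Function.iterate_succ_apply' _ _ _]
                   exact ih.deviation k
  have hJ : ∀ N (a : Fin n → S.A N), ∃ J, ∀ j ≥ J, F j N a = 0 := fun N a => by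
    choose w hw using fun i => S.exists_mem_W (a i)
    exact ⟨∑ i, w i + 1, fun j hj => hV j N w a hw (by omega)⟩
  choose χ hχ using fun N => MultilinearMap.exists_locallyFinite_sum (fun j => F j N) (hJ N)
  let P : ℕ → MultiOp S.A n := fun J => ∑ j ∈ Finset.range J, F j
  have hχ' : ∀ N a, ∀ᶠ J in Filter.atTop, χ N a = P J N a := fun N a =>
    (hχ N a).mono fun J hJ => by rw [hJ]; simp [P, Finset.sum_apply]
  have hPmem : ∀ J, P J ∈ MultiOp.gr S.A n k := fun J => Submodule.sum_mem _ fun j _ => (hF j).mem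
  have hPcl : ∀ J, MultiOp.endD k (P J) = 0 := fun J => by
    simp only [P, map_sum]
    exact Finset.sum_eq_zero fun j _ => (hF j).closed
  have hPval : ∀ J, S.value n (P J) = 0 := fun J => by
    simp only [P, map_sum]
    exact Finset.sum_eq_zero fun j _ => (hF j).reduced.2
  have hPun : ∀ J (N : ℕ) (i : Fin n) (a : S.A N),
      P J N (Function.update (fun _ => S.unit N) i a) = 0 := fun J N i a => by
    simp only [P, Finset.sum_apply, sum_apply]
    exact Finset.sum_eq_zero fun j _ => by
      rw [(hF j).reduced.1, (hF j).reduced.2, zero_smul]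
  have hPnat : ∀ J, S.IsNatural (P J) := fun J m N f a => by
    simp only [P, Finset.sum_apply, sum_apply, map_sum]
    exact Finset.sum_congr rfl fun j _ => (hF j).natural f a
  have hχmem : χ ∈ MultiOp.gr S.A n k := fun N α a ha => by
    obtain ⟨J, hJ⟩ := (hχ' N a).exists
    rw [hJ]
    exact hPmem J N α a ha
  have hχnat : S.IsNatural χ := fun m N f a => by
    obtain ⟨J, hJ, hJ'⟩ := ((hχ' N a).and (hχ' m _)).exists
    rw [hJ, hJ']
    exact hPnat J f a
  have hχval : S.value n χ = 0 := by
    obtain ⟨J, hJ⟩ := (hχ' 0 fun _ => S.unit 0).exists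
    rw [value_apply, hJ, ← value_apply, hPval]
  have hχred : S.IsReduced χ := ⟨fun N i a => by
    obtain ⟨J, hJ⟩ := (hχ' N (Function.update (fun _ => S.unit N) i a)).exists
    rw [hχval, zero_smul, hJ, hPun], hχval⟩
  have hχcl : MultiOp.endD k χ = 0 := by
    refine MultiOp.ext_homogeneous fun N α a ha => ?_
    obtain ⟨J, hJ, hJ'⟩ := ((hχ' N a).and (Filter.eventually_all.2 fun i =>
      hχ' N (Function.update a i ((S.A N).d (a i))))).exists
    have h1 := MultiOp.endD_apply k (P J) ha
    rw [hPcl J] at h1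
    rw [MultiOp.endD_apply k χ ha, hJ]
    simp only [hJ']
    exact h1.symm
  have hχc : IsReducedCycle k χ := ⟨hχmem, hχnat, hχred, hχcl⟩
  -- applying the deviation shifts the series
  have hdev : S.deviation k χ = χ - φ := by
    refine funext fun N => MultilinearMap.ext fun a => ?_
    obtain ⟨J, ⟨hJ, hJ'⟩⟩ := (((Filter.tendsto_add_atTop_nat 1).eventually (hχ' N a)).and
      (Filter.eventually_all.2 fun v => Filter.eventually_all.2 fun i =>
        hχ' N (S.hAt v i a))).exists
    have h1 : S.deviation k χ N a = S.deviation k (P J) N a := by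
      simp only [deviation_apply, Pi.neg_apply, Pi.smul_apply, neg_apply, smul_apply,
        contract_apply]
      simp only [hJ']
    have h2 : S.deviation k (P J) = P (J + 1) - φ := by
      simp only [P, map_sum, Finset.sum_range_succ' F]
      have : F 0 = φ := rfl
      rw [this, add_sub_cancel_right]
      exact Finset.sum_congr rfl fun j _ => (Function.iterate_succ_apply' _ _ _).symm
    rw [h1, h2, Pi.sub_apply, Pi.sub_apply, sub_apply, sub_apply, hJ]
  refine ⟨((k.negOnePow : ℤ) : R) • S.contract (fun _ v => S.L v) χ,
    Submodule.smul_mem _ _ (contract_L_mem hχmem), ?_, (S.contract_reduced _ hχred).smul _, ?_⟩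
  · intro m N f a
    simp [contract_isNatural hχnat f a]
  · rw [map_smul, endD_contract hχc, hdev, ← units_smul_eq, smul_smul, Int.units_mul_self, one_smul,
      sub_sub_cancel]

/-! ### The augmentation is a trivial fibration -/

variable (S)

theorem opAug_isQuasiIso_of_surjective {n : ℕ} (hs : Function.Surjective (S.opAug.app n).toLin) :
    (S.opAug.app n).IsQuasiIso := by
  refine DGModule.Hom.isQuasiIso_of_surjective _ hs fun k φ hφ h0 hd => ?_
  have hφ' : S.opOperad.incl φ ∈ S.opGr n k := hφ
  have hcyc : IsReducedCycle (S := S) (n := n) k (S.opOperad.incl φ) := by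
    refine ⟨hφ'.1, hφ'.2.1, ⟨hφ'.2.2, h0⟩, ?_⟩
    have h1 := GradedOperad.incl_d hφ
    have hd' : (S.opOperad.obj n).d φ = 0 := hd
    rw [hd', map_zero] at h1
    exact h1.symm
  obtain ⟨ψ, hψ, hnat, hred, hdψ⟩ := hcyc.exists_primitive
  have hψ' : ψ ∈ S.opOperad.gr n (k - 1) := ⟨hψ, hnat, hred.1⟩
  refine ⟨GradedOperad.ofMem ψ hψ', hred.2, GradedOperad.incl_injective ?_⟩
  have := GradedOperad.incl_d (GradedOperad.ofMem_mem (G := S.opOperad) ψ hψ')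
  exact this.trans hdψ

/-- The binary operation `∑ᵥ Lᵥ (a *ᵥ b)`, where `*ᵥ` is the product of the square-zero extension of
`R` by the kernel of the evaluation at the vertex `v`. -/
noncomputable def binaryOp : MultiOp S.A 2 := fun N =>
  { toFun := fun a => ∑ v, S.L v (S.ev v (a 0) • a 1 + S.ev v (a 1) • a 0 -
      (S.ev v (a 0) * S.ev v (a 1)) • S.unit N)
    map_update_add' := fun a i x y => by
      rw [← Finset.sum_add_distrib]
      refine Finset.sum_congr rfl fun v _ => ?_
      rw [← map_add]
      congr 1
      fin_cases i <;> simp [add_smul, smul_add, add_mul, mul_add] <;> abel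
    map_update_smul' := fun a i c x => by
      rw [Finset.smul_sum]
      refine Finset.sum_congr rfl fun v _ => ?_
      rw [← map_smul]
      congr 1
      fin_cases i <;> simp [smul_sub, smul_add, smul_smul, mul_comm, mul_left_comm] }

theorem binaryOp_apply (N : ℕ) (a : Fin 2 → S.A N) :
    S.binaryOp N a = ∑ v, S.L v (S.ev v (a 0) • a 1 + S.ev v (a 1) • a 0 -
      (S.ev v (a 0) * S.ev v (a 1)) • S.unit N) := rfl

theorem value_binaryOp : S.value 2 S.binaryOp = 1 := by
  rw [value_apply, binaryOp_apply]
  simp only [S.ev_unit, one_smul, mul_one, add_sub_cancel_right, S.sum_L]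

theorem binaryOp_mem : S.binaryOp ∈ S.opGr 2 0 := by
  refine ⟨fun N α a ha => ?_, fun m N f a => ?_, fun N i a => ?_⟩
  · rw [binaryOp_apply, zero_add, Fin.sum_univ_two]
    refine Submodule.sum_mem _ fun v _ => S.L_mem v ?_
    by_cases h0 : α 0 = 0
    · by_cases h1 : α 1 = 0
      · rw [h0, h1]
        have ha0 := ha 0
        have ha1 := ha 1
        rw [h0] at ha0
        rw [h1] at ha1
        exact Submodule.sub_mem _ (Submodule.add_mem _ (Submodule.smul_mem _ _ ha1)
          (Submodule.smul_mem _ _ ha0)) (Submodule.smul_mem _ _ (S.unit_mem N))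
      · rw [S.ev_of_ne v (ha 1) h1, h0, zero_add, mul_zero, zero_smul, zero_smul, add_zero,
        sub_zero]
        exact Submodule.smul_mem _ _ (ha 1)
    · rw [S.ev_of_ne v (ha 0) h0, zero_mul, zero_smul, zero_smul, zero_add, sub_zero]
      by_cases h1 : α 1 = 0
      · rw [h1, add_zero]
        exact Submodule.smul_mem _ _ (ha 0)
      · rw [S.ev_of_ne v (ha 1) h1, zero_smul]
        exact Submodule.zero_mem _
  · simp only [binaryOp_apply, map_sum, S.pull_L, Finset.sum_filter]
    rw [Finset.sum_comm]
    refine Finset.sum_congr rfl fun w _ => ?_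
    rw [Finset.sum_ite_eq, if_pos (Finset.mem_univ _)]
    simp [S.ev_pull, S.pull_unit]
  · rw [value_binaryOp, one_smul, binaryOp_apply]
    fin_cases i <;> simp [S.ev_unit, S.sum_L]

/-- Iterates of the binary operation have value `1`. -/
theorem exists_opGr_value_eq_one (n : ℕ) : ∃ φ ∈ S.opGr n 0, S.value n φ = 1 := by
  induction n with
  | zero =>
    refine ⟨fun N => MultilinearMap.constOfIsEmpty R _ (S.unit N),
      ⟨fun N α a _ => ?_, fun m N f a => ?_,
      fun N i => i.elim0⟩, ?_⟩
    · simpa using S.unit_mem N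
    · exact S.pull_unit f
    · exact S.ev_unit 0
  | succ n ih =>
    obtain ⟨φ, hφ, h1⟩ := ih
    have h : 2 + n = (n + 1) + 1 := by omega
    refine ⟨MultiOp.circ h 1 0 S.binaryOp φ, ?_, ?_⟩
    · have := opGr_circ h 1 S.binaryOp_mem hφ
      rwa [add_zero] at this
    · rw [value_circ h 1 hφ.2.1, h1, mul_one, value_binaryOp]

theorem opAug_isFibration : S.opAug.IsFibration := fun n => by
  obtain ⟨φ, hφ, h1⟩ := S.exists_opGr_value_eq_one n
  have hφ' : φ ∈ S.opOperad.gr n 0 := hφ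
  exact DGModule.Hom.surjective_base _ (x := GradedOperad.ofMem φ hφ') h1

theorem opAug_isWeakEquivalence : S.opAug.IsWeakEquivalence := fun n =>
  S.opAug_isQuasiIso_of_surjective (S.opAug_isFibration n)

/-- The unital augmented operad of natural and unital operations on a system of forms. -/
noncomputable def opUA : UAOperad R where
  toDGOperad := S.opOperad.toDGOperad
  aug := S.opAug
  aug_zero := ⟨S.opAug_injective fun φ hn _ h0 => funext fun N => MultilinearMap.ext fun a => by
    rw [Subsingleton.elim a fun _ => S.unit N, hn.apply_unit, h0, zero_smul]
    rfl, S.opAug_isFibration 0⟩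
  aug_one := ⟨S.opAug_injective fun φ _ hu h0 => funext fun N => MultilinearMap.ext fun a => by
    have h1 := hu N 0 (a 0)
    rw [h0, zero_smul] at h1
    have h2 : Function.update (fun _ => S.unit N) 0 (a 0) = a := by
      funext j
      obtain rfl : j = 0 := Subsingleton.elim _ _
      simp
    rw [← h2, h1]
    rfl, S.opAug_isFibration 1⟩

end FormSystem

/-! ### Matrices of operations -/

section Matrix

set_option linter.unusedSectionVars false

variable {R : Type u} [CommRing R] (O : DGOperad R) {B : Type} [Fintype B] [DecidableEq B]
  (deg : B → ℤ)

/-- The operations of arity `n` on the free graded module with basis `B`, with coefficients in the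
operad `O`. The entry `q w b` is the coefficient of `b` in the value at the basis elements `w`. -/
abbrev MatrixOp (B : Type) (n : ℕ) : Type u := (Fin n → B) → B → O.obj n

namespace MatrixOp

/-- The exponent of the Koszul sign in a partial composition of matrices, for basis elements of
degrees `α` as inputs, `c` as output of the inner operation and `b` as output of the outer one.
The first summand arises from moving the coefficient of the inner operation, which is of degree `p`,
past the outer matrix unit; the second one from moving the inner matrix unit past the first
inputs. -/
def circExp {m n l : ℕ} (h : m + n = l + 1) (i : Fin m) (p : ℤ) (α : Fin l → ℤ) (b c : ℤ) : ℤ :=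
  (b - ∑ j, plugAt h i c α j) * (p + ∑ k, α (innerSlot h i k) - c) +
    (c - ∑ k, α (innerSlot h i k)) * prefixSum α i.val

variable {O}

/-- The partial composition with a matrix of degree `p`. -/
noncomputable def circ {m n l : ℕ} (h : m + n = l + 1) (i : Fin m) (p : ℤ) :
    MatrixOp O B m →ₗ[R] MatrixOp O B n →ₗ[R] MatrixOp O B l :=
  LinearMap.mk₂ R (fun q q' w b => ∑ c, (circExp h i p (deg ∘ w) (deg b) (deg c)).negOnePow •
      O.circ h i (q (plugAt h i c w) b) (q' (w ∘ innerSlot h i) c))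
    (fun q r q' => by ext w b; simp [Finset.sum_add_distrib])
    (fun c q q' => by ext w b; simp [Finset.smul_sum, smul_comm c])
    (fun q q' r => by ext w b; simp [Finset.sum_add_distrib])
    (fun c q q' => by ext w b; simp [Finset.smul_sum, smul_comm c])

theorem circ_apply {m n l : ℕ} (h : m + n = l + 1) (i : Fin m) (p : ℤ) (q : MatrixOp O B m)
    (q' : MatrixOp O B n) (w : Fin l → B) (b : B) :
    circ deg h i p q q' w b = ∑ c, (circExp h i p (deg ∘ w) (deg b) (deg c)).negOnePow •
      O.circ h i (q (plugAt h i c w) b) (q' (w ∘ innerSlot h i) c) := rfl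

/-- The action of a permutation on matrices. -/
noncomputable def act {n : ℕ} (σ : Equiv.Perm (Fin n)) : MatrixOp O B n →ₗ[R] MatrixOp O B n where
  toFun q w b := koszulSign σ (deg ∘ w) • O.act σ (q (w ∘ σ.symm) b)
  map_add' q r := by ext w b; simp
  map_smul' c q := by ext w b; simp [smul_comm c]

theorem act_apply {n : ℕ} (σ : Equiv.Perm (Fin n)) (q : MatrixOp O B n) (w : Fin n → B) (b : B) :
    act deg σ q w b = koszulSign σ (deg ∘ w) • O.act σ (q (w ∘ σ.symm) b) := rfl

variable (O) in
/-- The matrices of degree `k`. -/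
def gr (n : ℕ) (k : ℤ) : Submodule R (MatrixOp O B n) :=
  ⨅ (w : Fin n → B) (b : B), ((O.obj n).gr (k + ∑ i, deg (w i) - deg b)).comap
    (LinearMap.proj b ∘ₗ LinearMap.proj w)

theorem mem_gr {n : ℕ} {k : ℤ} {q : MatrixOp O B n} :
    q ∈ gr O deg n k ↔ ∀ w b, q w b ∈ (O.obj n).gr (k + ∑ i, deg (w i) - deg b) := by
  simp [gr, Submodule.mem_iInf]

variable (O) in
theorem gr_indep (n : ℕ) : iSupIndep (gr O deg n) := by
  refine DGModule.iSupIndep_of_jointly_injective (ι := (Fin n → B) × B) (N := fun _ => O.obj n)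
    (fun t => LinearMap.proj t.2 ∘ₗ LinearMap.proj t.1)
    (fun t => deg t.2 - ∑ i, deg (t.1 i)) (fun q hq => ?_) (fun k q hq t => ?_)
  · exact funext fun w => funext fun b => hq ⟨w, b⟩
  · rw [sub_sub_eq_add_sub]
    exact (mem_gr deg).1 hq t.1 t.2

variable (O) in
/-- The matrix of a linear map with coefficients in `R`. -/
def ofLinear (M : B → B → R) : MatrixOp O B 1 := fun w b => M (w 0) b • O.one

/-- The differential of the coefficients. -/
noncomputable def coeffD {n : ℕ} : MatrixOp O B n →ₗ[R] MatrixOp O B n where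
  toFun q w b := (O.obj n).d (q w b)
  map_add' q r := by ext w b; simp
  map_smul' c q := by ext w b; simp

theorem coeffD_apply {n : ℕ} (q : MatrixOp O B n) (w : Fin n → B) (b : B) :
    coeffD q w b = (O.obj n).d (q w b) := rfl

theorem deg_comp_plugAt {m n l : ℕ} (h : m + n = l + 1) (i : Fin m) (c : B) (w : Fin l → B) :
    deg ∘ plugAt h i c w = plugAt h i (deg c) (deg ∘ w) :=
  funext fun j => apply_plugAt h i deg c w j

variable {deg}

theorem circ_term_mem {m n l : ℕ} (h : m + n = l + 1) (i : Fin m) {p p' : ℤ} {q : MatrixOp O B m}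
    {q' : MatrixOp O B n} (hq : q ∈ gr O deg m p) (hq' : q' ∈ gr O deg n p') (w : Fin l → B)
    (b c : B) :
    O.circ h i (q (plugAt h i c w) b) (q' (w ∘ innerSlot h i) c) ∈
      (O.obj l).gr (p + p' + ∑ i, deg (w i) - deg b) := by
  have h1 := O.circ_gr h i ((mem_gr deg).1 hq (plugAt h i c w) b)
    ((mem_gr deg).1 hq' (w ∘ innerSlot h i) c)
  have h2 : ∑ j, deg (plugAt h i c w j) = deg c + ∑ k, deg (w k) - ∑ k, deg (w (innerSlot h i k)) :=
    (Finset.sum_congr rfl fun j _ => congrFun (deg_comp_plugAt deg h i c w) j).trans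
      (sum_plugAt h i (deg ∘ w) (deg c))
  rw [h2] at h1
  convert h1 using 2
  simp only [Function.comp_apply]
  ring

theorem circ_mem {m n l : ℕ} (h : m + n = l + 1) (i : Fin m) {p p' : ℤ} {q : MatrixOp O B m}
    {q' : MatrixOp O B n} (hq : q ∈ gr O deg m p) (hq' : q' ∈ gr O deg n p') :
    circ deg h i p' q q' ∈ gr O deg l (p + p') := (mem_gr deg).2 fun w b => by
  rw [circ_apply]
  exact Submodule.sum_mem _ fun c _ =>
    Submodule.smul_of_tower_mem _ _ (circ_term_mem h i hq hq' w b c)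

/-- The compatibility of the signs with sequential associativity; it holds on the level of
exponents. -/
theorem circExp_seq {m n r a b' l : ℕ} (h₁ : m + n = a + 1) (h₂ : a + r = l + 1)
    (h₃ : n + r = b' + 1)
    (h₄ : m + b' = l + 1) (i : Fin m) (j : Fin n) (p s : ℤ) (α : Fin l → ℤ) (b c e : ℤ) :
    circExp h₂ (innerSlot h₁ i j) s α b e +
        circExp h₁ i p (plugAt h₂ (innerSlot h₁ i j) e α) b c =
      circExp h₄ i (p + s) α b c + circExp h₃ j s (α ∘ innerSlot h₄ i) c e := by
  have h5 : ∑ k, plugAt h₂ (innerSlot h₁ i j) e α (innerSlot h₁ i k) =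
      ∑ k, plugAt h₃ j e (α ∘ innerSlot h₄ i) k :=
    Finset.sum_congr rfl fun k _ => congrFun (plugAt_comp_innerSlot h₁ h₂ h₃ h₄ i j α e) k
  have h6 : ∑ k, α (innerSlot h₂ (innerSlot h₁ i j) k) =
      ∑ k, (α ∘ innerSlot h₄ i) (innerSlot h₃ j k) :=
    Finset.sum_congr rfl fun k _ => by
      rw [innerSlot_innerSlot h₁ h₂ h₃ h₄, Function.comp_apply]
  simp only [circExp, sum_plugAt, h5, h6, prefixSum_innerSlot h₁ h₃ h₄,
    prefixSum_plugAt_of_le h₂ (innerSlot h₁ i j) α e (N := i.val) (by simp)]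
  simp only [Function.comp_apply]
  ring

theorem circ_seq {m n r a b l : ℕ} (h₁ : m + n = a + 1) (h₂ : a + r = l + 1) (h₃ : n + r = b + 1)
    (h₄ : m + b = l + 1) (i : Fin m) (j : Fin n) (p s : ℤ) (q : MatrixOp O B m)
    (q' : MatrixOp O B n) (q'' : MatrixOp O B r) :
    circ deg h₂ (innerSlot h₁ i j) s (circ deg h₁ i p q q') q'' =
      circ deg h₄ i (p + s) q (circ deg h₃ j s q' q'') := by
  refine funext fun w => funext fun x => ?_
  simp only [circ_apply, map_sum, LinearMap.sum_apply, Finset.smul_sum]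
  rw [Finset.sum_comm]
  refine Finset.sum_congr rfl fun c _ => Finset.sum_congr rfl fun e _ => ?_
  rw [LinearMap.map_intUnit_smul₂, LinearMap.map_intUnit_smul, smul_smul, smul_smul,
    ← Int.negOnePow_add, ← Int.negOnePow_add, deg_comp_plugAt,
    circExp_seq h₁ h₂ h₃ h₄ i j p s, plugAt_comp_innerSlot h₁ h₂ h₃ h₄,
      plugAt_plugAt_inner h₁ h₂ h₄,
    O.circ_seq h₁ h₂ h₃ h₄]
  congr 4
  funext k
  simp only [Function.comp_apply, innerSlot_innerSlot h₁ h₂ h₃ h₄]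

/-- The compatibility of the signs with parallel associativity. The last term on the left is the
exponent of the sign for the coefficients, which are composed in the operad `O`. -/
theorem circExp_par {m n r a b' l : ℕ} (h₁ : m + n = a + 1) (h₂ : a + r = l + 1)
    (h₃ : m + r = b' + 1)
    (h₄ : b' + n = l + 1) (i k : Fin m) (hik : i ≠ k) (p s : ℤ) (α : Fin l → ℤ) (b c e : ℤ) :
    (circExp h₂ (outerSlot h₁ i k hik.symm) s α b e +
        circExp h₁ i p (plugAt h₂ (outerSlot h₁ i k hik.symm) e α) b c +
        (p + ∑ t, α (innerSlot h₄ (outerSlot h₃ k i hik) t) - c) *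
          (s + ∑ t, α (innerSlot h₂ (outerSlot h₁ i k hik.symm) t) - e)).negOnePow =
      (p * s + (circExp h₄ (outerSlot h₃ k i hik) p α b c +
        circExp h₃ k s (plugAt h₄ (outerSlot h₃ k i hik) c α) b e)).negOnePow := by
  have h5 : ∑ t, plugAt h₂ (outerSlot h₁ i k hik.symm) e α (innerSlot h₁ i t) =
      ∑ t, α (innerSlot h₄ (outerSlot h₃ k i hik) t) :=
    Finset.sum_congr rfl fun t _ =>
      congrFun (plugAt_outer_comp_innerSlot h₁ h₂ h₃ h₄ i k hik α e) t
  have h6 : ∑ t, plugAt h₄ (outerSlot h₃ k i hik) c α (innerSlot h₃ k t) =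
      ∑ t, α (innerSlot h₂ (outerSlot h₁ i k hik.symm) t) :=
    Finset.sum_congr rfl fun t _ =>
      congrFun (plugAt_outer_comp_innerSlot h₃ h₄ h₁ h₂ k i hik.symm α c) t
  rw [Int.negOnePow_eq_iff]
  simp only [circExp, sum_plugAt, h5, h6]
  set A' := ∑ t, α (innerSlot h₄ (outerSlot h₃ k i hik) t)
  set A'' := ∑ t, α (innerSlot h₂ (outerSlot h₁ i k hik.symm) t) with hA''
  have hs := outerSlot_val h₁ i k hik.symm
  have ht := outerSlot_val h₃ k i hik
  rcases hik.lt_or_gt with h | h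
  · have h' := Fin.lt_def.1 h
    rw [if_neg h.asymm] at hs
    rw [if_pos h] at ht
    rw [prefixSum_plugAt_of_le h₂ _ _ _ (by omega), prefixSum_plugAt h₄ _ _ _ (by omega), hs, ht]
    exact ⟨(A'' - e) * p, by ring⟩
  · have h' := Fin.lt_def.1 h
    rw [if_pos h] at hs
    rw [if_neg h.asymm] at ht
    rw [prefixSum_plugAt_of_le h₄ _ _ _ (by omega), prefixSum_plugAt h₂ _ _ _ (by omega), hs, ht]
    exact ⟨(A'' - e) * p + (A' - c) * (A'' - e), by ring⟩

theorem circ_par {m n r a b l : ℕ} (h₁ : m + n = a + 1) (h₂ : a + r = l + 1) (h₃ : m + r = b + 1)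
    (h₄ : b + n = l + 1) (i k : Fin m) (hik : i ≠ k) {p s : ℤ} (q : MatrixOp O B m)
    {q' : MatrixOp O B n} {q'' : MatrixOp O B r} (hq' : q' ∈ gr O deg n p)
    (hq'' : q'' ∈ gr O deg r s) :
    circ deg h₂ (outerSlot h₁ i k hik.symm) s (circ deg h₁ i p q q') q'' =
      (p * s).negOnePow • circ deg h₄ (outerSlot h₃ k i hik) p (circ deg h₃ k s q q'') q' := by
  refine funext fun w => funext fun x => ?_
  rw [Pi.smul_apply, Pi.smul_apply]
  simp only [circ_apply, map_sum, LinearMap.sum_apply, Finset.smul_sum]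
  rw [Finset.sum_comm]
  refine Finset.sum_congr rfl fun c _ => Finset.sum_congr rfl fun e _ => ?_
  rw [LinearMap.map_intUnit_smul₂, LinearMap.map_intUnit_smul₂,
    plugAt_outer_comp_innerSlot h₁ h₂ h₃ h₄ i k hik,
    plugAt_outer_comp_innerSlot h₃ h₄ h₁ h₂ k i hik.symm, plugAt_plugAt_outer h₁ h₂ h₃ h₄ i k hik,
    O.circ_par h₁ h₂ h₃ h₄ i k hik _ ((mem_gr deg).1 hq' _ c) ((mem_gr deg).1 hq'' _ e), smul_smul,
      smul_smul, smul_smul, smul_smul,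
    ← Int.negOnePow_add, ← Int.negOnePow_add, ← Int.negOnePow_add, ← Int.negOnePow_add,
    deg_comp_plugAt, deg_comp_plugAt, add_assoc (p * s)]
  congr 1
  exact circExp_par h₁ h₂ h₃ h₄ i k hik p s (deg ∘ w) (deg x) (deg c) (deg e)

theorem circ_act {m n l : ℕ} (h : m + n = l + 1) (i : Fin m) (σ : Equiv.Perm (Fin m))
    (τ : Equiv.Perm (Fin n)) (ρ : Equiv.Perm (Fin l))
    (hρ : ∀ (j : Fin m) (hj : j ≠ i),
      ρ (outerSlot h i j hj) = outerSlot h (σ i) (σ j) (fun e => hj (σ.injective e)))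
    (hρ' : ∀ k : Fin n, ρ (innerSlot h i k) = innerSlot h (σ i) (τ k)) (p : ℤ) (q : MatrixOp O B m)
    (q' : MatrixOp O B n) :
    circ deg h i p (act deg σ q) (act deg τ q') = act deg ρ (circ deg h (σ i) p q q') := by
  refine funext fun w => funext fun x => ?_
  simp only [circ_apply, act_apply, map_sum, Finset.smul_sum]
  refine Finset.sum_congr rfl fun c _ => ?_
  have hA : ∑ k, (deg ∘ w ∘ ρ.symm) (innerSlot h (σ i) k) = ∑ k, (deg ∘ w) (innerSlot h i k) := by
    rw [← Equiv.sum_comp τ]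
    refine Finset.sum_congr rfl fun k _ => ?_
    rw [← hρ']
    simp
  have hP : ∑ j, plugAt h (σ i) (deg c) (deg ∘ w ∘ ρ.symm) j =
      ∑ j, plugAt h i (deg c) (deg ∘ w) j := by
    rw [sum_plugAt, sum_plugAt, hA]
    congr 2
    exact Equiv.sum_comp ρ.symm (deg ∘ w)
  have hk := koszulSign_circ h i (deg ∘ w) σ τ ρ hρ hρ' (deg c - ∑ k, (deg ∘ w) (innerSlot h i k))
  rw [sub_add_cancel] at hk
  rw [LinearMap.map_intUnit_smul, LinearMap.map_intUnit_smul₂, LinearMap.map_intUnit_smul,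
    O.circ_act h i σ τ ρ hρ hρ', symm_comp_innerSlot h i σ τ ρ w hρ', plugAt_comp_symm h i σ ρ w hρ,
    smul_smul, smul_smul, smul_smul, deg_comp_plugAt]
  congr 1
  rw [circExp, circExp, hA, hP, Int.negOnePow_add, Int.negOnePow_add]
  simp only [Function.comp_assoc] at hk ⊢
  rw [mul_left_comm (koszulSign ρ _), hk]
  simp only [mul_assoc, mul_left_comm, mul_comm]

theorem act_mem {n : ℕ} (σ : Equiv.Perm (Fin n)) {k : ℤ} {q : MatrixOp O B n}
    (hq : q ∈ gr O deg n k) : act deg σ q ∈ gr O deg n k := (mem_gr deg).2 fun w b => by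
  rw [act_apply]
  have h1 := O.act_gr σ ((mem_gr deg).1 hq (w ∘ σ.symm) b)
  have h2 : ∑ i, deg ((w ∘ σ.symm) i) = ∑ i, deg (w i) := Equiv.sum_comp σ.symm fun i => deg (w i)
  rw [h2] at h1
  exact Submodule.smul_of_tower_mem _ _ h1

end MatrixOp

open MatrixOp

/-- The operad of matrices of operations, with the differential of the coefficients. -/
noncomputable def preMatrixOperad : GradedOperad R where
  T := MatrixOp O B
  gr := gr O deg
  indep := gr_indep O deg
  d _ := coeffD
  d_mem {n k q} hq := (mem_gr deg).2 fun w b => by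
    have := (O.obj n).d_mem ((mem_gr deg).1 hq w b)
    rw [coeffD_apply]
    convert this using 2
    ring
  d_d {n} _ _ _ := funext fun w => funext fun b => (O.obj n).d_d _
  act := act deg
  act_mem := act_mem
  act_one {n k q} _ := funext fun w => funext fun b => by
    rw [act_apply, koszulSign_one, one_smul, O.act_one]
    rfl
  act_mul {n} σ τ k q _ := funext fun w => funext fun b => by
    rw [act_apply, act_apply, act_apply, LinearMap.map_intUnit_smul, smul_smul, O.act_mul,
      koszulSign_mul]
    rfl
  act_d {n} σ k q _ := funext fun w => funext fun b => by
    rw [coeffD_apply, act_apply, act_apply, LinearMap.map_intUnit_smul, O.act_d]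
    rfl
  one := ofLinear O fun c b => if c = b then 1 else 0
  one_mem := (mem_gr deg).2 fun w b => by
    rw [ofLinear]
    split_ifs with h
    · rw [one_smul, ← h]
      simpa using O.one_gr
    · rw [zero_smul]
      exact Submodule.zero_mem _
  one_d := funext fun w => funext fun b => by
    rw [coeffD_apply, ofLinear, map_smul, O.one_d, smul_zero]
    rfl
  circ := circ deg
  circ_mem h i _ _ _ _ := circ_mem h i
  circ_d {m n l} h i p p' q q' hq hq' := funext fun w => funext fun b => by
    rw [coeffD_apply, circ_apply, map_sum, Pi.add_apply, Pi.add_apply, Pi.smul_apply, Pi.smul_apply,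
      circ_apply, circ_apply, Finset.smul_sum, ← Finset.sum_add_distrib]
    refine Finset.sum_congr rfl fun c _ => ?_
    rw [LinearMap.map_intUnit_smul, O.circ_d h i _ ((mem_gr deg).1 hq _ b), smul_add, smul_smul,
      smul_smul, coeffD_apply, coeffD_apply]
    congr 2
    rw [← Int.negOnePow_add, ← Int.negOnePow_add, Int.negOnePow_eq_iff]
    have h2 : ∑ j, deg (plugAt h i c w j) = ∑ j, plugAt h i (deg c) (deg ∘ w) j :=
      Finset.sum_congr rfl fun j _ => congrFun (deg_comp_plugAt deg h i c w) j
    rw [h2]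
    simp only [circExp]
    exact ⟨∑ j, plugAt h i (deg c) (deg ∘ w) j - deg b, by ring⟩
  one_circ {n} h k q hq := funext fun w => funext fun b => by
    rw [circ_apply, Finset.sum_eq_single b]
    · have h1 : w ∘ innerSlot h 0 = w := funext fun j => by rw [Function.comp_apply, one_innerSlot]
      have h3 : circExp h 0 k (deg ∘ w) (deg b) (deg b) = 0 := by
        simp [circExp, prefixSum]
      rw [h3, ofLinear, plugAt_self, if_pos rfl, one_smul, Int.negOnePow_zero, one_smul, h1,
        O.one_circ]
    · intro c _ hc
      rw [ofLinear, plugAt_self, if_neg hc, zero_smul, map_zero, LinearMap.zero_apply, smul_zero]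
    · exact fun h => absurd (Finset.mem_univ _) h
  circ_one {n} h i k q hq := funext fun w => funext fun b => by
    rw [circ_apply, Finset.sum_eq_single (w i)]
    · have h0 : innerSlot h i 0 = i := innerSlot_zero _ _ i.2
      have h1 : plugAt h i (w i) w = w := by
        funext j
        by_cases hj : j = i
        · subst hj; simp
        · rw [plugAt_of_ne _ _ _ _ hj, outerSlot_one]
      have h3 : circExp h i 0 (deg ∘ w) (deg b) (deg (w i)) = 0 := by
        simp [circExp, h0]
      rw [h3, ofLinear, Function.comp_apply, h0, if_pos rfl, one_smul, Int.negOnePow_zero, one_smul,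
        h1, O.circ_one]
    · intro c _ hc
      have h0 : innerSlot h i 0 = i := innerSlot_zero _ _ i.2
      rw [ofLinear, Function.comp_apply, h0, if_neg (Ne.symm hc), zero_smul, map_zero, smul_zero]
    · exact fun h => absurd (Finset.mem_univ _) h
  circ_seq h₁ h₂ h₃ h₄ i j _ _ _ _ _ _ _ _ _ := circ_seq h₁ h₂ h₃ h₄ i j _ _ _ _ _
  circ_par h₁ h₂ h₃ h₄ i k hik _ _ _ _ _ _ _ hy hz := circ_par h₁ h₂ h₃ h₄ i k hik _ hy hz
  circ_act h i σ τ ρ h₁ h₂ _ _ _ _ _ _ := circ_act h i σ τ ρ h₁ h₂ _ _ _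

end Matrix

/-! ### The path operad -/

/-- A basis of the cochain complex of the interval: the unit, the coordinate `t`, and `dt`. -/
inductive IntervalBasis where
  | one
  | t
  | dt
  deriving DecidableEq

namespace IntervalBasis

instance : Fintype IntervalBasis := ⟨{one, t, dt}, fun b => by cases b <;> simp⟩

/-- The degree of a basis element. -/
def deg (b : IntervalBasis) : ℤ :=
  match b with
  | one => 0
  | t => 0
  | dt => 1

/-- The product of a family of basis elements of degree `0`, where `t` is idempotent. -/
def top {n : ℕ} (w : Fin n → IntervalBasis) : IntervalBasis := if ∃ i, w i = t then t else one

theorem top_ne_dt {n : ℕ} (w : Fin n → IntervalBasis) : top w ≠ dt := by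
  unfold top; split_ifs <;> simp

theorem deg_top {n : ℕ} (w : Fin n → IntervalBasis) : deg (top w) = 0 := by
  unfold top; split_ifs <;> rfl

theorem deg_of_ne {b : IntervalBasis} (h : b ≠ dt) : deg b = 0 := by
  cases b <;> first | rfl | exact absurd rfl h

theorem deg_comp_eq_zero {n : ℕ} {w : Fin n → IntervalBasis} (h : ∀ i, w i ≠ dt) : deg ∘ w = 0 :=
  funext fun i => deg_of_ne (h i)

theorem top_one (n : ℕ) : top (fun _ : Fin n => one) = one := by simp [top]

theorem top_plugAt {m n l : ℕ} (h : m + n = l + 1) (i : Fin m) (w : Fin l → IntervalBasis) :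
    top (plugAt h i (top (w ∘ innerSlot h i)) w) = top w := by
  have : (∃ j, plugAt h i (top (w ∘ innerSlot h i)) w j = t) ↔ ∃ k, w k = t := by
    constructor
    · rintro ⟨j, hj⟩
      by_cases hji : j = i
      · subst hji
        rw [plugAt_self, top] at hj
        split_ifs at hj with h1
        obtain ⟨k, hk⟩ := h1
        exact ⟨_, hk⟩
      · rw [plugAt_of_ne _ _ _ _ hji] at hj
        exact ⟨_, hj⟩
    · rintro ⟨k, hk⟩
      rcases slot_cases h i k with ⟨s, rfl⟩ | ⟨j, hj, rfl⟩
      · exact ⟨i, by rw [plugAt_self, top, if_pos ⟨s, hk⟩]⟩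
      · exact ⟨j, by rw [plugAt_of_ne _ _ _ _ hj, hk]⟩
  rw [top, top]
  exact if_congr this rfl rfl

end IntervalBasis

section Path

open IntervalBasis MatrixOp

variable {R : Type u} [CommRing R] (O : DGOperad R)

/-- The matrix of the differential of the interval cochains. -/
noncomputable def intervalD : MatrixOp O IntervalBasis 1 :=
  ofLinear O fun c b => if c = t ∧ b = dt then 1 else 0

/-- The operad of operations, with coefficients in `O`, on the cochains of the interval. -/
noncomputable def intervalOperad : GradedOperad R :=
  (preMatrixOperad O IntervalBasis.deg).twist (intervalD O)
    ((mem_gr _).2 fun w b => by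
      rw [intervalD, ofLinear]
      split_ifs with h
      · rw [one_smul, h.2]
        simpa [h.1, IntervalBasis.deg] using O.one_gr
      · rw [zero_smul]
        exact Submodule.zero_mem _)
    (funext fun w => funext fun b => by
      change (O.obj 1).d (intervalD O w b) = 0
      rw [intervalD, ofLinear, map_smul, O.one_d, smul_zero])
    (funext fun w => funext fun b => by
      change circ IntervalBasis.deg _ _ _ _ _ w b = 0
      rw [circ_apply]
      refine Finset.sum_eq_zero fun c _ => ?_
      simp only [intervalD, ofLinear, plugAt_self]
      by_cases hc : c = dt
      · subst hc; simp
      · simp [hc])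

namespace MatrixOp

variable {O}

/-- The differential of the operad `intervalOperad O` on matrices of degree `k`. -/
noncomputable def pathD {n : ℕ} (k : ℤ) :
    MatrixOp O IntervalBasis n →ₗ[R] MatrixOp O IntervalBasis n := (intervalOperad O).d k

theorem pathD_apply {n : ℕ} (k : ℤ) (q : MatrixOp O IntervalBasis n) (w : Fin n → IntervalBasis)
    (b : IntervalBasis) :
    pathD k q w b = (O.obj n).d (q w b) +
      ((if b = dt then (k + ∑ i, (w i).deg).negOnePow • q w t else 0) -
        k.negOnePow • ∑ i : Fin n, if w i = t then
          (prefixSum (IntervalBasis.deg ∘ w) i.val).negOnePow • q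
            (Function.update w i dt) b else 0) := by
  have h : pathD k q = coeffD q +
      (circ IntervalBasis.deg (add_comm 1 n) 0 k (intervalD O) q -
        k.negOnePow • ∑ i : Fin n, circ IntervalBasis.deg (rfl : n + 1 = n + 1) i 1
          q (intervalD O)) :=
    congrArg (coeffD q + ·)
      (GradedOperad.ad_apply (G := preMatrixOperad O IntervalBasis.deg) (intervalD O) k q)
  rw [h]
  simp only [Pi.add_apply, Pi.sub_apply, Pi.smul_apply, Finset.sum_apply, coeffD_apply, circ_apply]
  congr 2
  · have h1 : w ∘ innerSlot (add_comm 1 n) 0 = w := funext fun j => by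
      rw [Function.comp_apply, one_innerSlot]
    have h2 : ∀ j, innerSlot (add_comm 1 n) 0 j = j := fun j => one_innerSlot _ j
    rw [Finset.sum_eq_single t]
    · by_cases hb : b = dt
      · subst hb
        rw [intervalD, ofLinear, plugAt_self, if_pos ⟨rfl, rfl⟩, one_smul, O.one_circ, if_pos rfl,
          h1]
        congr 2
        simp [circExp, IntervalBasis.deg, h2, prefixSum]
      · rw [intervalD, ofLinear, if_neg (fun h => hb h.2), zero_smul, map_zero,
          LinearMap.zero_apply, smul_zero, if_neg hb]
    · intro c _ hc
      rw [intervalD, ofLinear, plugAt_self, if_neg (fun h => hc h.1), zero_smul, map_zero,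
          LinearMap.zero_apply, smul_zero]
    · exact fun h => absurd (Finset.mem_univ _) h
  · congr 1
    refine Finset.sum_congr rfl fun i _ => ?_
    have h0 : innerSlot (rfl : n + 1 = n + 1) i 0 = i := innerSlot_zero _ _ i.2
    rw [Finset.sum_eq_single dt]
    · have h1 : plugAt (rfl : n + 1 = n + 1) i dt w = Function.update w i dt := by
        funext j
        by_cases hj : j = i
        · subst hj; simp
        · rw [plugAt_of_ne _ _ _ _ hj, outerSlot_one, Function.update_of_ne hj]
      rw [intervalD, ofLinear, Function.comp_apply, h0, h1]
      by_cases hi : w i = t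
      · rw [if_pos ⟨hi, rfl⟩, if_pos hi, one_smul, O.circ_one]
        congr 2
        simp [circExp, IntervalBasis.deg, h0, hi]
      · rw [if_neg (fun h => hi h.1), zero_smul, map_zero, smul_zero, if_neg hi]
    · intro c _ hc
      rw [intervalD, ofLinear, if_neg (fun h => hc h.2), zero_smul, map_zero, smul_zero]
    · exact fun h => absurd (Finset.mem_univ _) h

variable (O) in
/-- The entry of a matrix at the units. -/
noncomputable def unitEntry (n : ℕ) : MatrixOp O IntervalBasis n →ₗ[R] O.obj n :=
  LinearMap.proj one ∘ₗ LinearMap.proj fun _ => one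

theorem unitEntry_apply {n : ℕ} (q : MatrixOp O IntervalBasis n) :
    unitEntry O n q = q (fun _ => one) one := rfl

theorem unitEntry_mem {n : ℕ} {k : ℤ} {q : MatrixOp O IntervalBasis n}
    (hq : q ∈ gr O IntervalBasis.deg n k) : unitEntry O n q ∈ (O.obj n).gr k := by
  have := (mem_gr _).1 hq (fun _ => one) one
  change q (fun _ => one) one ∈ (O.obj n).gr k
  simpa [IntervalBasis.deg] using this

/-- Modulo `dt`, the matrix is the product of the interval cochains with a constant coefficient, and
it takes values without `dt` on the arguments without `dt`. -/
structure IsEndpointwise {n : ℕ} (q : MatrixOp O IntervalBasis n) : Prop where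
  apply_of_ne : ∀ w, (∀ i, w i ≠ dt) → ∀ b, q w b = if b = top w then unitEntry O n q else 0
  apply_of_eq : ∀ w i, w i = dt → ∀ b, b ≠ dt → q w b = 0

theorem IsEndpointwise.zero {n : ℕ} : IsEndpointwise (0 : MatrixOp O IntervalBasis n) :=
  ⟨fun w _ b => by simp, fun _ _ _ _ _ => rfl⟩

theorem IsEndpointwise.add {n : ℕ} {q r : MatrixOp O IntervalBasis n} (hq : IsEndpointwise q)
    (hr : IsEndpointwise r) : IsEndpointwise (q + r) :=
  ⟨fun w hw b => by
    rw [Pi.add_apply, Pi.add_apply, hq.1 w hw, hr.1 w hw, map_add]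
    split_ifs <;> simp,
  fun w i hi b hb => by rw [Pi.add_apply, Pi.add_apply, hq.2 w i hi b hb, hr.2 w i hi b hb,
    add_zero]⟩

theorem IsEndpointwise.smul {n : ℕ} {q : MatrixOp O IntervalBasis n} (hq : IsEndpointwise q)
    (c : R) :
    IsEndpointwise (c • q) :=
  ⟨fun w hw b => by
    rw [Pi.smul_apply, Pi.smul_apply, hq.1 w hw, map_smul]
    split_ifs <;> simp,
  fun w i hi b hb => by rw [Pi.smul_apply, Pi.smul_apply, hq.2 w i hi b hb, smul_zero]⟩

theorem IsEndpointwise.unit_smul {n : ℕ} {q : MatrixOp O IntervalBasis n} (hq : IsEndpointwise q)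
    (c : ℤˣ) : IsEndpointwise (c • q) := by
  rw [FormSystem.units_smul_eq (R := R)]
  exact hq.smul _

theorem IsEndpointwise.one : IsEndpointwise (intervalOperad O).one := by
  change IsEndpointwise (ofLinear O fun c b => if c = b then 1 else 0)
  refine ⟨fun w hw b => ?_, fun w i hi b hb => ?_⟩
  · rw [unitEntry_apply]
    simp only [ofLinear, if_true, one_smul]
    have h : top w = w 0 := by
      rw [top]
      rcases h0 : w 0 with _ | _ | _
      · rw [if_neg]
        rintro ⟨i, hi⟩
        rw [Subsingleton.elim i 0, h0] at hi
        exact absurd hi (by simp)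
      · rw [if_pos ⟨0, h0⟩]
      · exact absurd h0 (hw 0)
    rw [h]
    by_cases hb : w 0 = b
    · simp [hb]
    · simp [hb, Ne.symm hb]
  · rw [Subsingleton.elim i 0] at hi
    rw [ofLinear, hi, if_neg (Ne.symm hb), zero_smul]

theorem unitEntry_act {n : ℕ} (σ : Equiv.Perm (Fin n)) (q : MatrixOp O IntervalBasis n) :
    unitEntry O n (act IntervalBasis.deg σ q) = O.act σ (unitEntry O n q) := by
  rw [unitEntry_apply, act_apply]
  have : koszulSign σ (IntervalBasis.deg ∘ fun _ : Fin n => IntervalBasis.one) = 1 := by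
    simp [koszulSign, IntervalBasis.deg]
  rw [this, one_smul]
  rfl

theorem IsEndpointwise.act {n : ℕ} {q : MatrixOp O IntervalBasis n} (hq : IsEndpointwise q)
    (σ : Equiv.Perm (Fin n)) : IsEndpointwise (MatrixOp.act IntervalBasis.deg σ q) := by
  refine ⟨fun w hw b => ?_, fun w i hi b hb => ?_⟩
  · have h : top (w ∘ σ.symm) = top w := by
      rw [top, top]
      refine if_congr ⟨fun ⟨i, hi⟩ => ⟨_, hi⟩, fun ⟨i, hi⟩ => ⟨σ i, by simpa using hi⟩⟩ rfl rfl
    have h1 : koszulSign σ (IntervalBasis.deg ∘ w) = 1 := by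
      rw [deg_comp_eq_zero hw]
      simp [koszulSign]
    rw [act_apply, unitEntry_act, hq.1 (w ∘ σ.symm) (fun i => hw _), h, h1, one_smul]
    split_ifs <;> simp
  · rw [act_apply, hq.2 _ (σ i) (by simpa using hi) b hb, map_zero, smul_zero]

theorem IsEndpointwise.circ_apply {m n l : ℕ} (h : m + n = l + 1) (i : Fin m) (p : ℤ)
    {q : MatrixOp O IntervalBasis m} {q' : MatrixOp O IntervalBasis n} (hq : IsEndpointwise q)
    (hq' : IsEndpointwise q') (w : Fin l → IntervalBasis) (hw : ∀ i, w i ≠ dt) (b : IntervalBasis) :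
    circ IntervalBasis.deg h i p q q' w b =
      if b = top w then O.circ h i (unitEntry O m q) (unitEntry O n q') else 0 := by
  have hplug : ∀ j, plugAt h i (top (w ∘ innerSlot h i)) w j ≠ dt := fun j => by
    by_cases hj : j = i
    · subst hj
      rw [plugAt_self]
      exact top_ne_dt _
    · rw [plugAt_of_ne _ _ _ _ hj]
      exact hw _
  rw [MatrixOp.circ_apply, Finset.sum_eq_single (top (w ∘ innerSlot h i))]
  · rw [hq'.1 (w ∘ innerSlot h i) (fun k => hw _), if_pos rfl, hq.1 _ hplug, top_plugAt]
    split_ifs with hb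
    · have h1 : circExp h i p (IntervalBasis.deg ∘ w) b.deg
          (top (w ∘ innerSlot h i)).deg = 0 := by
        rw [circExp, deg_comp_eq_zero hw, deg_top, hb, deg_top, sum_plugAt]
        simp
      rw [h1, Int.negOnePow_zero, one_smul]
    · rw [map_zero, LinearMap.zero_apply, smul_zero]
  · intro c _ hc
    rw [hq'.1 (w ∘ innerSlot h i) (fun k => hw _), if_neg hc, map_zero, smul_zero]
  · exact fun h => absurd (Finset.mem_univ _) h

theorem IsEndpointwise.unitEntry_circ {m n l : ℕ} (h : m + n = l + 1) (i : Fin m) (p : ℤ)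
    {q : MatrixOp O IntervalBasis m} {q' : MatrixOp O IntervalBasis n} (hq : IsEndpointwise q)
    (hq' : IsEndpointwise q') : unitEntry O l (circ IntervalBasis.deg h i p q q') =
      O.circ h i (unitEntry O m q) (unitEntry O n q') := by
  rw [unitEntry_apply, hq.circ_apply h i p hq' _ (by simp), top_one, if_pos rfl]

theorem IsEndpointwise.circ {m n l : ℕ} (h : m + n = l + 1) (i : Fin m) (p : ℤ)
    {q : MatrixOp O IntervalBasis m} {q' : MatrixOp O IntervalBasis n} (hq : IsEndpointwise q)
    (hq' : IsEndpointwise q') : IsEndpointwise (MatrixOp.circ IntervalBasis.deg h i p q q') := by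
  refine ⟨fun w hw b => ?_, fun w s hs b hb => ?_⟩
  · rw [hq.circ_apply h i p hq' w hw, hq.unitEntry_circ h i p hq']
  · rw [MatrixOp.circ_apply]
    refine Finset.sum_eq_zero fun c _ => ?_
    have key : q (plugAt h i c w) b = 0 ∨ q' (w ∘ innerSlot h i) c = 0 := by
      by_cases hc : c = dt
      · exact Or.inl (hq.2 _ i (by rw [plugAt_self, hc]) b hb)
      · rcases slot_cases h i s with ⟨k, rfl⟩ | ⟨j, hj, rfl⟩
        · exact Or.inr (hq'.2 _ k hs c hc)
        · exact Or.inl (hq.2 _ j (by rw [plugAt_of_ne _ _ _ _ hj, hs]) b hb)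
    rcases key with h0 | h0
    · rw [h0, map_zero, LinearMap.zero_apply, smul_zero]
    · rw [h0, map_zero, smul_zero]

theorem IsEndpointwise.unitEntry_pathD {n : ℕ} (k : ℤ) (q : MatrixOp O IntervalBasis n) :
    unitEntry O n (pathD k q) = (O.obj n).d (unitEntry O n q) := by
  rw [unitEntry_apply, pathD_apply]
  simp [unitEntry_apply]

end MatrixOp

/-- The matrices of degree `k` which are endpointwise, together with their differentials. -/
def pathGr (n : ℕ) (k : ℤ) : Submodule R (MatrixOp O IntervalBasis n) where
  carrier := {q | q ∈ MatrixOp.gr O IntervalBasis.deg n k ∧ IsEndpointwise q ∧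
    IsEndpointwise (pathD k q)}
  zero_mem' := ⟨Submodule.zero_mem _, .zero, by rw [map_zero]; exact .zero⟩
  add_mem' hq hr := ⟨Submodule.add_mem _ hq.1 hr.1, hq.2.1.add hr.2.1,
    by rw [map_add]; exact hq.2.2.add hr.2.2⟩
  smul_mem' c _ hq := ⟨Submodule.smul_mem _ c hq.1, hq.2.1.smul c,
    by rw [map_smul]; exact hq.2.2.smul c⟩

/-- The path operad of `O`: the matrices of operations which at both endpoints of the interval
restrict to the same operation of `O`. -/
noncomputable def pathOperad : GradedOperad R :=
  (intervalOperad O).restrict (pathGr O) (fun hq => hq.1)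
    (fun {n k q} hq => ⟨(intervalOperad O).d_mem hq.1, hq.2.2, by
      have h : pathD (k + 1) (pathD k q) = 0 := (intervalOperad O).d_d hq.1
      change IsEndpointwise (pathD (k + 1) (pathD k q))
      rw [h]
      exact .zero⟩)
    (fun {n} σ k q hq => ⟨(intervalOperad O).act_mem σ hq.1, hq.2.1.act σ, by
      have h : pathD k (MatrixOp.act IntervalBasis.deg σ q) =
        MatrixOp.act IntervalBasis.deg σ (pathD k q) := (intervalOperad O).act_d σ hq.1
      change IsEndpointwise (pathD k (MatrixOp.act IntervalBasis.deg σ q))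
      rw [h]
      exact hq.2.2.act σ⟩)
    ⟨(intervalOperad O).one_mem, .one, by
      have h : pathD 0 (intervalOperad O).one = 0 := (intervalOperad O).one_d
      change IsEndpointwise (pathD 0 (intervalOperad O).one)
      rw [h]
      exact .zero⟩
    (fun {m n l} h i p p' q q' hq hq' => ⟨(intervalOperad O).circ_mem h i hq.1 hq'.1,
      hq.2.1.circ h i p' hq'.2.1, by
      have h1 : pathD (p + p') (MatrixOp.circ IntervalBasis.deg h i p' q q') =
        MatrixOp.circ IntervalBasis.deg h i p' (pathD p q) q' +
          p.negOnePow • MatrixOp.circ IntervalBasis.deg h i (p' + 1) q (pathD p' q') :=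
        (intervalOperad O).circ_d h i hq.1 hq'.1
      change IsEndpointwise (pathD (p + p') (MatrixOp.circ IntervalBasis.deg h i p' q q'))
      rw [h1]
      exact (hq.2.2.circ h i p' hq'.2.1).add ((hq.2.1.circ h i (p' + 1) hq'.2.2).unit_smul _)⟩)

/-- The restriction of the path operad to the endpoints. -/
noncomputable def pathHom : DGOperad.Hom (pathOperad O).toDGOperad O :=
  (pathOperad O).toHom O (unitEntry O)
    (fun {n k q} hq => unitEntry_mem hq.1)
    (fun {n k q} _ => IsEndpointwise.unitEntry_pathD k q)
    (fun {n} σ k q _ => unitEntry_act σ q)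
    (by
      change (ofLinear O fun c b => if c = b then 1 else 0) (fun _ => IntervalBasis.one) one = _
      simp [ofLinear])
    (fun {m n l} h i p p' q q' hq hq' => hq.2.1.unitEntry_circ h i p' hq'.2.1)

end Path

/-! ### The path operad is a path object -/

section Path

open IntervalBasis MatrixOp

variable {R : Type u} [CommRing R] {O : DGOperad R}

namespace MatrixOp

/-- The homotopy on functions of words which is induced by the contraction `dt ↦ t` of the interval
cochains to the unit: the first letter which is not the unit is replaced. -/
noncomputable def wordHomotopy {P : Type u} [AddCommGroup P] {n : ℕ}
    (g : (Fin n → IntervalBasis) → P) (w : Fin n → IntervalBasis) : P :=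
  ∑ i, if (∀ j < i, w j = one) ∧ w i = dt then g (Function.update w i t) else 0

theorem wordHomotopy_of_first {P : Type u} [AddCommGroup P] {n : ℕ}
    (g : (Fin n → IntervalBasis) → P) {w : Fin n → IntervalBasis} {f : Fin n}
    (hf : ∀ j < f, w j = one) (hf' : w f ≠ one) :
    wordHomotopy g w = if w f = dt then g (Function.update w f t) else 0 := by
  rw [wordHomotopy, Finset.sum_eq_single f]
  · exact if_congr ⟨fun h => h.2, fun h => ⟨hf, h⟩⟩ rfl rfl
  · intro i _ hi
    rw [if_neg]
    rintro ⟨h1, h2⟩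
    rcases lt_or_gt_of_ne hi with h | h
    · rw [hf i h] at h2
      exact absurd h2 (by simp)
    · exact hf' (h1 f h)
  · exact fun h => absurd (Finset.mem_univ _) h

theorem wordHomotopy_of_ne {P : Type u} [AddCommGroup P] {n : ℕ}
    (g : (Fin n → IntervalBasis) → P) {w : Fin n → IntervalBasis} (hw : ∀ i, w i ≠ dt) :
    wordHomotopy g w = 0 :=
  Finset.sum_eq_zero fun i _ => if_neg fun h => hw i h.2

theorem exists_first {n : ℕ} {w : Fin n → IntervalBasis} (hw : ¬ ∀ i, w i = one) :
    ∃ f, (∀ j < f, w j = one) ∧ w f ≠ one := by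
  push Not at hw
  have hne : (Finset.univ.filter fun i => w i ≠ one).Nonempty := by
    obtain ⟨i, hi⟩ := hw
    exact ⟨i, by simpa using hi⟩
  refine ⟨_, fun j hj => ?_, (Finset.mem_filter.1 (Finset.min'_mem _ hne)).2⟩
  by_contra hcon
  exact absurd (Finset.min'_le _ j (Finset.mem_filter.2 ⟨Finset.mem_univ j, hcon⟩)) (not_le.2 hj)

/-- The sum over all ways of replacing a letter `t` by `dt`, with Koszul signs. -/
noncomputable def wordD {P : Type u} [AddCommGroup P] {n : ℕ}
    (g : (Fin n → IntervalBasis) → P) (w : Fin n → IntervalBasis) : P :=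
  ∑ i : Fin n, if w i = t then
    (prefixSum (IntervalBasis.deg ∘ w) i.val).negOnePow • g (Function.update w i dt) else 0

theorem wordD_units_smul {P : Type u} [AddCommGroup P] {n : ℕ} (c : ℤˣ)
    (g : (Fin n → IntervalBasis) → P) (w : Fin n → IntervalBasis) :
    wordD (fun w => c • g w) w = c • wordD g w := by
  rw [wordD, wordD, Finset.smul_sum]
  refine Finset.sum_congr rfl fun i _ => ?_
  split_ifs
  · rw [smul_comm]
  · rw [smul_zero]

theorem wordHomotopy_units_smul {P : Type u} [AddCommGroup P] {n : ℕ} (c : ℤˣ)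
    (g : (Fin n → IntervalBasis) → P) (w : Fin n → IntervalBasis) :
    wordHomotopy (fun w => c • g w) w = c • wordHomotopy g w := by
  rw [wordHomotopy, wordHomotopy, Finset.smul_sum]
  refine Finset.sum_congr rfl fun i _ => ?_
  split_ifs
  · rfl
  · rw [smul_zero]

theorem map_wordHomotopy {P P' : Type u} [AddCommGroup P] [AddCommGroup P'] {n : ℕ} (φ : P →+ P')
    (g : (Fin n → IntervalBasis) → P) (w : Fin n → IntervalBasis) :
    φ (wordHomotopy g w) = wordHomotopy (fun w => φ (g w)) w := by
  rw [wordHomotopy, wordHomotopy, map_sum]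
  refine Finset.sum_congr rfl fun i _ => ?_
  split_ifs
  · rfl
  · rw [map_zero]

theorem prefixSum_deg_first {n : ℕ} {w : Fin n → IntervalBasis} {f : Fin n}
    (hf : ∀ j < f, w j = one) : prefixSum (IntervalBasis.deg ∘ w) f.val = 0 :=
  Finset.sum_eq_zero fun j hj => by
    rw [Function.comp_apply, hf j (Fin.lt_def.2 (Finset.mem_filter.1 hj).2)]
    rfl

/-- The homotopy formula on functions of words. -/
theorem wordD_wordHomotopy {P : Type u} [AddCommGroup P] {n : ℕ}
    (g : (Fin n → IntervalBasis) → P) {w : Fin n → IntervalBasis} (hw : ¬ ∀ i, w i = one) :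
    wordHomotopy (wordD g) w + wordD (wordHomotopy g) w = g w := by
  obtain ⟨f, hf, hf'⟩ := exists_first hw
  have hfi : ∀ i, w i = t → i ≠ f → f < i := fun i hi hne => by
    rcases lt_or_gt_of_ne hne with h | h
    · rw [hf i h] at hi
      exact absurd hi (by simp)
    · exact h
  rw [wordHomotopy_of_first _ hf hf']
  rcases h0 : w f with _ | _ | _
  · exact absurd h0 hf'
  · rw [if_neg (by simp), zero_add, wordD, Finset.sum_eq_single f]
    · rw [if_pos h0, prefixSum_deg_first hf, Int.negOnePow_zero, one_smul,
        wordHomotopy_of_first (f := f) _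
          (fun j hj => by rw [Function.update_of_ne hj.ne, hf j hj]) (by simp),
        Function.update_self, if_pos rfl, Function.update_idem, ← h0, Function.update_eq_self]
    · intro i _ hi
      split_ifs with hi'
      · have hlt := hfi i hi' hi
        rw [wordHomotopy_of_first (f := f) _
          (fun j hj => by rw [Function.update_of_ne (hj.trans hlt).ne, hf j hj])
          (by rw [Function.update_of_ne hlt.ne, h0]; simp),
          Function.update_of_ne hlt.ne, h0, if_neg (by simp), smul_zero]
      · rfl
    · exact fun h => absurd (Finset.mem_univ _) h
  · rw [if_pos rfl, wordD, wordD, ← Finset.sum_add_distrib, Finset.sum_eq_single f]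
    · have h1 : ∀ j < f, Function.update w f t j = one := fun j hj => by
        rw [Function.update_of_ne hj.ne, hf j hj]
      rw [if_pos (Function.update_self _ _ _), prefixSum_deg_first h1, if_neg (by rw [h0]; simp),
        Int.negOnePow_zero, one_smul, add_zero, Function.update_idem, ← h0, Function.update_eq_self]
    · intro i _ hi
      rw [Function.update_of_ne hi]
      split_ifs with hi'
      · have hlt := hfi i hi' hi
        have h1 : prefixSum (IntervalBasis.deg ∘ w) i.val =
            prefixSum (IntervalBasis.deg ∘ Function.update w f t) i.val + 1 := by
          have hmem : f ∈ (Finset.univ.filter fun k : Fin n => k.val < i.val) := by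
            simpa using Fin.lt_def.1 hlt
          rw [prefixSum, prefixSum, ← Finset.add_sum_erase _ _ hmem,
            ← Finset.add_sum_erase _ _ hmem, Function.comp_apply, Function.comp_apply,
            Function.update_self, h0]
          have h2 : ∀ k ∈ (Finset.univ.filter fun k : Fin n => k.val < i.val).erase f,
              (IntervalBasis.deg ∘ Function.update w f t) k = (IntervalBasis.deg ∘ w) k :=
            fun k hk => by
              rw [Function.comp_apply, Function.update_of_ne (Finset.ne_of_mem_erase hk)]
              rfl
          rw [Finset.sum_congr rfl h2]
          simp only [IntervalBasis.deg]
          ring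
        rw [wordHomotopy_of_first (f := f) _
          (fun j hj => by rw [Function.update_of_ne (hj.trans hlt).ne, hf j hj])
          (by rw [Function.update_of_ne hlt.ne, h0]; simp),
          Function.update_of_ne hlt.ne, h0, if_pos rfl, Function.update_comm hlt.ne', h1,
          Int.negOnePow_succ, Units.neg_smul, add_neg_cancel]
      · rw [add_zero]
    · exact fun h => absurd (Finset.mem_univ _) h

theorem pathD_apply' {n : ℕ} (k : ℤ) (q : MatrixOp O IntervalBasis n) (w : Fin n → IntervalBasis)
    (b : IntervalBasis) :
    pathD k q w b = (O.obj n).d (q w b) +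
      ((if b = dt then (k + ∑ i, (w i).deg).negOnePow • q w t else 0) -
        k.negOnePow • wordD (fun w => q w b) w) := pathD_apply k q w b

/-- The matrix of an operation which agrees with a given function of words in the entries at `dt` on
words containing `dt`, and is the product with a constant elsewhere. -/
noncomputable def extend {n : ℕ} (o : O.obj n) (g : (Fin n → IntervalBasis) → O.obj n) :
    MatrixOp O IntervalBasis n := fun w b =>
  if ∀ i, w i ≠ dt then (if b = top w then o else 0) else if b = dt then g w else 0

theorem unitEntry_extend {n : ℕ} (o : O.obj n) (g : (Fin n → IntervalBasis) → O.obj n) :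
    unitEntry O n (extend o g) = o := by
  rw [unitEntry_apply, extend, if_pos (by simp), top_one, if_pos rfl]

theorem extend_isEndpointwise {n : ℕ} (o : O.obj n) (g : (Fin n → IntervalBasis) → O.obj n) :
    IsEndpointwise (extend o g) := by
  refine ⟨fun w hw b => ?_, fun w i hi b hb => ?_⟩
  · rw [unitEntry_extend, extend, if_pos hw]
  · rw [extend, if_neg (fun h => h i hi), if_neg hb]

theorem extend_dt {n : ℕ} (o : O.obj n) {g : (Fin n → IntervalBasis) → O.obj n}
    (hg : ∀ w, (∀ i, w i ≠ dt) → g w = 0) (w : Fin n → IntervalBasis) : extend o g w dt = g w := by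
  rw [extend]
  split_ifs with h1 h2
  · exact absurd h2.symm (top_ne_dt w)
  · exact (hg w h1).symm
  · rfl
  · rename_i h; exact absurd rfl h

theorem extend_of_ne {n : ℕ} (o : O.obj n) (g : (Fin n → IntervalBasis) → O.obj n)
    (w : Fin n → IntervalBasis) {b : IntervalBasis} (hb : b ≠ dt) :
    extend o g w b = if (∀ i, w i ≠ dt) ∧ b = top w then o else 0 := by
  rw [extend]
  by_cases h1 : ∀ i, w i ≠ dt
  · simp [h1]
  · rw [if_neg h1, if_neg hb, if_neg fun h => h1 h.1]

theorem wordD_extend_of_ne {n : ℕ} (o : O.obj n) (g : (Fin n → IntervalBasis) → O.obj n)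
    (w : Fin n → IntervalBasis) {b : IntervalBasis} (hb : b ≠ dt) :
    wordD (fun w => extend o g w b) w = 0 := by
  refine Finset.sum_eq_zero fun i _ => ?_
  split_ifs
  · change (prefixSum (IntervalBasis.deg ∘ w) i.val).negOnePow •
      extend o g (Function.update w i dt) b = 0
    rw [extend_of_ne _ _ _ hb, if_neg (fun h => h.1 i (by simp)), smul_zero]
  · rfl

/-- For the differential of an extension to be endpointwise it suffices that the function of words
satisfies one condition on words without `dt`. -/
theorem isEndpointwise_pathD_extend {n : ℕ} (k : ℤ) (o : O.obj n)
    {g : (Fin n → IntervalBasis) → O.obj n} (hg : ∀ w, (∀ i, w i ≠ dt) → g w = 0)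
    (hE : ∀ w, (∀ i, w i ≠ dt) → wordD g w = if ∀ i, w i = one then 0 else o) :
    IsEndpointwise (pathD k (extend o g)) := by
  have hval : unitEntry O n (pathD k (extend o g)) = (O.obj n).d o := by
    rw [IsEndpointwise.unitEntry_pathD, unitEntry_extend]
  refine ⟨fun w hw b => ?_, fun w i hi b hb => ?_⟩
  · rw [hval, pathD_apply']
    by_cases hb : b = dt
    · subst hb
      have h1 : (fun w => extend o g w dt) = g := funext fun w => extend_dt o hg w
      have h2 : ∑ i, (w i).deg = 0 := Finset.sum_eq_zero fun i _ => deg_of_ne (hw i)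
      rw [if_pos rfl, extend_dt o hg, hg w hw, map_zero, h1, hE w hw, h2, add_zero,
        if_neg (top_ne_dt w).symm, extend_of_ne _ _ _ (by simp), zero_add]
      by_cases hone : ∀ i, w i = one
      · have h3 : ¬ ((∀ i, w i ≠ dt) ∧ t = top w) := by
          rintro ⟨_, h⟩
          rw [show w = fun _ => one from funext hone, top_one] at h
          exact absurd h (by simp)
        rw [if_pos hone, if_neg h3, smul_zero, sub_zero]
      · have h3 : t = top w := by
          push Not at hone
          obtain ⟨i, hi⟩ := hone
          have : w i = t := by
            rcases h : w i with _ | _ | _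
            · exact absurd h hi
            · rfl
            · exact absurd h (hw i)
          rw [top, if_pos ⟨i, this⟩]
        rw [if_neg hone, if_pos ⟨hw, h3⟩, sub_self]
    · rw [if_neg hb, wordD_extend_of_ne o g w hb, smul_zero, sub_zero, add_zero,
        extend_of_ne o g w hb]
      by_cases h1 : b = top w
      · rw [if_pos ⟨hw, h1⟩, if_pos h1]
      · rw [if_neg (fun h => h1 h.2), if_neg h1, map_zero]
  · rw [pathD_apply', if_neg hb, wordD_extend_of_ne o g w hb, extend_of_ne o g w hb,
      if_neg (fun h => h.1 i hi)]
    simp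

theorem extend_mem {n : ℕ} {k : ℤ} {o : O.obj n} (ho : o ∈ (O.obj n).gr k)
    {g : (Fin n → IntervalBasis) → O.obj n}
    (hg : ∀ w, g w ∈ (O.obj n).gr (k + ∑ i, (w i).deg - 1)) :
    extend o g ∈ gr O IntervalBasis.deg n k := by
  refine (mem_gr _).2 fun w b => ?_
  rw [extend]
  split_ifs with h1 h2 h3
  · have h2 : ∑ i, (w i).deg = 0 := Finset.sum_eq_zero fun i _ => deg_of_ne (h1 i)
    rw [h2, ‹b = top w›, deg_top, add_zero, sub_zero]
    exact ho
  · exact Submodule.zero_mem _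
  · rw [‹b = dt›]
    exact hg w
  · exact Submodule.zero_mem _

theorem wordHomotopy_mem {n : ℕ} {k : ℤ} {g : (Fin n → IntervalBasis) → O.obj n}
    (hg : ∀ w, g w ∈ (O.obj n).gr (k + ∑ i, (w i).deg)) (w : Fin n → IntervalBasis) :
    wordHomotopy g w ∈ (O.obj n).gr (k + ∑ i, (w i).deg - 1) := by
  refine Submodule.sum_mem _ fun i _ => ?_
  split_ifs with h
  · have h1 := hg (Function.update w i t)
    have h2 : ∑ j, (Function.update w i t j).deg = ∑ j, (w j).deg - 1 := by
      rw [Fintype.sum_eq_add_sum_compl i, Fintype.sum_eq_add_sum_compl i, Function.update_self, h.2]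
      have h3 : ∀ j ∈ ({i}ᶜ : Finset (Fin n)), (Function.update w i t j).deg = (w j).deg :=
        fun j hj => by rw [Function.update_of_ne (by simpa using hj)]
      rw [Finset.sum_congr rfl h3]
      simp only [IntervalBasis.deg]
      ring
    rw [h2] at h1
    convert h1 using 2
    ring
  · exact Submodule.zero_mem _

/-- A cycle which vanishes at the endpoints is the differential of an operation which vanishes at
the endpoints. -/
theorem exists_pathD_eq {n : ℕ} {k : ℤ} {q : MatrixOp O IntervalBasis n} (hq : q ∈ pathGr O n k)
    (hu : unitEntry O n q = 0) (hcl : pathD k q = 0) :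
    ∃ r ∈ pathGr O n (k - 1), unitEntry O n r = 0 ∧ pathD (k - 1) r = q := by
  have hq0 : ∀ w, (∀ i, w i ≠ dt) → ∀ b, q w b = 0 := fun w hw b => by
    rw [hq.2.1.1 w hw b, hu, ite_self]
  have hqt : ∀ w b, b ≠ dt → q w b = 0 := fun w b hb => by
    by_cases hw : ∀ i, w i ≠ dt
    · exact hq0 w hw b
    · push Not at hw
      obtain ⟨i, hi⟩ := hw
      exact hq.2.1.2 w i hi b hb
  let g : (Fin n → IntervalBasis) → O.obj n := fun w => k.negOnePow • q w dt
  have hg0 : ∀ w, (∀ i, w i ≠ dt) → wordHomotopy g w = 0 := fun w hw => wordHomotopy_of_ne _ hw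
  -- the cycle condition, read off in the column `dt`
  have hdg : ∀ w, (O.obj n).d (g w) = k.negOnePow • wordD g w := fun w => by
    have h1 : pathD k q w dt = 0 := by rw [hcl]; rfl
    rw [pathD_apply', if_pos rfl, hqt w t (by simp), smul_zero, zero_sub, ← sub_eq_add_neg,
      sub_eq_zero] at h1
    have h2 : wordD g w = k.negOnePow • wordD (fun w => q w dt) w := wordD_units_smul _ _ _
    rw [h2, ← h1]
    exact LinearMap.map_intUnit_smul _ _ _
  have hdt : (fun w => extend (0 : O.obj n) (wordHomotopy g) w dt) = wordHomotopy g :=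
    funext fun w => extend_dt 0 hg0 w
  have hD : pathD (k - 1) (extend 0 (wordHomotopy g)) = q := by
    funext w b
    rw [pathD_apply']
    by_cases hb : b = dt
    · subst hb
      have h1 : (O.obj n).d (wordHomotopy g w) = k.negOnePow • wordHomotopy (wordD g) w := by
        have := map_wordHomotopy (O.obj n).d.toAddMonoidHom g w
        rw [LinearMap.toAddMonoidHom_coe] at this
        rw [this, ← wordHomotopy_units_smul]
        exact congrArg (wordHomotopy · w) (funext hdg)
      rw [if_pos rfl, hdt, extend_dt 0 hg0, extend_of_ne _ _ _ (by simp), ite_self, smul_zero,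
        zero_sub, h1, Int.negOnePow_sub, Int.negOnePow_one, mul_neg, mul_one, Units.neg_smul,
          neg_neg,
        ← smul_add]
      by_cases hone : ∀ i, w i = one
      · have hw : ∀ i, w i ≠ dt := fun i => by rw [hone i]; simp
        have h2 : ∀ g' : (Fin n → IntervalBasis) → O.obj n, wordD g' w = 0 := fun g' =>
          Finset.sum_eq_zero fun i _ => if_neg (by rw [hone i]; simp)
        rw [wordHomotopy_of_ne _ hw, h2, add_zero, smul_zero, hq0 w hw]
      · rw [wordD_wordHomotopy g hone]
        simp only [g, smul_smul, Int.units_mul_self, one_smul]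
    · rw [if_neg hb, wordD_extend_of_ne _ _ w hb, extend_of_ne _ _ w hb, ite_self, hqt w b hb]
      simp
  refine ⟨extend 0 (wordHomotopy g), ⟨extend_mem (Submodule.zero_mem _) fun w => ?_,
    extend_isEndpointwise _ _, by rw [hD]; exact hq.2.1⟩, unitEntry_extend _ _, hD⟩
  have := wordHomotopy_mem (O := O) (k := k - 1) (g := g) (fun w => ?_) w
  · exact this
  · have h1 := (mem_gr _).1 hq.1 w dt
    have h2 : k + ∑ i, (w i).deg - IntervalBasis.deg dt = k - 1 + ∑ i, (w i).deg := by
      simp only [IntervalBasis.deg]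
      ring
    rw [h2] at h1
    exact Submodule.smul_of_tower_mem _ _ h1

end MatrixOp

variable (O)

/-- The restriction of the path operad to the endpoints is surjective: a preimage of `o` is given by
the product of `o` with the iterated cup product of interval cochains. -/
theorem pathHom_isFibration : (pathHom O).IsFibration := fun n o => by
  induction o using DGModule.induction_gr with
  | hadd x y hx hy =>
    obtain ⟨a, rfl⟩ := hx
    obtain ⟨b, rfl⟩ := hy
    exact ⟨a + b, map_add _ _ _⟩
  | h k o ho =>
    let g₀ : (Fin n → IntervalBasis) → O.obj n := fun w => if ∀ i, w i ≠ dt then o else 0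
    have hg : ∀ w, (∀ i, w i ≠ dt) → wordHomotopy g₀ w = 0 := fun w hw => wordHomotopy_of_ne _ hw
    have hmem : extend o (wordHomotopy g₀) ∈ pathGr O n k := by
      refine ⟨extend_mem ho (wordHomotopy_mem fun w => ?_), extend_isEndpointwise _ _,
        isEndpointwise_pathD_extend k o hg fun w hw => ?_⟩
      · by_cases h : ∀ i, w i ≠ dt
        · have h2 : ∑ i, (w i).deg = 0 := Finset.sum_eq_zero fun i _ => deg_of_ne (h i)
          simp only [g₀, if_pos h, h2, add_zero]
          exact ho
        · simp only [g₀, if_neg h]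
          exact Submodule.zero_mem _
      · by_cases hone : ∀ i, w i = one
        · rw [if_pos hone]
          exact Finset.sum_eq_zero fun i _ => if_neg (by rw [hone i]; simp)
        · have h1 := wordD_wordHomotopy g₀ hone
          rw [wordHomotopy_of_ne _ hw, zero_add] at h1
          rw [if_neg hone, h1]
          exact if_pos hw
    have hmem' : extend o (wordHomotopy g₀) ∈ (pathOperad O).gr n k := hmem
    exact ⟨GradedOperad.ofMem _ hmem', unitEntry_extend _ _⟩

/-- The kernel of the restriction to the endpoints is acyclic, by the contraction of the interval
cochains without the unit. -/
theorem pathHom_isWeakEquivalence : (pathHom O).IsWeakEquivalence := fun n => by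
  refine DGModule.Hom.isQuasiIso_of_surjective _ (pathHom_isFibration O n) fun k x hx h0 hd => ?_
  have hcl : pathD k ((pathOperad O).incl x) = 0 := by
    have h1 := GradedOperad.incl_d hx
    have hd' : ((pathOperad O).obj n).d x = 0 := hd
    rw [hd', map_zero] at h1
    exact h1.symm
  obtain ⟨r, hr, hr0, hrd⟩ := exists_pathD_eq (O := O) hx h0 hcl
  have hr' : r ∈ (pathOperad O).gr n (k - 1) := hr
  refine ⟨GradedOperad.ofMem r hr', hr0, GradedOperad.incl_injective ?_⟩
  refine (GradedOperad.incl_d (GradedOperad.ofMem_mem (G := pathOperad O) r hr')).trans ?_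
  exact hrd

end Path

/-! ### Sections of the path operad -/

section Path

open IntervalBasis MatrixOp

variable {R : Type u} [CommRing R]

/-- In arities `0` and `1` the path operad contains nothing but `O`. Hence it is again a unital
augmented operad. -/
theorem eq_zero_of_arity_zero {O : DGOperad R} {k : ℤ} {q : MatrixOp O IntervalBasis 0}
    (hq : q ∈ pathGr O 0 k) (hu : unitEntry O 0 q = 0) : q = 0 := by
  funext w b
  rw [hq.2.1.1 w (fun i => i.elim0) b, hu, ite_self]
  rfl

theorem eq_zero_of_arity_one {O : DGOperad R} {k : ℤ} {q : MatrixOp O IntervalBasis 1}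
    (hq : q ∈ pathGr O 1 k) (hu : unitEntry O 1 q = 0) : q = 0 := by
  have h0 : ∀ w, w 0 ≠ dt → ∀ b, q w b = 0 := fun w hw b => by
    rw [hq.2.1.1 w (fun i => by rwa [Subsingleton.elim i 0]) b, hu, ite_self]
  funext w b
  by_cases hw : w 0 = dt
  · by_cases hb : b = dt
    · -- the value at `dt` is read off from the differential at `t`
      have h1 := hq.2.2.1 (fun _ => t) (by simp) dt
      rw [IsEndpointwise.unitEntry_pathD, hu, map_zero, ite_self, pathD_apply,
        h0 _ (by simp), h0 _ (by simp)] at h1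
      have h2 : Function.update (fun _ : Fin 1 => t) 0 dt = w := by
        funext i
        rw [Subsingleton.elim i 0, Function.update_self, hw]
      simp only [Finset.univ_unique, Fin.default_eq_zero, Finset.sum_singleton, h2, if_true,
        map_zero, smul_zero, zero_add, zero_sub, neg_eq_zero, smul_smul] at h1
      rw [hb]
      exact (smul_eq_zero_iff_eq _).1 h1
    · exact hq.2.1.2 w 0 hw b hb
  · exact h0 w hw b

theorem pathHom_injective_zero (O : DGOperad R) :
    Function.Injective ((pathHom O).app 0).toLin :=
  DGModule.Hom.injective_of_homogeneous _ fun _ _ hx h0 =>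
    GradedOperad.incl_injective ((eq_zero_of_arity_zero (O := O) hx h0).trans (map_zero _).symm)

theorem pathHom_injective_one (O : DGOperad R) :
    Function.Injective ((pathHom O).app 1).toLin :=
  DGModule.Hom.injective_of_homogeneous _ fun _ _ hx h0 =>
    GradedOperad.incl_injective ((eq_zero_of_arity_one (O := O) hx h0).trans (map_zero _).symm)

/-- The composite of two morphisms of operads. -/
noncomputable def DGOperad.Hom.comp {O P Q : DGOperad R} (g : Hom P Q) (f : Hom O P) : Hom O Q where
  app n :=
    { toLin := (g.app n).toLin ∘ₗ (f.app n).toLin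
      map_gr := fun hx => (g.app n).map_gr ((f.app n).map_gr hx)
      map_d := fun x => by
        rw [LinearMap.comp_apply, LinearMap.comp_apply, (f.app n).map_d, (g.app n).map_d] }
  map_act σ x := by
    simp only [LinearMap.comp_apply, f.map_act, g.map_act]
  map_one := by
    simp only [LinearMap.comp_apply, f.map_one, g.map_one]
  map_circ _ _ _ _ := by
    simp only [LinearMap.comp_apply, f.map_circ, g.map_circ]

/-- The path operad of a unital augmented operad. -/
noncomputable def pathUA (O : UAOperad R) : UAOperad R where
  toDGOperad := (pathOperad O.toDGOperad).toDGOperad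
  aug := O.aug.comp (pathHom O.toDGOperad)
  aug_zero := O.aug_zero.comp ⟨pathHom_injective_zero _, pathHom_isFibration _ 0⟩
  aug_one := O.aug_one.comp ⟨pathHom_injective_one _, pathHom_isFibration _ 1⟩

/-- The restriction to the endpoints, as a morphism of unital augmented operads. -/
noncomputable def pathUAHom (O : UAOperad R) : UAOperad.Hom (pathUA O) O where
  toHom := pathHom O.toDGOperad
  map_aug _ _ := rfl

/-- The identity morphism. -/
noncomputable def UAOperad.Hom.refl (O : UAOperad R) : UAOperad.Hom O O where
  app _ := { toLin := LinearMap.id, map_gr := fun hx => hx, map_d := fun _ => rfl }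
  map_act _ _ := rfl
  map_one := rfl
  map_circ _ _ _ _ := rfl
  map_aug _ _ := rfl

/-- A multiplicative section of the path operad: it assigns to every operation of `O` an operation
on the cochains of the interval, with coefficients in `O`, which restricts to the given operation at
the endpoints. -/
structure PathSection (O : DGOperad R) where
  q : ∀ n, O.obj n →ₗ[R] MatrixOp O IntervalBasis n
  q_mem : ∀ {n : ℕ} {k : ℤ} {o : O.obj n}, o ∈ (O.obj n).gr k →
    q n o ∈ MatrixOp.gr O IntervalBasis.deg n k
  q_endpointwise : ∀ {n : ℕ} (o : O.obj n), IsEndpointwise (q n o)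
  unitEntry_q : ∀ {n : ℕ} (o : O.obj n), unitEntry O n (q n o) = o
  q_d : ∀ {n : ℕ} {k : ℤ} {o : O.obj n}, o ∈ (O.obj n).gr k → q n ((O.obj n).d o) = pathD k (q n o)
  q_act : ∀ {n : ℕ} (σ : Equiv.Perm (Fin n)) (o : O.obj n),
    q n (O.act σ o) = MatrixOp.act IntervalBasis.deg σ (q n o)
  q_circ : ∀ {m n l : ℕ} (h : m + n = l + 1) (i : Fin m) {p : ℤ} (x : O.obj m) {y : O.obj n},
    y ∈ (O.obj n).gr p →
      q l (O.circ h i x y) = MatrixOp.circ IntervalBasis.deg h i p (q m x) (q n y)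

/-- A cofibrant operad has a section of its path operad, a lift of the identity. -/
theorem UAOperad.IsCofibrant.exists_pathSection {O : UAOperad R} (hO : O.IsCofibrant) :
    Nonempty (PathSection O.toDGOperad) := by
  obtain ⟨g, hg⟩ := hO _ _ (pathUAHom O) (pathHom_isFibration _) (pathHom_isWeakEquivalence _)
    (UAOperad.Hom.refl O)
  let G := pathOperad O.toDGOperad
  let γ : DGOperad.Hom O.toDGOperad G.toDGOperad := g.toHom
  let q : ∀ n, O.obj n →ₗ[R] MatrixOp O.toDGOperad IntervalBasis n := fun n =>
    (G.incl (n := n)) ∘ₗ (γ.app n).toLin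
  have hq : ∀ {n : ℕ} {k : ℤ} {o : O.obj n}, o ∈ (O.obj n).gr k →
      q n o ∈ pathGr O.toDGOperad n k := fun ho => (γ.app _).map_gr ho
  exact ⟨{
    q := q
    q_mem := fun ho => (hq ho).1
    q_endpointwise := fun {n} o => by
      induction o using DGModule.induction_gr with
      | h k o ho => exact (hq ho).2.1
      | hadd x y hx hy => rw [map_add]; exact hx.add hy
    unitEntry_q := fun o => hg _ o
    q_d := fun {n k o} ho => by
      have h1 : q n ((O.obj n).d o) = G.incl ((G.obj n).d ((γ.app n).toLin o)) :=
        congrArg G.incl ((γ.app n).map_d o)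
      rw [h1]
      exact GradedOperad.incl_d ((γ.app n).map_gr ho)
    q_act := fun σ o => congrArg G.incl (γ.map_act σ o)
    q_circ := fun {m n l} h i {p} x {y} hy => by
      have h1 : q l (O.circ h i x y) = G.incl (G.objCirc h i ((γ.app m).toLin x)
        ((γ.app n).toLin y)) :=
        congrArg G.incl (γ.map_circ h i x y)
      rw [h1]
      exact G.incl_objCirc h i _ ((γ.app n).map_gr hy) }⟩

end Path

/-! ### Operations on vectors of generators -/

theorem MultilinearMap.map_eq_sum_single {R M ι : Type*} [CommRing R] [AddCommGroup M] [Module R M]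
    [Fintype ι] [DecidableEq ι] {p : ℕ} (f : MultilinearMap R (fun _ : Fin p => ι → R) M)
    (v : Fin p → ι → R) :
    f v = ∑ w : Fin p → ι, (∏ i, v i (w i)) • f fun i => Pi.single (w i) 1 := by
  have h : v = fun i => ∑ g, v i g • (Pi.single g 1 : ι → R) := funext fun i => by
    conv_lhs => rw [← Finset.univ_sum_single (v i)]
    refine Finset.sum_congr rfl fun g _ => ?_
    rw [← Pi.single_smul, smul_eq_mul, mul_one]
  conv_lhs => rw [h, MultilinearMap.map_sum]
  exact Finset.sum_congr rfl fun w _ => MultilinearMap.map_smul_univ _ _ _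

namespace FormGen

variable {R : Type u} [CommRing R]

/-- The vectors of generators which are homogeneous of degree `k`. -/
def IsHomogeneous {n : ℕ} (k : ℤ) (v : FormGen n → R) : Prop := ∀ g, g.deg ≠ k → v g = 0

theorem isHomogeneous_single {n : ℕ} (g : FormGen n) :
    IsHomogeneous g.deg (Pi.single g 1 : FormGen n → R) := fun g' h => by
  rw [Pi.single_apply, if_neg]
  rintro rfl
  exact h rfl

theorem IsHomogeneous.prod_eq_zero {n p : ℕ} {q : Fin p → ℤ} {v : Fin p → FormGen n → R}
    (hv : ∀ i, IsHomogeneous (q i) (v i)) {w : Fin p → FormGen n} (hw : ¬ ∀ i, (w i).deg = q i) :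
    ∏ i, v i (w i) = 0 := by
  push Not at hw
  obtain ⟨i, hi⟩ := hw
  exact Finset.prod_eq_zero (Finset.mem_univ i) (hv i _ hi)

/-- Multilinear maps which agree on the generators of given degrees agree on homogeneous vectors of
these degrees. -/
theorem multilinear_ext {n p : ℕ} {M : Type*} [AddCommGroup M] [Module R M]
    {f g : MultilinearMap R (fun _ : Fin p => FormGen n → R) M} {q : Fin p → ℤ}
    (h : ∀ w : Fin p → FormGen n, (∀ i, (w i).deg = q i) →
      f (fun i => Pi.single (w i) 1) = g fun i => Pi.single (w i) 1)
    {v : Fin p → FormGen n → R} (hv : ∀ i, IsHomogeneous (q i) (v i)) : f v = g v := by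
  rw [f.map_eq_sum_single, g.map_eq_sum_single]
  refine Finset.sum_congr rfl fun w _ => ?_
  by_cases hw : ∀ i, (w i).deg = q i
  · rw [h w hw]
  · rw [IsHomogeneous.prod_eq_zero hv hw, zero_smul, zero_smul]

variable (R) in
/-- The sum of the generators of degree `0`, which represents the unit. -/
def unitVec (n : ℕ) : FormGen n → R := Sum.elim 1 0

variable (R) in
/-- The differential of the free module on the generators. -/
def dVec (n : ℕ) : (FormGen n → R) →ₗ[R] (FormGen n → R) where
  toFun v := Sum.elim 0 fun j => v (.inl j)
  map_add' v v' := by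
    funext g
    rcases g with j | j <;> simp
  map_smul' c v := by
    funext g
    rcases g with j | j <;> simp

theorem dVec_inl {n : ℕ} (j : Fin (n + 1)) :
    dVec R n (Pi.single (.inl j) 1) = Pi.single (.inr j) 1 := by
  funext g
  rcases g with a | a <;> simp [dVec, Pi.single_apply]

theorem dVec_inr {n : ℕ} (j : Fin (n + 1)) : dVec R n (Pi.single (.inr j) 1) = 0 := by
  funext g
  rcases g with a | a <;> simp [dVec]

theorem IsHomogeneous.dVec {n : ℕ} {k : ℤ} {v : FormGen n → R} (hv : IsHomogeneous k v) :
    IsHomogeneous (k + 1) (FormGen.dVec R n v) := fun g hg => by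
  rcases g with a | a
  · rfl
  · exact hv (.inl a) fun h => hg (by rw [← h]; rfl)

theorem sum_single_inl (n : ℕ) :
    ∑ j : Fin (n + 1), (Pi.single (.inl j) 1 : FormGen n → R) = unitVec R n := by
  funext g
  rcases g with a | a <;> simp [unitVec, Pi.single_apply]

theorem sum_single_inr (n : ℕ) :
    ∑ j : Fin (n + 1), (Pi.single (.inr j) 1 : FormGen n → R) = dVec R n (unitVec R n) := by
  funext g
  rcases g with a | a <;> simp [unitVec, dVec, Pi.single_apply]

end FormGen

namespace UAOperad

open FormGen

variable {R : Type u} [CommRing R] (O : UAOperad R)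

/-- The projection to the quotient by the relations. -/
noncomputable def omegaMk (n : ℕ) : O.FormSum n →ₗ[R] O.omega n := (O.formRel n).mkQ

/-- The class of the tensor `o ⊗ w₁ ⊗ ⋯ ⊗ w_p`. -/
noncomputable def cls {n p : ℕ} (w : Fin p → FormGen n) : O.obj p →ₗ[R] O.omega n :=
  O.omegaMk n ∘ₗ O.word w

theorem omegaMk_surjective (n : ℕ) : Function.Surjective (O.omegaMk n) :=
    (O.formRel n).mkQ_surjective

theorem omegaMk_eq_zero {n : ℕ} {t : O.FormSum n} (ht : t ∈ O.formRel n) : O.omegaMk n t = 0 :=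
  (Submodule.Quotient.mk_eq_zero _).2 ht

/-- The linear map out of `Ω_n` induced by a linear map which respects the relations. -/
noncomputable def omegaLift {n : ℕ} {P : Type u} [AddCommGroup P] [Module R P]
    (f : O.FormSum n →ₗ[R] P) (hf : O.formRel n ≤ LinearMap.ker f) : O.omega n →ₗ[R] P :=
  (O.formRel n).liftQ f hf

theorem omegaLift_cls {n p : ℕ} {P : Type u} [AddCommGroup P] [Module R P]
    (f : O.FormSum n →ₗ[R] P) (hf : O.formRel n ≤ LinearMap.ker f) (w : Fin p → FormGen n)
    (o : O.obj p) : O.omegaLift f hf (O.cls w o) = f (O.word w o) := rfl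

variable {O}

theorem omega_hom_ext {n : ℕ} {P : Type u} [AddCommGroup P] [Module R P] {f g : O.omega n →ₗ[R] P}
    (h : ∀ (p : ℕ) (w : Fin p → FormGen n) (k : ℤ) (o : O.obj p), o ∈ (O.obj p).gr k →
      f (O.cls w o) = g (O.cls w o)) (x : O.omega n) : f x = g x := by
  obtain ⟨t, rfl⟩ := O.omegaMk_surjective n x
  exact O.formSum_induction (S := LinearMap.eqLocus (f ∘ₗ O.omegaMk n) (g ∘ₗ O.omegaMk n))
    (fun p w k o ho => h p w k o ho) t

theorem omega_gr_le {n : ℕ} {k : ℤ} {S : Submodule R (O.omega n)}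
    (h : ∀ (p : ℕ) (w : Fin p → FormGen n) (o : O.obj p),
      o ∈ (O.obj p).gr (k - FormWord.deg ⟨p, w⟩) → O.cls w o ∈ S) {x : O.omega n}
    (hx : x ∈ (O.omega n).gr k) : x ∈ S := by
  obtain ⟨t, ht, rfl⟩ := hx
  exact O.formSumGr_le (S := S.comap (O.omegaMk n)) h ht

theorem cls_mem {n p : ℕ} (w : Fin p → FormGen n) {k : ℤ} {o : O.obj p}
    (ho : o ∈ (O.obj p).gr k) : O.cls w o ∈ (O.omega n).gr (k + ∑ i, (w i).deg) :=
  ⟨_, O.word_gr w ho, rfl⟩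

theorem cls_act {n p : ℕ} (σ : Equiv.Perm (Fin p)) (w : Fin p → FormGen n) (o : O.obj p) :
    O.cls w (O.act σ o) = koszulSign σ (fun i => (w i).deg) • O.cls (w ∘ σ.symm) o := by
  have h := O.omegaMk_eq_zero (O.relAct_mem σ w o)
  rw [relAct_apply, map_sub, sub_eq_zero, LinearMap.map_intUnit_smul] at h
  exact h

theorem sum_cls_inl {n p : ℕ} (i : Fin (p + 1)) (w : Fin p → FormGen n) (o : O.obj (p + 1)) :
    ∑ j : Fin (n + 1), O.cls (i.insertNth (α := fun _ => FormGen n) (.inl j) w) o =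
      O.cls w (O.plugPt i o) := by
  have h := O.omegaMk_eq_zero (O.relSum_mem i w o)
  rw [relSum_apply, map_sub, sub_eq_zero, map_sum] at h
  exact h

theorem sum_cls_inr {n p : ℕ} (i : Fin (p + 1)) (w : Fin p → FormGen n) (o : O.obj (p + 1)) :
    ∑ j : Fin (n + 1), O.cls (i.insertNth (α := fun _ => FormGen n) (.inr j) w) o = 0 := by
  have h := O.omegaMk_eq_zero (O.relDSum_mem i w o)
  rw [relDSum_apply, map_sum] at h
  exact h

/-- The linear map out of the representatives of `Ω_n` with given values on tensors. -/
noncomputable def wordLift {n : ℕ} {P : Type u} [AddCommGroup P] [Module R P]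
    (f : ∀ p, (Fin p → FormGen n) → O.obj p →ₗ[R] P) : O.FormSum n →ₗ[R] P :=
  DirectSum.toModule R (FormWord n) P fun w => f w.1 w.2

theorem wordLift_word {n p : ℕ} {P : Type u} [AddCommGroup P] [Module R P]
    (f : ∀ p, (Fin p → FormGen n) → O.obj p →ₗ[R] P) (w : Fin p → FormGen n) (o : O.obj p) :
    wordLift f (O.word w o) = f p w o := by
  rw [wordLift, word, DirectSum.toModule_lof]

variable (O)

/-- The class of `o ⊗ v₁ ⊗ ⋯ ⊗ v_p` for vectors of generators, as a linear function of `o`. -/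
noncomputable def vecCls {n p : ℕ} (v : Fin p → FormGen n → R) : O.obj p →ₗ[R] O.omega n :=
  ∑ w : Fin p → FormGen n, (∏ i, v i (w i)) • O.cls w

variable {O}

theorem vecCls_apply {n p : ℕ} (v : Fin p → FormGen n → R) (o : O.obj p) :
    O.vecCls v o = ∑ w : Fin p → FormGen n, (∏ i, v i (w i)) • O.cls w o := by
  simp [vecCls]

/-- The class of `o ⊗ v₁ ⊗ ⋯ ⊗ v_p`, as a multilinear function of the vectors of generators. -/
noncomputable def vecOp {n p : ℕ} (o : O.obj p) :
    MultilinearMap R (fun _ : Fin p => FormGen n → R) (O.omega n) :=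
  ∑ w : Fin p → FormGen n, ((MultilinearMap.mkPiAlgebra R (Fin p) R).compLinearMap
    fun i => LinearMap.proj (w i)).smulRight (O.cls w o)

theorem vecOp_apply {n p : ℕ} (o : O.obj p) (v : Fin p → FormGen n → R) :
    vecOp o v = O.vecCls v o := by
  simp [vecCls, vecOp]

theorem vecCls_single {n p : ℕ} (w : Fin p → FormGen n) :
    O.vecCls (fun i => (Pi.single (w i) 1 : FormGen n → R)) = O.cls w := by
  rw [vecCls, Finset.sum_eq_single w]
  · simp
  · intro w' _ hw'
    obtain ⟨i, hi⟩ := Function.ne_iff.1 hw'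
    rw [Finset.prod_eq_zero (Finset.mem_univ i), zero_smul]
    rw [Pi.single_apply, if_neg hi]
  · exact fun h => absurd (Finset.mem_univ _) h

theorem vecCls_mem {n p : ℕ} {v : Fin p → FormGen n → R} {q : Fin p → ℤ}
    (hv : ∀ i, IsHomogeneous (q i) (v i)) {k : ℤ} {o : O.obj p} (ho : o ∈ (O.obj p).gr k) :
    O.vecCls v o ∈ (O.omega n).gr (k + ∑ i, q i) := by
  rw [vecCls_apply]
  refine Submodule.sum_mem _ fun w _ => ?_
  by_cases hw : ∀ i, (w i).deg = q i
  · have h := cls_mem w ho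
    simp only [hw] at h
    exact Submodule.smul_mem _ _ h
  · rw [IsHomogeneous.prod_eq_zero hv hw, zero_smul]
    exact Submodule.zero_mem _

theorem vecCls_act {n p : ℕ} (σ : Equiv.Perm (Fin p)) {v : Fin p → FormGen n → R} {q : Fin p → ℤ}
    (hv : ∀ i, IsHomogeneous (q i) (v i)) (o : O.obj p) :
    O.vecCls v (O.act σ o) = koszulSign σ q • O.vecCls (v ∘ σ.symm) o := by
  have h := FormGen.multilinear_ext (f := vecOp (O.act σ o))
    (g := (koszulSign σ q) • (vecOp o).domDomCongr σ.symm) (q := q) (fun w hw => ?_) hv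
  · rw [vecOp_apply] at h
    rw [h, ← vecOp_apply]
    rfl
  · have h1 : (koszulSign σ q • (vecOp o).domDomCongr σ.symm) (fun i => Pi.single (w i) 1) =
      koszulSign σ q • vecOp o (fun i => (Pi.single ((w ∘ σ.symm) i) 1 : FormGen n → R)) := rfl
    rw [h1, vecOp_apply, vecOp_apply, vecCls_single, vecCls_single, cls_act]
    simp only [hw]

theorem vecCls_sum_insertNth {n p : ℕ} {ι : Type*} (s : Finset ι) (i : Fin (p + 1))
    (a : ι → FormGen n → R) (v : Fin p → FormGen n → R) (o : O.obj (p + 1)) :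
    ∑ j ∈ s, O.vecCls (i.insertNth (α := fun _ => FormGen n → R) (a j) v) o =
      O.vecCls (i.insertNth (α := fun _ => FormGen n → R) (∑ j ∈ s, a j) v) o := by
  have h : ∀ b, i.insertNth (α := fun _ => FormGen n → R) b v =
      Function.update (i.insertNth (α := fun _ => FormGen n → R) 0 v) i b := fun b => by
    rw [Fin.update_insertNth]
  rw [h, ← vecOp_apply, MultilinearMap.map_update_sum]
  exact Finset.sum_congr rfl fun j _ => by rw [vecOp_apply, ← h]

theorem single_insertNth {n p : ℕ} (i : Fin (p + 1)) (g : FormGen n) (w : Fin p → FormGen n) :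
    (fun k => (Pi.single (i.insertNth (α := fun _ => FormGen n) g w k) 1 : FormGen n → R)) =
      i.insertNth (α := fun _ => FormGen n → R) (Pi.single g 1) fun k => Pi.single (w k) 1 := by
  funext k
  rcases Fin.eq_self_or_eq_succAbove i k with rfl | ⟨k, rfl⟩
  · rw [Fin.insertNth_apply_same, Fin.insertNth_apply_same]
  · rw [Fin.insertNth_apply_succAbove, Fin.insertNth_apply_succAbove]

/-- The multilinear map which is obtained by fixing one of the vectors of generators. -/
noncomputable def vecOpInsert {n p : ℕ} (o : O.obj (p + 1)) (i : Fin (p + 1)) (a : FormGen n → R) :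
    MultilinearMap R (fun _ : Fin p => FormGen n → R) (O.omega n) where
  toFun v := vecOp o (i.insertNth (α := fun _ => FormGen n → R) a v)
  map_update_add' := by
    intro inst v k x y
    obtain rfl := Subsingleton.elim inst (instDecidableEqFin p)
    rw [Fin.insertNth_update, Fin.insertNth_update, Fin.insertNth_update,
      MultilinearMap.map_update_add]
  map_update_smul' := by
    intro inst v k c x
    obtain rfl := Subsingleton.elim inst (instDecidableEqFin p)
    rw [Fin.insertNth_update, Fin.insertNth_update, MultilinearMap.map_update_smul]

theorem vecOpInsert_apply {n p : ℕ} (o : O.obj (p + 1)) (i : Fin (p + 1)) (a : FormGen n → R)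
    (v : Fin p → FormGen n → R) :
    vecOpInsert o i a v = O.vecCls (i.insertNth (α := fun _ => FormGen n → R) a v) o :=
  vecOp_apply _ _

theorem multilinear_ext' {n p : ℕ} {M : Type*} [AddCommGroup M] [Module R M]
    {f g : MultilinearMap R (fun _ : Fin p => FormGen n → R) M}
    (h : ∀ w : Fin p → FormGen n, f (fun i => Pi.single (w i) 1) = g fun i => Pi.single (w i) 1) :
    f = g := MultilinearMap.ext fun v => by
  rw [f.map_eq_sum_single, g.map_eq_sum_single]
  exact Finset.sum_congr rfl fun w _ => by rw [h]

/-- The relation `∑ xᵢ = 1₀`. -/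
theorem vecCls_insertNth_unitVec {n p : ℕ} (i : Fin (p + 1)) (v : Fin p → FormGen n → R)
    (o : O.obj (p + 1)) :
    O.vecCls (i.insertNth (α := fun _ => FormGen n → R) (unitVec R n) v) o =
      O.vecCls v (O.plugPt i o) := by
  have h : vecOpInsert o i (unitVec R n) = vecOp (O.plugPt i o) := multilinear_ext' fun w => by
    rw [vecOpInsert_apply, vecOp_apply, vecCls_single, ← sum_single_inl, ← vecCls_sum_insertNth,
      ← sum_cls_inl]
    refine Finset.sum_congr rfl fun j _ => ?_
    rw [← single_insertNth, vecCls_single]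
  rw [← vecOpInsert_apply, h, vecOp_apply]

/-- The relation `∑ dxᵢ = 0`. -/
theorem vecCls_insertNth_dUnitVec {n p : ℕ} (i : Fin (p + 1)) (v : Fin p → FormGen n → R)
    (o : O.obj (p + 1)) :
    O.vecCls (i.insertNth (α := fun _ => FormGen n → R) (dVec R n (unitVec R n)) v) o = 0 := by
  have h : vecOpInsert o i (dVec R n (unitVec R n)) = 0 := multilinear_ext' fun w => by
    rw [vecOpInsert_apply, ← sum_single_inr, ← vecCls_sum_insertNth,
      zero_apply, ← sum_cls_inr i w o]
    refine Finset.sum_congr rfl fun j _ => ?_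
    rw [← single_insertNth, vecCls_single]
  rw [← vecOpInsert_apply, h, zero_apply]

theorem vecCls_update_dUnitVec {n p : ℕ} (i : Fin p) (v : Fin p → FormGen n → R) (o : O.obj p) :
    O.vecCls (Function.update v i (dVec R n (unitVec R n))) o = 0 := by
  obtain ⟨p, rfl⟩ : ∃ p', p = p' + 1 := ⟨p - 1, by have := i.2; omega⟩
  rw [← Fin.insertNth_removeNth, vecCls_insertNth_dUnitVec]

variable (O) in
/-- The augmentation, with values in `R`. -/
def augBase (p : ℕ) : O.obj p →ₗ[R] R := (O.aug.app p).toLin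

theorem augBase_plugPt {p : ℕ} (i : Fin (p + 1)) (o : O.obj (p + 1)) :
    O.augBase p (O.plugPt i o) = O.augBase (p + 1) o := by
  have h : O.augBase p (O.plugPt i o) = O.augBase (p + 1) o * O.augBase 0 O.pt :=
    O.aug.map_circ _ _ _ _
  rw [h, show O.augBase 0 O.pt = 1 from O.aug_pt, mul_one]

/-- The evaluation of an operation at units. -/
theorem vecCls_unitVec {n p : ℕ} (o : O.obj p) :
    O.vecCls (fun _ => unitVec R n) o = O.augBase p o • O.cls (fun i : Fin 0 => i.elim0) O.pt := by
  induction p with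
  | zero =>
    have h : o = O.augBase 0 o • O.pt := by
      apply O.aug_zero.1
      rw [map_smul, aug_pt]
      exact (mul_one (M := R) _).symm
    rw [← map_smul, ← h, ← vecCls_single]
    congr 2
    exact Subsingleton.elim _ _
  | succ p ih =>
    have h1 : (fun _ : Fin (p + 1) => unitVec R n) =
        (0 : Fin (p + 1)).insertNth (α := fun _ => FormGen n → R) (unitVec R n)
          fun _ => unitVec R n := by
      funext k
      rcases Fin.eq_self_or_eq_succAbove 0 k with rfl | ⟨k, rfl⟩
      · rw [Fin.insertNth_apply_same]
      · rw [Fin.insertNth_apply_succAbove]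
    rw [h1, vecCls_insertNth_unitVec, ih, augBase_plugPt]

theorem cls_d {n p : ℕ} (w : Fin p → FormGen n) {k : ℤ} {o : O.obj p} (ho : o ∈ (O.obj p).gr k) :
    (O.omega n).d (O.cls w o) = O.cls w ((O.obj p).d o) +
      ∑ i, (k + ∑ j with j < i, (w j).deg).negOnePow •
        O.vecCls (Function.update (fun i => Pi.single (w i) 1) i
          (dVec R n (Pi.single (w i) 1))) o := by
  have h : (O.omega n).d (O.cls w o) = O.omegaMk n (O.dSum n (O.word w o)) := rfl
  rw [h, dSum_word, map_add, map_sum]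
  congr 1
  refine Finset.sum_congr rfl fun i _ => ?_
  rcases hw : w i with j | j
  · have h1 : Function.update (fun i => (Pi.single (w i) 1 : FormGen n → R)) i
        (Pi.single (.inr j) 1) = fun k => Pi.single (Function.update w i (.inr j) k) 1 := by
      funext k
      by_cases hk : k = i
      · subst hk; simp
      · simp [hk]
    rw [O.dLetter_inl hw, DGModule.sgn_apply _ ho, dVec_inl, h1, vecCls_single,
      LinearMap.map_intUnit_smul, LinearMap.map_intUnit_smul, LinearMap.map_intUnit_smul, smul_smul,
      add_comm k, Int.negOnePow_add]
    rfl
  · rw [O.dLetter_inr hw, dVec_inr, map_zero, ← vecOp_apply, MultilinearMap.map_update_zero,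
    smul_zero]

theorem vecCls_d {n p : ℕ} {v : Fin p → FormGen n → R} {q : Fin p → ℤ}
    (hv : ∀ i, IsHomogeneous (q i) (v i)) {k : ℤ} {o : O.obj p} (ho : o ∈ (O.obj p).gr k) :
    (O.omega n).d (O.vecCls v o) = O.vecCls v ((O.obj p).d o) +
      ∑ i, (k + ∑ j with j < i, q j).negOnePow •
        O.vecCls (Function.update v i (dVec R n (v i))) o := by
  let D : Fin p → MultilinearMap R (fun _ : Fin p => FormGen n → R) (O.omega n) := fun i =>
    (vecOp o).compLinearMap (Function.update (fun _ => LinearMap.id) i (dVec R n))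
  have hD : ∀ i v, D i v = O.vecCls (Function.update v i (dVec R n (v i))) o := fun i v => by
    rw [MultilinearMap.compLinearMap_apply, vecOp_apply]
    congr 1
    congr 1
    funext j
    by_cases hj : j = i
    · subst hj; simp
    · simp [hj]
  have h := FormGen.multilinear_ext (f := (O.omega n).d.compMultilinearMap (vecOp o))
    (g := vecOp ((O.obj p).d o) + ∑ i, (k + ∑ j with j < i, q j).negOnePow • D i) (q := q)
    (fun w hw => ?_) hv
  · rw [LinearMap.compMultilinearMap_apply, vecOp_apply] at h
    rw [h]
    simp only [add_apply, sum_apply, smul_apply, vecOp_apply, hD]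
  · rw [LinearMap.compMultilinearMap_apply, vecOp_apply, vecCls_single, cls_d w ho]
    simp only [add_apply, sum_apply, smul_apply, vecOp_apply, hD, vecCls_single, hw]

theorem pull_cls {m n p : ℕ} (f : Fin (m + 1) → Fin (n + 1)) (w : Fin p → FormGen n) (o : O.obj p) :
    (O.omegaPull f).toLin (O.cls w o) =
      ∑ v : Fin p → FormGen m with Sum.map f f ∘ v = w, O.cls v o := by
  have h : (O.omegaPull f).toLin (O.cls w o) = O.omegaMk m (O.pullSum f (O.word w o)) := rfl
  rw [h, pullSum_word, map_sum]
  rfl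

theorem pull_vecCls {m n p : ℕ} (f : Fin (m + 1) → Fin (n + 1)) (v : Fin p → FormGen n → R)
    (o : O.obj p) : (O.omegaPull f).toLin (O.vecCls v o) =
      O.vecCls (fun i => v i ∘ Sum.map f f) o := by
  rw [vecCls_apply, vecCls_apply, map_sum, ← Finset.sum_fiberwise Finset.univ
    (fun w : Fin p → FormGen m => Sum.map f f ∘ w)]
  refine Finset.sum_congr rfl fun w _ => ?_
  rw [map_smul, pull_cls, Finset.smul_sum]
  refine Finset.sum_congr rfl fun w' hw' => ?_
  rw [← (Finset.mem_filter.1 hw').2]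
  rfl

end UAOperad

/-! ### Evaluations, unit and partition of unity -/

namespace UAOperad

open FormGen

variable {R : Type u} [CommRing R] (O : UAOperad R)

/-- The unit of `Ω_n`. -/
noncomputable def omegaUnit (n : ℕ) : O.omega n := O.cls (fun i : Fin 0 => i.elim0) O.pt

theorem omegaUnit_mem (n : ℕ) : O.omegaUnit n ∈ (O.omega n).gr 0 := by
  have h := cls_mem (fun i : Fin 0 => (i.elim0 : FormGen n)) O.pt_gr
  rw [Fin.sum_univ_zero, add_zero] at h
  exact h

theorem omegaUnit_d (n : ℕ) : (O.omega n).d (O.omegaUnit n) = 0 := by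
  rw [omegaUnit, cls_d _ O.pt_gr, O.pt_d, map_zero, Fin.sum_univ_zero, add_zero]

theorem pull_omegaUnit {m n : ℕ} (f : Fin (m + 1) → Fin (n + 1)) :
    (O.omegaPull f).toLin (O.omegaUnit n) = O.omegaUnit m := by
  have h : ∀ n, O.omegaUnit n = O.vecCls (fun i : Fin 0 =>
    (i.elim0 : FormGen n → R)) O.pt := fun n => by
    rw [omegaUnit, ← vecCls_single]
    congr 2
    exact Subsingleton.elim _ _
  rw [h, h, pull_vecCls]
  congr 2
  exact Subsingleton.elim _ _

variable {O} in
theorem augBase_of_ne {p : ℕ} {k : ℤ} {o : O.obj p} (ho : o ∈ (O.obj p).gr k) (hk : k ≠ 0) :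
    O.augBase p o = 0 := (mem_baseGr (R := R)).1 ((O.aug.app p).map_gr ho) hk

theorem augBase_d {p : ℕ} (o : O.obj p) : O.augBase p ((O.obj p).d o) = 0 := (O.aug.app p).map_d o

theorem augBase_act {p : ℕ} (σ : Equiv.Perm (Fin p)) (o : O.obj p) :
    O.augBase p (O.act σ o) = O.augBase p o := O.aug.map_act σ o

variable (R) in
/-- The values of the generators at the `v`-th vertex. -/
def evGen {n : ℕ} (v : Fin (n + 1)) : FormGen n → R := Pi.single (.inl v) 1

theorem prod_evGen_of_deg {n p : ℕ} (v : Fin (n + 1)) {w : Fin p → FormGen n}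
    (h : ¬ ∀ i, (w i).deg = 0) : ∏ i, evGen R v (w i) = 0 := by
  push Not at h
  obtain ⟨i, hi⟩ := h
  exact Finset.prod_eq_zero (Finset.mem_univ i) (isHomogeneous_single (R := R) (.inl v) _ hi)

/-- The values of representatives at the `v`-th vertex. -/
noncomputable def evSum {n : ℕ} (v : Fin (n + 1)) : O.FormSum n →ₗ[R] R :=
  wordLift fun p w => (∏ i, evGen R v (w i)) • O.augBase p

theorem evSum_word {n p : ℕ} (v : Fin (n + 1)) (w : Fin p → FormGen n) (o : O.obj p) :
    O.evSum v (O.word w o) = (∏ i, evGen R v (w i)) * O.augBase p o := by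
  rw [evSum, wordLift_word]
  rfl

theorem evSum_rel {n : ℕ} (v : Fin (n + 1)) : O.formRel n ≤ LinearMap.ker (O.evSum v) := by
  refine O.formRel_le (fun p σ w o => ?_) (fun p i w o => ?_) (fun p i w o => ?_)
  · rw [LinearMap.mem_ker, relAct_apply, map_sub, LinearMap.map_intUnit_smul, evSum_word,
    evSum_word,
      augBase_act]
    have h1 : ∏ i, evGen R v ((w ∘ σ.symm) i) = ∏ i, evGen R v (w i) :=
      Equiv.prod_comp σ.symm fun i => evGen R v (w i)
    rw [h1]
    by_cases h : ∀ i, (w i).deg = 0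
    · have : koszulSign σ (fun i => (w i).deg) = 1 := by
        simp [koszulSign, h]
      rw [this, one_smul, sub_self]
    · rw [prod_evGen_of_deg v h, zero_mul, smul_zero, sub_self]
  · rw [LinearMap.mem_ker, relSum_apply, map_sub, map_sum, evSum_word, augBase_plugPt]
    simp only [evSum_word]
    rw [← Finset.sum_mul, ← sub_mul]
    simp only [Fin.prod_univ_succAbove _ i, Fin.insertNth_apply_same, Fin.insertNth_apply_succAbove]
    rw [← Finset.sum_mul]
    have : ∑ j : Fin (n + 1), evGen R v (.inl j) = 1 := by
      simp [evGen, Pi.single_apply]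
    rw [this, one_mul, sub_self, zero_mul]
  · rw [LinearMap.mem_ker, relDSum_apply, map_sum]
    refine Finset.sum_eq_zero fun j _ => ?_
    rw [evSum_word, prod_evGen_of_deg, zero_mul]
    intro h
    have := h i
    rw [Fin.insertNth_apply_same] at this
    exact absurd this (by simp [FormGen.deg])

/-- The evaluation of forms at the `v`-th vertex. -/
noncomputable def omegaEv {n : ℕ} (v : Fin (n + 1)) : O.omega n →ₗ[R] R :=
  O.omegaLift (O.evSum v) (O.evSum_rel v)

theorem omegaEv_cls {n p : ℕ} (v : Fin (n + 1)) (w : Fin p → FormGen n) (o : O.obj p) :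
    O.omegaEv v (O.cls w o) = (∏ i, evGen R v (w i)) * O.augBase p o :=
  (O.omegaLift_cls _ _ w o).trans (O.evSum_word v w o)

theorem omegaEv_of_ne {n : ℕ} (v : Fin (n + 1)) {k : ℤ} {x : O.omega n} (hx : x ∈ (O.omega n).gr k)
    (hk : k ≠ 0) : O.omegaEv v x = 0 := by
  refine omega_gr_le (S := LinearMap.ker (O.omegaEv v)) (fun p w o ho => ?_) hx
  rw [LinearMap.mem_ker, omegaEv_cls]
  by_cases h : ∀ i, (w i).deg = 0
  · have h1 : FormWord.deg ⟨p, w⟩ = 0 := Finset.sum_eq_zero fun i _ => h i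
    rw [h1, sub_zero] at ho
    rw [augBase_of_ne ho hk, mul_zero]
  · rw [prod_evGen_of_deg v h, zero_mul]

theorem omegaEv_vecCls {n p : ℕ} (v : Fin (n + 1)) (a : Fin p → FormGen n → R) (o : O.obj p) :
    O.omegaEv v (O.vecCls a o) = (∏ i, a i (.inl v)) * O.augBase p o := by
  rw [vecCls_apply, map_sum]
  simp only [map_smul, omegaEv_cls, smul_eq_mul, ← mul_assoc, ← Finset.prod_mul_distrib]
  have h := Finset.prod_univ_sum (fun _ : Fin p => (Finset.univ : Finset (FormGen n)))
    fun i g => a i g * evGen R v g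
  rw [Fintype.piFinset_univ] at h
  rw [← Finset.sum_mul, ← h]
  simp [evGen, Pi.single_apply]

theorem omegaEv_d {n : ℕ} (v : Fin (n + 1)) (x : O.omega n) :
    O.omegaEv v ((O.omega n).d x) = 0 := by
  refine omega_hom_ext (f := O.omegaEv v ∘ₗ (O.omega n).d) (g := 0) (fun p w k o ho => ?_) x
  rw [LinearMap.comp_apply, cls_d w ho, map_add, map_sum, omegaEv_cls, augBase_d, mul_zero,
    zero_add]
  refine Finset.sum_eq_zero fun i _ => ?_
  rw [LinearMap.map_intUnit_smul, omegaEv_vecCls, Finset.prod_eq_zero (Finset.mem_univ i), zero_mul,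
    smul_zero]
  rw [Function.update_self]
  rfl

theorem omegaEv_unit {n : ℕ} (v : Fin (n + 1)) : O.omegaEv v (O.omegaUnit n) = 1 := by
  rw [omegaUnit, omegaEv_cls, Finset.univ_eq_empty, Finset.prod_empty, one_mul]
  exact O.aug_pt

theorem single_comp_map {m n : ℕ} (f : Fin (m + 1) → Fin (n + 1)) (g : FormGen n)
    (v : Fin (m + 1)) :
    ((Pi.single g 1 : FormGen n → R) ∘ Sum.map f f) (.inl v) = evGen R (f v) g := by
  rw [Function.comp_apply, evGen, Pi.single_apply, Pi.single_apply]
  exact if_congr eq_comm rfl rfl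

theorem omegaEv_pull {m n : ℕ} (f : Fin (m + 1) → Fin (n + 1)) (v : Fin (m + 1)) (x : O.omega n) :
    O.omegaEv v ((O.omegaPull f).toLin x) = O.omegaEv (f v) x := by
  refine omega_hom_ext (f := O.omegaEv v ∘ₗ (O.omegaPull f).toLin) (g := O.omegaEv (f v))
    (fun p w k o ho => ?_) x
  rw [LinearMap.comp_apply, ← vecCls_single, pull_vecCls, omegaEv_vecCls, vecCls_single,
    omegaEv_cls]
  simp only [single_comp_map]

/-- The forms on the `0`-simplex are the multiples of the unit, as `x₀ = 1₀` and `dx₀ = 0`. -/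
theorem eq_omegaUnit (x : O.omega 0) : x = O.omegaEv 0 x • O.omegaUnit 0 := by
  refine omega_hom_ext (f := LinearMap.id) (g := (O.omegaEv 0).smulRight (O.omegaUnit 0))
    (fun p w k o ho => ?_) x
  rw [LinearMap.id_apply, LinearMap.smulRight_apply, omegaEv_cls]
  by_cases h : ∀ i, w i = .inl 0
  · have h1 : w = fun _ => .inl 0 := funext h
    have h2 : (fun i => (Pi.single (w i) 1 : FormGen 0 → R)) = fun _ => unitVec R 0 := by
      rw [h1]
      funext _
      rw [← sum_single_inl]
      exact (Fin.sum_univ_one fun j : Fin 1 => (Pi.single (.inl j) 1 : FormGen 0 → R)).symm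
    rw [← vecCls_single, h2, vecCls_unitVec, h1]
    simp [evGen, omegaUnit]
  · push Not at h
    obtain ⟨i, hi⟩ := h
    have h1 : w i = .inr 0 := by
      rcases h2 : w i with j | j
      · exact absurd (h2.trans (by rw [Fin.fin_one_eq_zero j])) hi
      · rw [Fin.fin_one_eq_zero j]
    rw [Finset.prod_eq_zero (Finset.mem_univ i) (by rw [h1]; simp [evGen]), zero_mul, zero_smul,
      ← vecCls_single, ← Function.update_eq_self i fun i => (Pi.single (w i) 1 : FormGen 0 → R), h1]
    have h3 : (Pi.single (.inr 0) 1 : FormGen 0 → R) = dVec R 0 (unitVec R 0) := by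
      rw [← sum_single_inr]
      exact (Fin.sum_univ_one fun j : Fin 1 => (Pi.single (.inr j) 1 : FormGen 0 → R)).symm
    rw [h3, vecCls_update_dUnitVec]

/-- The forms which are spanned by words with at most `N` letters `dxᵢ`. -/
noncomputable def omegaW (n N : ℕ) : Submodule R (O.omega n) :=
  Submodule.span R {x | ∃ (p : ℕ) (w : Fin p → FormGen n) (o : O.obj p),
    ∑ i, (w i).deg ≤ (N : ℤ) ∧ x = O.cls w o}

theorem exists_mem_omegaW {n : ℕ} (x : O.omega n) : ∃ N, x ∈ O.omegaW n N := by
  have hmono : ∀ {N M : ℕ}, N ≤ M → O.omegaW n N ≤ O.omegaW n M := fun hNM =>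
    Submodule.span_mono fun x ⟨p, w, o, hw, hx⟩ => ⟨p, w, o, hw.trans (by exact_mod_cast hNM), hx⟩
  let S : Submodule R (O.omega n) :=
    { carrier := {x | ∃ N, x ∈ O.omegaW n N}
      zero_mem' := ⟨0, Submodule.zero_mem _⟩
      add_mem' := fun ⟨N, hN⟩ ⟨M, hM⟩ => ⟨max N M, Submodule.add_mem _
        (hmono (le_max_left _ _) hN) (hmono (le_max_right _ _) hM)⟩
      smul_mem' := fun c _ ⟨N, hN⟩ => ⟨N, Submodule.smul_mem _ c hN⟩ }
  obtain ⟨t, rfl⟩ := O.omegaMk_surjective n x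
  refine O.formSum_induction (S := S.comap (O.omegaMk n)) (fun p w k o _ => ?_) t
  exact ⟨(∑ i, (w i).deg).toNat, Submodule.subset_span ⟨p, w, o, Int.self_le_toNat _, rfl⟩⟩

theorem omegaUnit_mem_W (n : ℕ) : O.omegaUnit n ∈ O.omegaW n 0 :=
  Submodule.subset_span ⟨0, _, _, by simp, rfl⟩

variable {O}

theorem vecCls_mem_W {n p N : ℕ} {v : Fin p → FormGen n → R} {q : Fin p → ℤ}
    (hv : ∀ i, IsHomogeneous (q i) (v i)) (hq : ∑ i, q i ≤ (N : ℤ)) (o : O.obj p) :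
    O.vecCls v o ∈ O.omegaW n N := by
  rw [vecCls_apply]
  refine Submodule.sum_mem _ fun w _ => ?_
  by_cases hw : ∀ i, (w i).deg = q i
  · exact Submodule.smul_mem _ _ (Submodule.subset_span
      ⟨p, w, o, by rwa [Finset.sum_congr rfl fun i _ => hw i], rfl⟩)
  · rw [IsHomogeneous.prod_eq_zero hv hw, zero_smul]
    exact Submodule.zero_mem _

theorem vecCls_eq_zero {n p : ℕ} {v : Fin p → FormGen n → R} {q : Fin p → ℤ}
    (hv : ∀ i, IsHomogeneous (q i) (v i)) (hq : ∑ i, q i < 0) (o : O.obj p) :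
    O.vecCls v o = 0 := by
  rw [vecCls_apply]
  refine Finset.sum_eq_zero fun w _ => ?_
  rw [IsHomogeneous.prod_eq_zero hv, zero_smul]
  intro hw
  rw [← Finset.sum_congr rfl fun i _ => hw i] at hq
  refine absurd (Finset.sum_nonneg fun i _ => ?_) (not_le.2 hq)
  rcases w i with j | j <;> simp [FormGen.deg]

section Mul

variable (μ : O.obj 2)

/-- The product with the generator `x_v` on representatives, for a choice of a binary operation. -/
noncomputable def mulSum {n : ℕ} (v : Fin (n + 1)) : O.FormSum n →ₗ[R] O.omega n :=
  wordLift fun p w => O.cls ((Fin.last p).insertNth (α := fun _ => FormGen n) (.inl v) w) ∘ₗ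
    O.circ (by omega) 0 μ

theorem mulSum_word {n p : ℕ} (v : Fin (n + 1)) (w : Fin p → FormGen n) (o : O.obj p) :
    mulSum μ v (O.word w o) = O.cls ((Fin.last p).insertNth (α := fun _ => FormGen n) (.inl v) w)
      (O.circ (by omega) 0 μ o) := by
  rw [mulSum, wordLift_word]
  rfl

theorem innerSlot_two {p : ℕ} (h : 2 + p = p + 1 + 1) (k : Fin p) :
    innerSlot h 0 k = (Fin.last p).succAbove k := by
  rw [Fin.succAbove_last]
  exact Fin.ext (by simp [innerSlot])

theorem outerSlot_two {p : ℕ} (h : 2 + p = p + 1 + 1) (j : Fin 2) (hj : j ≠ 0) :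
    outerSlot h 0 j hj = Fin.last p := by
  obtain rfl : j = 1 := by omega
  exact Fin.ext (by simp [outerSlot])

/-- The extension of a permutation by a fixed last element. -/
def extendPerm {p : ℕ} (σ : Equiv.Perm (Fin p)) : Equiv.Perm (Fin (p + 1)) :=
  (finSuccEquivLast.symm.permCongr) σ.optionCongr

theorem extendPerm_last {p : ℕ} (σ : Equiv.Perm (Fin p)) :
    extendPerm σ (Fin.last p) = Fin.last p := by
  simp [extendPerm, Equiv.permCongr_apply]

theorem extendPerm_castSucc {p : ℕ} (σ : Equiv.Perm (Fin p)) (k : Fin p) :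
    extendPerm σ k.castSucc = (σ k).castSucc := by
  simp [extendPerm, Equiv.permCongr_apply]

theorem insertNth_comp_extendPerm {p : ℕ} {α : Type*} (σ : Equiv.Perm (Fin p)) (x : α)
    (w : Fin p → α) : (Fin.last p).insertNth (α := fun _ => α) x w ∘ (extendPerm σ).symm =
      (Fin.last p).insertNth (α := fun _ => α) x (w ∘ σ.symm) := by
  rw [← Equiv.eq_comp_symm, Equiv.symm_symm]
  funext k
  induction k using Fin.lastCases with
  | last => rw [Function.comp_apply, extendPerm_last, Fin.insertNth_apply_same,
    Fin.insertNth_apply_same]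
  | cast k =>
    rw [Function.comp_apply, extendPerm_castSucc, ← Fin.succAbove_last,
      Fin.insertNth_apply_succAbove,
      Fin.insertNth_apply_succAbove, Function.comp_apply, Equiv.symm_apply_apply]

theorem koszulSign_extendPerm {p : ℕ} (σ : Equiv.Perm (Fin p)) (q : Fin (p + 1) → ℤ)
    (hq : q (Fin.last p) = 0) :
    koszulSign (extendPerm σ) q = koszulSign σ fun k => q k.castSucc := by
  rw [koszulSign, koszulSign, Fin.sum_univ_castSucc]
  simp only [Fin.sum_univ_castSucc (n := p), extendPerm_castSucc, hq, mul_zero, zero_mul, ite_self,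
    Finset.sum_const_zero, add_zero, Fin.castSucc_lt_castSucc_iff]

theorem insertNth_last_insertNth {p : ℕ} {α : Type*} (i : Fin (p + 1)) (x y : α) (w : Fin p → α) :
    (Fin.last (p + 1)).insertNth (α := fun _ => α) y (i.insertNth (α := fun _ => α) x w) =
      i.castSucc.insertNth (α := fun _ => α) x ((Fin.last p).insertNth (α := fun _ => α) y w) := by
  rw [Fin.eq_insertNth_iff, Fin.eq_insertNth_iff]
  refine ⟨?_, ?_, ?_⟩
  · rw [← Fin.succAbove_last, Fin.insertNth_apply_succAbove, Fin.insertNth_apply_same]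
  · have h : i.castSucc.succAbove (Fin.last p) = Fin.last (p + 1) := by
      rw [Fin.succAbove_of_le_castSucc _ _ (Fin.castSucc_le_castSucc_iff.2 (Fin.le_last i)),
        Fin.succ_last]
    rw [Fin.removeNth, h, Fin.insertNth_apply_same]
  · funext k
    have h : i.castSucc.succAbove ((Fin.last p).succAbove k) =
        (Fin.last (p + 1)).succAbove (i.succAbove k) := by
      rw [Fin.succAbove_last, Fin.succAbove_last, Fin.castSucc_succAbove_castSucc]
    rw [Fin.removeNth, Fin.removeNth, h, Fin.insertNth_apply_succAbove,
      Fin.insertNth_apply_succAbove]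

/-- Plugging the point into an input of `μ ∘₁ o` other than the last one amounts to plugging it
into the corresponding input of `o`. -/
theorem plugPt_circ {p : ℕ} (i : Fin (p + 1)) (h : 2 + (p + 1) = p + 1 + 1 + 1)
    (h' : 2 + p = p + 1 + 1)
    (o : O.obj (p + 1)) :
    O.plugPt i.castSucc (O.circ h 0 μ o) = O.circ h' 0 μ (O.plugPt i o) := by
  have h1 := O.circ_seq (n := p + 1) (r := 0) (b := p) h rfl rfl h' 0 i μ o O.pt
  rw [innerSlot_two, Fin.succAbove_last] at h1
  exact h1

theorem mulSum_rel {n : ℕ} (v : Fin (n + 1)) : O.formRel n ≤ LinearMap.ker (mulSum μ v) := by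
  refine O.formRel_le (fun p σ w o => ?_) (fun p i w o => ?_) (fun p i w o => ?_)
  · rw [LinearMap.mem_ker, relAct_apply, map_sub, LinearMap.map_intUnit_smul, mulSum_word,
      mulSum_word, sub_eq_zero]
    have h1 := O.circ_act (n := p) (l := p + 1) (by omega) 0 1 σ (extendPerm σ)
      (fun j hj => by
        rw [outerSlot_two _ _ hj, extendPerm_last]
        exact (outerSlot_two _ _ hj).symm)
      (fun k => by
        rw [Equiv.Perm.one_apply, innerSlot_two, innerSlot_two, Fin.succAbove_last,
          extendPerm_castSucc]) μ o
    rw [O.act_one, Equiv.Perm.one_apply] at h1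
    rw [h1, cls_act, insertNth_comp_extendPerm, koszulSign_extendPerm _ _ (by
      rw [Fin.insertNth_apply_same]; rfl)]
    simp only [← Fin.succAbove_last_apply, Fin.insertNth_apply_succAbove]
  · rw [LinearMap.mem_ker, relSum_apply, map_sub, map_sum, sub_eq_zero, mulSum_word]
    simp only [mulSum_word, insertNth_last_insertNth]
    rw [sum_cls_inl, plugPt_circ]
  · rw [LinearMap.mem_ker, relDSum_apply, map_sum]
    simp only [mulSum_word, insertNth_last_insertNth]
    rw [sum_cls_inr]

/-- The product with the generator `x_v`, for a choice of a binary operation. -/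
noncomputable def omegaMul {n : ℕ} (v : Fin (n + 1)) : O.omega n →ₗ[R] O.omega n :=
  O.omegaLift (mulSum μ v) (mulSum_rel μ v)

theorem omegaMul_cls {n p : ℕ} (v : Fin (n + 1)) (w : Fin p → FormGen n) (o : O.obj p) :
    omegaMul μ v (O.cls w o) = O.cls ((Fin.last p).insertNth (α := fun _ => FormGen n) (.inl v) w)
      (O.circ (by omega) 0 μ o) :=
  (O.omegaLift_cls _ _ w o).trans (mulSum_word μ v w o)

theorem omegaMul_mem (hμ : μ ∈ (O.obj 2).gr 0) {n : ℕ} (v : Fin (n + 1)) {k : ℤ} {x : O.omega n}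
    (hx : x ∈ (O.omega n).gr k) : omegaMul μ v x ∈ (O.omega n).gr k := by
  refine omega_gr_le (S := ((O.omega n).gr k).comap (omegaMul μ v)) (fun p w o ho => ?_) hx
  rw [Submodule.mem_comap, omegaMul_cls]
  have h := cls_mem ((Fin.last p).insertNth (α := fun _ => FormGen n) (.inl v) w)
    (O.circ_gr (n := p) (l := p + 1) (by omega) 0 hμ ho)
  have h1 := deg_insertNth (Fin.last p) (.inl v) w
  simp only [FormWord.deg] at h1 h
  rw [h1] at h
  simpa [FormGen.deg] using h

theorem sum_map_inl {m n : ℕ} {P : Type u} [AddCommGroup P] (f : Fin (m + 1) → Fin (n + 1))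
    (v : Fin (n + 1)) (F : FormGen m → P) :
    ∑ c : FormGen m with Sum.map f f c = .inl v, F c = ∑ a with f a = v, F (.inl a) := by
  simp [Finset.sum_filter, Fintype.sum_sum_type]

theorem pull_omegaMul {m n : ℕ} (f : Fin (m + 1) → Fin (n + 1)) (v : Fin (n + 1)) (x : O.omega n) :
    (O.omegaPull f).toLin (omegaMul μ v x) =
      ∑ w with f w = v, omegaMul μ w ((O.omegaPull f).toLin x) := by
  have h := omega_hom_ext (f := (O.omegaPull f).toLin ∘ₗ omegaMul μ v)
    (g := ∑ w with f w = v, omegaMul μ w ∘ₗ (O.omegaPull f).toLin) (fun p w k o ho => ?_) x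
  · rw [LinearMap.comp_apply] at h
    rw [h, LinearMap.sum_apply]
    rfl
  · rw [LinearMap.comp_apply, omegaMul_cls, pull_cls, LinearMap.sum_apply, sum_over_insertNth]
    simp only [LinearMap.comp_apply, pull_cls, map_sum, omegaMul_cls, sum_map_inl]
    exact Finset.sum_comm

/-- The operators `omegaMul μ v` sum to the identity: by `∑ x_v = 1₀` their sum is given by the
composition with `μ ∘₂ 1₀`, which is the unit of the operad as its augmentation is `1`. -/
theorem sum_omegaMul (hμ : O.augBase 2 μ = 1) {n : ℕ} (x : O.omega n) :
    ∑ v, omegaMul μ v x = x := by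
  have h := omega_hom_ext (f := ∑ v, omegaMul μ v) (g := LinearMap.id) (fun p w k o ho => ?_) x
  · rw [LinearMap.sum_apply] at h
    exact h
  · simp only [LinearMap.sum_apply, omegaMul_cls, LinearMap.id_apply]
    rw [sum_cls_inl]
    congr 1
    have h1 := O.circ_par (n := p) (r := 0) (a := p + 1) (b := 1) (l := p) (by omega) rfl rfl
      (by omega) 0 1 (by simp) μ ho O.pt_gr
    rw [outerSlot_two, mul_zero, Int.negOnePow_zero, one_smul] at h1
    have h2 : O.circ (m := 2) (n := 0) (l := 1) rfl 1 μ O.pt = O.one := by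
      apply O.aug_one.1
      rw [O.aug.map_circ, O.aug.map_one, aug_pt]
      exact (mul_one (M := R) _).trans hμ
    rw [plugPt, LinearMap.flip_apply, h1, h2, Subsingleton.elim (outerSlot _ _ _ _) 0, O.one_circ]

end Mul

end UAOperad

/-! ### Signs of the evaluation on paths -/

/-- The exponent of the sign which arises when a matrix of operations with column index `dt` and row
index `c` is applied to elements of total degrees `q`: the coefficients in the forms are moved past
the interval cochains of degrees `c`. -/
def pathExp {p : ℕ} (q c : Fin p → ℤ) : ℤ :=
  (1 + ∑ k, c k) * (∑ k, q k + ∑ k, c k) + ∑ k, prefixSum c k.val * (q k - c k)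

theorem sum_filter_lt_eq_prefixSum {p : ℕ} (q : Fin p → ℤ) (i : Fin p) :
    ∑ j with j < i, q j = prefixSum q i.val := rfl

theorem sum_mul_update_add {p : ℕ} (x q : Fin p → ℤ) (i : Fin p) (a : ℤ) :
    ∑ k, x k * Function.update q i (q i + a) k = ∑ k, x k * q k + x i * a := by
  rw [Fintype.sum_eq_add_sum_compl i, Fintype.sum_eq_add_sum_compl i, Function.update_self,
    Finset.sum_congr rfl fun k hk => by rw [Function.update_of_ne (by simpa using hk)]]
  ring

theorem sum_update_add {p : ℕ} (q : Fin p → ℤ) (i : Fin p) (a : ℤ) :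
    ∑ k, Function.update q i (q i + a) k = ∑ k, q k + a := by
  simpa using sum_mul_update_add 1 q i a

theorem prefixSum_update_add {p : ℕ} (q : Fin p → ℤ) (i : Fin p) (a : ℤ) (k : ℕ) :
    prefixSum (Function.update q i (q i + a)) k = prefixSum q k + if i.val < k then a else 0 := by
  have h := sum_mul_update_add (fun j : Fin p => if j.val < k then 1 else 0) q i a
  simp only [ite_mul, one_mul, zero_mul] at h
  rw [prefixSum_eq, prefixSum_eq, h]

theorem pathExp_update_left {p : ℕ} (q c : Fin p → ℤ) (i : Fin p) :
    pathExp (Function.update q i (q i + 1)) c = pathExp q c +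
      (1 + ∑ k, c k) + prefixSum c i.val := by
  have h1 : ∀ k, prefixSum c k.val * (Function.update q i (q i + 1) k - c k) =
      prefixSum c k.val * Function.update q i (q i + 1) k - prefixSum c k.val * c k :=
    fun k => mul_sub _ _ _
  have h2 : ∀ k, prefixSum c k.val * (q k - c k) =
      prefixSum c k.val * q k - prefixSum c k.val * c k := fun k => mul_sub _ _ _
  rw [pathExp, pathExp, sum_update_add]
  simp only [h1, h2, Finset.sum_sub_distrib, sum_mul_update_add]
  ring

theorem sum_ite_lt {p : ℕ} (x : Fin p → ℤ) (i : Fin p) :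
    ∑ k : Fin p, (if i.val < k.val then x k else 0) = ∑ k, x k - x i - prefixSum x i.val := by
  have h : ∀ k : Fin p, x k = (if i.val < k.val then x k else 0) + (if k = i then x k else 0) +
      (if k.val < i.val then x k else 0) := fun k => by
    rcases lt_trichotomy k i with h | h | h
    · have h' := Fin.lt_def.1 h
      simp [h.ne, h', h'.not_gt]
    · simp [h]
    · have h' := Fin.lt_def.1 h
      simp [h.ne', h', h'.not_gt]
  have h2 : ∑ k, x k =
      ∑ k : Fin p, (if i.val < k.val then x k else 0) + x i + prefixSum x i.val := by
    conv_lhs => rw [Finset.sum_congr rfl fun k _ => h k]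
    rw [Finset.sum_add_distrib, Finset.sum_add_distrib, prefixSum_eq]
    simp
  rw [h2]
  ring

theorem negOnePow_pathExp_update_right {p : ℕ} (q c : Fin p → ℤ) (i : Fin p) (hi : c i = 0) :
    (pathExp q (Function.update c i 1)).negOnePow =
      (pathExp q c + prefixSum q i.val + q i + ∑ k, c k).negOnePow := by
  have h0 : Function.update c i 1 = Function.update c i (c i + 1) := by rw [hi, zero_add]
  have h1 : ∀ k : Fin p, (prefixSum c k.val + if i.val < k.val then 1 else 0) *
      (q k - Function.update c i (c i + 1) k) =
      prefixSum c k.val * q k - prefixSum c k.val * Function.update c i (c i + 1) k +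
      (if i.val < k.val then q k - c k else 0) := fun k => by
    by_cases hk : i.val < k.val
    · rw [if_pos hk, if_pos hk, Function.update_of_ne (by rintro rfl; omega)]
      ring
    · rw [if_neg hk, if_neg hk]
      ring
  have h2 : ∀ k : Fin p, prefixSum c k.val * (q k - c k) =
      prefixSum c k.val * q k - prefixSum c k.val * c k := fun k => mul_sub _ _ _
  have h3 : prefixSum (fun k => q k - c k) i.val = prefixSum q i.val - prefixSum c i.val := by
    rw [prefixSum, prefixSum, prefixSum, Finset.sum_sub_distrib]
  rw [Int.negOnePow_eq_iff, h0, pathExp, pathExp, sum_update_add]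
  simp only [prefixSum_update_add, h1, h2, Finset.sum_add_distrib, Finset.sum_sub_distrib,
    sum_mul_update_add, sum_ite_lt, h3]
  exact ⟨∑ k, q k + 1 - prefixSum q i.val - q i, by rw [hi]; ring⟩

theorem prefixSum_insertNth {p : ℕ} (i : Fin (p + 1)) (c : Fin p → ℤ) (k : Fin p) :
    prefixSum (i.insertNth (α := fun _ => ℤ) 0 c) (i.succAbove k).val = prefixSum c k.val := by
  rw [prefixSum_eq, prefixSum_eq, Fin.sum_univ_succAbove _ i]
  simp only [Fin.insertNth_apply_same, ite_self, zero_add, Fin.insertNth_apply_succAbove,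
    ← Fin.lt_def, Fin.succAbove_lt_succAbove_iff]

theorem pathExp_insertNth {p : ℕ} (i : Fin (p + 1)) (q c : Fin p → ℤ) :
    pathExp (i.insertNth (α := fun _ => ℤ) 0 q) (i.insertNth (α := fun _ => ℤ) 0 c) =
      pathExp q c := by
  simp only [pathExp, Fin.sum_univ_succAbove _ i, Fin.insertNth_apply_same,
    Fin.insertNth_apply_succAbove, prefixSum_insertNth, zero_add, sub_self, mul_zero]

theorem negOnePow_pathExp_comp_symm {p : ℕ} (σ : Equiv.Perm (Fin p)) (q c : Fin p → ℤ) :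
    (pathExp q c).negOnePow * (koszulSign σ c * koszulSign σ fun i => q i - c i) =
      koszulSign σ q * (pathExp (q ∘ σ.symm) (c ∘ σ.symm)).negOnePow := by
  have hs : ∀ x : Fin p → ℤ, ∑ k, (x ∘ σ.symm) k = ∑ k, x k := fun x =>
    Equiv.sum_comp σ.symm x
  have h1 : ∑ k, prefixSum (c ∘ σ.symm) k.val * ((q ∘ σ.symm) k - (c ∘ σ.symm) k) =
      ∑ k, ∑ j, if σ j < σ k then c j * (q k - c k) else 0 := by
    rw [← Equiv.sum_comp σ]
    refine Finset.sum_congr rfl fun k _ => ?_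
    rw [prefixSum_eq, ← Equiv.sum_comp σ, Finset.sum_mul]
    simp only [Function.comp_apply, Equiv.symm_apply_apply, ite_mul, zero_mul, Fin.lt_def]
  have h2 : ∑ k, prefixSum c k.val * (q k - c k) =
      ∑ k : Fin p, ∑ j, if j < k then c j * (q k - c k) else 0 := by
    refine Finset.sum_congr rfl fun k _ => ?_
    rw [prefixSum_eq, Finset.sum_mul]
    simp only [ite_mul, zero_mul, Fin.lt_def]
  let A : ℤ := ∑ k, ∑ j, if j < k ∧ σ j < σ k then c j * (q k - c k) else 0
  have h3 : ∑ k : Fin p, ∑ j, (if j < k then c j * (q k - c k) else 0) =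
      A + ∑ k, ∑ j, if j < k ∧ σ k < σ j then c j * (q k - c k) else 0 := by
    simp only [A, ← Finset.sum_add_distrib]
    refine Finset.sum_congr rfl fun k _ => Finset.sum_congr rfl fun j _ => ?_
    by_cases hjk : j < k
    · rcases lt_trichotomy (σ j) (σ k) with h | h | h
      · simp [hjk, h, h.asymm]
      · exact absurd (σ.injective h) hjk.ne
      · simp [hjk, h, h.asymm]
    · simp [hjk]
  have h4 : ∑ k, ∑ j, (if σ j < σ k then c j * (q k - c k) else 0) =
      A + ∑ k, ∑ j, if j < k ∧ σ k < σ j then c k * (q j - c j) else 0 := by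
    have h5 : ∑ k, ∑ j, (if j < k ∧ σ k < σ j then c k * (q j - c j) else 0) =
        ∑ k, ∑ j, (if k < j ∧ σ j < σ k then c j * (q k - c k) else 0) := Finset.sum_comm
    rw [h5]
    simp only [A, ← Finset.sum_add_distrib]
    refine Finset.sum_congr rfl fun k _ => Finset.sum_congr rfl fun j _ => ?_
    by_cases h : σ j < σ k
    · rcases lt_trichotomy j k with hjk | hjk | hjk
      · simp [hjk, h, hjk.asymm]
      · exact absurd (congrArg σ hjk) h.ne
      · simp [hjk, h, hjk.asymm]
    · simp [h]
  rw [koszulSign, koszulSign, koszulSign, ← Int.negOnePow_add, ← Int.negOnePow_add,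
    ← Int.negOnePow_add, Int.negOnePow_eq_iff, pathExp, pathExp, h1, h2, h3, h4, hs, hs]
  have h6 : ∀ f : Fin p → Fin p → ℤ, (∑ k, ∑ j, if j < k ∧ σ k < σ j then f j k else 0) =
      ∑ i, ∑ j, if i < j ∧ σ j < σ i then f i j else 0 := fun f => Finset.sum_comm
  rw [h6 fun j k => c j * (q k - c k), h6 fun j k => c k * (q j - c j)]
  refine ⟨- ∑ i, ∑ j, if i < j ∧ σ j < σ i then c j * (q i - c i) else 0, ?_⟩
  have key : (∑ i, ∑ j, if i < j ∧ σ j < σ i then c i * (q j - c j) else 0) +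
      (∑ i, ∑ j, if i < j ∧ σ j < σ i then c i * c j else 0) +
      (∑ i, ∑ j, if i < j ∧ σ j < σ i then (q i - c i) * (q j - c j) else 0) +
      (∑ i, ∑ j, if i < j ∧ σ j < σ i then c j * (q i - c i) else 0) =
      ∑ i, ∑ j, if i < j ∧ σ j < σ i then q i * q j else 0 := by
    simp only [← Finset.sum_add_distrib]
    refine Finset.sum_congr rfl fun i _ => Finset.sum_congr rfl fun j _ => ?_
    split_ifs
    · ring
    · simp
  linarith

/-! ### Evaluation of generators on paths -/

namespace FormGen

open IntervalBasis

variable {R : Type u} [CommRing R]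

variable (R) in
/-- The map which sends `dxᵢ` to `xᵢ` and `xᵢ` to `0`. -/
def shiftVec (n : ℕ) : (FormGen n → R) →ₗ[R] (FormGen n → R) where
  toFun a := Sum.elim (fun j => a (.inr j)) 0
  map_add' a b := by
    funext g
    rcases g with j | j <;> simp
  map_smul' c a := by
    funext g
    rcases g with j | j <;> simp

/-- The components of the linear path from the `v`-th vertex `e_v` to the identity,
`xᵢ ↦ e_v(xᵢ) + t (xᵢ - e_v(xᵢ))` and `dxᵢ ↦ t dxᵢ + dt (xᵢ - e_v(xᵢ))`. -/
def slot {n : ℕ} (v : Fin (n + 1)) (c : IntervalBasis) : (FormGen n → R) →ₗ[R] (FormGen n → R) :=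
  match c with
  | .one => (LinearMap.proj (.inl v)).smulRight (unitVec R n)
  | .t => LinearMap.id - (LinearMap.proj (.inl v)).smulRight (unitVec R n)
  | .dt => shiftVec R n - (LinearMap.proj (.inr v)).smulRight (unitVec R n)

variable {n : ℕ} (v : Fin (n + 1))

theorem slot_one (a : FormGen n → R) : slot v one a = a (.inl v) • unitVec R n := rfl

theorem slot_t (a : FormGen n → R) : slot v t a = a - a (.inl v) • unitVec R n := rfl

theorem slot_dt (a : FormGen n → R) : slot v dt a = shiftVec R n a - a (.inr v) • unitVec R n := rfl

theorem isHomogeneous_unitVec : IsHomogeneous 0 (unitVec R n) := fun g hg => by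
  rcases g with j | j
  · exact absurd rfl hg
  · rfl

theorem IsHomogeneous.slot {k : ℤ} {a : FormGen n → R} (ha : IsHomogeneous k a)
    (c : IntervalBasis) :
    IsHomogeneous (k - c.deg) (FormGen.slot v c a) := fun g hg => by
  rcases c with _ | _ | _
  · change g.deg ≠ k - 0 at hg
    rw [sub_zero] at hg
    rw [slot_one, Pi.smul_apply]
    by_cases hk : k = 0
    · rw [isHomogeneous_unitVec g (hk ▸ hg), smul_zero]
    · rw [ha (.inl v) (Ne.symm hk), zero_smul]
  · change g.deg ≠ k - 0 at hg
    rw [sub_zero] at hg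
    rw [slot_t, Pi.sub_apply, Pi.smul_apply, ha g hg]
    by_cases hk : k = 0
    · rw [isHomogeneous_unitVec g (hk ▸ hg), smul_zero, sub_zero]
    · rw [ha (.inl v) (Ne.symm hk), zero_smul, sub_zero]
  · change g.deg ≠ k - 1 at hg
    rcases g with j | j
    · have hk : (1 : ℤ) ≠ k := fun h => hg (by rw [← h]; rfl)
      rw [slot_dt, Pi.sub_apply, Pi.smul_apply, ha (.inr v) hk, zero_smul, sub_zero]
      exact ha (.inr j) hk
    · rw [slot_dt]
      simp [shiftVec, unitVec]

/-- At the endpoint `t = 1` the path is the identity. -/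
theorem slot_one_add_slot_t (a : FormGen n → R) : slot v one a + slot v t a = a := by
  rw [slot_one, slot_t, add_sub_cancel]

/-- The path is constant on `∑ xᵢ`; together with `slot_dUnitVec` this is why it respects the
relations of `Ω_n`. -/
theorem slot_unitVec (c : IntervalBasis) :
    slot v c (unitVec R n) = if c = one then unitVec R n else 0 := by
  rcases c with _ | _ | _
  · simp [slot_one, unitVec]
  · simp [slot_t, unitVec]
  · funext g
    rcases g with j | j <;> simp [slot_dt, unitVec, shiftVec]

theorem slot_dUnitVec (c : IntervalBasis) :
    slot v c (dVec R n (unitVec R n)) = if c = t then dVec R n (unitVec R n) else 0 := by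
  rcases c with _ | _ | _
  · simp [slot_one, dVec]
  · simp [slot_t, dVec]
  · funext g
    rcases g with j | j <;> simp [slot_dt, unitVec, shiftVec, dVec]

theorem slot_comp_map {m : ℕ} (f : Fin (m + 1) → Fin (n + 1)) (v : Fin (m + 1)) (c : IntervalBasis)
    (a : FormGen n → R) : slot v c (a ∘ Sum.map f f) = slot (f v) c a ∘ Sum.map f f := by
  funext g
  rcases c with _ | _ | _ <;> rcases g with j | j <;> simp [slot, unitVec, shiftVec]

theorem dVec_slot_one (a : FormGen n → R) :
    dVec R n (slot v one a) = a (.inl v) • dVec R n (unitVec R n) := by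
  rw [slot_one, map_smul]

theorem slot_one_dVec (a : FormGen n → R) : slot v one (dVec R n a) = 0 := by
  rw [slot_one]
  simp [dVec]

theorem dVec_slot_t (a : FormGen n → R) :
    dVec R n (slot v t a) = slot v t (dVec R n a) - a (.inl v) • dVec R n (unitVec R n) := by
  rw [slot_t, slot_t, map_sub, map_smul]
  simp [dVec]

/-- On generators of degree `k`, the components `t` and `dt` of the path are related by the
differential. -/
theorem slot_dt_dVec {k : ℤ} {g : FormGen n} (hg : g.deg = k) :
    slot v dt (dVec R n (Pi.single g 1)) = dVec R n (slot v dt (Pi.single g 1)) +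
      k.negOnePow • slot v t (Pi.single g 1) +
        (Pi.single g 1 : FormGen n → R) (.inr v) • dVec R n (unitVec R n) := by
  subst hg
  rcases g with j | j
  · rw [dVec_inl]
    funext g
    rcases g with i | i <;>
      simp [slot_dt, slot_t, FormGen.deg, shiftVec, dVec, unitVec, Pi.single_apply]
  · rw [dVec_inr, map_zero]
    funext g
    rcases g with i | i <;> by_cases hv : v = j <;>
      simp [slot_dt, slot_t, FormGen.deg, shiftVec, dVec, unitVec, Pi.single_apply, hv]
    ring

end FormGen

/-! ### The homotopy on forms -/

namespace UAOperad

open FormGen IntervalBasis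

variable {R : Type u} [CommRing R] {O : UAOperad R} (S : PathSection O.toDGOperad)

/-- The entry at `(c, dt)` of the matrix of an operation. -/
noncomputable def pathEntry {p : ℕ} (c : Fin p → IntervalBasis) : O.obj p →ₗ[R] O.obj p :=
  LinearMap.proj dt ∘ₗ LinearMap.proj c ∘ₗ S.q p

theorem pathEntry_apply {p : ℕ} (c : Fin p → IntervalBasis) (o : O.obj p) :
    pathEntry S c o = S.q p o c dt := rfl

theorem pathEntry_mem {p : ℕ} (c : Fin p → IntervalBasis) {k : ℤ} {o : O.obj p}
    (ho : o ∈ (O.obj p).gr k) : pathEntry S c o ∈ (O.obj p).gr (k + ∑ i, (c i).deg - 1) :=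
  (MatrixOp.mem_gr _).1 (S.q_mem ho) c dt

/-- A product of interval cochains without `dt` has no component at `dt`. -/
theorem pathEntry_of_ne {p : ℕ} {c : Fin p → IntervalBasis} (hc : ∀ i, c i ≠ dt) (o : O.obj p) :
    pathEntry S c o = 0 := by
  rw [pathEntry_apply, (S.q_endpointwise o).apply_of_ne c hc, if_neg (top_ne_dt c).symm]

theorem pathEntry_act {p : ℕ} (σ : Equiv.Perm (Fin p)) (c : Fin p → IntervalBasis) (o : O.obj p) :
    pathEntry S c (O.act σ o) =
      koszulSign σ (IntervalBasis.deg ∘ c) • O.act σ (pathEntry S (c ∘ σ.symm) o) := by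
  rw [pathEntry_apply, S.q_act]
  rfl

theorem plugAt_zero {p : ℕ} {X : Type*} (i : Fin (p + 1)) (y : X) (c : Fin p → X) :
    plugAt (n := 0) (rfl : p + 1 + 0 = p + 1) i y c = i.insertNth (α := fun _ => X) y c := by
  funext j
  rcases Fin.eq_self_or_eq_succAbove i j with rfl | ⟨k, rfl⟩
  · rw [plugAt_self, Fin.insertNth_apply_same]
  · rw [plugAt_of_ne _ _ _ _ (Fin.succAbove_ne i k), Fin.insertNth_apply_succAbove]
    congr 1
    apply Fin.ext
    rcases lt_or_ge k.castSucc i with h | h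
    · have h' : i.succAbove k < i := Fin.succAbove_lt_iff_castSucc_lt _ _ |>.2 h
      simp only [outerSlot, h', dif_pos]
      rw [Fin.succAbove_of_castSucc_lt _ _ h]
      rfl
    · have h' : ¬ i.succAbove k < i := fun h'' =>
        absurd (Fin.succAbove_lt_iff_castSucc_lt _ _ |>.1 h'') (not_lt.2 h)
      simp only [outerSlot, h', dif_neg, not_false_eq_true]
      rw [Fin.succAbove_of_le_castSucc _ _ h]
      simp

/-- The section is compatible with the composition with `1₀`, which it sends to the unit of the
interval cochains. -/
theorem pathEntry_plugPt {p : ℕ} (i : Fin (p + 1)) (c : Fin p → IntervalBasis) (o : O.obj (p + 1)) :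
    pathEntry S c (O.plugPt i o) =
      O.plugPt i (pathEntry S (i.insertNth (α := fun _ => IntervalBasis) one c) o) := by
  have h1 : pathEntry S c (O.plugPt i o) =
      MatrixOp.circ IntervalBasis.deg (rfl : p + 1 + 0 = p + 1) i 0 (S.q (p + 1) o)
        (S.q 0 O.pt) c dt := by
    rw [← S.q_circ (n := 0) (l := p) rfl i o O.pt_gr]
    rfl
  have h2 : ∀ b, S.q 0 O.pt (c ∘ innerSlot (rfl : p + 1 + 0 = p + 1) i) b =
      if b = one then O.pt else 0 := fun b => by
    rw [(S.q_endpointwise O.pt).apply_of_ne _ (fun k => k.elim0), S.unitEntry_q]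
    have : top (c ∘ innerSlot (rfl : p + 1 + 0 = p + 1) i) = one := by
      rw [top, if_neg]
      rintro ⟨k, _⟩
      exact k.elim0
    rw [this]
  rw [h1, MatrixOp.circ_apply, Finset.sum_eq_single one]
  · rw [h2, if_pos rfl, plugAt_zero, plugPt, LinearMap.flip_apply, pathEntry_apply]
    have h3 : MatrixOp.circExp (rfl : p + 1 + 0 = p + 1) i 0 (IntervalBasis.deg ∘ c)
        (IntervalBasis.deg dt) (IntervalBasis.deg one) = 0 := by
      simp [MatrixOp.circExp, IntervalBasis.deg]
    rw [h3, Int.negOnePow_zero, one_smul]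
  · intro b _ hb
    rw [h2, if_neg hb, map_zero, smul_zero]
  · exact fun h => absurd (Finset.mem_univ _) h

/-- The summand with row index `c` of the component at `dt` of the evaluation on the linear path to
the `v`-th vertex. -/
noncomputable def pathTerm {n p : ℕ} (v : Fin (n + 1)) (q : Fin p → ℤ) (a : Fin p → FormGen n → R)
    (c : Fin p → IntervalBasis) : O.obj p →ₗ[R] O.omega n :=
  (pathExp q (IntervalBasis.deg ∘ c)).negOnePow •
    O.vecCls (fun i => slot v (c i) (a i)) ∘ₗ pathEntry S c

theorem pathTerm_apply {n p : ℕ} (v : Fin (n + 1)) (q : Fin p → ℤ) (a : Fin p → FormGen n → R)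
    (c : Fin p → IntervalBasis) (o : O.obj p) : pathTerm S v q a c o =
      (pathExp q (IntervalBasis.deg ∘ c)).negOnePow •
        O.vecCls (fun i => slot v (c i) (a i)) (pathEntry S c o) := rfl

/-- The component at `dt` of the evaluation on the linear path to the `v`-th vertex, on
representatives. -/
noncomputable def pathSum {n : ℕ} (v : Fin (n + 1)) : O.FormSum n →ₗ[R] O.omega n :=
  wordLift fun _ w => ∑ c, pathTerm S v (fun i => (w i).deg) (fun i => Pi.single (w i) 1) c

theorem pathSum_word {n p : ℕ} (v : Fin (n + 1)) (w : Fin p → FormGen n) (o : O.obj p) :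
    pathSum S v (O.word w o) =
      ∑ c, pathTerm S v (fun i => (w i).deg) (fun i => Pi.single (w i) 1) c o := by
  rw [pathSum, wordLift_word, LinearMap.sum_apply]

theorem vecCls_insertNth_zero {n p : ℕ} (i : Fin (p + 1)) (a : Fin p → FormGen n → R)
    (o : O.obj (p + 1)) :
    O.vecCls (i.insertNth (α := fun _ => FormGen n → R) 0 a) o = 0 := by
  rw [← vecOp_apply]
  exact MultilinearMap.map_coord_zero _ i (Fin.insertNth_apply_same _ _ _)

theorem comp_insertNth {p : ℕ} {X Y : Type*} (f : X → Y) (i : Fin (p + 1)) (x : X) (w : Fin p → X) :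
    (fun k => f (i.insertNth (α := fun _ => X) x w k)) =
      i.insertNth (α := fun _ => Y) (f x) fun k => f (w k) := by
  funext k
  rcases Fin.eq_self_or_eq_succAbove i k with rfl | ⟨k, rfl⟩
  · rw [Fin.insertNth_apply_same, Fin.insertNth_apply_same]
  · rw [Fin.insertNth_apply_succAbove, Fin.insertNth_apply_succAbove]

/-- The evaluation on the path of a sum of words which differ in one letter. -/
theorem sum_pathSum_insertNth {n p : ℕ} (v : Fin (n + 1)) (i : Fin (p + 1))
    (g : Fin (n + 1) → FormGen n) {D : ℤ} (hg : ∀ j, (g j).deg = D) (w : Fin p → FormGen n)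
    (o : O.obj (p + 1)) :
    ∑ j, pathSum S v (O.word (i.insertNth (α := fun _ => FormGen n) (g j) w) o) =
      ∑ b, ∑ c : Fin p → IntervalBasis,
        (pathExp (i.insertNth (α := fun _ => ℤ) D fun k => (w k).deg)
          (i.insertNth (α := fun _ => ℤ) (IntervalBasis.deg b) (IntervalBasis.deg ∘ c))).negOnePow •
          O.vecCls (i.insertNth (α := fun _ => FormGen n → R) (slot v b (∑ j, Pi.single (g j) 1))
            fun k => slot v (c k) (Pi.single (w k) 1))
            (pathEntry S (i.insertNth (α := fun _ => IntervalBasis) b c) o) := by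
  have h : ∀ j, pathSum S v (O.word (i.insertNth (α := fun _ => FormGen n) (g j) w) o) =
      ∑ b, ∑ c : Fin p → IntervalBasis,
        (pathExp (i.insertNth (α := fun _ => ℤ) D fun k => (w k).deg)
          (i.insertNth (α := fun _ => ℤ) (IntervalBasis.deg b) (IntervalBasis.deg ∘ c))).negOnePow •
          O.vecCls (i.insertNth (α := fun _ => FormGen n → R) (slot v b (Pi.single (g j) 1))
            fun k => slot v (c k) (Pi.single (w k) 1))
            (pathEntry S (i.insertNth (α := fun _ => IntervalBasis) b c) o) := fun j => by
    rw [pathSum_word, ← Equiv.sum_comp (Fin.insertNthEquiv (fun _ => IntervalBasis) i),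
      Fintype.sum_prod_type]
    refine Finset.sum_congr rfl fun b _ => Finset.sum_congr rfl fun c _ => ?_
    have h0 : Fin.insertNthEquiv (fun _ => IntervalBasis) i (b, c) =
        i.insertNth (α := fun _ => IntervalBasis) b c := rfl
    rw [h0, pathTerm_apply]
    have h1 := comp_insertNth FormGen.deg i (g j) w
    have h2 : IntervalBasis.deg ∘ i.insertNth (α := fun _ => IntervalBasis) b c =
        i.insertNth (α := fun _ => ℤ) (IntervalBasis.deg b) (IntervalBasis.deg ∘ c) :=
      comp_insertNth IntervalBasis.deg i b c
    have h3 : (fun k => slot v (i.insertNth (α := fun _ => IntervalBasis) b c k)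
        (Pi.single (i.insertNth (α := fun _ => FormGen n) (g j) w k) 1 : FormGen n → R)) =
        i.insertNth (α := fun _ => FormGen n → R) (slot v b (Pi.single (g j) 1))
            fun k => slot v (c k) (Pi.single (w k) 1) := by
      funext k
      rcases Fin.eq_self_or_eq_succAbove i k with rfl | ⟨k, rfl⟩
      · simp only [Fin.insertNth_apply_same]
      · simp only [Fin.insertNth_apply_succAbove]
    rw [hg] at h1
    rw [h1, h2, h3]
  rw [Finset.sum_congr rfl fun j _ => h j, Finset.sum_comm]
  refine Finset.sum_congr rfl fun b _ => ?_
  rw [Finset.sum_comm]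
  refine Finset.sum_congr rfl fun c _ => ?_
  rw [← Finset.smul_sum, vecCls_sum_insertNth, map_sum]

theorem pathSum_act {n p : ℕ} (v : Fin (n + 1)) (σ : Equiv.Perm (Fin p)) (w : Fin p → FormGen n)
    (o : O.obj p) : pathSum S v (O.word w (O.act σ o)) =
      koszulSign σ (fun i => (w i).deg) • pathSum S v (O.word (w ∘ σ.symm) o) := by
  rw [pathSum_word, pathSum_word, Finset.smul_sum]
  conv_rhs => rw [← Equiv.sum_comp (σ.arrowCongr (Equiv.refl IntervalBasis))]
  refine Finset.sum_congr rfl fun c _ => ?_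
  have hc : σ.arrowCongr (Equiv.refl IntervalBasis) c = c ∘ σ.symm := rfl
  rw [hc, pathTerm_apply, pathTerm_apply, pathEntry_act, LinearMap.map_intUnit_smul,
    vecCls_act σ fun i => (isHomogeneous_single (w i)).slot v (c i), smul_smul, smul_smul,
      smul_smul]
  congr 1
  have h := negOnePow_pathExp_comp_symm σ (fun i => (w i).deg) (IntervalBasis.deg ∘ c)
  rw [mul_assoc]
  exact h

theorem pathSum_rel {n : ℕ} (v : Fin (n + 1)) : O.formRel n ≤ LinearMap.ker (pathSum S v) := by
  refine O.formRel_le (fun p σ w o => ?_) (fun p i w o => ?_) (fun p i w o => ?_)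
  · rw [LinearMap.mem_ker, relAct_apply, map_sub, LinearMap.map_intUnit_smul, pathSum_act, sub_self]
  · rw [LinearMap.mem_ker, relSum_apply, map_sub, map_sum,
      sum_pathSum_insertNth S v i (D := 0) _ (fun _ => rfl), sub_eq_zero, sum_single_inl,
      Finset.sum_eq_single one, pathSum_word]
    · refine Finset.sum_congr rfl fun c _ => ?_
      have h := pathExp_insertNth i (fun k => (w k).deg) (IntervalBasis.deg ∘ c)
      rw [slot_unitVec, if_pos rfl, vecCls_insertNth_unitVec, pathTerm_apply, pathEntry_plugPt, ← h]
      rfl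
    · intro b _ hb
      refine Finset.sum_eq_zero fun c _ => ?_
      rw [slot_unitVec, if_neg hb, vecCls_insertNth_zero, smul_zero]
    · exact fun h => absurd (Finset.mem_univ _) h
  · rw [LinearMap.mem_ker, relDSum_apply, map_sum,
      sum_pathSum_insertNth S v i (D := 1) _ (fun _ => rfl), sum_single_inr]
    refine Finset.sum_eq_zero fun b _ => Finset.sum_eq_zero fun c _ => ?_
    rw [slot_dUnitVec]
    split_ifs
    · rw [vecCls_insertNth_dUnitVec, smul_zero]
    · rw [vecCls_insertNth_zero, smul_zero]

/-- The component at `dt` of the evaluation of forms on the linear path to the `v`-th vertex. -/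
noncomputable def pathMap {n : ℕ} (v : Fin (n + 1)) : O.omega n →ₗ[R] O.omega n :=
  O.omegaLift (pathSum S v) (pathSum_rel S v)

theorem pathMap_vecCls {n p : ℕ} (v : Fin (n + 1)) {q : Fin p → ℤ} {a : Fin p → FormGen n → R}
    (ha : ∀ i, IsHomogeneous (q i) (a i)) (o : O.obj p) :
    pathMap S v (O.vecCls a o) = ∑ c, pathTerm S v q a c o := by
  have h := FormGen.multilinear_ext (f := (pathMap S v).compMultilinearMap (vecOp o))
    (g := ∑ c : Fin p → IntervalBasis, (pathExp q (IntervalBasis.deg ∘ c)).negOnePow •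
      (vecOp (pathEntry S c o)).compLinearMap fun i => slot v (c i)) (q := q) (fun w hw => ?_) ha
  · rw [LinearMap.compMultilinearMap_apply, vecOp_apply] at h
    rw [h]
    simp only [sum_apply, smul_apply, MultilinearMap.compLinearMap_apply, vecOp_apply,
      pathTerm_apply]
  · rw [LinearMap.compMultilinearMap_apply, vecOp_apply, vecCls_single]
    have h1 : pathMap S v (O.cls w o) = pathSum S v (O.word w o) := O.omegaLift_cls _ _ w o
    rw [h1, pathSum_word]
    simp only [sum_apply, smul_apply, MultilinearMap.compLinearMap_apply, vecOp_apply,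
      pathTerm_apply,
      hw]

theorem pathMap_cls {n p : ℕ} (v : Fin (n + 1)) (w : Fin p → FormGen n) (o : O.obj p) :
    pathMap S v (O.cls w o) =
      ∑ c, pathTerm S v (fun i => (w i).deg) (fun i => Pi.single (w i) 1) c o := by
  rw [← vecCls_single, pathMap_vecCls S v fun i => isHomogeneous_single (w i)]

theorem pathMap_mem {n : ℕ} (v : Fin (n + 1)) {k : ℤ} {x : O.omega n}
    (hx : x ∈ (O.omega n).gr k) : pathMap S v x ∈ (O.omega n).gr (k - 1) := by
  refine omega_gr_le (S := ((O.omega n).gr (k - 1)).comap (pathMap S v)) (fun p w o ho => ?_) hx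
  rw [Submodule.mem_comap, pathMap_cls]
  refine Submodule.sum_mem _ fun c _ => ?_
  rw [pathTerm_apply]
  refine Submodule.smul_of_tower_mem _ _ ?_
  have h := vecCls_mem (fun i => (isHomogeneous_single (R := R) (w i)).slot v (c i))
    (pathEntry_mem S c ho)
  rw [Finset.sum_sub_distrib] at h
  have h1 : k - FormWord.deg ⟨p, w⟩ + ∑ i, (c i).deg - 1 + (∑ i, (w i).deg - ∑ i, (c i).deg) =
      k - 1 := by
    rw [FormWord.deg]
    ring
  rwa [h1] at h

theorem pull_pathMap {m n : ℕ} (f : Fin (m + 1) → Fin (n + 1)) (v : Fin (m + 1)) (x : O.omega n) :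
    (O.omegaPull f).toLin (pathMap S (f v) x) = pathMap S v ((O.omegaPull f).toLin x) := by
  refine omega_hom_ext (f := (O.omegaPull f).toLin ∘ₗ pathMap S (f v))
    (g := pathMap S v ∘ₗ (O.omegaPull f).toLin) (fun p w k o ho => ?_) x
  have h : ∀ i, IsHomogeneous (w i).deg ((Pi.single (w i) 1 : FormGen n → R) ∘ Sum.map f f) :=
    fun i g hg => isHomogeneous_single (w i) _ (by rwa [deg_map])
  rw [LinearMap.comp_apply, LinearMap.comp_apply, pathMap_cls, ← vecCls_single, pull_vecCls,
    pathMap_vecCls S v h, map_sum]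
  refine Finset.sum_congr rfl fun c _ => ?_
  rw [pathTerm_apply, pathTerm_apply, LinearMap.map_intUnit_smul, pull_vecCls]
  simp only [slot_comp_map]

theorem pathMap_unit {n : ℕ} (v : Fin (n + 1)) : pathMap S v (O.omegaUnit n) = 0 := by
  rw [omegaUnit, pathMap_cls]
  refine Finset.sum_eq_zero fun c _ => ?_
  rw [pathTerm_apply, pathEntry_of_ne S (fun i => i.elim0), map_zero, smul_zero]

/-- Every term which does not vanish involves a component at `dt` of the path, which lowers the
number of letters `dxᵢ`. -/
theorem pathTerm_weight {n p : ℕ} (v : Fin (n + 1)) (w : Fin p → FormGen n)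
    (c : Fin p → IntervalBasis) (o : O.obj p) :
    pathTerm S v (fun i => (w i).deg) (fun i => Pi.single (w i) 1) c o = 0 ∨
      0 < ∑ i, (c i).deg := by
  by_cases hc : ∀ i, c i ≠ dt
  · left
    rw [pathTerm_apply, pathEntry_of_ne S hc, map_zero, smul_zero]
  · right
    push Not at hc
    obtain ⟨i, hi⟩ := hc
    refine Finset.sum_pos' (fun j _ => ?_) ⟨i, Finset.mem_univ _, by rw [hi]; exact one_pos⟩
    rcases c j with _ | _ | _ <;> simp [IntervalBasis.deg]

theorem pathMap_W_zero {n : ℕ} (v : Fin (n + 1)) {x : O.omega n} (hx : x ∈ O.omegaW n 0) :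
    pathMap S v x = 0 := by
  have h : O.omegaW n 0 ≤ LinearMap.ker (pathMap S v) := Submodule.span_le.2 (by
    rintro _ ⟨p, w, o, hw, rfl⟩
    rw [SetLike.mem_coe, LinearMap.mem_ker, pathMap_cls]
    refine Finset.sum_eq_zero fun c _ => ?_
    rcases pathTerm_weight S v w c o with h | h
    · exact h
    · rw [pathTerm_apply, vecCls_eq_zero fun i => (isHomogeneous_single (R := R) (w i)).slot v
      (c i),
        smul_zero]
      rw [Finset.sum_sub_distrib]
      simp only [Nat.cast_zero] at hw
      linarith)
  exact h hx

theorem pathMap_W_succ {n : ℕ} (v : Fin (n + 1)) {N : ℕ} {x : O.omega n}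
    (hx : x ∈ O.omegaW n (N + 1)) : pathMap S v x ∈ O.omegaW n N := by
  have h : O.omegaW n (N + 1) ≤ (O.omegaW n N).comap (pathMap S v) := Submodule.span_le.2 (by
    rintro _ ⟨p, w, o, hw, rfl⟩
    rw [SetLike.mem_coe, Submodule.mem_comap, pathMap_cls]
    refine Submodule.sum_mem _ fun c _ => ?_
    rcases pathTerm_weight S v w c o with h | h
    · rw [h]
      exact Submodule.zero_mem _
    · rw [pathTerm_apply]
      refine Submodule.smul_of_tower_mem _ _ (vecCls_mem_W
        (fun i => (isHomogeneous_single (R := R) (w i)).slot v (c i)) ?_ _)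
      rw [Finset.sum_sub_distrib]
      push_cast at hw
      linarith)
  exact h hx

/-- The sign involution preserves weights. -/
theorem sgn_mem_W {n N : ℕ} {x : O.omega n} (hx : x ∈ O.omegaW n N) :
    (O.omega n).sgn x ∈ O.omegaW n N := by
  have h : O.omegaW n N ≤ (O.omegaW n N).comap (O.omega n).sgn := Submodule.span_le.2 (by
    rintro _ ⟨p, w, o, hw, rfl⟩
    rw [SetLike.mem_coe, Submodule.mem_comap]
    induction o using DGModule.induction_gr with
    | h k o ho =>
      rw [DGModule.sgn_apply _ (cls_mem w ho)]
      exact Submodule.smul_of_tower_mem _ _ (Submodule.subset_span ⟨p, w, o, hw, rfl⟩)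
    | hadd x y hx hy =>
      rw [map_add, map_add]
      exact Submodule.add_mem _ hx hy)
  exact h hx

end UAOperad

/-! ### The homotopy formula -/

namespace UAOperad

open FormGen IntervalBasis

variable {R : Type u} [CommRing R] {O : UAOperad R} (S : PathSection O.toDGOperad)

/-- The compatibility of the section with the differentials, read off in the column `dt`. -/
theorem pathEntry_d {p : ℕ} (c : Fin p → IntervalBasis) {k : ℤ} {o : O.obj p}
    (ho : o ∈ (O.obj p).gr k) :
    pathEntry S c ((O.obj p).d o) = (O.obj p).d (pathEntry S c o) +
      ((k + ∑ i, (c i).deg).negOnePow • S.q p o c t -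
        k.negOnePow • ∑ i : Fin p, if c i = t then
          (prefixSum (IntervalBasis.deg ∘ c) i.val).negOnePow •
            pathEntry S (Function.update c i dt) o else 0) := by
  rw [pathEntry_apply, S.q_d ho, MatrixOp.pathD_apply, if_pos rfl]
  rfl

/-- The sum over all ways of choosing the components `1` and `t` of the path, not all of them equal
to `1`, is the difference of the identity and the evaluation at the vertex. -/
theorem sum_vecCls_slot {n p : ℕ} (v : Fin (n + 1)) (w : Fin p → FormGen n) (o : O.obj p) :
    ∑ c : Fin p → IntervalBasis, (if (∀ i, c i ≠ dt) ∧ t = top c then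
        O.vecCls (fun i => slot v (c i) (Pi.single (w i) 1)) o else 0) =
      O.cls w o - O.omegaEv v (O.cls w o) • O.omegaUnit n := by
  have h1 : O.cls w o = ∑ c : Fin p → IntervalBasis, if ∀ i, c i ≠ dt then
      O.vecCls (fun i => slot v (c i) (Pi.single (w i) 1)) o else 0 := by
    have h2 := (vecOp o).map_sum_finset
      (fun i b => slot v b (Pi.single (w i) 1 : FormGen n → R)) fun _ =>
        ({one, t} : Finset IntervalBasis)
    have h3 : (fun i => ∑ b ∈ ({one, t} : Finset IntervalBasis),
        slot v b (Pi.single (w i) 1 : FormGen n → R)) =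
          fun i => Pi.single (w i) 1 := funext fun i => by
      rw [Finset.sum_pair (by simp), slot_one_add_slot_t]
    rw [h3, vecOp_apply, vecCls_single] at h2
    rw [h2, ← Finset.sum_filter]
    refine Finset.sum_congr ?_ fun c _ => vecOp_apply _ _
    ext c
    rw [Fintype.mem_piFinset, Finset.mem_filter]
    refine ⟨fun h => ⟨Finset.mem_univ _, fun i hi => ?_⟩, fun h i => ?_⟩
    · have := h i
      rw [hi] at this
      simp at this
    · have h4 := h.2 i
      generalize c i = b at h4
      rcases b with _ | _ | _
      · simp
      · simp
      · exact absurd rfl h4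
  have h4 : O.vecCls (fun i => slot v one (Pi.single (w i) 1)) o =
      O.omegaEv v (O.cls w o) • O.omegaUnit n := by
    have h5 := (vecOp o).map_smul_univ (fun i => (Pi.single (w i) 1 : FormGen n → R) (.inl v))
      fun _ => unitVec R n
    rw [vecOp_apply, vecOp_apply, vecCls_unitVec, smul_smul] at h5
    have h6 : ∏ i, (Pi.single (w i) 1 : FormGen n → R) (.inl v) = ∏ i, evGen R v (w i) :=
      Finset.prod_congr rfl fun i _ => by
        rw [evGen, Pi.single_apply, Pi.single_apply]
        exact if_congr eq_comm rfl rfl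
    rw [omegaEv_cls, ← h6]
    exact h5
  have h7 : O.vecCls (fun i => slot v one (Pi.single (w i) 1)) o =
      ∑ c : Fin p → IntervalBasis, if c = fun _ => one then
        O.vecCls (fun i => slot v (c i) (Pi.single (w i) 1)) o else 0 := by
    rw [Finset.sum_ite_eq' Finset.univ (fun _ => one), if_pos (Finset.mem_univ _)]
  rw [← h4, eq_sub_iff_add_eq, h7, h1, ← Finset.sum_add_distrib]
  refine Finset.sum_congr rfl fun c _ => ?_
  by_cases hc : ∀ i, c i ≠ dt
  · by_cases h1 : c = fun _ => one
    · have h2 : ¬ ((∀ i, c i ≠ dt) ∧ t = top c) := by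
        rw [h1, top_one]
        simp
      rw [if_neg h2, if_pos h1, if_pos hc, zero_add]
    · have h2 : t = top c := by
        obtain ⟨i, hi⟩ := Function.ne_iff.1 h1
        rw [top, if_pos]
        refine ⟨i, ?_⟩
        rcases h : c i with _ | _ | _
        · exact absurd h hi
        · rfl
        · exact absurd h (hc i)
      rw [if_pos ⟨hc, h2⟩, if_neg h1, if_pos hc, add_zero]
  · have h1 : c ≠ fun _ => one := fun h => hc (by rw [h]; simp)
    rw [if_neg (fun h => hc h.1), if_neg h1, if_neg hc, add_zero]

/-- The contribution of the column `t` of the matrices, that is, of the restriction to the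
endpoints. -/
theorem sum_endpoint {n p : ℕ} (v : Fin (n + 1)) (w : Fin p → FormGen n) (o : O.obj p) (k : ℤ) :
    ∑ c : Fin p → IntervalBasis, (pathExp (fun i => (w i).deg) (IntervalBasis.deg ∘ c)).negOnePow •
      (k + ∑ i, (c i).deg).negOnePow •
        O.vecCls (fun i => slot v (c i) (Pi.single (w i) 1)) (S.q p o c t) =
      (k + ∑ i, (w i).deg).negOnePow • (O.cls w o - O.omegaEv v (O.cls w o) • O.omegaUnit n) := by
  rw [← sum_vecCls_slot, Finset.smul_sum]
  refine Finset.sum_congr rfl fun c _ => ?_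
  by_cases hc : ∀ i, c i ≠ dt
  · rw [(S.q_endpointwise o).apply_of_ne c hc, S.unitEntry_q]
    by_cases h : t = top c
    · have h0 : IntervalBasis.deg ∘ c = 0 := deg_comp_eq_zero hc
      have h1 : ∑ i, (c i).deg = 0 := Finset.sum_eq_zero fun i _ => deg_of_ne (hc i)
      rw [if_pos h, if_pos ⟨hc, h⟩, smul_smul, ← Int.negOnePow_add, h1, h0]
      congr 2
      simp [pathExp, prefixSum]
      ring
    · rw [if_neg h, if_neg (fun h' => h h'.2), map_zero, smul_zero, smul_zero, smul_zero]
  · rw [if_neg (fun h => hc h.1), smul_zero]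
    push Not at hc
    obtain ⟨i, hi⟩ := hc
    rw [(S.q_endpointwise o).apply_of_eq c i hi t (by simp), map_zero, smul_zero, smul_zero]

theorem vecCls_update_add {n p : ℕ} (a : Fin p → FormGen n → R) (i : Fin p) (x y : FormGen n → R)
    (o : O.obj p) : O.vecCls (Function.update a i (x + y)) o =
      O.vecCls (Function.update a i x) o + O.vecCls (Function.update a i y) o := by
  simp only [← vecOp_apply]
  exact (vecOp o).map_update_add _ _ _ _

theorem vecCls_update_smul {n p : ℕ} (a : Fin p → FormGen n → R) (i : Fin p) (r : R)
    (x : FormGen n → R) (o : O.obj p) : O.vecCls (Function.update a i (r • x)) o =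
      r • O.vecCls (Function.update a i x) o := by
  simp only [← vecOp_apply]
  exact (vecOp o).map_update_smul _ _ _ _

/-- Modulo the relation `∑ dxᵢ = 0`, the failure of the components of the path to commute with the
differential is the component at `t`. -/
theorem vecCls_update_slot_dVec {n p : ℕ} (v : Fin (n + 1)) (a : Fin p → FormGen n → R) (i : Fin p)
    (g : FormGen n) (c : IntervalBasis) (o : O.obj p) :
    O.vecCls (Function.update a i (slot v c (dVec R n (Pi.single g 1)))) o =
      O.vecCls (Function.update a i (dVec R n (slot v c (Pi.single g 1)))) o +
        if c = dt then g.deg.negOnePow • O.vecCls (Function.update a i (slot v t (Pi.single g 1))) o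
          else 0 := by
  rcases c with _ | _ | _
  · rw [slot_one_dVec, dVec_slot_one, vecCls_update_smul, vecCls_update_dUnitVec, smul_zero,
      if_neg (by simp), add_zero, ← vecOp_apply, MultilinearMap.map_update_zero]
  · rw [dVec_slot_t, sub_eq_add_neg, ← neg_smul, vecCls_update_add, vecCls_update_smul,
      vecCls_update_dUnitVec, smul_zero, if_neg (by simp), add_zero, add_zero]
  · rw [slot_dt_dVec v rfl, vecCls_update_add, vecCls_update_add, vecCls_update_smul,
      vecCls_update_dUnitVec, smul_zero, add_zero, if_pos rfl, FormSystem.units_smul_eq (R := R),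
      vecCls_update_smul, FormSystem.units_smul_eq (R := R)]

/-- Words with the letter `dt` at the place `i` correspond to words with the letter `t` there. -/
theorem sum_ite_dt {p : ℕ} {M : Type*} [AddCommGroup M] (i : Fin p)
    (F : (Fin p → IntervalBasis) → M) :
    ∑ c, (if c i = dt then F c else 0) =
      ∑ c, if c i = t then F (Function.update c i dt) else 0 := by
  rw [← Finset.sum_filter, ← Finset.sum_filter]
  refine Finset.sum_nbij' (fun c => Function.update c i t) (fun c => Function.update c i dt)
    (fun c _ => by simp) (fun c _ => by simp) (fun c hc => ?_) (fun c hc => ?_) (fun c hc => ?_)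
  · rw [Function.update_idem, ← (Finset.mem_filter.1 hc).2, Function.update_eq_self]
  · rw [Function.update_idem, ← (Finset.mem_filter.1 hc).2, Function.update_eq_self]
  · rw [Function.update_idem, ← (Finset.mem_filter.1 hc).2, Function.update_eq_self]

/-- The exponent of the sign of the derivative of the `i`-th letter. -/
def letterExp {p : ℕ} (k : ℤ) (q c : Fin p → ℤ) (i : Fin p) : ℤ :=
  pathExp q c + k + (1 + ∑ j, c j) + prefixSum q i.val + prefixSum c i.val

/-- The evaluation on the path of the differential of a tensor. -/
theorem pathMap_d_cls {n p : ℕ} (v : Fin (n + 1)) (w : Fin p → FormGen n) {k : ℤ} {o : O.obj p}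
    (ho : o ∈ (O.obj p).gr k) :
    pathMap S v ((O.omega n).d (O.cls w o)) =
      (∑ c, pathTerm S v (fun i => (w i).deg) (fun i => Pi.single (w i) 1) c ((O.obj p).d o)) +
      ∑ c, ∑ i, (letterExp k (fun i => (w i).deg) (IntervalBasis.deg ∘ c) i).negOnePow •
        O.vecCls (Function.update (fun i => slot v (c i) (Pi.single (w i) 1)) i
          (slot v (c i) (dVec R n (Pi.single (w i) 1)))) (pathEntry S c o) := by
  rw [cls_d w ho, map_add, pathMap_cls, map_sum, Finset.sum_comm]
  congr 1
  refine Finset.sum_congr rfl fun i _ => ?_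
  have hh : ∀ j, IsHomogeneous (Function.update (fun i => (w i).deg) i ((w i).deg + 1) j)
      (Function.update (fun i => (Pi.single (w i) 1 : FormGen n → R)) i
        (dVec R n (Pi.single (w i) 1)) j) := fun j => by
    by_cases hj : j = i
    · subst hj
      rw [Function.update_self, Function.update_self]
      exact (isHomogeneous_single (w j)).dVec
    · rw [Function.update_of_ne hj, Function.update_of_ne hj]
      exact isHomogeneous_single (w j)
  rw [LinearMap.map_intUnit_smul, pathMap_vecCls S v hh, Finset.smul_sum]
  refine Finset.sum_congr rfl fun c _ => ?_
  have h1 : (fun j => slot v (c j) (Function.update (fun i => (Pi.single (w i) 1 : FormGen n → R)) i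
      (dVec R n (Pi.single (w i) 1)) j)) =
      Function.update (fun i => slot v (c i) (Pi.single (w i) 1)) i
          (slot v (c i) (dVec R n (Pi.single (w i) 1))) := funext fun j => by
    by_cases hj : j = i
    · subst hj; simp
    · simp [hj]
  rw [pathTerm_apply, h1, smul_smul, ← Int.negOnePow_add,
    pathExp_update_left (fun i => (w i).deg) _ i, sum_filter_lt_eq_prefixSum]
  congr 2
  rw [letterExp]
  ring

/-- The differential of a term of the evaluation on the path. -/
theorem d_pathTerm {n p : ℕ} (v : Fin (n + 1)) (w : Fin p → FormGen n) {k : ℤ} {o : O.obj p}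
    (ho : o ∈ (O.obj p).gr k) (c : Fin p → IntervalBasis) :
    (O.omega n).d (pathTerm S v (fun i => (w i).deg) (fun i => Pi.single (w i) 1) c o) =
      (pathExp (fun i => (w i).deg) (IntervalBasis.deg ∘ c)).negOnePow •
        O.vecCls (fun i => slot v (c i) (Pi.single (w i) 1)) ((O.obj p).d (pathEntry S c o)) +
      ∑ i, (letterExp k (fun i => (w i).deg) (IntervalBasis.deg ∘ c) i).negOnePow •
        O.vecCls (Function.update (fun i => slot v (c i) (Pi.single (w i) 1)) i
          (dVec R n (slot v (c i) (Pi.single (w i) 1)))) (pathEntry S c o) := by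
  rw [pathTerm_apply, LinearMap.map_intUnit_smul,
    vecCls_d (fun i => (isHomogeneous_single (w i)).slot v (c i)) (pathEntry_mem S c ho), smul_add,
    Finset.smul_sum]
  congr 1
  refine Finset.sum_congr rfl fun i _ => ?_
  rw [smul_smul, ← Int.negOnePow_add]
  congr 1
  rw [Int.negOnePow_eq_iff, Finset.sum_sub_distrib, letterExp, prefixSum, prefixSum]
  have h1 : ∑ j with j < i, (c j).deg = ∑ j with j.val < i.val, (IntervalBasis.deg ∘ c) j := rfl
  have h2 : ∑ j with j < i, (w j).deg = ∑ j with j.val < i.val, (w j).deg := rfl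
  have h3 : ∑ j, (IntervalBasis.deg ∘ c) j = ∑ j, (c j).deg := rfl
  rw [h1, h2, h3]
  exact ⟨-1 - ∑ j with j.val < i.val, (IntervalBasis.deg ∘ c) j, by ring⟩

theorem negOnePow_letterExp_update {p : ℕ} (k : ℤ) (q : Fin p → ℤ) (c : Fin p → IntervalBasis)
    (i : Fin p) (hi : c i = t) :
    (letterExp k q (IntervalBasis.deg ∘ Function.update c i dt) i + q i).negOnePow =
      (pathExp q (IntervalBasis.deg ∘ c)).negOnePow *
        (k.negOnePow * (prefixSum (IntervalBasis.deg ∘ c) i.val).negOnePow) := by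
  have h0 : (IntervalBasis.deg ∘ c) i = 0 := by
    rw [Function.comp_apply, hi]
    rfl
  have h1 : IntervalBasis.deg ∘ Function.update c i dt =
      Function.update (IntervalBasis.deg ∘ c) i ((IntervalBasis.deg ∘ c) i + 1) := by
    rw [h0, Function.comp_update]
    rfl
  have h2 := negOnePow_pathExp_update_right q (IntervalBasis.deg ∘ c) i h0
  rw [letterExp, h1, sum_update_add, prefixSum_update_add, if_neg (lt_irrefl _), h0, zero_add]
  have h3 : ∀ a b d e f : ℤ, (a + b + d + e + f).negOnePow = a.negOnePow *
    (b + d + e + f).negOnePow :=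
    fun a b d e f => by rw [← Int.negOnePow_add]; congr 1; ring
  rw [add_assoc, add_zero, h3, h2, ← Int.negOnePow_add, ← Int.negOnePow_add, ← Int.negOnePow_add,
    Int.negOnePow_eq_iff]
  exact ⟨prefixSum q i.val + q i + ∑ j, (IntervalBasis.deg ∘ c) j + 1, by ring⟩

/-- The component at `dt` of the evaluation on paths is, up to signs, a homotopy. -/
theorem pathMap_homotopy_cls {n p : ℕ} (v : Fin (n + 1)) (w : Fin p → FormGen n) {k : ℤ}
    {o : O.obj p}
    (ho : o ∈ (O.obj p).gr k) :
    pathMap S v ((O.omega n).d (O.cls w o)) = (O.omega n).d (pathMap S v (O.cls w o)) +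
      (k + ∑ i, (w i).deg).negOnePow •
        (O.cls w o - O.omegaEv v (O.cls w o) • O.omegaUnit n) := by
  have h1 : ∀ c : Fin p → IntervalBasis,
      pathTerm S v (fun i => (w i).deg) (fun i => Pi.single (w i) 1) c ((O.obj p).d o) =
      (pathExp (fun i => (w i).deg) (IntervalBasis.deg ∘ c)).negOnePow •
        O.vecCls (fun i => slot v (c i) (Pi.single (w i) 1)) ((O.obj p).d (pathEntry S c o)) +
      (pathExp (fun i => (w i).deg) (IntervalBasis.deg ∘ c)).negOnePow •
        (k + ∑ i, (c i).deg).negOnePow •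
          O.vecCls (fun i => slot v (c i) (Pi.single (w i) 1)) (S.q p o c t) -
      ∑ i, if c i = t then (letterExp k (fun i => (w i).deg)
          (IntervalBasis.deg ∘ Function.update c i dt) i + (w i).deg).negOnePow •
        O.vecCls (fun i => slot v (c i) (Pi.single (w i) 1))
          (pathEntry S (Function.update c i dt) o) else 0 := fun c => by
    rw [pathTerm_apply, pathEntry_d S c ho, map_add, map_sub, smul_add, smul_sub,
      LinearMap.map_intUnit_smul, LinearMap.map_intUnit_smul, map_sum, Finset.smul_sum,
      Finset.smul_sum, add_sub_assoc]
    congr 2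
    refine Finset.sum_congr rfl fun i _ => ?_
    split_ifs with hi
    · rw [negOnePow_letterExp_update k (fun i => (w i).deg) c i hi, LinearMap.map_intUnit_smul,
        smul_smul, smul_smul, mul_assoc]
    · rw [map_zero, smul_zero, smul_zero]
  have h2 : ∑ c : Fin p → IntervalBasis, ∑ i, (if c i = t then (letterExp k (fun i => (w i).deg)
          (IntervalBasis.deg ∘ Function.update c i dt) i + (w i).deg).negOnePow •
        O.vecCls (fun i => slot v (c i) (Pi.single (w i) 1))
          (pathEntry S (Function.update c i dt) o) else 0) =
      ∑ c : Fin p → IntervalBasis, ∑ i,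
        (letterExp k (fun i => (w i).deg) (IntervalBasis.deg ∘ c) i).negOnePow •
        if c i = dt then (w i).deg.negOnePow •
          O.vecCls (Function.update (fun i => slot v (c i) (Pi.single (w i) 1)) i
            (slot v t (Pi.single (w i) 1))) (pathEntry S c o) else 0 := by
    rw [Finset.sum_comm, Finset.sum_comm (s := Finset.univ (α := Fin p → IntervalBasis))
      (t := Finset.univ (α := Fin p))]
    refine Finset.sum_congr rfl fun i _ => ?_
    simp only [smul_ite, smul_zero]
    rw [sum_ite_dt]
    refine Finset.sum_congr rfl fun c _ => ?_
    split_ifs with hi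
    · have h3 : Function.update (fun j => slot v (Function.update c i dt j)
          (Pi.single (w j) 1 : FormGen n → R)) i (slot v t (Pi.single (w i) 1)) =
          fun j => slot v (c j) (Pi.single (w j) 1) := funext fun j => by
        by_cases hj : j = i
        · subst hj
          rw [Function.update_self, hi]
        · rw [Function.update_of_ne hj, Function.update_of_ne hj]
      rw [h3, smul_smul, ← Int.negOnePow_add]
    · rfl
  -- the terms in `h2` are the failure of the path to commute with the differential
  rw [pathMap_d_cls S v w ho, pathMap_cls, map_sum, ← sum_endpoint S]
  simp only [h1, d_pathTerm S v w ho, vecCls_update_slot_dVec, smul_add, Finset.sum_add_distrib,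
    Finset.sum_sub_distrib, h2]
  abel

variable {n : ℕ} (v : Fin (n + 1))

/-- The contracting homotopy of forms to the `v`-th vertex. -/
noncomputable def omegaH : O.omega n →ₗ[R] O.omega n := - (pathMap S v ∘ₗ (O.omega n).sgn)

theorem omegaH_apply (x : O.omega n) : omegaH S v x = - pathMap S v ((O.omega n).sgn x) := rfl

theorem omegaH_mem {k : ℤ} {x : O.omega n} (hx : x ∈ (O.omega n).gr k) :
    omegaH S v x ∈ (O.omega n).gr (k - 1) := by
  rw [omegaH_apply, DGModule.sgn_apply _ hx, LinearMap.map_intUnit_smul]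
  exact Submodule.neg_mem _ (Submodule.smul_of_tower_mem _ _ (pathMap_mem S v hx))

/-- `omegaH S v` is a chain homotopy from the evaluation at the `v`-th vertex to the identity. -/
theorem d_omegaH (x : O.omega n) : (O.omega n).d (omegaH S v x) + omegaH S v ((O.omega n).d x) =
    x - O.omegaEv v x • O.omegaUnit n := by
  refine omega_hom_ext (f := (O.omega n).d ∘ₗ omegaH S v + omegaH S v ∘ₗ (O.omega n).d)
    (g := LinearMap.id - (O.omegaEv v).smulRight (O.omegaUnit n)) (fun p w k o ho => ?_) x
  have h := cls_mem w ho
  simp only [LinearMap.add_apply, LinearMap.comp_apply, LinearMap.sub_apply, LinearMap.id_apply,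
    LinearMap.smulRight_apply]
  rw [omegaH_apply, omegaH_apply, DGModule.sgn_apply _ h, DGModule.sgn_apply _
    ((O.omega n).d_mem h),
    LinearMap.map_intUnit_smul, LinearMap.map_intUnit_smul, pathMap_homotopy_cls S v w ho, map_neg,
    LinearMap.map_intUnit_smul, Int.negOnePow_succ, Units.neg_smul, neg_neg, smul_add, smul_smul,
    Int.units_mul_self, one_smul, neg_add_cancel_left]

theorem omegaH_unit : omegaH S v (O.omegaUnit n) = 0 := by
  rw [omegaH_apply, DGModule.sgn_apply _ (O.omegaUnit_mem n), Int.negOnePow_zero, one_smul,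
    pathMap_unit, neg_zero]

theorem pull_omegaH {m : ℕ} (f : Fin (m + 1) → Fin (n + 1)) (v : Fin (m + 1)) (x : O.omega n) :
    (O.omegaPull f).toLin (omegaH S (f v) x) = omegaH S v ((O.omegaPull f).toLin x) := by
  rw [omegaH_apply, omegaH_apply, map_neg, pull_pathMap,
    DGModule.sgn_map (O.omegaPull f).toLin fun _ _ hx => (O.omegaPull f).map_gr hx]

end UAOperad

variable {R : Type u} [CommRing R]

/-- The system of generalised differential forms. The section of the path operad gives the
homotopies, and the binary operation gives the partition of unity. -/
noncomputable def UAOperad.formSystem (O : UAOperad R) (S : PathSection O.toDGOperad) (μ : O.obj 2)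
    (hμ : μ ∈ (O.obj 2).gr 0) (hμ' : O.augBase 2 μ = 1) : FormSystem R where
  A := O.omega
  pull := O.omegaPull
  unit := O.omegaUnit
  unit_mem := O.omegaUnit_mem
  unit_d := O.omegaUnit_d
  pull_unit := O.pull_omegaUnit
  ev := O.omegaEv
  ev_of_ne v _ _ hx hk := O.omegaEv_of_ne v hx hk
  ev_d := O.omegaEv_d
  ev_unit := O.omegaEv_unit
  ev_pull := O.omegaEv_pull
  eq_unit := O.eq_omegaUnit
  L := UAOperad.omegaMul μ
  L_mem v _ _ hx := UAOperad.omegaMul_mem μ hμ v hx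
  pull_L := UAOperad.pull_omegaMul μ
  sum_L := UAOperad.sum_omegaMul μ hμ'
  h := UAOperad.omegaH S
  h_mem v _ _ hx := UAOperad.omegaH_mem S v hx
  d_h := UAOperad.d_omegaH S
  h_unit := UAOperad.omegaH_unit S
  pull_h := UAOperad.pull_omegaH S
  W := O.omegaW
  exists_mem_W := O.exists_mem_omegaW
  unit_mem_W := O.omegaUnit_mem_W
  h_W_zero v _ hx := by
    rw [UAOperad.omegaH_apply, UAOperad.pathMap_W_zero S v (UAOperad.sgn_mem_W hx), neg_zero]
  h_W_succ v _ _ hx := Submodule.neg_mem _ (UAOperad.pathMap_W_succ S v (UAOperad.sgn_mem_W hx))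

/-! ### The action on generalised differential forms -/

section Forms

variable {R : Type u} [CommRing R]

/-- The algebra structure obtained by restriction along a morphism of operads. -/
def DGOperad.Algebra.restrict {O P : DGOperad R} (f : DGOperad.Hom O P) {A : DGModule R}
    (α : P.Algebra A) : O.Algebra A where
  θ n := α.θ n ∘ₗ (f.app n).toLin
  θ_gr hx ha := α.θ_gr ((f.app _).map_gr hx) ha
  θ_d hx ha := by
    simp only [LinearMap.comp_apply, (f.app _).map_d]
    exact α.θ_d ((f.app _).map_gr hx) ha
  θ_one a := by
    rw [LinearMap.comp_apply, f.map_one, α.θ_one]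
  θ_act σ _ x _ ha := by
    rw [LinearMap.comp_apply, f.map_act, α.θ_act σ _ ha]
    rfl
  θ_circ h i _ _ x _ _ hy ha := by
    rw [LinearMap.comp_apply, f.map_circ, α.θ_circ h i _ ((f.app _).map_gr hy) ha]
    rfl

/-- The operad `𝒞om`, augmented by the identity. -/
noncomputable def comUA (R : Type u) [CommRing R] : UAOperad R where
  toDGOperad := comOperad R
  aug :=
    { app := fun _ => { toLin := LinearMap.id, map_gr := fun hx => hx, map_d := fun _ => rfl }
      map_act := fun _ _ => rfl
      map_one := rfl
      map_circ := fun _ _ _ _ => rfl }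
  aug_zero := Function.bijective_id
  aug_one := Function.bijective_id

/-- The augmentation, as a morphism of unital augmented operads. -/
noncomputable def UAOperad.augHom (O : UAOperad R) : UAOperad.Hom O (comUA R) where
  toHom := O.aug
  map_aug _ _ := rfl

namespace UAOperad

variable (O : UAOperad R)

/-- The pointwise action of a family of operations on the functions on the simplices of `X` with
values in `Ω_*`. -/
noncomputable def pointwise (X : SSet.{u}) {n : ℕ} :
    MultiOp O.omega n →ₗ[R]
      MultilinearMap R (fun _ : Fin n => ∀ m : ℕ, X _⦋m⦌ → O.omega m)
        (∀ m : ℕ, X _⦋m⦌ → O.omega m) where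
  toFun φ := MultilinearMap.pi fun m => MultilinearMap.pi fun s =>
    (φ m).compLinearMap fun _ => LinearMap.proj s ∘ₗ LinearMap.proj m
  map_add' _ _ := rfl
  map_smul' _ _ := rfl

@[simp] theorem pointwise_apply (X : SSet.{u}) {n : ℕ} (φ : MultiOp O.omega n)
    (ω : Fin n → ∀ m : ℕ, X _⦋m⦌ → O.omega m) (m : ℕ) (s : X _⦋m⦌) :
    O.pointwise X φ ω m s = φ m fun i => ω i m s := rfl

variable {O} in
/-- Natural operations preserve simplicial maps into `Ω_*`. -/
theorem pointwise_mem {X : SSet.{u}} {n : ℕ} {k : ℤ} {φ : MultiOp O.omega n}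
    (hφ : φ ∈ MultiOp.gr O.omega n k)
    (hn : ∀ ⦃m N : ℕ⦄ (f : Fin (m + 1) → Fin (N + 1)) (a : Fin n → O.omega N),
      (O.omegaPull f).toLin (φ N a) = φ m fun j => (O.omegaPull f).toLin (a j))
    {q : Fin n → ℤ} {ω : Fin n → ∀ m : ℕ, X _⦋m⦌ → O.omega m}
    (hω : ∀ i, ω i ∈ O.formsGr X (q i)) :
    O.pointwise X φ ω ∈ O.formsGr X (k + ∑ i, q i) := by
  refine ⟨fun m N α s => ?_, fun m s => hφ m _ _ fun i => (hω i).2 m s⟩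
  rw [pointwise_apply, pointwise_apply, hn]
  exact congrArg (φ m) (funext fun i => (hω i).1 m N α s)

variable (S : PathSection O.toDGOperad) (μ : O.obj 2) (hμ : μ ∈ (O.obj 2).gr 0)
  (hμ' : O.augBase 2 μ = 1)

/-- The operations on `Ω_*` underlying the elements of the operad of natural unital operations. -/
noncomputable def opIncl (n : ℕ) :
    (O.formSystem S μ hμ hμ').opUA.obj n →ₗ[R] MultiOp O.omega n :=
  (O.formSystem S μ hμ hμ').opOperad.incl

variable {O S μ hμ hμ'}

theorem opIncl_mem {n : ℕ} {k : ℤ} {x : (O.formSystem S μ hμ hμ').opUA.obj n}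
    (hx : x ∈ ((O.formSystem S μ hμ hμ').opUA.obj n).gr k) :
    O.opIncl S μ hμ hμ' n x ∈ MultiOp.gr O.omega n k := hx.1

theorem opIncl_natural {n : ℕ} {k : ℤ} {x : (O.formSystem S μ hμ hμ').opUA.obj n}
    (hx : x ∈ ((O.formSystem S μ hμ hμ').opUA.obj n).gr k) ⦃m N : ℕ⦄
    (f : Fin (m + 1) → Fin (N + 1)) (a : Fin n → O.omega N) :
    (O.omegaPull f).toLin (O.opIncl S μ hμ hμ' n x N a) =
      O.opIncl S μ hμ hμ' n x m fun j => (O.omegaPull f).toLin (a j) :=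
  hx.2.1 f a

theorem opIncl_d {n : ℕ} {k : ℤ} {x : (O.formSystem S μ hμ hμ').opUA.obj n}
    (hx : x ∈ ((O.formSystem S μ hμ hμ').opUA.obj n).gr k) :
    O.opIncl S μ hμ hμ' n (((O.formSystem S μ hμ hμ').opUA.obj n).d x) =
      MultiOp.endD k (O.opIncl S μ hμ hμ' n x) :=
  GradedOperad.incl_d hx

theorem opIncl_act {n : ℕ} (σ : Equiv.Perm (Fin n)) (x : (O.formSystem S μ hμ hμ').opUA.obj n) :
    O.opIncl S μ hμ hμ' n ((O.formSystem S μ hμ hμ').opUA.act σ x) =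
      MultiOp.act σ (O.opIncl S μ hμ hμ' n x) := rfl

theorem opIncl_circ {m n l : ℕ} (h : m + n = l + 1) (i : Fin m) {q : ℤ}
    (x : (O.formSystem S μ hμ hμ').opUA.obj m) {y : (O.formSystem S μ hμ hμ').opUA.obj n}
    (hy : y ∈ ((O.formSystem S μ hμ hμ').opUA.obj n).gr q) :
    O.opIncl S μ hμ hμ' l ((O.formSystem S μ hμ hμ').opUA.circ h i x y) =
      MultiOp.circ h i q (O.opIncl S μ hμ hμ' m x) (O.opIncl S μ hμ hμ' n y) :=
  (O.formSystem S μ hμ hμ').opOperad.incl_objCirc h i x hy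

theorem pointwise_opIncl_mem_iSup (X : SSet.{u}) {n : ℕ}
    (x : (O.formSystem S μ hμ hμ').opUA.obj n) (ω : Fin n → O.forms X) :
    O.pointwise X (O.opIncl S μ hμ hμ' n x)
        (fun i => (⨆ k, O.formsGr X k).subtype (ω i)) ∈ ⨆ k, O.formsGr X k := by
  induction x using DGModule.induction_gr with
  | h k x hx =>
    -- the composite with the projection modulo the simplicial maps vanishes on homogeneous forms
    have h0 : (⨆ k, O.formsGr X k).mkQ.compMultilinearMap
        ((O.pointwise X (O.opIncl S μ hμ hμ' n x)).compLinearMap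
          fun _ => (⨆ k, O.formsGr X k).subtype) =
        (0 : MultilinearMap R (fun _ : Fin n => (O.forms X).carrier) _) :=
      DGModule.multilinearMap_ext (M := O.forms X) fun q a ha => by
        change (⨆ k, O.formsGr X k).mkQ _ = 0
        rw [Submodule.mkQ_apply, Submodule.Quotient.mk_eq_zero]
        exact le_iSup (O.formsGr X) _ (pointwise_mem (opIncl_mem hx) (opIncl_natural hx) ha)
    have h1 := congrArg (fun f => f ω) h0
    exact (Submodule.Quotient.mk_eq_zero _).1 h1
  | hadd x y hx hy =>
    rw [map_add, map_add]
    exact Submodule.add_mem _ hx hy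

variable (O S μ hμ hμ')

/-- The pointwise action of the operad of natural unital operations on `Ω(X)`. -/
noncomputable def formsAction (X : SSet.{u}) (n : ℕ) :
    (O.formSystem S μ hμ hμ').opUA.obj n →ₗ[R]
      MultilinearMap R (fun _ : Fin n => (O.forms X).carrier) (O.forms X).carrier where
  toFun x := ((O.pointwise X (O.opIncl S μ hμ hμ' n x)).compLinearMap
    fun _ => (⨆ k, O.formsGr X k).subtype).codRestrict (⨆ k, O.formsGr X k)
      (pointwise_opIncl_mem_iSup X x)
  map_add' x y := MultilinearMap.ext fun a => Subtype.ext (by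
    change O.pointwise X (O.opIncl S μ hμ hμ' n (x + y)) _ = _
    rw [map_add, map_add]
    rfl)
  map_smul' c x := MultilinearMap.ext fun a => Subtype.ext (by
    change O.pointwise X (O.opIncl S μ hμ hμ' n (c • x)) _ = _
    rw [map_smul, map_smul]
    rfl)

/-- The value of a form on a simplex. -/
noncomputable def formsVal (X : SSet.{u}) {m : ℕ} (s : X _⦋m⦌) : O.forms X →ₗ[R] O.omega m :=
  LinearMap.proj s ∘ₗ LinearMap.proj m ∘ₗ (⨆ k, O.formsGr X k).subtype

variable {O S μ hμ hμ'}

theorem forms_ext {X : SSet.{u}} {ω η : O.forms X}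
    (h : ∀ (m : ℕ) (s : X _⦋m⦌), O.formsVal X s ω = O.formsVal X s η) : ω = η :=
  Subtype.ext (funext fun m => funext fun s => h m s)

theorem formsVal_mem {X : SSet.{u}} {m : ℕ} (s : X _⦋m⦌) {k : ℤ} {ω : O.forms X}
    (hω : ω ∈ (O.forms X).gr k) : O.formsVal X s ω ∈ (O.omega m).gr k := hω.2 m s

theorem formsVal_d {X : SSet.{u}} {m : ℕ} (s : X _⦋m⦌) (ω : O.forms X) :
    O.formsVal X s ((O.forms X).d ω) = (O.omega m).d (O.formsVal X s ω) := rfl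

theorem formsVal_formsAction {X : SSet.{u}} {m : ℕ} (s : X _⦋m⦌) {n : ℕ}
    (x : (O.formSystem S μ hμ hμ').opUA.obj n) (ω : Fin n → O.forms X) :
    O.formsVal X s (O.formsAction S μ hμ hμ' X n x ω) =
      O.opIncl S μ hμ hμ' n x m fun i => O.formsVal X s (ω i) := rfl

variable (O S μ hμ hμ')

/-- The module `Ω(X)` is an algebra over the operad of natural unital operations on `Ω_*`. -/
noncomputable def formsAlgebra (X : SSet.{u}) :
    (O.formSystem S μ hμ hμ').opUA.toDGOperad.Algebra (O.forms X) where
  θ := O.formsAction S μ hμ hμ' X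
  θ_gr hx ha := pointwise_mem (opIncl_mem hx) (opIncl_natural hx) ha
  θ_d {n p q x a} hx ha := forms_ext fun m s => by
    have h1 := MultiOp.endD_apply p (O.opIncl S μ hμ hμ' n x)
      (fun i => formsVal_mem s (ha i))
    rw [formsVal_d, formsVal_formsAction, map_add, formsVal_formsAction, opIncl_d hx, h1, map_sum,
      Finset.smul_sum]
    rw [sub_add_eq_add_sub, add_sub_assoc, left_eq_add, sub_eq_zero]
    refine Finset.sum_congr rfl fun i _ => ?_
    rw [LinearMap.map_intUnit_smul, formsVal_formsAction, Int.negOnePow_add, ← smul_smul]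
    congr 3
    funext j
    by_cases hj : j = i
    · subst hj; simp [formsVal_d]
    · simp [hj]
  θ_one a := rfl
  θ_act σ q x a ha := forms_ext fun m s => by
    rw [formsVal_formsAction, opIncl_act, LinearMap.map_intUnit_smul, formsVal_formsAction,
      MultiOp.act_apply σ _ (fun i => formsVal_mem s (ha i))]
    rfl
  θ_circ h i p q x y a hy ha := forms_ext fun m s => by
    rw [formsVal_formsAction, opIncl_circ h i x hy, LinearMap.map_intUnit_smul,
      formsVal_formsAction, MultiOp.circ_apply h i p _ _ (fun i => formsVal_mem s (ha i))]
    congr 2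
    funext j
    exact (apply_plugAt h i (O.formsVal X s)
      (O.formsAction S μ hμ hμ' X _ y fun k => a (innerSlot h i k)) a j).symm

end UAOperad

end Forms

theorem mainTheorem3 {R : Type u} [CommRing R] (O E : UAOperad R)
    (hO : O.IsCofibrant) (hO' : O.aug.IsFibration) (hE : E.IsCofibrantModelOfCom) :
    ∃ α : ∀ X : SSet.{u}, E.toDGOperad.Algebra (O.forms X),
      ∀ (X Y : SSet.{u}) (f : X ⟶ Y), (α Y).IsHom (α X) (O.formsMap f) := by
  obtain ⟨S⟩ := hO.exists_pathSection
  -- the component of degree `0` of `x` still has augmentation `1`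
  obtain ⟨x, hx⟩ := hO' 2 (1 : R)
  have hμ' : O.augBase 2 ((O.obj 2).proj 0 x) = 1 := by
    change (O.aug.app 2).toLin ((O.obj 2).proj 0 x) = (1 : R)
    rw [← DGModule.Hom.proj_apply, hx]
    exact DGModule.proj_apply_self _ ((mem_baseGr (R := R)).2 fun h => absurd rfl h)
  let F := O.formSystem S _ ((O.obj 2).proj_mem 0 x) hμ'
  -- the augmentation of `E` is lifted along the trivial fibration from the operad of operations
  obtain ⟨g, -⟩ := hE.1 F.opUA (comUA R) F.opUA.augHom F.opAug_isFibration
    F.opAug_isWeakEquivalence E.augHom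
  exact ⟨fun X => (O.formsAlgebra S _ _ hμ' X).restrict g.toHom, fun X Y f n e a => rfl⟩
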